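/- Fix a nonzero vector $\vec v$ in the plane $\mathbb{R}^2$. A \emph{planar knotoid diagram} is a smooth immersion $\phi:[0,1]\to\mathbb{R}^2$ whose only singularities are transversal double points, carrying over/undercrossing data; the end-points $\phi(0)$ (the leg) and $\phi(1)$ (the head) are distinct from each other and are not double points. Diagrams are considered up to orientation-preserving smooth reparametrization of $[0,1]$. A \emph{planar knotoid} is a class of such diagrams under the equivalence relation generated by smooth ambient isotopies of $\mathbb{R}^2$ and the Reidemeister moves $R1,R2,R3$, each performed in a disc away from the end-points. A \emph{biframed planar knotoid diagram} is a planar knotoid diagram whose tangent vectors $\phi'(0)$ and $\phi'(1)$ are positive multiples of $\vec v$. A \emph{biframed planar knotoid} is a class of such diagrams under the equivalence relation generated by $R2$, $R3$, the weakened first Reidemeister move $R1'$ (replacing a kink in an arc by a kink of the same crossing sign, possibly on the other side of the arc), and smooth ambient isotopies of $\mathbb{R}^2$ that keep the diagram biframed at every stage. For a biframed planar knotoid diagram $K$ given by $\phi$, let $\mathrm{fr}(K)$ be its writhe, i.e. the sum of the signs of its crossings, and let $$\mathrm{cofr}(K)=n_0-n_1,$$ where $n_0$ and $n_1$ are the winding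 numbers of the curve about the leg and about the head, each counted along the curve starting from the end-point in question: $2\pi n_0$ is the total variation of the angle of $\phi(t)-\phi(0)$ as $t$ goes from $0$ to $1$, and $2\pi n_1$ is the total variation of the angle of $\phi(t)-\phi(1)$ as $t$ goes from $1$ to $0$. Then $\mathrm{cofr}(K)$ is an integer, the underlying planar knotoid of $K$, $\mathrm{fr}(K)$ and $\mathrm{cofr}(K)$ depend only on the biframed planar knotoid represented by $K$, and the map $$\{\text{biframed planar knotoids}\}\to\{\text{planar knotoids}\}\times\mathbb{Z}^2,\qquad K\mapsto\bigl(K,\mathrm{fr}(K),\mathrm{cofr}(K)\bigr)$$ is a bijection. -/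

import Mathlib

open scoped ContDiff Manifold

noncomputable section

/-- The determinant of the pair of plane vectors `z`, `w` (the plane is `ℂ`). -/
def planeDet (z w : ℂ) : ℝ := z.re * w.im - z.im * w.re

/-- `w` is parallel to `v` and points in the same direction. -/
def SameDirection (w v : ℂ) : Prop := ∃ c : ℝ, 0 < c ∧ w = (c : ℂ) * v

/-- A planar knotoid diagram: a smooth immersion `[0,1] → ℝ² = ℂ` whose only singularities are
transversal double points, away from the two end-points, with over/undercrossing data.
Only the restriction of `curve` to `[0,1]` matters (a smooth map on `[0,1]` is the restriction of
a smooth map on `ℝ`).  `upper` is the set of those times at which the curve runs through a double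
point on the upper strand. -/
structure KnotoidDiagram where
  curve : ℝ → ℂ
  upper : Set ℝ
  smooth : ContDiff ℝ ∞ curve
  immersion : ∀ t ∈ Set.Icc (0 : ℝ) 1, deriv curve t ≠ 0
  no_triple : ∀ s ∈ Set.Icc (0 : ℝ) 1, ∀ t ∈ Set.Icc (0 : ℝ) 1, ∀ u ∈ Set.Icc (0 : ℝ) 1,
    curve s = curve t → curve t = curve u → s = t ∨ t = u ∨ s = u
  transversal : ∀ s ∈ Set.Icc (0 : ℝ) 1, ∀ t ∈ Set.Icc (0 : ℝ) 1, s ≠ t →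
    curve s = curve t → planeDet (deriv curve s) (deriv curve t) ≠ 0
  endpoints_simple : ∀ s ∈ Set.Icc (0 : ℝ) 1, ∀ t ∈ Set.Icc (0 : ℝ) 1, s ≠ t →
    curve s = curve t → s ∈ Set.Ioo (0 : ℝ) 1
  upper_crossing : ∀ s ∈ upper, s ∈ Set.Icc (0 : ℝ) 1 ∧
    ∃ t ∈ Set.Icc (0 : ℝ) 1, s ≠ t ∧ curve s = curve t
  upper_iff : ∀ s ∈ Set.Icc (0 : ℝ) 1, ∀ t ∈ Set.Icc (0 : ℝ) 1, s ≠ t →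
    curve s = curve t → (s ∈ upper ↔ t ∉ upper)

namespace KnotoidDiagram

/-- The crossings of the diagram, each listed once as (time on the upper strand, time on the
lower strand).  By compactness and transversality this is a finite set. -/
def crossings (D : KnotoidDiagram) : Set (ℝ × ℝ) :=
  {p | p.1 ∈ Set.Icc (0 : ℝ) 1 ∧ p.2 ∈ Set.Icc (0 : ℝ) 1 ∧ p.1 ≠ p.2 ∧
    D.curve p.1 = D.curve p.2 ∧ p.1 ∈ D.upper}

/-- The crossings located in the region `B` of the plane. -/
def crossingsIn (D : KnotoidDiagram) (B : Set ℂ) : Set (ℝ × ℝ) :=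
  {p | p ∈ D.crossings ∧ D.curve p.1 ∈ B}

/-- The sign of a crossing: `+1` if turning the direction of the upper strand counterclockwise
by an angle less than `π` gives that of the lower strand, and `-1` otherwise. -/
def crossingSign (D : KnotoidDiagram) (p : ℝ × ℝ) : ℤ :=
  (SignType.sign (planeDet (deriv D.curve p.1) (deriv D.curve p.2)) : ℤ)

/-- The framing: the writhe, i.e. the sum of the signs of all crossings. -/
def framing (D : KnotoidDiagram) : ℤ := ∑ᶠ p ∈ D.crossings, D.crossingSign p

/-- The winding number of the curve about its leg, traversing it from the leg to the head:
`(2π)⁻¹` times the total variation of the angle of `curve t - curve 0`.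
(The integrand `dθ/dt` is bounded and continuous on `(0,1]`, as `curve` is an immersion.) -/
def legWinding (D : KnotoidDiagram) : ℝ :=
  (2 * Real.pi)⁻¹ * ∫ t in (0 : ℝ)..1, (deriv D.curve t / (D.curve t - D.curve 0)).im

/-- The winding number of the curve about its head, traversing it from the head to the leg
(note the order of the limits of integration). -/
def headWinding (D : KnotoidDiagram) : ℝ :=
  (2 * Real.pi)⁻¹ * ∫ t in (1 : ℝ)..0, (deriv D.curve t / (D.curve t - D.curve 1)).im

/-- The coframing: the difference of the winding numbers about the two end-points, each counted
along the curve starting at that end-point. -/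
def coframing (D : KnotoidDiagram) : ℝ := D.legWinding - D.headWinding

end KnotoidDiagram

/-- A smooth ambient isotopy of the plane, starting at the identity. -/
structure AmbientIsotopy where
  toDiffeo : ℝ → Diffeomorph 𝓘(ℝ, ℂ) 𝓘(ℝ, ℂ) ℂ ℂ ∞
  smooth : ContDiff ℝ ∞ (fun p : ℝ × ℂ => toDiffeo p.1 p.2)
  zero : ∀ z, toDiffeo 0 z = z

/-- An orientation preserving smooth reparametrization of `[0,1]`. -/
structure IsReparam (h : ℝ → ℝ) : Prop where
  smooth : ContDiff ℝ ∞ h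
  zero : h 0 = 0
  one : h 1 = 1
  deriv_pos : ∀ t ∈ Set.Icc (0 : ℝ) 1, 0 < deriv h t

/-- `D'` is, up to reparametrization, the image of `D` under the final map of the isotopy `F`,
with the over/undercrossing data carried along. -/
def IsotopyCarries (F : AmbientIsotopy) (D D' : KnotoidDiagram) : Prop :=
  ∃ h : ℝ → ℝ, IsReparam h ∧ ∀ t ∈ Set.Icc (0 : ℝ) 1,
    D'.curve t = F.toDiffeo 1 (D.curve (h t)) ∧ (t ∈ D'.upper ↔ h t ∈ D.upper)

/-- A smoothly embedded closed disc in the plane. -/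
def IsDisc (B : Set ℂ) : Prop :=
  ∃ G : Diffeomorph 𝓘(ℝ, ℂ) 𝓘(ℝ, ℂ) ℂ ℂ ∞, B = G '' Metric.closedBall (0 : ℂ) 1

/-- The diagram `D` meets the disc `B` exactly in the `n` arcs `D.curve '' [a i, b i]`, which run
through the interior of `B` between points of its boundary; all crossings in `B` are interior. -/
def MeetsDiscInArcs (D : KnotoidDiagram) (B : Set ℂ) {n : ℕ} (a b : Fin n → ℝ) : Prop :=
  (∀ t ∈ Set.Icc (0 : ℝ) 1, (D.curve t ∈ B ↔ ∃ i, t ∈ Set.Icc (a i) (b i))) ∧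
  (∀ t ∈ Set.Icc (0 : ℝ) 1, (D.curve t ∈ interior B ↔ ∃ i, t ∈ Set.Ioo (a i) (b i))) ∧
  D.crossingsIn B ⊆ D.crossingsIn (interior B)

/-- `D` and `D'` coincide outside the disc `B`, which does not contain the end-points, and both
meet `B` in `n` arcs with the same end-points. -/
structure LocalChange (D D' : KnotoidDiagram) (B : Set ℂ) {n : ℕ} (a b : Fin n → ℝ) : Prop where
  disc : IsDisc B
  arcs : ∀ i, 0 < a i ∧ a i < b i ∧ b i < 1
  disjoint : ∀ i j, i ≠ j → Disjoint (Set.Icc (a i) (b i)) (Set.Icc (a j) (b j))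
  meets : MeetsDiscInArcs D B a b
  meets' : MeetsDiscInArcs D' B a b
  outside : ∀ t ∈ Set.Icc (0 : ℝ) 1, (∀ i, t ∉ Set.Ioo (a i) (b i)) →
    D'.curve t = D.curve t ∧ (t ∈ D'.upper ↔ t ∈ D.upper)

/-- `D` arises from `D₀` by adding a kink with a crossing of sign `ε` to the arc over `[a, b]`,
inside the disc `B`, which that arc crosses without further crossings. -/
def AddsKink (D₀ D : KnotoidDiagram) (B : Set ℂ) (a b : ℝ) (ε : ℤ) : Prop :=
  LocalChange D₀ D B (fun _ : Fin 1 => a) (fun _ : Fin 1 => b) ∧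
  D₀.crossingsIn B = ∅ ∧ ∃ p, D.crossingsIn B = {p} ∧ D.crossingSign p = ε

/-- The first Reidemeister move: a kink is added to an arc. -/
def ReidemeisterOne (D D' : KnotoidDiagram) : Prop :=
  ∃ B a b ε, AddsKink D D' B a b ε

/-- The weakened first Reidemeister move: a kink in an arc is replaced by a kink of the same
crossing sign, which may lie on the other side of the arc. -/
def WeakReidemeisterOne (D D' : KnotoidDiagram) : Prop :=
  ∃ D₀ B a b ε, AddsKink D₀ D B a b ε ∧ AddsKink D₀ D' B a b ε

/-- The second Reidemeister move: two arcs without crossings become two arcs forming a bigon, the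
first one running over the second one at both crossings (which then have opposite signs). -/
def ReidemeisterTwo (D D' : KnotoidDiagram) : Prop :=
  ∃ (B : Set ℂ) (a b : Fin 2 → ℝ), LocalChange D D' B a b ∧ D.crossingsIn B = ∅ ∧
    ∃ p q, p ≠ q ∧ D'.crossingsIn B = {p, q} ∧
      p.1 ∈ Set.Icc (a 0) (b 0) ∧ q.1 ∈ Set.Icc (a 0) (b 0) ∧
      p.2 ∈ Set.Icc (a 1) (b 1) ∧ q.2 ∈ Set.Icc (a 1) (b 1) ∧
      D'.crossingSign p = -D'.crossingSign q

/-- The crossings of `D` in `B` are `p`, `q`, `r`, where arc `0` runs over arc `1` at `p`, arc `0`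
over arc `2` at `q`, and arc `1` over arc `2` at `r`. -/
def IsTriangle (D : KnotoidDiagram) (B : Set ℂ) (a b : Fin 3 → ℝ) (p q r : ℝ × ℝ) : Prop :=
  D.crossingsIn B = {p, q, r} ∧
    p.1 ∈ Set.Icc (a 0) (b 0) ∧ p.2 ∈ Set.Icc (a 1) (b 1) ∧
    q.1 ∈ Set.Icc (a 0) (b 0) ∧ q.2 ∈ Set.Icc (a 2) (b 2) ∧
    r.1 ∈ Set.Icc (a 1) (b 1) ∧ r.2 ∈ Set.Icc (a 2) (b 2)

/-- The third Reidemeister move: in a disc, three arcs (upper, middle and lower) that cross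
pairwise exactly once are replaced by three such arcs with the same end-points.  (The signs of
corresponding crossings then agree.) -/
def ReidemeisterThree (D D' : KnotoidDiagram) : Prop :=
  ∃ (B : Set ℂ) (a b : Fin 3 → ℝ), LocalChange D D' B a b ∧
    ∃ p q r p' q' r', IsTriangle D B a b p q r ∧ IsTriangle D' B a b p' q' r' ∧
      D.crossingSign p = D'.crossingSign p' ∧ D.crossingSign q = D'.crossingSign q' ∧
      D.crossingSign r = D'.crossingSign r'

/-- The elementary steps generating equivalence of planar knotoid diagrams. -/
inductive PlanarStep : KnotoidDiagram → KnotoidDiagram → Prop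
  | isotopy {D D' : KnotoidDiagram} (F : AmbientIsotopy) :
      IsotopyCarries F D D' → PlanarStep D D'
  | r1 {D D' : KnotoidDiagram} : ReidemeisterOne D D' → PlanarStep D D'
  | r2 {D D' : KnotoidDiagram} : ReidemeisterTwo D D' → PlanarStep D D'
  | r3 {D D' : KnotoidDiagram} : ReidemeisterThree D D' → PlanarStep D D'

/-- Planar knotoids: diagrams up to the equivalence relation generated by the steps
(`Quot` is the quotient by the generated equivalence relation). -/
def PlanarKnotoid : Type := Quot PlanarStep

/-- A biframed planar knotoid diagram: its tangent vectors at both end-points have the direction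
of the fixed vector `v`. -/
structure BiframedDiagram (v : ℂ) extends KnotoidDiagram where
  leg_direction : SameDirection (deriv curve 0) v
  head_direction : SameDirection (deriv curve 1) v

/-- The elementary steps generating equivalence of biframed planar knotoid diagrams.  An isotopy
must keep the diagram biframed at each stage. -/
inductive BiframedStep (v : ℂ) : BiframedDiagram v → BiframedDiagram v → Prop
  | isotopy {K K' : BiframedDiagram v} (F : AmbientIsotopy) :
      IsotopyCarries F K.toKnotoidDiagram K'.toKnotoidDiagram →
      (∀ s ∈ Set.Icc (0 : ℝ) 1,
        SameDirection (deriv (fun t => F.toDiffeo s (K.curve t)) 0) v ∧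
        SameDirection (deriv (fun t => F.toDiffeo s (K.curve t)) 1) v) →
      BiframedStep v K K'
  | r1' {K K' : BiframedDiagram v} :
      WeakReidemeisterOne K.toKnotoidDiagram K'.toKnotoidDiagram → BiframedStep v K K'
  | r2 {K K' : BiframedDiagram v} :
      ReidemeisterTwo K.toKnotoidDiagram K'.toKnotoidDiagram → BiframedStep v K K'
  | r3 {K K' : BiframedDiagram v} :
      ReidemeisterThree K.toKnotoidDiagram K'.toKnotoidDiagram → BiframedStep v K K'

/-- Biframed planar knotoids with respect to the fixed vector `v`. -/
def BiframedKnotoid (v : ℂ) : Type := Quot (BiframedStep v)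

end

/-! The map factors through regular equivalence, generated by all ambient isotopies and by R1', R2
and R3, with no condition at the end-points (`RegularStep`). Biframed knotoids correspond to regular
classes together with a coframing, and regular classes correspond to planar knotoids together with a
framing. The two correspondences are independent of each other.

Coframing. Since the curve is an immersion, a continuous angle of `curve t - curve 0` extends to `t
= 0`, where it becomes an angle of the tangent. Up to the factor 2π, the leg winding is therefore
the angle of the chord minus that of the leg tangent, and the head winding is the same quantity for
the reversed curve. The two chords are opposite, so in the difference only the tangents matter.
Hence the coframing of a biframed diagram is an integer, and an isotopy changes it by the turning of
the head tangent minus the turning of the leg tangent (`IsotopyCarries.coframing_sub`). A change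
inside a disc does not affect it, because the angle about a point outside the disc is a
single-valued function on the disc. Twists about the end-points realize every coframing
(`exists_biframing`). If an isotopy joins two biframed diagrams of equal coframing, both tangents
turn by the same total angle, a multiple of 2π. A rotation of the plane and a twist about the head
then make the isotopy biframed at every stage without changing its final map
(`biframedStep_of_isotopyCarries`).

Framing. Regular steps preserve the writhe. Adding a kink of given sign is a well-defined operation
on regular classes, and the operations for the two signs are inverse to each other, because a kink
with an opposite kink inside it arises from a plain arc by a single R2 (`exists_nested_kinks`). So ℤ
acts on regular classes through `kinkPerm`, and an R1 move shifts the class and the framing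
simultaneously. Shifting a class to framing zero gives an invariant of planar knotoids
(`unframedClass`), which shows that the planar knotoid and the framing determine the regular class.
Powers of `kinkPerm` realize all framings.

The main work is to show that adding a kink is well defined. A kink can be placed away from the disc
of any move, so what remains is independence of its position. Two kinks at the same time are
compared, by R1', with a third one inside both discs. This makes the class locally constant along
simple points. At a double point the kink has to be pushed across the other strand: in a chart where
the strands are coordinate axes, explicit curves realize this by an R2, an R3 and an R2 in reverse
(`IsKinkClass.pass`). -/

noncomputable section

/-! ### Angles and winding -/

open Set Filter Topology MeasureTheory

/-- `θ` is an angle of the nonzero plane vector `w`. -/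
def HasAngle (w : ℂ) (θ : ℝ) : Prop := ∃ r : ℝ, 0 < r ∧ w = r * Complex.exp (θ * Complex.I)

theorem HasAngle.ne_zero {w : ℂ} {θ : ℝ} (h : HasAngle w θ) : w ≠ 0 := by
  obtain ⟨r, hr, rfl⟩ := h
  exact mul_ne_zero (by exact_mod_cast hr.ne') (Complex.exp_ne_zero _)

theorem hasAngle_exp (z : ℂ) : HasAngle (Complex.exp z) z.im := by
  refine ⟨Real.exp z.re, Real.exp_pos _, ?_⟩
  rw [Complex.ofReal_exp, ← Complex.exp_add, Complex.re_add_im]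

theorem HasAngle.smul {w : ℂ} {θ c : ℝ} (h : HasAngle w θ) (hc : 0 < c) : HasAngle (c * w) θ := by
  obtain ⟨r, hr, rfl⟩ := h
  exact ⟨c * r, mul_pos hc hr, by push_cast; ring⟩

theorem HasAngle.neg {w : ℂ} {θ : ℝ} (h : HasAngle w θ) : HasAngle (-w) (θ + Real.pi) := by
  obtain ⟨r, hr, rfl⟩ := h
  refine ⟨r, hr, ?_⟩
  push_cast
  rw [add_mul, Complex.exp_add, Complex.exp_pi_mul_I]
  ring

theorem HasAngle.mul {w z : ℂ} {θ φ : ℝ} (h : HasAngle w θ) (h' : HasAngle z φ) :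
    HasAngle (w * z) (θ + φ) := by
  obtain ⟨r, hr, rfl⟩ := h
  obtain ⟨s, hs, rfl⟩ := h'
  exact ⟨r * s, mul_pos hr hs, by push_cast; rw [add_mul, Complex.exp_add]; ring⟩

theorem HasAngle.inv {w : ℂ} {θ : ℝ} (h : HasAngle w θ) : HasAngle w⁻¹ (-θ) := by
  obtain ⟨r, hr, rfl⟩ := h
  refine ⟨r⁻¹, inv_pos.2 hr, ?_⟩
  push_cast
  rw [neg_mul, Complex.exp_neg, mul_inv]

theorem HasAngle.div {w z : ℂ} {θ φ : ℝ} (h : HasAngle w θ) (h' : HasAngle z φ) :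
    HasAngle (w / z) (θ - φ) := by
  rw [div_eq_mul_inv, sub_eq_add_neg]; exact h.mul h'.inv

theorem exists_hasAngle {w : ℂ} (hw : w ≠ 0) : ∃ θ, HasAngle w θ :=
  ⟨_, by simpa [Complex.exp_log hw] using hasAngle_exp (Complex.log w)⟩

theorem HasAngle.arg_eq {w : ℂ} {θ : ℝ} (h : HasAngle w θ) (hθ : θ ∈ Ioc (-Real.pi) Real.pi) :
    w.arg = θ := by
  obtain ⟨r, hr, rfl⟩ := h
  rw [Complex.exp_mul_I]
  exact_mod_cast Complex.arg_mul_cos_add_sin_mul_I hr hθ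

theorem HasAngle.sub_eq {w : ℂ} {θ φ : ℝ} (h : HasAngle w θ) (h' : HasAngle w φ) :
    ∃ n : ℤ, θ - φ = 2 * Real.pi * n := by
  obtain ⟨r, hr, hw⟩ := h.div h'
  rw [div_self h.ne_zero] at hw
  have hr1 : r = 1 := by
    have := congrArg (‖·‖) hw
    simp only [norm_one, norm_mul, Complex.norm_real, Complex.norm_exp_ofReal_mul_I, mul_one,
      Real.norm_eq_abs, abs_of_pos hr] at this
    exact this.symm
  rw [hr1, Complex.ofReal_one, one_mul] at hw
  obtain ⟨n, hn⟩ := Complex.exp_eq_one_iff.1 hw.symm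
  refine ⟨n, ?_⟩
  have := congrArg Complex.im hn
  simpa [mul_comm, mul_left_comm] using this

theorem HasAngle.congr_int {w : ℂ} {θ : ℝ} (h : HasAngle w θ) (n : ℤ) :
    HasAngle w (θ + 2 * Real.pi * n) := by
  obtain ⟨r, hr, rfl⟩ := h
  refine ⟨r, hr, ?_⟩
  push_cast
  rw [add_mul, Complex.exp_add, show (2 * Real.pi * n : ℂ) * Complex.I = n * (2 * Real.pi * Complex.I)
    by ring, Complex.exp_int_mul_two_pi_mul_I, mul_one]

/-- A real function on the unit interval that is continuous and takes values in `2πℤ` is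
constant. -/
theorem eq_of_continuousOn_of_mem_two_pi_int {f : ℝ → ℝ} (hf : ContinuousOn f (Icc 0 1))
    (h : ∀ s ∈ Icc (0 : ℝ) 1, ∃ n : ℤ, f s = 2 * Real.pi * n) : f 0 = f 1 := by
  have hd : ∀ s ∈ Icc (0 : ℝ) 1, f s / (2 * Real.pi) ∈ range ((↑) : ℤ → ℝ) := fun s hs => by
    obtain ⟨n, hn⟩ := h s hs
    exact ⟨n, by rw [hn]; field_simp⟩
  have := isPreconnected_Icc.constant_of_mapsTo (T := range ((↑) : ℤ → ℝ))
    Int.isClosedEmbedding_coe_real.isInducing.isDiscrete_range (hf.div_const (2 * Real.pi)) hd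
    (left_mem_Icc.2 zero_le_one) (right_mem_Icc.2 zero_le_one)
  have hp : (2 * Real.pi) ≠ 0 := by positivity
  field_simp at this
  exact this

/-- Two continuous angles of a vector function and of a constant multiple of it have the same
variation. -/
theorem angle_variation_eq {w : ℝ → ℂ} {k : ℂ} {θ φ : ℝ → ℝ} (hθ : ContinuousOn θ (Icc 0 1))
    (hφ : ContinuousOn φ (Icc 0 1)) (h : ∀ s ∈ Icc (0 : ℝ) 1, HasAngle (w s) (θ s))
    (h' : ∀ s ∈ Icc (0 : ℝ) 1, HasAngle (w s * k) (φ s)) : φ 1 - φ 0 = θ 1 - θ 0 := by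
  have h0 := left_mem_Icc.2 (zero_le_one' ℝ)
  have hk : k ≠ 0 := right_ne_zero_of_mul (h' 0 h0).ne_zero
  have hd : ∀ s ∈ Icc (0 : ℝ) 1, HasAngle k (φ s - θ s) := fun s hs => by
    simpa [mul_div_cancel_left₀ _ (h s hs).ne_zero] using (h' s hs).div (h s hs)
  have := eq_of_continuousOn_of_mem_two_pi_int (f := fun s => φ s - θ s - (φ 0 - θ 0))
    ((hφ.sub hθ).sub continuousOn_const) fun s hs => (hd s hs).sub_eq (hd 0 h0)
  linarith

/-- Continuous logarithms of nowhere vanishing functions on a real normed space. -/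
theorem exists_continuous_exp_eq {V : Type*} [NormedAddCommGroup V] [NormedSpace ℝ V] {g : V → ℂ}
    (hg : Continuous g) (h0 : ∀ x, g x ≠ 0) :
    ∃ f : V → ℂ, Continuous f ∧ ∀ x, Complex.exp (f x) = g x := by
  have hs : IsSimplyConnected (univ : Set V) := by
    have : ContractibleSpace (univ : Set V) := convex_univ.contractibleSpace ⟨0, mem_univ _⟩
    exact (inferInstance : SimplyConnectedSpace (univ : Set V))
  obtain ⟨f, hf, he⟩ := Complex.exists_continuousOn_eqOn_exp_comp hs isOpen_univ hg.continuousOn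
    (by rintro ⟨x, -, hx⟩; exact h0 x hx)
  exact ⟨f, continuousOn_univ.1 hf, fun x => he (mem_univ x)⟩

theorem exists_continuous_hasAngle {V : Type*} [NormedAddCommGroup V] [NormedSpace ℝ V] {g : V → ℂ}
    (hg : Continuous g) (h0 : ∀ x, g x ≠ 0) :
    ∃ f : V → ℝ, Continuous f ∧ ∀ x, HasAngle (g x) (f x) := by
  obtain ⟨f, hf, he⟩ := exists_continuous_exp_eq hg h0
  exact ⟨fun x => (f x).im, Complex.continuous_im.comp hf, fun x => he x ▸ hasAngle_exp _⟩

/-- By continuity `θ` varies by less than π near `t₀`, so there it equals `θ t₀` plus the imaginary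
part of the principal logarithm of `z t / z t₀`. -/
theorem hasDerivAt_angle {z : ℝ → ℂ} {z' : ℂ} {θ : ℝ → ℝ} {t₀ : ℝ} (hz : HasDerivAt z z' t₀)
    (hθ : ContinuousAt θ t₀) (h : ∀ᶠ t in 𝓝 t₀, HasAngle (z t) (θ t)) :
    HasDerivAt θ (z' / z t₀).im t₀ := by
  have hz0 : z t₀ ≠ 0 := h.self_of_nhds.ne_zero
  have h1 : HasDerivAt (fun t => Complex.log (z t / z t₀)) (z' / z t₀) t₀ := by
    have := (hz.div_const (z t₀)).clog_real (by simp [div_self hz0])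
    simpa [div_self hz0] using this
  have h2 : HasDerivAt (fun t => θ t₀ + (Complex.log (z t / z t₀)).im) (z' / z t₀).im t₀ := by
    have := (Complex.imCLM.hasFDerivAt.comp_hasDerivAt t₀ h1)
    exact (this.const_add _)
  refine h2.congr_of_eventuallyEq ?_
  have h3 : ∀ᶠ t in 𝓝 t₀, θ t - θ t₀ ∈ Ioo (-Real.pi) Real.pi := by
    have : Tendsto (fun t => θ t - θ t₀) (𝓝 t₀) (𝓝 0) := by
      have h4 : ContinuousAt (fun t => θ t - θ t₀) t₀ := hθ.sub continuousAt_const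
      simpa only [sub_self] using h4.tendsto
    exact this.eventually (Ioo_mem_nhds (by linarith [Real.pi_pos]) Real.pi_pos)
  filter_upwards [h, h3] with t ht ht3
  rw [Complex.log_im, (ht.div h.self_of_nhds).arg_eq ⟨ht3.1, ht3.2.le⟩]
  ring

/-- The total variation of the angle of `γ t - γ 0` over the unit interval. -/
def angleIntegral (γ : ℝ → ℂ) : ℝ := ∫ t in (0 : ℝ)..1, (deriv γ t / (γ t - γ 0)).im

/-- The quotient has a pole like `1 / t` at `0`, but `1 / t` is real. After subtracting it the
numerator is `O(t²)` by Taylor's formula, while the denominator is at least a multiple of `t²`, so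
the imaginary part is bounded. -/
theorem intervalIntegrable_angle {γ : ℝ → ℂ} (hγ : ContDiff ℝ ∞ γ) (h0 : deriv γ 0 ≠ 0)
    (hne : ∀ t ∈ Ioc (0 : ℝ) 1, γ t ≠ γ 0) :
    IntervalIntegrable (fun t => (deriv γ t / (γ t - γ 0)).im) volume 0 1 := by
  have hd : Differentiable ℝ γ := hγ.differentiable (by simp)
  have hγ1 : ContDiff ℝ 1 γ := hγ.of_le (by exact_mod_cast le_top)
  have hcd : Continuous (deriv γ) := hγ1.continuous_deriv le_rfl
  have hd2 : ContDiff ℝ 1 (deriv γ) := by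
    have : ContDiff ℝ 2 γ := contDiff_infty.1 hγ 2
    rw [show (2 : WithTop ℕ∞) = 1 + 1 from rfl, contDiff_succ_iff_deriv] at this
    exact this.2.2
  obtain ⟨C, hC⟩ := isCompact_Icc.exists_bound_of_continuousOn (s := Icc (0 : ℝ) 1)
    (hd2.continuous_deriv le_rfl).continuousOn
  obtain ⟨M, hM⟩ := isCompact_Icc.exists_bound_of_continuousOn (s := Icc (0 : ℝ) 1)
    hcd.continuousOn
  have hlip : ∀ s ∈ Icc (0 : ℝ) 1, ∀ t ∈ Icc (0 : ℝ) 1, ‖deriv γ t - deriv γ s‖ ≤ C * ‖t - s‖ :=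
    fun s hs t ht => (convex_Icc 0 1).norm_image_sub_le_of_norm_deriv_le
      (fun x _ => (hd2.differentiable one_ne_zero).differentiableAt) hC hs ht
  have hC0 : 0 ≤ C := (norm_nonneg _).trans (hC 0 (by simp))
  have hM0 : 0 ≤ M := (norm_nonneg _).trans (hM 0 (by simp))
  have htay : ∀ t ∈ Icc (0 : ℝ) 1, ‖γ t - γ 0 - t * deriv γ t‖ ≤ C * t * t := by
    intro t ht
    have := (convex_Icc 0 t).norm_image_sub_le_of_norm_hasDerivWithin_le (𝕜 := ℝ)
      (f := fun x => γ x - x * deriv γ t)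
      (f' := fun x => deriv γ x - deriv γ t) (C := C * t) (x := 0) (y := t) ?_ ?_
      (left_mem_Icc.2 ht.1) (right_mem_Icc.2 ht.1)
    · simp only [Complex.ofReal_zero, zero_mul, sub_zero, Real.norm_eq_abs, abs_of_nonneg ht.1]
        at this
      rwa [show γ t - γ 0 - t * deriv γ t = γ t - t * deriv γ t - γ 0 by ring]
    · intro x _
      have h1 : HasDerivAt (fun x : ℝ => (x : ℂ) * deriv γ t) (1 * deriv γ t) x :=
        Complex.ofRealCLM.hasDerivAt.mul_const _
      rw [one_mul] at h1
      exact ((hd x).hasDerivAt.sub h1).hasDerivWithinAt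
    · intro x hx
      refine (hlip t ht x ⟨hx.1, hx.2.trans ht.2⟩).trans ?_
      gcongr
      rw [Real.norm_eq_abs, abs_le]
      constructor <;> linarith [hx.1, hx.2]
  -- a positive lower bound for the difference quotient
  obtain ⟨m, hm, hmb⟩ : ∃ m : ℝ, 0 < m ∧ ∀ t ∈ Ioc (0 : ℝ) 1, m * t ≤ ‖γ t - γ 0‖ := by
    -- The difference quotient, completed by the derivative at `0`, is continuous and has no zero on
    -- the compact interval, so its norm has a positive minimum.
    have hcs : Continuous (dslope γ 0) := by
      rw [continuous_iff_continuousAt]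
      intro t
      by_cases h : t = 0
      · subst h; exact continuousAt_dslope_same.2 (hd 0)
      · exact (continuousAt_dslope_of_ne h).2 (hd t).continuousAt
    have hn : ∀ t ∈ Icc (0 : ℝ) 1, dslope γ 0 t ≠ 0 := by
      intro t ht
      by_cases h : t = 0
      · subst h; simpa using h0
      · rw [dslope_of_ne _ h, slope_def_module]
        have := hne t ⟨lt_of_le_of_ne ht.1 (Ne.symm h), ht.2⟩
        exact smul_ne_zero (by simpa using h) (sub_ne_zero.2 this)
    obtain ⟨x, hx, hmin⟩ := isCompact_Icc.exists_isMinOn (s := Icc (0 : ℝ) 1) ⟨0, by simp⟩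
      hcs.norm.continuousOn
    refine ⟨‖dslope γ 0 x‖, norm_pos_iff.2 (hn x hx), fun t ht => ?_⟩
    have h1 : ‖dslope γ 0 x‖ ≤ ‖dslope γ 0 t‖ := hmin ⟨ht.1.le, ht.2⟩
    have h2 : t • dslope γ 0 t = γ t - γ 0 := by
      simpa using sub_smul_dslope γ 0 t
    rw [← h2, norm_smul, Real.norm_eq_abs, abs_of_pos ht.1, mul_comm]
    exact mul_le_mul_of_nonneg_left h1 ht.1.le
  rw [intervalIntegrable_iff_integrableOn_Ioc_of_le zero_le_one]
  -- The estimates give `C / m`; the inequality `m ≤ M` turns this into the bound used here.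
  refine ⟨?_, .restrict_of_bounded (C := M * C / (m * m)) (by simp) ?_⟩
  · refine ContinuousOn.aestronglyMeasurable ?_ measurableSet_Ioc
    refine Complex.continuous_im.comp_continuousOn (hcd.continuousOn.div
      (hd.continuous.sub continuous_const).continuousOn fun t ht => sub_ne_zero.2 (hne t ht))
  · refine (ae_restrict_iff' measurableSet_Ioc).2 (Eventually.of_forall fun t ht => ?_)
    have hz : γ t - γ 0 ≠ 0 := sub_ne_zero.2 (hne t ht)
    have ht0 : (t : ℂ) ≠ 0 := by exact_mod_cast ht.1.ne'
    set z := γ t - γ 0 with hzdef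
    -- Subtracting the real number `t⁻¹` leaves the imaginary part unchanged.
    have e1 : ((z - t * deriv γ t) / (t * z)).im = -(deriv γ t / z).im := by
      have : (z - t * deriv γ t) / (t * z) = ((t⁻¹ : ℝ) : ℂ) - deriv γ t / z := by
        push_cast; field_simp
      rw [this, Complex.sub_im, Complex.ofReal_im]; ring
    have e2 : ‖(deriv γ t / z).im‖ ≤ ‖(z - t * deriv γ t) / (t * z)‖ := by
      rw [← norm_neg, ← e1]; exact Complex.abs_im_le_norm _
    have hmC : m ≤ M := by
      have hh : ∀ t ∈ Ioc (0 : ℝ) 1, m ≤ M := by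
        intro t ht
        have := (convex_Icc (0:ℝ) 1).norm_image_sub_le_of_norm_deriv_le (𝕜 := ℝ) (f := γ)
          (fun x _ => hd x) hM (x := 0) (y := t) (by simp) ⟨ht.1.le, ht.2⟩
        have h3 := hmb t ht
        rw [sub_zero, Real.norm_eq_abs, abs_of_pos ht.1] at this
        nlinarith [ht.1]
      exact hh 1 (by simp)
    refine e2.trans ?_
    rw [norm_div, norm_mul, Complex.norm_real, Real.norm_eq_abs, abs_of_pos ht.1]
    have hzp : 0 < ‖z‖ := norm_pos_iff.2 hz
    rw [div_le_div_iff₀ (mul_pos ht.1 hzp) (mul_pos hm hm)]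
    have i1 := htay t ⟨ht.1.le, ht.2⟩
    have i2 := hmb t ht
    calc ‖z - t * deriv γ t‖ * (m * m) ≤ (C * t * t) * (m * m) := by gcongr
      _ = (C * t * m) * (m * t) := by ring
      _ ≤ (C * t * M) * ‖z‖ := by
        exact mul_le_mul (mul_le_mul_of_nonneg_left hmC (mul_nonneg hC0 ht.1.le)) i2
          (mul_nonneg hm.le ht.1.le) (mul_nonneg (mul_nonneg hC0 ht.1.le) hM0)
      _ = M * C * (t * ‖z‖) := by ring

/-- At `t = 0` only continuity of `θ` is required, as the vector vanishes there. The value `θ 0` is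
the limit angle, which later is an angle of the tangent. -/
theorem angleIntegral_eq {γ : ℝ → ℂ} (hγ : ContDiff ℝ ∞ γ) (h0 : deriv γ 0 ≠ 0)
    {θ : ℝ → ℝ} (hθ : ContinuousOn θ (Icc 0 1))
    (h : ∀ t ∈ Ioc (0 : ℝ) 1, HasAngle (γ t - γ 0) (θ t)) :
    angleIntegral γ = θ 1 - θ 0 := by
  refine intervalIntegral.integral_eq_sub_of_hasDerivAt_of_le zero_le_one hθ (fun t ht => ?_)
    (intervalIntegrable_angle hγ h0 fun t ht => sub_ne_zero.1 (h t ht).ne_zero)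
  refine hasDerivAt_angle (z := fun t => γ t - γ 0) ?_ ?_ ?_
  · exact ((hγ.differentiable (by simp)) t).hasDerivAt.sub_const _
  · exact hθ.continuousAt (Icc_mem_nhds ht.1 ht.2)
  · filter_upwards [Ioc_mem_nhds ht.1 ht.2] with u hu using h u hu

/-- Continuous angles for a smooth family of curves. -/
theorem exists_angle_family {Γ : ℝ × ℝ → ℂ} (hΓ : ContDiff ℝ ∞ Γ)
    (hne : ∀ s, ∀ t ∈ Ioc (0 : ℝ) 1, Γ (s, t) ≠ Γ (s, 0))
    (h0 : ∀ s, deriv (fun t => Γ (s, t)) 0 ≠ 0) :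
    ∃ θ : ℝ × ℝ → ℝ, Continuous θ ∧ (∀ s, HasAngle (deriv (fun t => Γ (s, t)) 0) (θ (s, 0))) ∧
      ∀ s, ∀ t ∈ Ioc (0 : ℝ) 1, HasAngle (Γ (s, t) - Γ (s, 0)) (θ (s, t)) := by
  have hd : ∀ s t, HasDerivAt (fun t => Γ (s, t)) (fderiv ℝ Γ (s, t) (0, 1)) t := fun s t => by
    have h1 : HasDerivAt (fun t : ℝ => (s, t)) ((0 : ℝ), (1 : ℝ)) t :=
      (hasDerivAt_const t s).prodMk (hasDerivAt_id t)
    exact ((hΓ.differentiable (by simp)) (s, t)).hasFDerivAt.comp_hasDerivAt t h1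
  have hc : Continuous fun p : ℝ × ℝ => fderiv ℝ Γ p (0, 1) :=
    (hΓ.continuous_fderiv (by simp)).clm_apply continuous_const
  -- Hadamard quotient: `Q (s, t)` is `(Γ (s, t) - Γ (s, 0)) / t`, continued by the derivative at `t
  -- = 0`. For positive `t` it has the same angles as the difference itself, and it is continuous in
  -- both variables.
  let Q : ℝ × ℝ → ℂ := fun p => ∫ u in (0 : ℝ)..1, fderiv ℝ Γ (p.1, u * p.2) (0, 1)
  have hQc : Continuous Q := by
    refine intervalIntegral.continuous_parametric_intervalIntegral_of_continuous'
      (f := fun (p : ℝ × ℝ) u => fderiv ℝ Γ (p.1, u * p.2) (0, 1)) ?_ 0 1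
    exact hc.comp (f := fun q : (ℝ × ℝ) × ℝ => (q.1.1, q.2 * q.1.2)) (by fun_prop)
  have hQ : ∀ s t : ℝ, (t : ℂ) * Q (s, t) = Γ (s, t) - Γ (s, 0) := by
    intro s t
    have h1 : ∀ u ∈ uIcc (0 : ℝ) 1, HasDerivAt (fun u => Γ (s, u * t))
        (t • fderiv ℝ Γ (s, u * t) (0, 1)) u := fun u _ => by
      have h2 : HasDerivAt (fun u : ℝ => u * t) t u := by
        simpa using (hasDerivAt_id' u).mul_const t
      exact (hd s (u * t)).scomp u h2
    have hcu' : Continuous fun u : ℝ => fderiv ℝ Γ (s, u * t) (0, 1) :=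
      hc.comp (f := fun u : ℝ => (s, u * t)) (by fun_prop)
    have hcu : Continuous fun u : ℝ => t • fderiv ℝ Γ (s, u * t) (0, 1) := by fun_prop
    have h2 := intervalIntegral.integral_eq_sub_of_hasDerivAt h1 (hcu.intervalIntegrable _ _)
    rw [intervalIntegral.integral_smul] at h2
    simpa using h2
  have hQ0 : ∀ s, Q (s, 0) = deriv (fun t => Γ (s, t)) 0 := fun s => by
    simp [Q, (hd s 0).deriv]
  -- `Q` is known to be nonzero only for `t` in the unit interval. Clamping `t` gives a nowhere
  -- vanishing function on the whole plane, where a logarithm exists.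
  let cl : ℝ → ℝ := fun t => max 0 (min 1 t)
  have hcl : ∀ t ∈ Icc (0 : ℝ) 1, cl t = t := fun t ht => by simp [cl, ht.1, ht.2]
  have hclc : Continuous cl := by fun_prop
  obtain ⟨θ, hθ, hθa⟩ := exists_continuous_hasAngle (V := ℝ × ℝ)
    (g := fun p => Q (p.1, cl p.2)) (by fun_prop) (fun p => by
      have h1 : cl p.2 ∈ Icc (0 : ℝ) 1 := ⟨le_max_left _ _, max_le zero_le_one (min_le_left _ _)⟩
      rcases eq_or_lt_of_le h1.1 with h | h
      · rw [← h, hQ0]; exact h0 _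
      · intro h3
        have := hQ p.1 (cl p.2)
        rw [h3, mul_zero] at this
        exact hne p.1 _ ⟨h, h1.2⟩ (sub_eq_zero.1 this.symm))
  refine ⟨θ, hθ, fun s => ?_, fun s t ht => ?_⟩
  · have := hθa (s, 0)
    simp only [hcl 0 (by simp), hQ0] at this
    exact this
  · have := hθa (s, t)
    simp only [hcl t ⟨ht.1.le, ht.2⟩] at this
    rw [← hQ]
    exact this.smul ht.1

/-- One-sided difference quotients determine the derivative. This is needed at the end-points, as
diagrams are compared only on the unit interval. -/
theorem HasDerivAt.eq_of_eqOn_Icc {f g : ℝ → ℂ} {f' g' : ℂ} {t a b : ℝ} (hf : HasDerivAt f f' t)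
    (hg : HasDerivAt g g' t) (hab : a < b) (ht : t ∈ Icc a b) (h : EqOn f g (Icc a b)) :
    f' = g' :=
  ((uniqueDiffOn_Icc hab) t ht).eq_deriv _ (hf.hasDerivWithinAt.congr (fun _ hx => (h hx).symm)
    (h ht).symm) hg.hasDerivWithinAt

/-- The change of the angle integral in a smooth family of curves, up to reparametrization. -/
theorem angleIntegral_family {Γ : ℝ × ℝ → ℂ} (hΓ : ContDiff ℝ ∞ Γ)
    (hne : ∀ s, ∀ t ∈ Ioc (0 : ℝ) 1, Γ (s, t) ≠ Γ (s, 0))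
    (h0 : ∀ s, deriv (fun t => Γ (s, t)) 0 ≠ 0) {φ ψ : ℝ → ℝ} (hφ : Continuous φ)
    (hψ : Continuous ψ) (hφa : ∀ s, HasAngle (deriv (fun t => Γ (s, t)) 0) (φ s))
    (hψa : ∀ s, HasAngle (Γ (s, 1) - Γ (s, 0)) (ψ s))
    {γ δ : ℝ → ℂ} (hγ : ContDiff ℝ ∞ γ) (hδ : ContDiff ℝ ∞ δ) (hγ0 : deriv γ 0 ≠ 0)
    (hδ0 : deriv δ 0 ≠ 0) {h : ℝ → ℝ} (hh : IsReparam h)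
    (hmaps : ∀ t ∈ Ioc (0 : ℝ) 1, h t ∈ Ioc (0 : ℝ) 1)
    (hγΓ : ∀ t ∈ Icc (0 : ℝ) 1, γ t = Γ (0, t)) (hδΓ : ∀ t ∈ Icc (0 : ℝ) 1, δ t = Γ (1, h t)) :
    angleIntegral δ - angleIntegral γ = (ψ 1 - ψ 0) - (φ 1 - φ 0) := by
  obtain ⟨θ, hθ, hθ0, hθt⟩ := exists_angle_family hΓ hne h0
  have h01 : (0 : ℝ) ∈ Icc (0 : ℝ) 1 := by simp
  have e1 : angleIntegral γ = θ (0, 1) - θ (0, 0) :=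
    angleIntegral_eq (θ := fun t => θ (0, t)) hγ hγ0 (by fun_prop) fun t ht => by
      rw [hγΓ t ⟨ht.1.le, ht.2⟩, hγΓ 0 h01]; exact hθt 0 t ht
  have hhc : Continuous h := hh.smooth.continuous
  have e2 : angleIntegral δ = θ (1, 1) - θ (1, 0) := by
    have := angleIntegral_eq (θ := fun t => θ (1, h t)) hδ hδ0 (by fun_prop) fun t ht => by
      rw [hδΓ t ⟨ht.1.le, ht.2⟩, hδΓ 0 h01, hh.zero]; exact hθt 1 _ (hmaps t ht)
    rwa [hh.zero, hh.one] at this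
  have e3 := angle_variation_eq (w := fun s => deriv (fun t => Γ (s, t)) 0) (k := 1)
    (θ := fun s => θ (s, 0)) (φ := φ) (by fun_prop) hφ.continuousOn (fun s _ => hθ0 s)
    (fun s _ => by simpa using hφa s)
  have e4 := angle_variation_eq (w := fun s => Γ (s, 1) - Γ (s, 0)) (k := 1)
    (θ := fun s => θ (s, 1)) (φ := ψ) (by fun_prop) hψ.continuousOn
    (fun s _ => hθt s 1 (by simp)) (fun s _ => by simpa using hψa s)
  rw [e1, e2, e3, e4]; ring

/-! ### Elementary properties of diagrams -/

/-- Diffeomorphisms of the plane. -/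
abbrev PlaneDiffeo : Type := Diffeomorph 𝓘(ℝ, ℂ) 𝓘(ℝ, ℂ) ℂ ℂ ∞

theorem PlaneDiffeo.contDiff (G : PlaneDiffeo) : ContDiff ℝ ∞ G :=
  G.contMDiff.contDiff

theorem PlaneDiffeo.differentiable (G : PlaneDiffeo) : Differentiable ℝ G :=
  G.contDiff.differentiable (by simp)

namespace KnotoidDiagram

theorem differentiable (D : KnotoidDiagram) : Differentiable ℝ D.curve :=
  D.smooth.differentiable (by simp)

theorem hasDerivAt (D : KnotoidDiagram) (t : ℝ) : HasDerivAt D.curve (deriv D.curve t) t :=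
  (D.differentiable t).hasDerivAt

theorem leg_ne (D : KnotoidDiagram) {t : ℝ} (ht : t ∈ Ioc (0 : ℝ) 1) : D.curve t ≠ D.curve 0 :=
  fun h => (D.endpoints_simple 0 (by simp) t ⟨ht.1.le, ht.2⟩ ht.1.ne h.symm).1.false

theorem head_ne (D : KnotoidDiagram) {t : ℝ} (ht : t ∈ Ico (0 : ℝ) 1) : D.curve t ≠ D.curve 1 :=
  fun h => (D.endpoints_simple 1 (by simp) t ⟨ht.1, ht.2.le⟩ ht.2.ne' h.symm).2.false

/-- The curve traversed backwards. -/
def revCurve (D : KnotoidDiagram) (t : ℝ) : ℂ := D.curve (1 - t)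

theorem revCurve_smooth (D : KnotoidDiagram) : ContDiff ℝ ∞ D.revCurve :=
  D.smooth.comp (contDiff_const.sub contDiff_id)

theorem deriv_revCurve (D : KnotoidDiagram) (t : ℝ) :
    deriv D.revCurve t = -deriv D.curve (1 - t) :=
  deriv_comp_const_sub (f := D.curve) (a := 1) (x := t)

theorem legWinding_eq (D : KnotoidDiagram) :
    D.legWinding = (2 * Real.pi)⁻¹ * angleIntegral D.curve := rfl

/-- The substitution `t ↦ 1 - t` turns the head into the leg of the reversed curve, so that only one
kind of end-point has to be analysed. -/
theorem headWinding_eq (D : KnotoidDiagram) :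
    D.headWinding = (2 * Real.pi)⁻¹ * angleIntegral D.revCurve := by
  have h := intervalIntegral.integral_comp_sub_left (a := 0) (b := 1)
    (fun t => (deriv D.curve t / (D.curve t - D.curve 1)).im) 1
  rw [headWinding, angleIntegral]
  congr 1
  rw [intervalIntegral.integral_symm]
  simp only [deriv_revCurve, revCurve, sub_zero, sub_self] at h ⊢
  rw [← h, ← intervalIntegral.integral_neg]
  congr 1
  ext t
  rw [neg_div, Complex.neg_im]

theorem deriv_revCurve_zero_ne (D : KnotoidDiagram) : deriv D.revCurve 0 ≠ 0 := by
  rw [deriv_revCurve, sub_zero]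
  exact neg_ne_zero.2 (D.immersion 1 (by simp))

theorem revCurve_ne (D : KnotoidDiagram) {t : ℝ} (ht : t ∈ Ioc (0 : ℝ) 1) :
    D.revCurve t ≠ D.revCurve 0 := by
  rw [revCurve, revCurve, sub_zero]
  exact D.head_ne ⟨by linarith [ht.2], by linarith [ht.1]⟩

end KnotoidDiagram

theorem SameDirection.hasAngle {w v : ℂ} {θ : ℝ} (h : SameDirection w v) (hv : HasAngle v θ) :
    HasAngle w θ := by
  obtain ⟨c, hc, rfl⟩ := h
  exact hv.smul hc

theorem HasAngle.sameDirection {w v : ℂ} {θ : ℝ} (h : HasAngle w θ) (h' : HasAngle v θ) :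
    SameDirection w v := by
  obtain ⟨r, hr, rfl⟩ := h
  obtain ⟨s, hs, rfl⟩ := h'
  refine ⟨r / s, div_pos hr hs, ?_⟩
  have : (s : ℂ) ≠ 0 := by exact_mod_cast hs.ne'
  push_cast
  field_simp

/-- The angle at the leg runs from the direction of `v` to that of the chord, the angle at the head
from the direction of `-v` to that of the opposite chord. Both discrepancies are half-turns modulo
2π, so the difference of the variations is a multiple of 2π. -/
theorem BiframedDiagram.exists_coframing_eq_int {v : ℂ} (K : BiframedDiagram v) :
    ∃ n : ℤ, (n : ℝ) = K.coframing := by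
  obtain ⟨θ, hθ, hθ0, hθt⟩ := exists_angle_family (Γ := fun p => K.curve p.2)
    (K.smooth.comp contDiff_snd) (fun s t ht => K.leg_ne ht) (fun s => K.immersion 0 (by simp))
  obtain ⟨φ, hφ, hφ0, hφt⟩ := exists_angle_family (Γ := fun p => K.revCurve p.2)
    (K.revCurve_smooth.comp contDiff_snd) (fun s t ht => K.revCurve_ne ht)
    (fun s => K.deriv_revCurve_zero_ne)
  have e1 := angleIntegral_eq (θ := fun t => θ (0, t)) K.smooth (K.immersion 0 (by simp))
    (by fun_prop) (hθt 0)
  have e2 := angleIntegral_eq (θ := fun t => φ (0, t)) K.revCurve_smooth K.deriv_revCurve_zero_ne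
    (by fun_prop) (hφt 0)
  have a1 := hθ0 0
  have a2 : HasAngle (deriv K.revCurve 0) (φ (0, 0)) := hφ0 0
  rw [K.deriv_revCurve, sub_zero] at a2
  have b1 : HasAngle (K.curve 1 - K.curve 0) (θ (0, 1)) := hθt 0 1 (by simp)
  have b2 := hφt 0 1 (by simp)
  simp only [KnotoidDiagram.revCurve, sub_self, sub_zero] at b2
  have a3 := a2.neg
  rw [neg_neg] at a3
  obtain ⟨τ, hτ⟩ := exists_hasAngle (w := v) fun h => by
    obtain ⟨c, -, hc⟩ := K.leg_direction
    exact K.immersion 0 (by simp) (by rw [hc, h, mul_zero])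
  obtain ⟨n, hn⟩ := (K.leg_direction.hasAngle hτ).sub_eq a1
  obtain ⟨m, hm⟩ := (K.head_direction.hasAngle hτ).sub_eq a3
  have b3 := b1.neg
  rw [neg_sub] at b3
  obtain ⟨l, hl⟩ := b3.sub_eq b2
  -- The `-1` is the sum of two half-turns: one from reversing the chord, one from reversing the
  -- head tangent.
  refine ⟨l + n - m - 1, ?_⟩
  rw [KnotoidDiagram.coframing, K.legWinding_eq, K.headWinding_eq, e1, e2, ← mul_sub]
  have hp : (2 * Real.pi) ≠ 0 := by positivity
  field_simp
  push_cast
  linear_combination hm - hn - hl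

/-! ### Reparametrizations -/

namespace IsReparam

variable {h : ℝ → ℝ} (hh : IsReparam h)
include hh

theorem strictMonoOn : StrictMonoOn h (Icc 0 1) :=
  strictMonoOn_of_deriv_pos (convex_Icc 0 1) hh.smooth.continuous.continuousOn
    fun t ht => hh.deriv_pos t (interior_subset ht)

theorem mapsTo_Icc : MapsTo h (Icc 0 1) (Icc 0 1) := fun t ht =>
  ⟨by rw [← hh.zero]; exact hh.strictMonoOn.monotoneOn (by simp) ht ht.1,
   by conv_rhs => rw [← hh.one]
      exact hh.strictMonoOn.monotoneOn ht (by simp) ht.2⟩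

theorem mapsTo_Ioc : MapsTo h (Ioc 0 1) (Ioc 0 1) := fun t ht =>
  ⟨by rw [← hh.zero]; exact hh.strictMonoOn (by simp) ⟨ht.1.le, ht.2⟩ ht.1,
   (hh.mapsTo_Icc ⟨ht.1.le, ht.2⟩).2⟩

theorem surjOn_Icc : SurjOn h (Icc 0 1) (Icc 0 1) := by
  have := intermediate_value_Icc (zero_le_one' ℝ) hh.smooth.continuous.continuousOn
  rwa [hh.zero, hh.one] at this

theorem reverse : IsReparam fun t => 1 - h (1 - t) where
  smooth := contDiff_const.sub (hh.smooth.comp (contDiff_const.sub contDiff_id))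
  zero := by simp [hh.one]
  one := by simp [hh.zero]
  deriv_pos t ht := by
    have h1 : HasDerivAt (fun t => h (1 - t)) (-deriv h (1 - t)) t :=
      (hh.smooth.differentiable (by simp) (1 - t)).hasDerivAt.comp_const_sub 1 t
    rw [(h1.const_sub 1).deriv, neg_neg]
    exact hh.deriv_pos _ ⟨by linarith [ht.2], by linarith [ht.1]⟩

end IsReparam

theorem isReparam_id : IsReparam id where
  smooth := contDiff_id
  zero := rfl
  one := rfl
  deriv_pos t _ := by simp

/-! ### The coframing under isotopies -/

/-- The track of the curve under an isotopy. -/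
def AmbientIsotopy.track (F : AmbientIsotopy) (γ : ℝ → ℂ) (p : ℝ × ℝ) : ℂ :=
  F.toDiffeo p.1 (γ p.2)

theorem AmbientIsotopy.track_smooth (F : AmbientIsotopy) {γ : ℝ → ℂ} (hγ : ContDiff ℝ ∞ γ) :
    ContDiff ℝ ∞ (F.track γ) :=
  F.smooth.comp (contDiff_fst.prodMk (hγ.comp contDiff_snd))

theorem PlaneDiffeo.fderiv_symm_apply (G : PlaneDiffeo) (z w : ℂ) :
    fderiv ℝ G.symm (G z) (fderiv ℝ G z w) = w := by
  have h1 : HasFDerivAt (G.symm ∘ G) ((fderiv ℝ G.symm (G z)).comp (fderiv ℝ G z)) z :=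
    (PlaneDiffeo.differentiable G.symm (G z)).hasFDerivAt.comp z (G.differentiable z).hasFDerivAt
  have h2 : (G.symm ∘ G : ℂ → ℂ) = id := funext fun z => G.symm_apply_apply z
  rw [h2] at h1
  have := h1.unique (hasFDerivAt_id z)
  exact congrArg (fun L : ℂ →L[ℝ] ℂ => L w) this

theorem PlaneDiffeo.fderiv_ne_zero (G : PlaneDiffeo) {z w : ℂ} (hw : w ≠ 0) :
    fderiv ℝ G z w ≠ 0 := fun h => hw (by rw [← G.fderiv_symm_apply z w, h, map_zero])

theorem PlaneDiffeo.hasDerivAt_comp (G : PlaneDiffeo) {γ : ℝ → ℂ} {γ' : ℂ} {t : ℝ}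
    (h : HasDerivAt γ γ' t) : HasDerivAt (fun t => G (γ t)) (fderiv ℝ G (γ t) γ') t :=
  (G.differentiable (γ t)).hasFDerivAt.comp_hasDerivAt t h

/-- Each angle integral is an angle of the chord minus an angle of the tangent at the end-point,
followed continuously through the isotopy. The chords seen from the two end-points are opposite, so
their angles `χ` and `χ + π` vary equally and cancel; what remains is the turning of the two
tangents. -/
theorem IsotopyCarries.coframing_sub {F : AmbientIsotopy} {D D' : KnotoidDiagram}
    (hc : IsotopyCarries F D D') {φ ψ : ℝ → ℝ} (hφ : Continuous φ) (hψ : Continuous ψ)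
    (hφa : ∀ s, HasAngle (deriv (fun t => F.toDiffeo s (D.curve t)) 0) (φ s))
    (hψa : ∀ s, HasAngle (deriv (fun t => F.toDiffeo s (D.curve t)) 1) (ψ s)) :
    D'.coframing - D.coframing =
      (2 * Real.pi)⁻¹ * ((ψ 1 - ψ 0) - (φ 1 - φ 0)) := by
  obtain ⟨h, hh, hD'⟩ := hc
  have hinj : ∀ s, Function.Injective (F.toDiffeo s) := fun s => (F.toDiffeo s).injective
  have hs1 := F.track_smooth D.smooth
  have hs2 := F.track_smooth D.revCurve_smooth
  obtain ⟨χ, hχ, hχa⟩ := exists_continuous_hasAngle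
    (g := fun s : ℝ => F.track D.curve (s, 1) - F.track D.curve (s, 0))
    ((hs1.continuous.comp (by fun_prop)).sub (hs1.continuous.comp (by fun_prop)))
    (fun s => sub_ne_zero.2 fun h => D.leg_ne (t := 1) (by simp) (hinj s h))
  have hne0 : ∀ (s t : ℝ), t ∈ Icc (0:ℝ) 1 → deriv (fun t => F.toDiffeo s (D.curve t)) t ≠ 0 :=
    fun s t ht => by
      rw [(PlaneDiffeo.hasDerivAt_comp (F.toDiffeo s) (D.hasDerivAt t)).deriv]
      exact PlaneDiffeo.fderiv_ne_zero _ (D.immersion t ht)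
  have e1 := angleIntegral_family hs1 (fun s t ht h => D.leg_ne ht (hinj s h))
    (fun s => hne0 s 0 (by simp)) hφ hχ hφa hχa D.smooth D'.smooth (D.immersion 0 (by simp))
    (D'.immersion 0 (by simp)) hh hh.mapsTo_Ioc (fun t _ => (F.zero _).symm)
    (fun t ht => (hD' t ht).1)
  have hrev : ∀ s, deriv (fun t => F.track D.revCurve (s, t)) 0 =
      -deriv (fun t => F.toDiffeo s (D.curve t)) 1 := fun s => by
    have := deriv_comp_const_sub (f := fun t => F.toDiffeo s (D.curve t)) (a := 1) (x := 0)
    rw [sub_zero] at this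
    exact this
  have e2 := angleIntegral_family hs2 (fun s t ht h => D.revCurve_ne ht (hinj s h))
    (fun s => by rw [hrev]; exact neg_ne_zero.2 (hne0 s 1 (by simp)))
    (φ := fun s => ψ s + Real.pi) (ψ := fun s => χ s + Real.pi) (by fun_prop) (by fun_prop)
    (fun s => by rw [hrev]; exact (hψa s).neg)
    (fun s => by
      have := (hχa s).neg
      simpa [AmbientIsotopy.track, KnotoidDiagram.revCurve] using this)
    D.revCurve_smooth D'.revCurve_smooth D.deriv_revCurve_zero_ne
    D'.deriv_revCurve_zero_ne hh.reverse hh.reverse.mapsTo_Ioc (fun t _ => (F.zero _).symm)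
    (fun t ht => by
      simp only [KnotoidDiagram.revCurve, AmbientIsotopy.track, sub_sub_cancel]
      exact (hD' (1 - t) ⟨by linarith [ht.2], by linarith [ht.1]⟩).1)
  rw [KnotoidDiagram.coframing, KnotoidDiagram.coframing, D.legWinding_eq, D.headWinding_eq,
    D'.legWinding_eq, D'.headWinding_eq]
  linear_combination (2 * Real.pi)⁻¹ * e1 - (2 * Real.pi)⁻¹ * e2

/-! ### Local changes -/

namespace LocalChange

variable {D D' : KnotoidDiagram} {B : Set ℂ} {n : ℕ} {a b : Fin n → ℝ}

theorem symm (h : LocalChange D D' B a b) : LocalChange D' D B a b where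
  disc := h.disc
  arcs := h.arcs
  disjoint := h.disjoint
  meets := h.meets'
  meets' := h.meets
  outside t ht ha := ⟨(h.outside t ht ha).1.symm, (h.outside t ht ha).2.symm⟩

theorem zero_notMem (h : LocalChange D D' B a b) (i : Fin n) : (0 : ℝ) ∉ Icc (a i) (b i) :=
  fun hi => absurd hi.1 (not_le.2 (h.arcs i).1)

theorem one_notMem (h : LocalChange D D' B a b) (i : Fin n) : (1 : ℝ) ∉ Icc (a i) (b i) :=
  fun hi => absurd hi.2 (not_le.2 (h.arcs i).2.2)

theorem Icc_subset (h : LocalChange D D' B a b) (i : Fin n) :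
    Icc (a i) (b i) ⊆ Ioo (0 : ℝ) 1 := fun _ ht =>
  ⟨(h.arcs i).1.trans_le ht.1, ht.2.trans_lt (h.arcs i).2.2⟩

theorem eq_outside (h : LocalChange D D' B a b) {t : ℝ} (ht : t ∈ Icc (0 : ℝ) 1)
    (hi : ∀ i, t ∉ Icc (a i) (b i)) : D'.curve t = D.curve t :=
  (h.outside t ht fun i hti => hi i (Ioo_subset_Icc_self hti)).1

/-- The curves agree on a neighbourhood of `t` relative to the unit interval. A one-sided
neighbourhood suffices, which covers the two end-points. -/
theorem deriv_eq (h : LocalChange D D' B a b) {t : ℝ} (ht : t ∈ Icc (0 : ℝ) 1)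
    (hi : ∀ i, t ∉ Icc (a i) (b i)) : deriv D'.curve t = deriv D.curve t := by
  have hev : ∀ᶠ u in 𝓝[Icc (0 : ℝ) 1] t, D'.curve u = D.curve u := by
    have h1 : ∀ᶠ u in 𝓝[Icc (0 : ℝ) 1] t, ∀ i, u ∉ Icc (a i) (b i) :=
      eventually_all.2 fun i => nhdsWithin_le_nhds (isClosed_Icc.isOpen_compl.mem_nhds (hi i))
    filter_upwards [h1, self_mem_nhdsWithin] with u hu hu'
    exact h.eq_outside hu' hu
  exact (uniqueDiffOn_Icc zero_lt_one t ht).eq_deriv _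
    ((D'.hasDerivAt t).hasDerivWithinAt.congr_of_eventuallyEq
      (hev.mono fun _ hx => hx.symm) (h.eq_outside ht hi).symm)
    (D.hasDerivAt t).hasDerivWithinAt

end LocalChange

theorem IsDisc.isClosed {B : Set ℂ} (hB : IsDisc B) : IsClosed B := by
  obtain ⟨G, rfl⟩ := hB
  exact (G.toHomeomorph.isClosedMap) _ Metric.isClosed_closedBall

/-- A continuous angle about a point outside a disc. -/
theorem IsDisc.exists_angle {B : Set ℂ} (hB : IsDisc B) {p : ℂ} (hp : p ∉ B) :
    ∃ θ : ℂ → ℝ, Continuous θ ∧ ∀ z ∈ B, HasAngle (z - p) (θ z) := by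
  obtain ⟨G, rfl⟩ := hB
  -- The radial retraction onto the closed unit disc extends `G - p` from that disc to a nowhere
  -- vanishing function on the plane.
  let cl : ℂ → ℂ := fun w => (max 1 ‖w‖)⁻¹ • w
  have hpos : ∀ w : ℂ, 0 < max 1 ‖w‖ := fun w => zero_lt_one.trans_le (le_max_left _ _)
  have hcl : Continuous cl :=
    (Continuous.inv₀ (by fun_prop) fun w => (hpos w).ne').smul continuous_id
  have hcl1 : ∀ w, cl w ∈ Metric.closedBall (0 : ℂ) 1 := fun w => by
    rw [mem_closedBall_zero_iff, norm_smul, norm_inv, Real.norm_eq_abs, abs_of_pos (hpos w),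
      inv_mul_le_one₀ (hpos w)]
    exact le_max_right _ _
  have hcl2 : ∀ w ∈ Metric.closedBall (0 : ℂ) 1, cl w = w := fun w hw => by
    rw [mem_closedBall_zero_iff] at hw
    simp [cl, max_eq_left hw]
  obtain ⟨θ, hθ, hθa⟩ := exists_continuous_hasAngle (V := ℂ) (g := fun w => G (cl w) - p)
    ((G.continuous.comp hcl).sub continuous_const)
    (fun w => sub_ne_zero.2 fun h => hp ⟨cl w, hcl1 w, h⟩)
  refine ⟨fun z => θ (G.symm z), hθ.comp G.symm.continuous, ?_⟩
  rintro _ ⟨w, hw, rfl⟩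
  have := hθa w
  rw [hcl2 w hw] at this
  simpa using this

namespace LocalChange

variable {D D' : KnotoidDiagram} {B : Set ℂ} {n : ℕ} {a b : Fin n → ℝ}

/-- On the disc the angle about `p` is a single-valued function `θ`, so along an arc inside the disc
the integral telescopes to the values of `θ` at the ends of the arc. -/
theorem arc_integral_eq (h : LocalChange D D' B a b) {p : ℂ} (i : Fin n) {θ : ℂ → ℝ}
    (hθ : Continuous θ) (hθa : ∀ z ∈ B, HasAngle (z - p) (θ z))
    (hint : IntervalIntegrable (fun t => (deriv D.curve t / (D.curve t - p)).im) volume (a i) (b i)) :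
    ∫ t in (a i)..(b i), (deriv D.curve t / (D.curve t - p)).im =
      θ (D.curve (b i)) - θ (D.curve (a i)) := by
  refine intervalIntegral.integral_eq_sub_of_hasDerivAt_of_le (f := fun t => θ (D.curve t))
    (h.arcs i).2.1.le (hθ.comp D.smooth.continuous).continuousOn (fun t ht => ?_) hint
  refine hasDerivAt_angle (z := fun t => D.curve t - p) ((D.hasDerivAt t).sub_const p)
    (hθ.comp D.smooth.continuous).continuousAt ?_
  filter_upwards [Icc_mem_nhds ht.1 ht.2] with u hu
  exact hθa _ ((h.meets.1 u (Ioo_subset_Icc_self (h.Icc_subset i hu))).2 ⟨i, hu⟩)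

/-- The integrands differ only on the arcs, and over each arc both integrals are the difference of
the same function `θ` at the common ends. -/
theorem integral_eq (h : LocalChange D D' B a b) {p : ℂ} (hp : p ∉ B)
    (hD : IntervalIntegrable (fun t => (deriv D.curve t / (D.curve t - p)).im) volume 0 1)
    (hD' : IntervalIntegrable (fun t => (deriv D'.curve t / (D'.curve t - p)).im) volume 0 1) :
    ∫ t in (0 : ℝ)..1, (deriv D'.curve t / (D'.curve t - p)).im =
      ∫ t in (0 : ℝ)..1, (deriv D.curve t / (D.curve t - p)).im := by
  obtain ⟨θ, hθ, hθa⟩ := h.disc.exists_angle hp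
  rw [← sub_eq_zero, ← intervalIntegral.integral_sub hD' hD,
    intervalIntegral.integral_of_le zero_le_one]
  set g : ℝ → ℝ := fun t => (deriv D'.curve t / (D'.curve t - p)).im -
    (deriv D.curve t / (D.curve t - p)).im with hg
  have hgi : IntegrableOn g (Ioc 0 1) :=
    (intervalIntegrable_iff_integrableOn_Ioc_of_le zero_le_one).1 (hD'.sub hD)
  have hsub : ∀ i, Icc (a i) (b i) ⊆ Ioc (0 : ℝ) 1 := fun i =>
    (h.Icc_subset i).trans Ioo_subset_Ioc_self
  have h1 : ∫ t in Ioc (0 : ℝ) 1, g t = ∫ t in ⋃ i, Icc (a i) (b i), g t := by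
    refine (setIntegral_eq_of_subset_of_forall_sdiff_eq_zero measurableSet_Ioc (iUnion_subset hsub)
      fun t ht => ?_)
    have hti : ∀ i, t ∉ Icc (a i) (b i) := fun i hi => ht.2 (mem_iUnion.2 ⟨i, hi⟩)
    have ht1 : t ∈ Icc (0 : ℝ) 1 := Ioc_subset_Icc_self ht.1
    simp only [hg, h.deriv_eq ht1 hti, h.eq_outside ht1 hti, sub_self]
  rw [h1, integral_iUnion_fintype (fun i => measurableSet_Icc)
    (fun i j hij => h.disjoint i j hij) fun i => hgi.mono_set (hsub i)]
  refine Finset.sum_eq_zero fun i _ => ?_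
  have hle := (h.arcs i).2.1.le
  have hsub' : uIcc (a i) (b i) ⊆ uIcc (0 : ℝ) 1 := by
    rw [uIcc_of_le hle, uIcc_of_le zero_le_one]
    exact (hsub i).trans Ioc_subset_Icc_self
  rw [integral_Icc_eq_integral_Ioc, ← intervalIntegral.integral_of_le hle,
    intervalIntegral.integral_sub (hD'.mono_set hsub') (hD.mono_set hsub'),
    h.arc_integral_eq i hθ hθa (hD.mono_set hsub'),
    h.symm.arc_integral_eq i hθ hθa (hD'.mono_set hsub')]
  -- The ends of an arc lie in no open arc: not in their own, and not in another one by
  -- disjointness.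
  have hend : ∀ t ∈ Icc (a i) (b i), t = a i ∨ t = b i → D'.curve t = D.curve t := by
    intro t ht hte
    refine (h.outside t (Ioc_subset_Icc_self (hsub i ht)) fun j hj => ?_).1
    by_cases hij : i = j
    · subst hij
      rcases hte with rfl | rfl
      · exact hj.1.false
      · exact hj.2.false
    · exact disjoint_left.1 (h.disjoint i j hij) ht (Ioo_subset_Icc_self hj)
  rw [hend _ (right_mem_Icc.2 hle) (Or.inr rfl), hend _ (left_mem_Icc.2 hle) (Or.inl rfl)]
  ring

theorem leg_notMem (h : LocalChange D D' B a b) : D.curve 0 ∉ B := fun hB => by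
  obtain ⟨i, hi⟩ := (h.meets.1 0 (by simp)).1 hB
  exact h.zero_notMem i hi

theorem head_notMem (h : LocalChange D D' B a b) : D.curve 1 ∉ B := fun hB => by
  obtain ⟨i, hi⟩ := (h.meets.1 1 (by simp)).1 hB
  exact h.one_notMem i hi

theorem intervalIntegrable_head (D : KnotoidDiagram) :
    IntervalIntegrable (fun t => (deriv D.curve t / (D.curve t - D.curve 1)).im) volume 0 1 := by
  have := (intervalIntegrable_angle D.revCurve_smooth D.deriv_revCurve_zero_ne
    (fun t ht => D.revCurve_ne ht)).comp_sub_left 1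
  simp only [KnotoidDiagram.deriv_revCurve, KnotoidDiagram.revCurve, sub_sub_cancel, sub_zero,
    sub_self, neg_div, Complex.neg_im] at this
  have h2 := this.symm.neg
  simpa [Pi.neg_def] using h2

/-- Both end-points lie outside the disc, so the two winding numbers are unchanged separately. -/
theorem coframing_eq (h : LocalChange D D' B a b) : D'.coframing = D.coframing := by
  have e0 : D'.curve 0 = D.curve 0 := h.eq_outside (by simp) h.zero_notMem
  have e1 : D'.curve 1 = D.curve 1 := h.eq_outside (by simp) h.one_notMem
  have i0 := intervalIntegrable_angle D.smooth (D.immersion 0 (by simp)) (fun t ht => D.leg_ne ht)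
  have i0' := intervalIntegrable_angle D'.smooth (D'.immersion 0 (by simp))
    (fun t ht => D'.leg_ne ht)
  have i1 := intervalIntegrable_head D
  have i1' := intervalIntegrable_head D'
  rw [e0] at i0'
  rw [e1] at i1'
  have r0 := h.integral_eq h.leg_notMem i0 i0'
  have r1 := h.integral_eq h.head_notMem i1 i1'
  rw [KnotoidDiagram.coframing, KnotoidDiagram.coframing, KnotoidDiagram.legWinding,
    KnotoidDiagram.legWinding, KnotoidDiagram.headWinding, KnotoidDiagram.headWinding,
    intervalIntegral.integral_symm 0 1, intervalIntegral.integral_symm 0 1, e0, e1, r0, r1]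

end LocalChange

/-! ### Finiteness of the set of crossings -/

theorem planeDet_smul_left (c : ℝ) (z w : ℂ) : planeDet (c * z) w = c * planeDet z w := by
  simp [planeDet]; ring

theorem planeDet_smul_right (c : ℝ) (z w : ℂ) : planeDet z (c * w) = c * planeDet z w := by
  simp [planeDet]; ring

theorem planeDet_swap (z w : ℂ) : planeDet z w = -planeDet w z := by
  simp [planeDet]; ring

theorem planeDet_map (A : ℂ →L[ℝ] ℂ) (z w : ℂ) :
    planeDet (A z) (A w) = planeDet (A 1) (A Complex.I) * planeDet z w := by
  have h : ∀ z : ℂ, A z = z.re * A 1 + z.im * A Complex.I := fun z => by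
    conv_lhs => rw [← Complex.re_add_im z]
    rw [map_add, show (z.re : ℂ) = z.re • (1 : ℂ) by simp,
      show (z.im : ℂ) * Complex.I = z.im • Complex.I by simp, map_smul, map_smul]
    simp
  rw [h z, h w]
  simp only [planeDet, Complex.add_re, Complex.add_im, Complex.mul_re, Complex.mul_im,
    Complex.ofReal_re, Complex.ofReal_im]
  ring

theorem eq_zero_of_planeDet_ne_zero {z w : ℂ} (h : planeDet z w ≠ 0) {u v : ℝ}
    (h0 : (u : ℂ) * z + v * w = 0) : u = 0 ∧ v = 0 := by
  have h1 : u * planeDet z w = 0 := by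
    rw [← planeDet_smul_left, eq_neg_of_add_eq_zero_left h0]; simp [planeDet]; ring
  have h2 : v * planeDet z w = 0 := by
    rw [← planeDet_smul_right, eq_neg_of_add_eq_zero_right h0]; simp [planeDet]; ring
  exact ⟨(mul_eq_zero.1 h1).resolve_right h, (mul_eq_zero.1 h2).resolve_right h⟩

theorem eventually_injective_of_deriv_ne_zero {γ : ℝ → ℂ} {γ' : ℂ} {t : ℝ}
    (h : HasStrictDerivAt γ γ' t) (h0 : γ' ≠ 0) :
    ∀ᶠ p : ℝ × ℝ in 𝓝 (t, t), γ p.1 = γ p.2 → p.1 = p.2 := by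
  have := h.hasStrictFDerivAt.isLittleO.def (half_pos (norm_pos_iff.2 h0))
  filter_upwards [this] with p hp he
  rw [he, sub_self, zero_sub, norm_neg] at hp
  simp only [ContinuousLinearMap.toSpanSingleton_apply, norm_smul] at hp
  by_contra hne
  have : 0 < ‖p.1 - p.2‖ := norm_pos_iff.2 (sub_ne_zero.2 hne)
  nlinarith [norm_pos_iff.2 h0]

namespace KnotoidDiagram

theorem hasStrictDerivAt (D : KnotoidDiagram) (t : ℝ) :
    HasStrictDerivAt D.curve (deriv D.curve t) t :=
  (D.smooth.contDiffAt.hasStrictDerivAt (by simp))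

/-- An infinite set of such pairs would accumulate at some `(s, t)` in the compact square. This is
impossible on the diagonal because an immersion is locally injective, at a double point because
transversality makes the derivative of `(s, t) ↦ curve s - curve t` injective, and elsewhere by
continuity. -/
theorem finite_doublePoints (D : KnotoidDiagram) :
    {p : ℝ × ℝ | p.1 ∈ Icc (0 : ℝ) 1 ∧ p.2 ∈ Icc (0 : ℝ) 1 ∧ p.1 ≠ p.2 ∧
      D.curve p.1 = D.curve p.2}.Finite := by
  by_contra hinf
  obtain ⟨x, hx, hacc⟩ := Set.Infinite.exists_accPt_of_subset_isCompact hinf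
    ((isCompact_Icc (a := (0 : ℝ)) (b := 1)).prod (isCompact_Icc (a := (0 : ℝ)) (b := 1)))
    (fun p hp => ⟨hp.1, hp.2.1⟩)
  rw [accPt_iff_frequently] at hacc
  refine hacc ?_
  obtain ⟨s, t⟩ := x
  by_cases hst : s = t
  · subst hst
    filter_upwards [eventually_injective_of_deriv_ne_zero (D.hasStrictDerivAt s)
      (D.immersion s hx.1)] with p hp hq
    exact hq.2.2.2.1 (hp hq.2.2.2.2)
  by_cases hc : D.curve s = D.curve t
  · let L : ℝ × ℝ →L[ℝ] ℂ :=
      (ContinuousLinearMap.toSpanSingleton ℝ (deriv D.curve s)).comp (.fst ℝ ℝ ℝ) -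
        (ContinuousLinearMap.toSpanSingleton ℝ (deriv D.curve t)).comp (.snd ℝ ℝ ℝ)
    have hd1 : HasFDerivAt (fun p : ℝ × ℝ => D.curve p.1)
        ((ContinuousLinearMap.toSpanSingleton ℝ (deriv D.curve s)).comp (.fst ℝ ℝ ℝ)) (s, t) :=
      HasFDerivAt.comp (f := Prod.fst) (s, t) (D.hasDerivAt s).hasFDerivAt hasFDerivAt_fst
    have hd2 : HasFDerivAt (fun p : ℝ × ℝ => D.curve p.2)
        ((ContinuousLinearMap.toSpanSingleton ℝ (deriv D.curve t)).comp (.snd ℝ ℝ ℝ)) (s, t) :=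
      HasFDerivAt.comp (f := Prod.snd) (s, t) (D.hasDerivAt t).hasFDerivAt hasFDerivAt_snd
    have hd : HasFDerivAt (fun p : ℝ × ℝ => D.curve p.1 - D.curve p.2) L (s, t) := hd1.sub hd2
    obtain ⟨C, -, hC⟩ := LinearMap.exists_antilipschitzWith L.toLinearMap (by
          rw [LinearMap.ker_eq_bot']
          rintro ⟨u, v⟩ huv
          have := eq_zero_of_planeDet_ne_zero (D.transversal s hx.1 t hx.2 hst hc) (u := u)
            (v := -v) (by simpa [L, sub_eq_add_neg] using huv)
          ext
          · exact this.1
          · simpa using this.2)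
    have := hd.eventually_ne (c := 0) ⟨C, hC⟩
    rw [eventually_nhdsWithin_iff] at this
    filter_upwards [this] with p hp hq
    exact hp hq.1 (sub_eq_zero.2 hq.2.2.2.2)
  · have h1 : ∀ᶠ p : ℝ × ℝ in 𝓝 (s, t), D.curve p.1 - D.curve p.2 ≠ 0 :=
      ContinuousAt.eventually_ne (g := fun p : ℝ × ℝ => D.curve p.1 - D.curve p.2)
        (((D.smooth.continuous.comp continuous_fst).sub
          (D.smooth.continuous.comp continuous_snd)).continuousAt) (sub_ne_zero.2 hc)
    filter_upwards [h1] with p hp hq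
    exact hp (sub_eq_zero.2 hq.2.2.2.2)

theorem finite_crossings (D : KnotoidDiagram) : D.crossings.Finite :=
  D.finite_doublePoints.subset fun _ hp => ⟨hp.1, hp.2.1, hp.2.2.1, hp.2.2.2.1⟩

theorem crossingsIn_eq (D : KnotoidDiagram) (B : Set ℂ) :
    D.crossingsIn B = D.crossings ∩ {p | D.curve p.1 ∈ B} := rfl

theorem crossing_fst_mem {D : KnotoidDiagram} {p : ℝ × ℝ} (hp : p ∈ D.crossings) :
    p.1 ∈ Ioo (0 : ℝ) 1 := D.endpoints_simple _ hp.1 _ hp.2.1 hp.2.2.1 hp.2.2.2.1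

theorem crossing_snd_mem {D : KnotoidDiagram} {p : ℝ × ℝ} (hp : p ∈ D.crossings) :
    p.2 ∈ Ioo (0 : ℝ) 1 :=
  D.endpoints_simple _ hp.2.1 _ hp.1 hp.2.2.1.symm hp.2.2.2.1.symm

end KnotoidDiagram

/-! ### The framing under local changes -/

namespace LocalChange

variable {D D' : KnotoidDiagram} {B : Set ℂ} {n : ℕ} {a b : Fin n → ℝ}

theorem notMem_arcs (h : LocalChange D D' B a b) {t : ℝ} (ht : t ∈ Icc (0 : ℝ) 1)
    (hB : D.curve t ∉ B) (i : Fin n) : t ∉ Icc (a i) (b i) :=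
  fun hi => hB ((h.meets.1 t ht).2 ⟨i, hi⟩)

theorem crossings_diff_subset (h : LocalChange D D' B a b) {p : ℝ × ℝ}
    (hp : p ∈ D.crossings \ {p | D.curve p.1 ∈ B}) :
    p ∈ D'.crossings \ {p | D'.curve p.1 ∈ B} ∧ D'.crossingSign p = D.crossingSign p := by
  obtain ⟨⟨h1, h2, h3, h4, h5⟩, hB⟩ := hp
  have hB : D.curve p.1 ∉ B := hB
  have n1 := h.notMem_arcs h1 hB
  have n2 := h.notMem_arcs h2 (h4 ▸ hB)
  refine ⟨⟨⟨h1, h2, h3, ?_, ?_⟩, ?_⟩, ?_⟩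
  · rw [h.eq_outside h1 n1, h.eq_outside h2 n2, h4]
  · exact (h.outside _ h1 fun i hi => n1 i (Ioo_subset_Icc_self hi)).2.2 h5
  · rw [mem_ofPred_eq, h.eq_outside h1 n1]; exact hB
  · rw [KnotoidDiagram.crossingSign, KnotoidDiagram.crossingSign, h.deriv_eq h1 n1,
      h.deriv_eq h2 n2]

/-- The crossings outside the disc, and the derivatives there, are common to both diagrams. The
effect of a move on the framing is thus read off from the crossings inside the disc. -/
theorem framing_sub (h : LocalChange D D' B a b) :
    D'.framing - ∑ᶠ p ∈ D'.crossingsIn B, D'.crossingSign p =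
      D.framing - ∑ᶠ p ∈ D.crossingsIn B, D.crossingSign p := by
  rw [KnotoidDiagram.framing, KnotoidDiagram.framing,
    ← finsum_mem_inter_add_sdiff {p | D.curve p.1 ∈ B} D.finite_crossings,
    ← finsum_mem_inter_add_sdiff {p | D'.curve p.1 ∈ B} D'.finite_crossings,
    ← KnotoidDiagram.crossingsIn_eq, ← KnotoidDiagram.crossingsIn_eq, add_sub_cancel_left,
    add_sub_cancel_left]
  have hs : D'.crossings \ {p | D'.curve p.1 ∈ B} = D.crossings \ {p | D.curve p.1 ∈ B} :=
    Subset.antisymm (fun p hp => (h.symm.crossings_diff_subset hp).1)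
      fun p hp => (h.crossings_diff_subset hp).1
  rw [hs]
  exact finsum_mem_congr rfl fun p hp => (h.crossings_diff_subset hp).2

end LocalChange

theorem AddsKink.framing_eq {D₀ D : KnotoidDiagram} {B : Set ℂ} {a b : ℝ} {ε : ℤ}
    (h : AddsKink D₀ D B a b ε) : D.framing = D₀.framing + ε := by
  obtain ⟨hl, h0, p, hp, rfl⟩ := h
  have := hl.framing_sub
  rw [h0, hp, finsum_mem_empty, finsum_mem_singleton] at this
  linarith

theorem ReidemeisterTwo.framing_eq {D D' : KnotoidDiagram} (h : ReidemeisterTwo D D') :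
    D'.framing = D.framing := by
  obtain ⟨B, a, b, hl, h0, p, q, hpq, hin, -, -, -, -, hs⟩ := h
  have := hl.framing_sub
  rw [h0, hin, finsum_mem_empty, finsum_mem_pair hpq] at this
  linarith

/-- The arcs are disjoint in time, so the three pairs are distinct and the sum over the set has
three terms. -/
theorem IsTriangle.sum_eq {D D' : KnotoidDiagram} {B : Set ℂ} {a b : Fin 3 → ℝ}
    (hl : LocalChange D D' B a b) {p q r : ℝ × ℝ} (h : IsTriangle D B a b p q r) :
    ∑ᶠ x ∈ D.crossingsIn B, D.crossingSign x =
      D.crossingSign p + D.crossingSign q + D.crossingSign r := by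
  obtain ⟨hin, p1, p2, q1, q2, r1, r2⟩ := h
  have hd : ∀ i j, i ≠ j → ∀ x, x ∈ Icc (a i) (b i) → x ∉ Icc (a j) (b j) :=
    fun i j hij x hx => disjoint_left.1 (hl.disjoint i j hij) hx
  have hpq : p ≠ q := fun h => hd 1 2 (by decide) _ p2 (h ▸ q2)
  have hpr : p ≠ r := fun h => hd 0 1 (by decide) _ p1 (h ▸ r1)
  have hqr : q ≠ r := fun h => hd 0 1 (by decide) _ q1 (h ▸ r1)
  rw [hin, finsum_mem_insert _ (by simp [hpq, hpr]) (by simp), finsum_mem_pair hqr, add_assoc]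

theorem ReidemeisterThree.framing_eq {D D' : KnotoidDiagram} (h : ReidemeisterThree D D') :
    D'.framing = D.framing := by
  obtain ⟨B, a, b, hl, p, q, r, p', q', r', ht, ht', h1, h2, h3⟩ := h
  have := hl.framing_sub
  rw [ht.sum_eq hl, ht'.sum_eq hl.symm, h1, h2, h3] at this
  linarith

theorem WeakReidemeisterOne.framing_eq {D D' : KnotoidDiagram} (h : WeakReidemeisterOne D D') :
    D'.framing = D.framing := by
  obtain ⟨D₀, B, a, b, ε, h1, h2⟩ := h
  rw [h1.framing_eq, h2.framing_eq]

theorem WeakReidemeisterOne.coframing_eq {D D' : KnotoidDiagram} (h : WeakReidemeisterOne D D') :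
    D'.coframing = D.coframing := by
  obtain ⟨D₀, B, a, b, ε, h1, h2⟩ := h
  rw [h1.1.coframing_eq, h2.1.coframing_eq]

/-! ### Transport by diffeomorphisms and the framing under isotopies -/

/-- The Jacobian determinant of a diffeomorphism of the plane. -/
def PlaneDiffeo.jac (G : PlaneDiffeo) (z : ℂ) : ℝ :=
  planeDet (fderiv ℝ G z 1) (fderiv ℝ G z Complex.I)

theorem PlaneDiffeo.jac_ne_zero (G : PlaneDiffeo) (z : ℂ) : G.jac z ≠ 0 := by
  intro h
  have h1 := planeDet_map (fderiv ℝ G.symm (G z)) (fderiv ℝ G z 1) (fderiv ℝ G z Complex.I)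
  rw [G.fderiv_symm_apply, G.fderiv_symm_apply, ← PlaneDiffeo.jac, ← PlaneDiffeo.jac, h,
    mul_zero] at h1
  simp [planeDet] at h1

theorem PlaneDiffeo.planeDet_fderiv (G : PlaneDiffeo) (z u w : ℂ) :
    planeDet (fderiv ℝ G z u) (fderiv ℝ G z w) = G.jac z * planeDet u w :=
  planeDet_map _ _ _

theorem continuous_planeDet {X : Type*} [TopologicalSpace X] {f g : X → ℂ} (hf : Continuous f)
    (hg : Continuous g) : Continuous fun x => planeDet (f x) (g x) := by
  unfold planeDet; fun_prop

theorem AmbientIsotopy.fderiv_eq (F : AmbientIsotopy) (s : ℝ) (z w : ℂ) :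
    fderiv ℝ (F.toDiffeo s) z w =
      fderiv ℝ (fun p : ℝ × ℂ => F.toDiffeo p.1 p.2) (s, z) (0, w) := by
  have h1 : HasFDerivAt (fun z : ℂ => (s, z)) ((0 : ℂ →L[ℝ] ℝ).prod (ContinuousLinearMap.id ℝ ℂ)) z :=
    (hasFDerivAt_const s z).prodMk (hasFDerivAt_id z)
  have h2 := ((F.smooth.differentiable (by simp)) (s, z)).hasFDerivAt.comp z h1
  have h3 : HasFDerivAt (F.toDiffeo s) _ z := h2
  rw [h3.fderiv]
  rfl

/-- The Jacobian is continuous in time, never zero, and equal to `1` at time `0`. -/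
theorem AmbientIsotopy.jac_pos (F : AmbientIsotopy) (s : ℝ) (z : ℂ) :
    0 < PlaneDiffeo.jac (F.toDiffeo s) z := by
  have hc : Continuous fun s => PlaneDiffeo.jac (F.toDiffeo s) z := by
    have hf := F.smooth.continuous_fderiv (by simp)
    unfold PlaneDiffeo.jac
    simp only [F.fderiv_eq]
    refine continuous_planeDet ?_ ?_ <;>
    exact (hf.comp (f := fun s : ℝ => (s, z)) (by fun_prop)).clm_apply continuous_const
  have h0 : PlaneDiffeo.jac (F.toDiffeo 0) z = 1 := by
    have : (F.toDiffeo 0 : ℂ → ℂ) = id := funext F.zero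
    unfold PlaneDiffeo.jac
    rw [this, fderiv_id]
    simp [planeDet]
  by_contra hneg
  have := mem_range_of_exists_le_of_exists_ge hc (c := 0) ⟨s, not_lt.1 hneg⟩
    ⟨0, by simp [h0]⟩
  obtain ⟨u, hu⟩ := this
  exact PlaneDiffeo.jac_ne_zero _ _ hu

/-- Applying `h` to both times is a bijection between the crossings. It preserves signs, since the
determinant is multiplied by a positive Jacobian and two positive derivatives of `h`. -/
theorem isotopyCarries_framing_eq {F : AmbientIsotopy} {D D' : KnotoidDiagram}
    (hc : IsotopyCarries F D D') : D'.framing = D.framing := by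
  obtain ⟨h, hh, hD⟩ := hc
  refine finsum_mem_eq_of_bijOn (Prod.map h h) ⟨?_, ?_, ?_⟩ ?_
  · rintro p ⟨h1, h2, h3, h4, h5⟩
    refine ⟨hh.mapsTo_Icc h1, hh.mapsTo_Icc h2, fun he => h3 (hh.strictMonoOn.injOn h1 h2 he), ?_,
      (hD _ h1).2.1 h5⟩
    rw [(hD _ h1).1, (hD _ h2).1] at h4
    exact (F.toDiffeo 1).injective h4
  · rintro p hp q hq he
    have := Prod.ext_iff.1 he
    exact Prod.ext (hh.strictMonoOn.injOn hp.1 hq.1 this.1)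
      (hh.strictMonoOn.injOn hp.2.1 hq.2.1 this.2)
  · rintro ⟨x, y⟩ ⟨h1, h2, h3, h4, h5⟩
    obtain ⟨s, hs, rfl⟩ := hh.surjOn_Icc h1
    obtain ⟨t, ht, rfl⟩ := hh.surjOn_Icc h2
    refine ⟨(s, t), ⟨hs, ht, fun he => h3 (congrArg h he), ?_, (hD _ hs).2.2 h5⟩, rfl⟩
    rw [(hD _ hs).1, (hD _ ht).1]
    exact congrArg _ h4
  · intro p hp
    have hder : ∀ t ∈ Ioo (0 : ℝ) 1, deriv D'.curve t =
        fderiv ℝ (F.toDiffeo 1) (D.curve (h t)) ((deriv h t : ℝ) * deriv D.curve (h t)) := by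
      intro t ht
      have h1 : HasDerivAt (fun t => D.curve (h t)) (deriv h t • deriv D.curve (h t)) t :=
        (D.hasDerivAt (h t)).scomp t (hh.smooth.differentiable (by simp) t).hasDerivAt
      have h2 := PlaneDiffeo.hasDerivAt_comp (F.toDiffeo 1) h1
      rw [Complex.real_smul] at h2
      refine (h2.congr_of_eventuallyEq ?_).deriv
      filter_upwards [Icc_mem_nhds ht.1 ht.2] with u hu using (hD u hu).1
    have h1 := KnotoidDiagram.crossing_fst_mem hp
    have h2 := KnotoidDiagram.crossing_snd_mem hp
    have heq : D.curve (h p.2) = D.curve (h p.1) := by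
      have := hp.2.2.2.1
      rw [(hD _ hp.1).1, (hD _ hp.2.1).1] at this
      exact ((F.toDiffeo 1).injective this).symm
    simp only [KnotoidDiagram.crossingSign, Prod.map_fst, Prod.map_snd]
    rw [hder _ h1, hder _ h2, heq, PlaneDiffeo.planeDet_fderiv, planeDet_smul_left,
      planeDet_smul_right, sign_mul, sign_mul, sign_mul, sign_pos (F.jac_pos 1 _),
      sign_pos (hh.deriv_pos _ hp.1), sign_pos (hh.deriv_pos _ hp.2.1), one_mul, one_mul, one_mul]

/-! ### Images of diagrams under diffeomorphisms -/

theorem PlaneDiffeo.inj (G : PlaneDiffeo) : Function.Injective (G : ℂ → ℂ) := G.injective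

namespace KnotoidDiagram

/-- The image of a diagram under a diffeomorphism of the plane. -/
def map (D : KnotoidDiagram) (G : PlaneDiffeo) : KnotoidDiagram where
  curve t := G (D.curve t)
  upper := D.upper
  smooth := G.contDiff.comp D.smooth
  immersion t ht := by
    rw [(G.hasDerivAt_comp (D.hasDerivAt t)).deriv]
    exact G.fderiv_ne_zero (D.immersion t ht)
  no_triple s hs t ht u hu h1 h2 := D.no_triple s hs t ht u hu (G.injective h1) (G.injective h2)
  transversal s hs t ht hst h := by
    have h := G.injective h
    rw [(G.hasDerivAt_comp (D.hasDerivAt t)).deriv, (G.hasDerivAt_comp (D.hasDerivAt s)).deriv, h,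
      G.planeDet_fderiv]
    exact mul_ne_zero (G.jac_ne_zero _) (D.transversal s hs t ht hst h)
  endpoints_simple s hs t ht hst h := D.endpoints_simple s hs t ht hst (G.injective h)
  upper_crossing s hs := by
    obtain ⟨h, t, ht, hst, he⟩ := D.upper_crossing s hs
    exact ⟨h, t, ht, hst, congrArg G he⟩
  upper_iff s hs t ht hst h := D.upper_iff s hs t ht hst (G.injective h)

variable (D : KnotoidDiagram) (G : PlaneDiffeo)

@[simp] theorem map_curve (t : ℝ) : (D.map G).curve t = G (D.curve t) := rfl

@[simp] theorem map_upper : (D.map G).upper = D.upper := rfl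

theorem deriv_map (t : ℝ) :
    deriv (D.map G).curve t = fderiv ℝ G (D.curve t) (deriv D.curve t) :=
  (G.hasDerivAt_comp (D.hasDerivAt t)).deriv

theorem map_crossings : (D.map G).crossings = D.crossings := by
  ext p
  simp only [crossings, mem_ofPred_eq, map_curve, map_upper, G.inj.eq_iff]

theorem map_crossingsIn (B : Set ℂ) : (D.map G).crossingsIn (G '' B) = D.crossingsIn B := by
  ext p
  simp only [crossingsIn, mem_ofPred_eq, map_crossings, map_curve, G.inj.mem_set_image]

theorem map_map_symm : (D.map G).map G.symm = D := by
  cases D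
  simp [map]

end KnotoidDiagram

/-- The sign of the Jacobian determinant of a diffeomorphism. -/
def PlaneDiffeo.orientation (G : PlaneDiffeo) : ℤ := SignType.sign (G.jac 0)

/-- A continuous function without zeros on the connected plane has constant sign. -/
theorem PlaneDiffeo.sign_jac (G : PlaneDiffeo) (z : ℂ) :
    ((SignType.sign (G.jac z) : SignType) : ℤ) = G.orientation := by
  have hc : Continuous G.jac := by
    have := G.contDiff.continuous_fderiv (by simp)
    exact continuous_planeDet (this.clm_apply continuous_const) (this.clm_apply continuous_const)
  rcases lt_or_gt_of_ne (G.jac_ne_zero 0) with h | h <;>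
    rcases lt_or_gt_of_ne (G.jac_ne_zero z) with h' | h'
  · simp [orientation, sign_neg h, sign_neg h']
  · obtain ⟨x, hx⟩ := mem_range_of_exists_le_of_exists_ge hc ⟨0, h.le⟩ ⟨z, h'.le⟩
    exact absurd hx (G.jac_ne_zero x)
  · obtain ⟨x, hx⟩ := mem_range_of_exists_le_of_exists_ge hc ⟨z, h'.le⟩ ⟨0, h.le⟩
    exact absurd hx (G.jac_ne_zero x)
  · simp [orientation, sign_pos h, sign_pos h']

theorem PlaneDiffeo.orientation_eq (G : PlaneDiffeo) : G.orientation = 1 ∨ G.orientation = -1 := by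
  rcases lt_or_gt_of_ne (G.jac_ne_zero 0) with h | h
  · right; simp [orientation, sign_neg h]
  · left; simp [orientation, sign_pos h]

theorem KnotoidDiagram.map_crossingSign (D : KnotoidDiagram) (G : PlaneDiffeo) {p : ℝ × ℝ}
    (hp : p ∈ D.crossings) :
    (D.map G).crossingSign p = G.orientation * D.crossingSign p := by
  rw [crossingSign, crossingSign, deriv_map, deriv_map, ← hp.2.2.2.1, G.planeDet_fderiv, sign_mul,
    ← G.sign_jac (D.curve p.1)]
  push_cast
  rfl

theorem IsDisc.image {B : Set ℂ} (hB : IsDisc B) (G : PlaneDiffeo) : IsDisc (G '' B) := by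
  obtain ⟨H, rfl⟩ := hB
  exact ⟨H.trans G, by rw [image_image]; rfl⟩

theorem PlaneDiffeo.interior_image (G : PlaneDiffeo) (B : Set ℂ) :
    interior (G '' B) = G '' interior B :=
  (G.toHomeomorph.image_interior B).symm

theorem MeetsDiscInArcs.map {D : KnotoidDiagram} {B : Set ℂ} {n : ℕ} {a b : Fin n → ℝ}
    (h : MeetsDiscInArcs D B a b) (G : PlaneDiffeo) :
    MeetsDiscInArcs (D.map G) (G '' B) a b := by
  refine ⟨fun t ht => ?_, fun t ht => ?_, ?_⟩
  · rw [D.map_curve, G.inj.mem_set_image]; exact h.1 t ht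
  · rw [D.map_curve, G.interior_image, G.inj.mem_set_image]; exact h.2.1 t ht
  · rw [G.interior_image, D.map_crossingsIn, D.map_crossingsIn]; exact h.2.2

section Transport

variable {D D' : KnotoidDiagram} (G : PlaneDiffeo)

theorem LocalChange.map {B : Set ℂ} {n : ℕ} {a b : Fin n → ℝ} (h : LocalChange D D' B a b) :
    LocalChange (D.map G) (D'.map G) (G '' B) a b where
  disc := h.disc.image G
  arcs := h.arcs
  disjoint := h.disjoint
  meets := h.meets.map G
  meets' := h.meets'.map G
  outside t ht hi := ⟨congrArg G (h.outside t ht hi).1, (h.outside t ht hi).2⟩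

/-- A chart may reverse the orientation, and then the sign of the kink flips. Kinks built in charts
compensate for this factor in advance. -/
theorem AddsKink.map {B : Set ℂ} {a b : ℝ} {ε : ℤ} (h : AddsKink D D' B a b ε) :
    AddsKink (D.map G) (D'.map G) (G '' B) a b (G.orientation * ε) := by
  obtain ⟨hl, h0, p, hp, rfl⟩ := h
  refine ⟨hl.map G, by rw [D.map_crossingsIn, h0], p, by rw [D'.map_crossingsIn, hp], ?_⟩
  exact D'.map_crossingSign G (hp.symm ▸ mem_singleton p : p ∈ D'.crossingsIn B).1

theorem WeakReidemeisterOne.map (h : WeakReidemeisterOne D D') :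
    WeakReidemeisterOne (D.map G) (D'.map G) := by
  obtain ⟨D₀, B, a, b, ε, h1, h2⟩ := h
  exact ⟨D₀.map G, _, a, b, _, h1.map G, h2.map G⟩

theorem ReidemeisterTwo.map (h : ReidemeisterTwo D D') : ReidemeisterTwo (D.map G) (D'.map G) := by
  obtain ⟨B, a, b, hl, h0, p, q, hpq, hin, i1, i2, i3, i4, hs⟩ := h
  have hp : p ∈ D'.crossingsIn B := by rw [hin]; simp
  have hq : q ∈ D'.crossingsIn B := by rw [hin]; simp
  refine ⟨_, a, b, hl.map G, by rw [D.map_crossingsIn, h0], p, q, hpq,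
    by rw [D'.map_crossingsIn, hin], i1, i2, i3, i4, ?_⟩
  rw [D'.map_crossingSign G hp.1, D'.map_crossingSign G hq.1, hs, mul_neg]

theorem IsTriangle.map {B : Set ℂ} {a b : Fin 3 → ℝ} {p q r : ℝ × ℝ}
    (h : IsTriangle D B a b p q r) : IsTriangle (D.map G) (G '' B) a b p q r :=
  ⟨by rw [D.map_crossingsIn, h.1], h.2⟩

theorem ReidemeisterThree.map (h : ReidemeisterThree D D') :
    ReidemeisterThree (D.map G) (D'.map G) := by
  obtain ⟨B, a, b, hl, p, q, r, p', q', r', ht, ht', h1, h2, h3⟩ := h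
  have hc : ∀ x, x = p ∨ x = q ∨ x = r → x ∈ D.crossings := fun x hx => by
    have : x ∈ D.crossingsIn B := by rw [ht.1]; exact hx
    exact this.1
  have hc' : ∀ x, x = p' ∨ x = q' ∨ x = r' → x ∈ D'.crossings := fun x hx => by
    have : x ∈ D'.crossingsIn B := by rw [ht'.1]; exact hx
    exact this.1
  refine ⟨_, a, b, hl.map G, p, q, r, p', q', r', ht.map G, ht'.map G, ?_, ?_, ?_⟩
  · rw [D.map_crossingSign G (hc p (by simp)), D'.map_crossingSign G (hc' p' (by simp)), h1]
  · rw [D.map_crossingSign G (hc q (by simp)), D'.map_crossingSign G (hc' q' (by simp)), h2]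
  · rw [D.map_crossingSign G (hc r (by simp)), D'.map_crossingSign G (hc' r' (by simp)), h3]

end Transport

/-! ### Rotations and twists of the plane -/

/-- A diffeomorphism of the plane from a smooth map and a smooth inverse. -/
def PlaneDiffeo.mk (f g : ℂ → ℂ) (hf : ContDiff ℝ ∞ f) (hg : ContDiff ℝ ∞ g)
    (hgf : ∀ z, g (f z) = z) (hfg : ∀ z, f (g z) = z) : PlaneDiffeo where
  toFun := f
  invFun := g
  left_inv := hgf
  right_inv := hfg
  contMDiff_toFun := hf.contMDiff
  contMDiff_invFun := hg.contMDiff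

/-- Rotation about the origin. -/
def rotDiffeo (a : ℝ) : PlaneDiffeo :=
  PlaneDiffeo.mk (fun z => Complex.exp (a * Complex.I) * z) (fun z => Complex.exp (-(a * Complex.I)) * z)
    (contDiff_const.mul contDiff_id) (contDiff_const.mul contDiff_id)
    (fun z => by rw [← mul_assoc, ← Complex.exp_add]; simp)
    (fun z => by rw [← mul_assoc, ← Complex.exp_add]; simp)

/-- The proportion in which a point at relative squared distance `u` from the centre takes part in a
twist. -/
def twistCutoff (u : ℝ) : ℝ := Real.smoothTransition (2 - 4 * u)

/-- The square of the distance of two points of the plane, as a polynomial. -/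
def sqDist (z w : ℂ) : ℝ := (z.re - w.re) ^ 2 + (z.im - w.im) ^ 2

theorem sqDist_eq (z w : ℂ) : sqDist z w = ‖z - w‖ ^ 2 := by
  rw [← Complex.normSq_eq_norm_sq, Complex.normSq_apply, sqDist, Complex.sub_re, Complex.sub_im]
  ring

theorem sqDist_ne_zero {z w : ℂ} (h : z ≠ w) : sqDist z w ≠ 0 := by
  rw [sqDist_eq]
  exact pow_ne_zero _ (norm_ne_zero_iff.2 (sub_ne_zero.2 h))

/-- The twist by the angle `a` around `p`, which is the identity near `q` and outside of a disc. -/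
def twistMap (p q : ℂ) (a : ℝ) (z : ℂ) : ℂ :=
  p + Complex.exp ((a * twistCutoff (sqDist z p / sqDist q p) : ℝ) * Complex.I) * (z - p)

theorem sqDist_twistMap (p q : ℂ) (a : ℝ) (z : ℂ) : sqDist (twistMap p q a z) p = sqDist z p := by
  rw [sqDist_eq, sqDist_eq, twistMap, add_sub_cancel_left, norm_mul,
    Complex.norm_exp_ofReal_mul_I, one_mul]

theorem twistMap_neg (p q : ℂ) (a : ℝ) (z : ℂ) : twistMap p q (-a) (twistMap p q a z) = z := by
  rw [twistMap, sqDist_twistMap, twistMap, add_sub_cancel_left, ← mul_assoc, ← Complex.exp_add]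
  rw [show ((-a * twistCutoff (sqDist z p / sqDist q p) : ℝ) : ℂ) * Complex.I +
    ((a * twistCutoff (sqDist z p / sqDist q p) : ℝ) : ℂ) * Complex.I = 0 by push_cast; ring]
  simp

theorem twistMap_zero (p q z : ℂ) : twistMap p q 0 z = z := by simp [twistMap]

theorem contDiff_sqDist {E : Type*} [NormedAddCommGroup E] [NormedSpace ℝ E] {f g : E → ℂ}
    (hf : ContDiff ℝ ∞ f) (hg : ContDiff ℝ ∞ g) : ContDiff ℝ ∞ fun e => sqDist (f e) (g e) := by
  have hre : ∀ {f : E → ℂ}, ContDiff ℝ ∞ f → ContDiff ℝ ∞ fun e => (f e).re :=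
    fun h => Complex.reCLM.contDiff.comp h
  have him : ∀ {f : E → ℂ}, ContDiff ℝ ∞ f → ContDiff ℝ ∞ fun e => (f e).im :=
    fun h => Complex.imCLM.contDiff.comp h
  exact (((hre hf).sub (hre hg)).pow 2).add (((him hf).sub (him hg)).pow 2)

theorem contDiff_expI {E : Type*} [NormedAddCommGroup E] [NormedSpace ℝ E] {a : E → ℝ}
    (ha : ContDiff ℝ ∞ a) : ContDiff ℝ ∞ fun e => Complex.exp ((a e : ℂ) * Complex.I) :=
  (Complex.contDiff_exp (𝕜 := ℝ)).comp ((Complex.ofRealCLM.contDiff.comp ha).mul contDiff_const)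

theorem contDiff_twistMap {E : Type*} [NormedAddCommGroup E] [NormedSpace ℝ E] {p q w : E → ℂ}
    {a : E → ℝ} (hp : ContDiff ℝ ∞ p) (hq : ContDiff ℝ ∞ q) (hw : ContDiff ℝ ∞ w)
    (ha : ContDiff ℝ ∞ a) (hpq : ∀ e, q e ≠ p e) :
    ContDiff ℝ ∞ fun e => twistMap (p e) (q e) (a e) (w e) := by
  have h1 : ContDiff ℝ ∞ fun e => sqDist (w e) (p e) / sqDist (q e) (p e) :=
    (contDiff_sqDist hw hp).div (contDiff_sqDist hq hp) fun e => sqDist_ne_zero (hpq e)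
  have h2 : ContDiff ℝ ∞ fun e => a e * twistCutoff (sqDist (w e) (p e) / sqDist (q e) (p e)) :=
    ha.mul (Real.smoothTransition.contDiff.comp (contDiff_const.sub (contDiff_const.mul h1)))
  exact hp.add ((contDiff_expI h2).mul (hw.sub hp))

/-- `twistMap` as a diffeomorphism. -/
def twistDiffeo (p q : ℂ) (hpq : q ≠ p) (a : ℝ) : PlaneDiffeo :=
  PlaneDiffeo.mk (twistMap p q a) (twistMap p q (-a))
    (contDiff_twistMap contDiff_const contDiff_const contDiff_id contDiff_const fun _ => hpq)
    (contDiff_twistMap contDiff_const contDiff_const contDiff_id contDiff_const fun _ => hpq)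
    (twistMap_neg p q a) (fun z => by simpa using twistMap_neg p q (-a) z)

/-- The cutoff is `1` up to relative squared distance `1 / 4`, so near the centre the twist is a
rigid rotation. -/
theorem hasDerivAt_twistMap_center {p q : ℂ} (a : ℝ) {γ : ℝ → ℂ} {γ' : ℂ} {t : ℝ}
    (h : HasDerivAt γ γ' t) (ht : γ t = p) :
    HasDerivAt (fun t => twistMap p q a (γ t)) (Complex.exp (a * Complex.I) * γ') t := by
  have h1 : HasDerivAt (fun t => p + Complex.exp (a * Complex.I) * (γ t - p))
      (Complex.exp (a * Complex.I) * γ') t := ((h.sub_const p).const_mul _).const_add p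
  refine h1.congr_of_eventuallyEq ?_
  have hc : ContinuousAt (fun t => sqDist (γ t) p / sqDist q p) t := by
    have := h.continuousAt
    unfold sqDist
    fun_prop
  have h0 : sqDist (γ t) p / sqDist q p < 1 / 4 := by rw [ht]; simp [sqDist]
  filter_upwards [hc.eventually_lt continuousAt_const h0] with u hu
  rw [twistMap, twistCutoff, Real.smoothTransition.one_of_one_le (by linarith), mul_one]

/-- The cutoff vanishes from relative squared distance `1 / 2` on, whereas `q` is at distance `1`;
near `q` the twist is the identity. -/
theorem hasDerivAt_twistMap_away {p q : ℂ} (hpq : q ≠ p) (a : ℝ) {γ : ℝ → ℂ} {γ' : ℂ} {t : ℝ}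
    (h : HasDerivAt γ γ' t) (ht : γ t = q) :
    HasDerivAt (fun t => twistMap p q a (γ t)) γ' t := by
  refine h.congr_of_eventuallyEq ?_
  have hc : ContinuousAt (fun t => sqDist (γ t) p / sqDist q p) t := by
    have := h.continuousAt
    unfold sqDist
    fun_prop
  have h0 : (1 / 2 : ℝ) < sqDist (γ t) p / sqDist q p := by
    rw [ht, div_self (sqDist_ne_zero hpq)]; norm_num
  filter_upwards [continuousAt_const.eventually_lt hc h0] with u hu
  rw [twistMap, twistCutoff, Real.smoothTransition.zero_of_nonpos (by linarith)]
  simp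

theorem twistMap_apply_center (p q : ℂ) (a : ℝ) : twistMap p q a p = p := by simp [twistMap]

theorem twistMap_apply_away {p q : ℂ} (hpq : q ≠ p) (a : ℝ) : twistMap p q a q = q := by
  rw [twistMap, div_self (sqDist_ne_zero hpq), twistCutoff,
    Real.smoothTransition.zero_of_nonpos (by norm_num)]
  simp

/-! ### Correcting isotopies at the end-points -/

/-- A continuous angle is automatically smooth, because its derivative is the imaginary part of `w'
/ w`. Smoothness is needed to use such angles inside isotopies. -/
theorem exists_contDiff_hasAngle {w : ℝ → ℂ} (hw : ContDiff ℝ ∞ w) (h0 : ∀ s, w s ≠ 0) :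
    ∃ θ : ℝ → ℝ, ContDiff ℝ ∞ θ ∧ ∀ s, HasAngle (w s) (θ s) := by
  obtain ⟨θ, hθ, hθa⟩ := exists_continuous_hasAngle (V := ℝ) hw.continuous h0
  have hd : ∀ s, HasDerivAt θ (deriv w s / w s).im s := fun s =>
    hasDerivAt_angle ((hw.differentiable (by simp)) s).hasDerivAt hθ.continuousAt
      (Eventually.of_forall hθa)
  refine ⟨θ, contDiff_infty_iff_deriv.2 ⟨fun s => (hd s).differentiableAt, ?_⟩, hθa⟩
  rw [show deriv θ = fun s => (deriv w s / w s).im from funext fun s => (hd s).deriv]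
  have := (contDiff_infty_iff_deriv.1 hw).2
  simp only [div_eq_mul_inv]
  exact Complex.imCLM.contDiff.comp (this.mul (hw.inv h0))

namespace AmbientIsotopy

/-- The trivial isotopy. -/
def refl : AmbientIsotopy where
  toDiffeo _ := Diffeomorph.refl _ _ _
  smooth := contDiff_snd
  zero _ := rfl

/-- The composition of two isotopies, at each time. -/
def comp (F G : AmbientIsotopy) : AmbientIsotopy where
  toDiffeo s := (G.toDiffeo s).trans (F.toDiffeo s)
  smooth := F.smooth.comp (contDiff_fst.prodMk G.smooth)
  zero z := by
    change F.toDiffeo 0 (G.toDiffeo 0 z) = z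
    rw [G.zero, F.zero]

@[simp] theorem comp_apply (F G : AmbientIsotopy) (s : ℝ) (z : ℂ) :
    (F.comp G).toDiffeo s z = F.toDiffeo s (G.toDiffeo s z) := rfl

/-- A twist with linearly growing angle. -/
def twist (p q : ℂ) (hpq : q ≠ p) (a : ℝ) : AmbientIsotopy where
  toDiffeo s := twistDiffeo p q hpq (s * a)
  smooth := contDiff_twistMap contDiff_const contDiff_const contDiff_snd
    (contDiff_fst.mul contDiff_const) fun _ => hpq
  zero z := by
    change twistMap p q (0 * a) z = z
    rw [zero_mul, twistMap_zero]

@[simp] theorem twist_apply (p q : ℂ) (hpq : q ≠ p) (a s : ℝ) (z : ℂ) :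
    (twist p q hpq a).toDiffeo s z = twistMap p q (s * a) z := rfl

theorem deriv_track (F : AmbientIsotopy) {γ : ℝ → ℂ} {γ' : ℂ} {t : ℝ} (h : HasDerivAt γ γ' t)
    (s : ℝ) : HasDerivAt (fun t => F.toDiffeo s (γ t))
      (fderiv ℝ (fun p : ℝ × ℂ => F.toDiffeo p.1 p.2) (s, γ t) (0, γ')) t := by
  rw [← F.fderiv_eq]
  exact PlaneDiffeo.hasDerivAt_comp (F.toDiffeo s) h

theorem contDiff_deriv_track (F : AmbientIsotopy) (z w : ℂ) :
    ContDiff ℝ ∞ fun s : ℝ => fderiv ℝ (fun p : ℝ × ℂ => F.toDiffeo p.1 p.2) (s, z) (0, w) := by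
  have h1 : ContDiff ℝ ∞ (fderiv ℝ (fun p : ℝ × ℂ => F.toDiffeo p.1 p.2)) :=
    F.smooth.fderiv_right (by simp)
  exact (h1.comp (contDiff_id.prodMk contDiff_const)).clm_apply contDiff_const

theorem contDiff_apply (F : AmbientIsotopy) (z : ℂ) : ContDiff ℝ ∞ fun s : ℝ => F.toDiffeo s z :=
  F.smooth.comp (contDiff_id.prodMk contDiff_const)

/-- An isotopy corrected by a rotation and a twist about the image of a point `z₁`. -/
def correct (F : AmbientIsotopy) (z₀ z₁ : ℂ) (h : z₀ ≠ z₁) (a b : ℝ → ℝ) (ha : ContDiff ℝ ∞ a)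
    (hb : ContDiff ℝ ∞ b) (ha0 : a 0 = 0) (hb0 : b 0 = 0) : AmbientIsotopy where
  toDiffeo s := ((F.toDiffeo s).trans (twistDiffeo (F.toDiffeo s z₁) (F.toDiffeo s z₀)
    (fun he => h ((F.toDiffeo s).injective he)) (b s))).trans (rotDiffeo (a s))
  smooth := by
    have h1 : ContDiff ℝ ∞ fun p : ℝ × ℂ =>
        twistMap (F.toDiffeo p.1 z₁) (F.toDiffeo p.1 z₀) (b p.1) (F.toDiffeo p.1 p.2) :=
      contDiff_twistMap ((F.contDiff_apply z₁).comp contDiff_fst)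
        ((F.contDiff_apply z₀).comp contDiff_fst) F.smooth (hb.comp contDiff_fst)
        fun p he => h ((F.toDiffeo p.1).injective he)
    exact (contDiff_expI (ha.comp contDiff_fst)).mul h1
  zero z := by
    change Complex.exp (a 0 * Complex.I) *
      twistMap (F.toDiffeo 0 z₁) (F.toDiffeo 0 z₀) (b 0) (F.toDiffeo 0 z) = z
    rw [ha0, hb0, twistMap_zero, F.zero]
    simp

theorem correct_apply (F : AmbientIsotopy) {z₀ z₁ : ℂ} {h : z₀ ≠ z₁} {a b : ℝ → ℝ}
    {ha : ContDiff ℝ ∞ a} {hb : ContDiff ℝ ∞ b} {ha0 : a 0 = 0} {hb0 : b 0 = 0} (s : ℝ) (z : ℂ) :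
    (F.correct z₀ z₁ h a b ha hb ha0 hb0).toDiffeo s z = Complex.exp (a s * Complex.I) *
      twistMap (F.toDiffeo s z₁) (F.toDiffeo s z₀) (b s) (F.toDiffeo s z) := rfl

end AmbientIsotopy

theorem hasAngle_expI (a : ℝ) : HasAngle (Complex.exp (a * Complex.I)) a := ⟨1, one_pos, by simp⟩

theorem IsotopyCarries.deriv_eq {F : AmbientIsotopy} {D D' : KnotoidDiagram} {h : ℝ → ℝ}
    (hh : IsReparam h) (hc : ∀ t ∈ Icc (0 : ℝ) 1, D'.curve t = F.toDiffeo 1 (D.curve (h t)))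
    {t : ℝ} (ht : t ∈ Icc (0 : ℝ) 1) (hht : h t = t) :
    deriv D'.curve t = (deriv h t : ℝ) * deriv (fun t => F.toDiffeo 1 (D.curve t)) t := by
  have h1 : HasDerivAt (fun t => F.toDiffeo 1 (D.curve t))
      (deriv (fun t => F.toDiffeo 1 (D.curve t)) t) t :=
    (F.deriv_track (D.hasDerivAt t) 1).differentiableAt.hasDerivAt
  have h1' : HasDerivAt (fun t => F.toDiffeo 1 (D.curve t))
      (deriv (fun t => F.toDiffeo 1 (D.curve t)) t) (h t) := by rw [hht]; exact h1
  have h2 : HasDerivAt (fun t => F.toDiffeo 1 (D.curve (h t)))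
      (deriv h t • deriv (fun t => F.toDiffeo 1 (D.curve t)) t) t :=
    h1'.scomp t (hh.smooth.differentiable (by simp) t).hasDerivAt
  rw [Complex.real_smul] at h2
  exact (D'.hasDerivAt t).eq_of_eqOn_Icc h2 zero_lt_one ht hc

/-- Rotating the plane back by the turning of the leg tangent, and twisting about the head by the
difference of the two turnings, keeps both tangents in the direction of `v` at every stage. Equal
coframings mean equal total turnings, so the twist ends at the identity. The total turning is a
multiple of 2π because both diagrams are biframed, so the rotation ends at the identity as well. -/
theorem biframedStep_of_isotopyCarries {v : ℂ} {K K' : BiframedDiagram v} {F : AmbientIsotopy}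
    (hc : IsotopyCarries F K.toKnotoidDiagram K'.toKnotoidDiagram)
    (hco : K'.coframing = K.coframing) : BiframedStep v K K' := by
  have d0 := F.deriv_track (K.hasDerivAt 0)
  have d1 := F.deriv_track (K.hasDerivAt 1)
  set w₀ : ℝ → ℂ := fun s => fderiv ℝ (fun p : ℝ × ℂ => F.toDiffeo p.1 p.2) (s, K.curve 0)
    (0, deriv K.curve 0)
  set w₁ : ℝ → ℂ := fun s => fderiv ℝ (fun p : ℝ × ℂ => F.toDiffeo p.1 p.2) (s, K.curve 1)
    (0, deriv K.curve 1)
  have hw : ∀ (s t : ℝ), t ∈ Icc (0 : ℝ) 1 →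
      fderiv ℝ (fun p : ℝ × ℂ => F.toDiffeo p.1 p.2) (s, K.curve t) (0, deriv K.curve t) ≠ 0 :=
    fun s t ht => by
      rw [← F.fderiv_eq]; exact PlaneDiffeo.fderiv_ne_zero _ (K.immersion t ht)
  obtain ⟨θ₀, hθ₀, hθ₀a⟩ := exists_contDiff_hasAngle (w := w₀) (F.contDiff_deriv_track _ _)
    fun s => hw s 0 (by simp)
  obtain ⟨θ₁, hθ₁, hθ₁a⟩ := exists_contDiff_hasAngle (w := w₁) (F.contDiff_deriv_track _ _)
    fun s => hw s 1 (by simp)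
  have hF0 : ∀ t, (fun t => F.toDiffeo 0 (K.curve t)) t = K.curve t := fun t => F.zero _
  have hw0 : w₀ 0 = deriv K.curve 0 :=
    (d0 0).deriv.symm.trans (congrArg (fun f => deriv f 0) (funext hF0))
  have hw1 : w₁ 0 = deriv K.curve 1 :=
    (d1 0).deriv.symm.trans (congrArg (fun f => deriv f 1) (funext hF0))
  obtain ⟨τ, hτ⟩ := exists_hasAngle (w := v) fun h => by
    obtain ⟨c, -, hc⟩ := K.leg_direction
    exact K.immersion 0 (by simp) (by rw [hc, h, mul_zero])
  have hτ0 : HasAngle v (θ₀ 0) := by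
    obtain ⟨n, hn⟩ := (hw0 ▸ hθ₀a 0).sub_eq (K.leg_direction.hasAngle hτ)
    have := hτ.congr_int n
    rwa [← hn, add_sub_cancel] at this
  have hτ1 : HasAngle v (θ₁ 0) := by
    obtain ⟨n, hn⟩ := (hw1 ▸ hθ₁a 0).sub_eq (K.head_direction.hasAngle hτ)
    have := hτ.congr_int n
    rwa [← hn, add_sub_cancel] at this
  have hvar := hc.coframing_sub hθ₀.continuous hθ₁.continuous
    (fun s => by rw [(d0 s).deriv]; exact hθ₀a s) (fun s => by rw [(d1 s).deriv]; exact hθ₁a s)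
  have hvar' : θ₁ 1 - θ₁ 0 = θ₀ 1 - θ₀ 0 := by
    rw [hco, sub_self] at hvar
    have hp : (2 * Real.pi)⁻¹ ≠ 0 := by positivity
    linarith [(mul_eq_zero.1 hvar.symm).resolve_left hp]
  have hne : K.curve 0 ≠ K.curve 1 := (K.leg_ne (by simp)).symm
  -- The twist is trivial near the leg, so the rotation alone corrects the leg; the twist angle is
  -- what the head needs in addition.
  let G := F.correct (K.curve 0) (K.curve 1) hne (fun s => -(θ₀ s - θ₀ 0))
    (fun s => (θ₀ s - θ₀ 0) - (θ₁ s - θ₁ 0)) (by fun_prop) (by fun_prop) (by simp) (by simp)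
  obtain ⟨h, hh, hcar⟩ := hc
  -- At the final stage the leg tangent has, up to the positive factor from the reparametrization,
  -- the direction of the leg tangent of `K'`, which is that of `v`.
  have hturn : ∃ n : ℤ, θ₀ 1 - θ₀ 0 = 2 * Real.pi * n := by
    have e := IsotopyCarries.deriv_eq hh (fun t ht => (hcar t ht).1) (t := 0) (by simp) hh.zero
    rw [(d0 1).deriv] at e
    have h1 := (hθ₀a 1).smul (hh.deriv_pos 0 (by simp))
    rw [show w₀ 1 = _ from rfl, ← e] at h1
    exact h1.sub_eq (K'.leg_direction.hasAngle hτ0)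
  have hG1 : ∀ z, G.toDiffeo 1 z = F.toDiffeo 1 z := fun z => by
    obtain ⟨n, hn⟩ := hturn
    rw [AmbientIsotopy.correct_apply, hvar', sub_self, twistMap_zero, hn]
    push_cast
    rw [show -(2 * Real.pi * n : ℂ) * Complex.I = (-n : ℤ) * (2 * Real.pi * Complex.I) by
      push_cast; ring, Complex.exp_int_mul_two_pi_mul_I, one_mul]
  refine BiframedStep.isotopy G ⟨h, hh, fun t ht => ?_⟩ fun s _ => ⟨?_, ?_⟩
  · rw [hG1]; exact hcar t ht
  · have h1 := (hasDerivAt_twistMap_away (p := F.toDiffeo s (K.curve 1))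
      (q := F.toDiffeo s (K.curve 0)) (fun he => hne ((F.toDiffeo s).injective he))
      ((θ₀ s - θ₀ 0) - (θ₁ s - θ₁ 0)) (d0 s) rfl).const_mul
      (Complex.exp ((-(θ₀ s - θ₀ 0) : ℝ) * Complex.I))
    have h2 := h1.deriv
    refine HasAngle.sameDirection (θ := θ₀ 0) ?_ hτ0
    have h3 := (hasAngle_expI (-(θ₀ s - θ₀ 0))).mul (hθ₀a s)
    rw [show -(θ₀ s - θ₀ 0) + θ₀ s = θ₀ 0 by ring] at h3
    exact h2.symm ▸ h3
  · have h1 := (hasDerivAt_twistMap_center (p := F.toDiffeo s (K.curve 1))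
      (q := F.toDiffeo s (K.curve 0))
      ((θ₀ s - θ₀ 0) - (θ₁ s - θ₁ 0)) (d1 s) rfl).const_mul
      (Complex.exp ((-(θ₀ s - θ₀ 0) : ℝ) * Complex.I))
    have h2 := h1.deriv
    refine HasAngle.sameDirection (θ := θ₁ 0) ?_ hτ1
    have h3 := (hasAngle_expI (-(θ₀ s - θ₀ 0))).mul
      ((hasAngle_expI ((θ₀ s - θ₀ 0) - (θ₁ s - θ₁ 0))).mul (hθ₁a s))
    rw [show -(θ₀ s - θ₀ 0) + ((θ₀ s - θ₀ 0) - (θ₁ s - θ₁ 0) + θ₁ s) = θ₁ 0 by ring] at h3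
    exact h2.symm ▸ h3

/-! ### Regular equivalence and biframed equivalence -/

/-- The steps generating the equivalence of diagrams that preserves the framing, without any
condition on the end-points. -/
inductive RegularStep : KnotoidDiagram → KnotoidDiagram → Prop
  | isotopy {D D' : KnotoidDiagram} (F : AmbientIsotopy) :
      IsotopyCarries F D D' → RegularStep D D'
  | r1' {D D' : KnotoidDiagram} : WeakReidemeisterOne D D' → RegularStep D D'
  | r2 {D D' : KnotoidDiagram} : ReidemeisterTwo D D' → RegularStep D D'
  | r3 {D D' : KnotoidDiagram} : ReidemeisterThree D D' → RegularStep D D'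

/-- The class of a diagram under regular equivalence. -/
def regularClass (D : KnotoidDiagram) : Quot RegularStep := Quot.mk RegularStep D

theorem RegularStep.framing_eq {D D' : KnotoidDiagram} (h : RegularStep D D') :
    D'.framing = D.framing := by
  cases h with
  | isotopy F hc => exact isotopyCarries_framing_eq hc
  | r1' h => exact h.framing_eq
  | r2 h => exact h.framing_eq
  | r3 h => exact h.framing_eq

theorem isotopyCarries_map (D : KnotoidDiagram) (F : AmbientIsotopy) :
    IsotopyCarries F D (D.map (F.toDiffeo 1)) :=
  ⟨id, isReparam_id, fun _ _ => ⟨rfl, Iff.rfl⟩⟩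

theorem BiframedDiagram.ne_zero {v : ℂ} (K : BiframedDiagram v) : v ≠ 0 := fun h => by
  obtain ⟨c, -, hc⟩ := K.leg_direction
  exact K.immersion 0 (by simp) (by rw [hc, h, mul_zero])

/-- During a biframed isotopy each tangent angle stays in a translate of the discrete set 2πℤ, hence
is constant, and the formula for the change of the coframing gives zero. The other moves are local
changes. -/
theorem BiframedStep.coframing_eq {v : ℂ} {K K' : BiframedDiagram v} (h : BiframedStep v K K') :
    K'.coframing = K.coframing := by
  cases h with
  | isotopy F hc hs =>
    obtain ⟨τ, hτ⟩ := exists_hasAngle K.ne_zero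
    obtain ⟨φ, hφ, hφa⟩ := exists_continuous_hasAngle (V := ℝ)
      (F.contDiff_deriv_track (K.curve 0) (deriv K.curve 0)).continuous fun s => by
        rw [← F.fderiv_eq]; exact PlaneDiffeo.fderiv_ne_zero _ (K.immersion 0 (by simp))
    obtain ⟨ψ, hψ, hψa⟩ := exists_continuous_hasAngle (V := ℝ)
      (F.contDiff_deriv_track (K.curve 1) (deriv K.curve 1)).continuous fun s => by
        rw [← F.fderiv_eq]; exact PlaneDiffeo.fderiv_ne_zero _ (K.immersion 1 (by simp))
    have d0 := fun s => (F.deriv_track (K.hasDerivAt 0) s).deriv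
    have d1 := fun s => (F.deriv_track (K.hasDerivAt 1) s).deriv
    have e := hc.coframing_sub hφ hψ (fun s => by rw [d0]; exact hφa s)
      fun s => by rw [d1]; exact hψa s
    have h0 := eq_of_continuousOn_of_mem_two_pi_int (f := fun s => φ s - τ)
      (by fun_prop) fun s hs' => (d0 s ▸ hφa s).sub_eq ((hs s hs').1.hasAngle hτ)
    have h1 := eq_of_continuousOn_of_mem_two_pi_int (f := fun s => ψ s - τ)
      (by fun_prop) fun s hs' => (d1 s ▸ hψa s).sub_eq ((hs s hs').2.hasAngle hτ)
    rw [show ψ 1 - ψ 0 = 0 by linarith, show φ 1 - φ 0 = 0 by linarith, sub_zero, mul_zero] at e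
    linarith
  | r1' h => exact h.coframing_eq
  | r2 h => obtain ⟨B, a, b, hl, -⟩ := h; exact hl.coframing_eq
  | r3 h => obtain ⟨B, a, b, hl, -⟩ := h; exact hl.coframing_eq

/-- A twist about the leg followed by one about the head turns both tangents to the direction of
`v`, each twist being trivial near the other end-point. Every additional full turn at the head
raises the coframing by one. The second isotopy undoes the first at each stage, so that moves and
isotopies can be conjugated with it. -/
theorem exists_biframing {v : ℂ} (hv : v ≠ 0) (D : KnotoidDiagram) (m : ℤ) :
    ∃ (K : BiframedDiagram v) (F F' : AmbientIsotopy), K.toKnotoidDiagram = D.map (F.toDiffeo 1) ∧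
      (∀ s z, F'.toDiffeo s (F.toDiffeo s z) = z) ∧ K.coframing = m := by
  have hne : D.curve 1 ≠ D.curve 0 := D.leg_ne (by simp)
  obtain ⟨τ, hτ⟩ := exists_hasAngle hv
  obtain ⟨θ₀, hθ₀⟩ := exists_hasAngle (D.immersion 0 (by simp))
  obtain ⟨θ₁, hθ₁⟩ := exists_hasAngle (D.immersion 1 (by simp))
  let F : ℝ → AmbientIsotopy := fun b => (AmbientIsotopy.twist _ _ hne.symm b).comp
    (AmbientIsotopy.twist _ _ hne (τ - θ₀))
  have d0 : ∀ b s, HasDerivAt (fun t => (F b).toDiffeo s (D.curve t))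
      (Complex.exp ((s * (τ - θ₀) : ℝ) * Complex.I) * deriv D.curve 0) 0 := fun b s => by
    have h1 := hasDerivAt_twistMap_center (q := D.curve 1) (s * (τ - θ₀)) (D.hasDerivAt 0) rfl
    exact hasDerivAt_twistMap_away hne.symm (s * b) h1 (twistMap_apply_center _ _ _)
  have d1 : ∀ b s, HasDerivAt (fun t => (F b).toDiffeo s (D.curve t))
      (Complex.exp ((s * b : ℝ) * Complex.I) * deriv D.curve 1) 1 := fun b s => by
    have h1 := hasDerivAt_twistMap_away hne (s * (τ - θ₀)) (D.hasDerivAt 1) rfl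
    exact hasDerivAt_twistMap_center (s * b) h1 (twistMap_apply_away hne _)
  have hleg : ∀ b s, HasAngle (deriv (fun t => (F b).toDiffeo s (D.curve t)) 0)
      (s * (τ - θ₀) + θ₀) := fun b s => by
    rw [(d0 b s).deriv]; exact (hasAngle_expI _).mul hθ₀
  have hhead : ∀ b s, HasAngle (deriv (fun t => (F b).toDiffeo s (D.curve t)) 1)
      (s * b + θ₁) := fun b s => by
    rw [(d1 b s).deriv]; exact (hasAngle_expI _).mul hθ₁
  have hco : ∀ b, (D.map ((F b).toDiffeo 1)).coframing - D.coframing =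
      (2 * Real.pi)⁻¹ * (b - (τ - θ₀)) := fun b => by
    rw [(isotopyCarries_map D (F b)).coframing_sub (by fun_prop) (by fun_prop) (hleg b) (hhead b)]
    ring
  let K : ℤ → BiframedDiagram v := fun k =>
    { D.map ((F (τ - θ₁ + 2 * Real.pi * k)).toDiffeo 1) with
      leg_direction := (hleg _ 1).sameDirection (by simpa using hτ)
      head_direction := (hhead _ 1).sameDirection (by
        have := hτ.congr_int k
        rwa [show 1 * (τ - θ₁ + 2 * Real.pi * k) + θ₁ = τ + 2 * Real.pi * k by ring]) }
  -- `K 0` has some integer coframing `n`; then `m - n` further turns at the head produce coframing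
  -- `m`.
  obtain ⟨n, hn⟩ := (K 0).exists_coframing_eq_int
  refine ⟨K (m - n), F (τ - θ₁ + 2 * Real.pi * (m - n : ℤ)),
    (AmbientIsotopy.twist _ _ hne (-(τ - θ₀))).comp
      (AmbientIsotopy.twist _ _ hne.symm (-(τ - θ₁ + 2 * Real.pi * (m - n : ℤ)))), rfl, ?_, ?_⟩
  · intro s z
    simp only [F, AmbientIsotopy.comp_apply, AmbientIsotopy.twist_apply, mul_neg, twistMap_neg]
  · have h0 := hco (τ - θ₁ + 2 * Real.pi * (0 : ℤ))
    have h1 := hco (τ - θ₁ + 2 * Real.pi * (m - n : ℤ))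
    change (K 0).coframing - D.coframing = _ at h0
    change (K (m - n)).coframing - D.coframing = _ at h1
    rw [← hn] at h0
    have hp : (2 * Real.pi) ≠ 0 := by positivity
    have h2 : (K (m - n)).coframing - n = (2 * Real.pi)⁻¹ * (2 * Real.pi * (m - n : ℤ)) := by
      push_cast at h0 h1 ⊢
      linear_combination h1 - h0
    rw [inv_mul_cancel_left₀ hp] at h2
    push_cast at h2
    linarith

/-- A biframed diagram obtained from `D` by twists at the end-points, with coframing `m`. -/
def biframing {v : ℂ} (hv : v ≠ 0) (m : ℤ) (D : KnotoidDiagram) : BiframedDiagram v :=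
  (exists_biframing hv D m).choose

/-! ### Regular classes with a prescribed coframing -/

section

variable {v : ℂ} (hv : v ≠ 0) (m : ℤ)

theorem biframing_coframing (D : KnotoidDiagram) : (biframing hv m D).coframing = m :=
  (exists_biframing hv D m).choose_spec.choose_spec.choose_spec.2.2

theorem biframing_spec (D : KnotoidDiagram) : ∃ F F' : AmbientIsotopy,
    (biframing hv m D).toKnotoidDiagram = D.map (F.toDiffeo 1) ∧
      ∀ s z, F'.toDiffeo s (F.toDiffeo s z) = z := by
  obtain ⟨F, F', h1, h2, -⟩ := (exists_biframing hv D m).choose_spec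
  exact ⟨F, F', h1, h2⟩

/-- Undoing `F₀`, applying `F`, and then applying `F₁` is an isotopy from `K` to `K'`. Since the
coframings agree, it can be corrected to a biframed one. -/
theorem mk_eq_of_isotopyCarries {D D' : KnotoidDiagram} {K K' : BiframedDiagram v}
    {F F₀ F₀' F₁ : AmbientIsotopy} (hc : IsotopyCarries F D D')
    (hK : K.toKnotoidDiagram = D.map (F₀.toDiffeo 1))
    (hF₀ : ∀ s z, F₀'.toDiffeo s (F₀.toDiffeo s z) = z)
    (hK' : K'.toKnotoidDiagram = D'.map (F₁.toDiffeo 1)) (hco : K'.coframing = K.coframing) :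
    Quot.mk (BiframedStep v) K = Quot.mk (BiframedStep v) K' := by
  refine Quot.sound (biframedStep_of_isotopyCarries (F := F₁.comp (F.comp F₀')) ?_ hco)
  obtain ⟨h, hh, hD⟩ := hc
  refine ⟨h, hh, fun t ht => ?_⟩
  rw [hK, hK']
  simp only [AmbientIsotopy.comp_apply, KnotoidDiagram.map_curve, KnotoidDiagram.map_upper, hF₀]
  exact ⟨congrArg _ (hD t ht).1, (hD t ht).2⟩

theorem isotopyCarries_refl (D : KnotoidDiagram) : IsotopyCarries AmbientIsotopy.refl D D :=
  ⟨id, isReparam_id, fun _ _ => ⟨rfl, Iff.rfl⟩⟩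

theorem LocalChange.exists_biframed {D D' : KnotoidDiagram} {B : Set ℂ} {n : ℕ} {a b : Fin n → ℝ}
    (h : LocalChange D D' B a b) {K : BiframedDiagram v} (hK : K.toKnotoidDiagram = D) :
    ∃ K' : BiframedDiagram v, K'.toKnotoidDiagram = D' ∧ K'.coframing = K.coframing := by
  subst hK
  exact ⟨{ D' with
    leg_direction := by
      rw [h.deriv_eq (by simp) h.zero_notMem]; exact K.leg_direction
    head_direction := by
      rw [h.deriv_eq (by simp) h.one_notMem]; exact K.head_direction }, rfl, h.coframing_eq⟩

/-- The twist chosen for `D` is applied to both sides of the move. It need not be the one chosen for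
`D'`, but the two biframed images of `D'` have the same coframing and differ by an isotopy. -/
theorem mk_biframing_eq_of_localChange {D D' : KnotoidDiagram}
    (hmap : ∀ G : PlaneDiffeo, ∀ K K' : BiframedDiagram v, K.toKnotoidDiagram = D.map G →
      K'.toKnotoidDiagram = D'.map G → BiframedStep v K K')
    (hl : ∃ (B : Set ℂ) (n : ℕ) (a b : Fin n → ℝ), LocalChange D D' B a b) :
    Quot.mk (BiframedStep v) (biframing hv m D) = Quot.mk (BiframedStep v) (biframing hv m D') := by
  obtain ⟨B, n, a, b, hl⟩ := hl
  obtain ⟨F, F', hF, hF'⟩ := biframing_spec hv m D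
  obtain ⟨F₁, -, hF₁, -⟩ := biframing_spec hv m D'
  obtain ⟨K', hK', hco⟩ := (hl.map (F.toDiffeo 1)).exists_biframed hF
  refine (Quot.sound (hmap _ _ _ hF hK')).trans ?_
  refine mk_eq_of_isotopyCarries (isotopyCarries_refl D') hK' hF' hF₁ ?_
  rw [hco, biframing_coframing, biframing_coframing]

/-- Both diagrams agree with `D₀` outside the arc, so R1' is itself a local change. -/
theorem AddsKink.trans_localChange {D₀ D D' : KnotoidDiagram} {B : Set ℂ} {a b : ℝ} {ε : ℤ}
    (h : AddsKink D₀ D B a b ε) (h' : AddsKink D₀ D' B a b ε) :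
    LocalChange D D' B (fun _ : Fin 1 => a) (fun _ : Fin 1 => b) where
  disc := h.1.disc
  arcs := h.1.arcs
  disjoint := h.1.disjoint
  meets := h.1.meets'
  meets' := h'.1.meets'
  outside t ht hi := ⟨(h'.1.outside t ht hi).1.trans (h.1.outside t ht hi).1.symm,
    (h'.1.outside t ht hi).2.trans (h.1.outside t ht hi).2.symm⟩

/-- The class of the biframing of a regular class with given coframing. -/
def biframingClass : Quot RegularStep → BiframedKnotoid v :=
  Quot.lift (fun D => Quot.mk (BiframedStep v) (biframing hv m D)) (by
    intro D D' h
    cases h with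
    | isotopy F hc =>
      obtain ⟨F₀, F₀', hF₀, hF₀'⟩ := biframing_spec hv m D
      obtain ⟨F₁, -, hF₁, -⟩ := biframing_spec hv m D'
      exact mk_eq_of_isotopyCarries hc hF₀ hF₀' hF₁
        (by rw [biframing_coframing, biframing_coframing])
    | r1' h =>
      refine mk_biframing_eq_of_localChange hv m (fun G K K' hK hK' => BiframedStep.r1' ?_) ?_
      · rw [hK, hK']; exact h.map G
      · obtain ⟨D₀, B, a, b, ε, h1, h2⟩ := h
        exact ⟨B, _, _, _, h1.trans_localChange h2⟩
    | r2 h =>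
      refine mk_biframing_eq_of_localChange hv m (fun G K K' hK hK' => BiframedStep.r2 ?_) ?_
      · rw [hK, hK']; exact h.map G
      · obtain ⟨B, a, b, hl, -⟩ := h
        exact ⟨B, _, _, _, hl⟩
    | r3 h =>
      refine mk_biframing_eq_of_localChange hv m (fun G K K' hK hK' => BiframedStep.r3 ?_) ?_
      · rw [hK, hK']; exact h.map G
      · obtain ⟨B, a, b, hl, -⟩ := h
        exact ⟨B, _, _, _, hl⟩)

theorem biframingClass_mk (K : BiframedDiagram v) (hm : K.coframing = m) :
    biframingClass hv m (regularClass K.toKnotoidDiagram) = Quot.mk (BiframedStep v) K := by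
  obtain ⟨F, -, hF, -⟩ := biframing_spec hv m K.toKnotoidDiagram
  refine (mk_eq_of_isotopyCarries (isotopyCarries_refl K.toKnotoidDiagram)
    (F₀ := AmbientIsotopy.refl) (F₀' := AmbientIsotopy.refl) rfl (fun _ _ => rfl) hF ?_).symm
  rw [biframing_coframing, hm]

theorem regularClass_biframing (D : KnotoidDiagram) :
    regularClass (biframing hv m D).toKnotoidDiagram = regularClass D := by
  obtain ⟨F, -, hF, -⟩ := biframing_spec hv m D
  rw [hF]
  exact (Quot.sound (RegularStep.isotopy F (isotopyCarries_map D F))).symm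

end

/-- Biframed diagrams that are regularly equivalent and have the same coframing represent the same
biframed knotoid. -/
theorem mk_eq_of_regularClass_eq {v : ℂ} (hv : v ≠ 0) {K K' : BiframedDiagram v}
    (h : regularClass K.toKnotoidDiagram = regularClass K'.toKnotoidDiagram)
    (hco : K.coframing = K'.coframing) :
    Quot.mk (BiframedStep v) K = Quot.mk (BiframedStep v) K' := by
  obtain ⟨m, hm⟩ := K.exists_coframing_eq_int
  rw [← biframingClass_mk hv m K hm.symm, h, biframingClass_mk hv m K' (hco ▸ hm.symm)]

/-! ### Extending local diffeomorphisms -/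

/-- On the ball of radius `2 * r` the error `e` is at most `2 * r * η`, and the cutoff has slope at
most `C / r`. By the product rule the constant is `2 * C * η + η`, independently of `r`. -/
theorem lipschitz_cutoff_mul {e : ℂ → ℂ} {ρ : ℂ → ℝ} {C η r : ℝ} (hC : 0 ≤ C) (hη : 0 ≤ η)
    (hr : 0 < r) (h0 : e 0 = 0) (he : ∀ x y, ‖x‖ < 2 * r → ‖y‖ < 2 * r → ‖e x - e y‖ ≤ η * ‖x - y‖)
    (hρ1 : ∀ x, |ρ x| ≤ 1) (hρ0 : ∀ x, 2 * r ≤ ‖x‖ → ρ x = 0)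
    (hρ : ∀ x y, |ρ x - ρ y| ≤ C / r * ‖x - y‖) (x y : ℂ) :
    ‖ρ x • e x - ρ y • e y‖ ≤ (2 * C + 1) * η * ‖x - y‖ := by
  have hsmall : ∀ x, ‖x‖ < 2 * r → ‖e x‖ ≤ η * (2 * r) := fun x hx => by
    have := he x 0 hx (by simpa using hr)
    rw [h0, sub_zero, sub_zero] at this
    exact this.trans (mul_le_mul_of_nonneg_left hx.le hη)
  have hfirst : ∀ x y, ‖x‖ < 2 * r → ‖(ρ x - ρ y) • e x‖ ≤ 2 * C * η * ‖x - y‖ := fun x y hx => by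
    rw [norm_smul, Real.norm_eq_abs]
    calc |ρ x - ρ y| * ‖e x‖ ≤ (C / r * ‖x - y‖) * (η * (2 * r)) := by
          gcongr
          · exact hρ x y
          · exact hsmall x hx
      _ = 2 * C * η * ‖x - y‖ := by field_simp
  have hout : ∀ x y, ‖x‖ < 2 * r → 2 * r ≤ ‖y‖ →
      ‖ρ x • e x - ρ y • e y‖ ≤ (2 * C + 1) * η * ‖x - y‖ := fun x y hx hy => by
    have h1 := hfirst x y hx
    rw [hρ0 y hy, sub_zero] at h1
    rw [hρ0 y hy, zero_smul, sub_zero]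
    nlinarith [mul_nonneg hη (norm_nonneg (x - y))]
  rcases lt_or_ge ‖x‖ (2 * r) with hx | hx <;> rcases lt_or_ge ‖y‖ (2 * r) with hy | hy
  · have h2 : ρ x • e x - ρ y • e y = (ρ x - ρ y) • e x + ρ y • (e x - e y) := by module
    rw [h2]
    refine (norm_add_le _ _).trans ?_
    have h3 : ‖ρ y • (e x - e y)‖ ≤ 1 * (η * ‖x - y‖) := by
      rw [norm_smul, Real.norm_eq_abs]
      exact mul_le_mul (hρ1 y) (he x y hx hy) (norm_nonneg _) zero_le_one
    linarith [hfirst x y hx]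
  · exact hout x y hx hy
  · rw [norm_sub_rev, norm_sub_rev x y]
    exact hout y x hy hx
  · rw [hρ0 x hx, hρ0 y hy, zero_smul, zero_smul, sub_zero, norm_zero]
    positivity

/-- A smooth map of the plane with invertible derivative at the origin agrees near the origin with
a diffeomorphism of the plane. -/
theorem exists_planeDiffeo_eq_near_zero {f : ℂ → ℂ} (hf : ContDiff ℝ ∞ f)
    (hinj : Function.Injective (fderiv ℝ f 0)) :
    ∃ (G : PlaneDiffeo) (r : ℝ), 0 < r ∧ ∀ z, ‖z‖ < r → G z = f z := by
  let L : ℂ ≃L[ℝ] ℂ :=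
    (LinearEquiv.ofInjectiveEndo (fderiv ℝ f 0).toLinearMap hinj).toContinuousLinearEquiv
  have hL : (L : ℂ →L[ℝ] ℂ) = fderiv ℝ f 0 := by ext z <;> rfl
  have hstrict : HasStrictFDerivAt f (L : ℂ →L[ℝ] ℂ) 0 := by
    rw [hL]; exact hf.contDiffAt.hasStrictFDerivAt (by simp)
  -- A cutoff that is `1` on the unit disc and vanishes outside the disc of radius `2`, defined
  -- through the squared norm in order to be smooth.
  let ρ : ℂ → ℝ := fun z => Real.smoothTransition (2 - (z.re ^ 2 + z.im ^ 2))
  have hρs : ContDiff ℝ ∞ ρ := by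
    have h1 : ContDiff ℝ ∞ fun z : ℂ => z.re := Complex.reCLM.contDiff
    have h2 : ContDiff ℝ ∞ fun z : ℂ => z.im := Complex.imCLM.contDiff
    exact Real.smoothTransition.contDiff.comp (contDiff_const.sub ((h1.pow 2).add (h2.pow 2)))
  have hnsq : ∀ z : ℂ, z.re ^ 2 + z.im ^ 2 = ‖z‖ ^ 2 := fun z => by
    rw [← Complex.normSq_eq_norm_sq, Complex.normSq_apply]; ring
  have hρ0 : ∀ z, 2 ≤ ‖z‖ → ρ z = 0 := fun z hz => by
    refine Real.smoothTransition.zero_of_nonpos ?_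
    rw [hnsq]; nlinarith
  have hρ1 : ∀ z, ‖z‖ ≤ 1 → ρ z = 1 := fun z hz => by
    refine Real.smoothTransition.one_of_one_le ?_
    rw [hnsq]; nlinarith [norm_nonneg z]
  obtain ⟨C, hC⟩ := ContDiff.lipschitzWith_of_hasCompactSupport (𝕂 := ℝ) (f := ρ)
    (HasCompactSupport.of_support_subset_isCompact (isCompact_closedBall (0 : ℂ) 2) fun z hz => by
      rw [mem_closedBall_zero_iff]
      by_contra h
      exact hz (hρ0 z (not_le.1 h).le)) hρs (by simp)
  have hLpos : 0 < ‖(L.symm : ℂ →L[ℝ] ℂ)‖₊ := by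
    rw [← NNReal.coe_pos, coe_nnnorm]
    exact norm_pos_iff.2 fun h => by
      have := congrArg (fun A : ℂ →L[ℝ] ℂ => A 1) h
      simp at this
  -- A perturbation of `L` with Lipschitz constant below `‖L⁻¹‖⁻¹` is bijective; half of that bound
  -- leaves a margin.
  set c : NNReal := ‖(L.symm : ℂ →L[ℝ] ℂ)‖₊⁻¹ / 2 with hc
  have hcpos : 0 < c := by positivity
  have hcl : c < ‖(L.symm : ℂ →L[ℝ] ℂ)‖₊⁻¹ := by rw [hc]; exact half_lt_self (by positivity)
  -- Chosen so that the constant `(2 * C + 1) * η` of the cut-off error is exactly `c`.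
  set η : ℝ := c / (2 * C + 1) with hη
  have hηpos : 0 < η := by positivity
  obtain ⟨δ, hδ, hball⟩ := Metric.eventually_nhds_iff.1 (hstrict.isLittleO.def hηpos)
  set r := δ / 2 with hr
  have hrpos : 0 < r := by positivity
  let e : ℂ → ℂ := fun z => f z - f 0 - L z
  have hlip := lipschitz_cutoff_mul (e := e) (ρ := fun z => ρ (z / r)) (C := C) (η := η) (r := r)
    C.2 hηpos.le hrpos (by simp [e]) (fun x y hx hy => by
      have := hball (y := (x, y)) (by
        rw [Prod.dist_eq, max_lt_iff, dist_zero_right, dist_zero_right]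
        constructor <;> simp only <;> linarith)
      simpa [e, sub_sub_sub_comm] using this)
    (fun x => by
      rw [abs_of_nonneg (Real.smoothTransition.nonneg _)]
      exact Real.smoothTransition.le_one _)
    (fun x hx => hρ0 _ (by
      rw [norm_div, Complex.norm_real, Real.norm_eq_abs, abs_of_pos hrpos, le_div_iff₀ hrpos]
      exact hx))
    (fun x y => by
      have := hC.dist_le_mul (x / r) (y / r)
      rw [Real.dist_eq, dist_eq_norm, ← sub_div, norm_div, Complex.norm_real, Real.norm_eq_abs,
        abs_of_pos hrpos] at this
      calc _ ≤ _ := this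
        _ = _ := by ring)
  let g : ℂ → ℂ := fun z => f 0 + L z + ρ (z / r) • e z
  have hLs : ContDiff ℝ ∞ (fun z => L z) := L.contDiff
  have hgs : ContDiff ℝ ∞ g := (contDiff_const.add hLs).add
    ((hρs.comp (contDiff_id.div_const _)).smul ((hf.sub contDiff_const).sub hLs))
  have happ : ApproximatesLinearOn g (L : ℂ →L[ℝ] ℂ) univ c := by
    intro x _ y _
    have h1 : g x - g y - L (x - y) = ρ (x / r) • e x - ρ (y / r) • e y := by
      simp only [g, map_sub]; ring
    have h2 : (2 * (C : ℝ) + 1) * η = c := by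
      rw [hη]; field_simp
    rw [ContinuousLinearEquiv.coe_coe, h1, ← h2]
    exact hlip x y
  -- The derivative of `g` differs from `L` by an operator of norm at most `c`, so it is injective
  -- everywhere. This is what makes the inverse smooth.
  have hinjg : ∀ z, Function.Injective (fderiv ℝ g z) := by
    intro z
    rw [← ContinuousLinearMap.coe_coe, ← LinearMap.ker_eq_bot, LinearMap.ker_eq_bot']
    intro w hw
    have h1 : HasFDerivAt (g - (L : ℂ → ℂ)) (fderiv ℝ g z - (L : ℂ →L[ℝ] ℂ)) z :=
      ((hgs.differentiable (by simp)) z).hasFDerivAt.sub L.hasFDerivAt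
    have h2 : LipschitzWith c (g - (L : ℂ → ℂ)) := by
      have := happ.lipschitz_sub
      refine LipschitzWith.of_dist_le_mul fun x y => ?_
      exact this.dist_le_mul ⟨x, mem_univ _⟩ ⟨y, mem_univ _⟩
    have h3 := (fderiv ℝ g z - (L : ℂ →L[ℝ] ℂ)).le_of_opNorm_le (h1.le_of_lipschitz h2) w
    have hw' : fderiv ℝ g z w = 0 := hw
    rw [sub_apply, hw', zero_sub, norm_neg] at h3
    have h4 := (L.symm : ℂ →L[ℝ] ℂ).le_opNorm (L w)
    simp only [ContinuousLinearEquiv.coe_coe, L.symm_apply_apply] at h3 h4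
    have h5 : ‖(L.symm : ℂ →L[ℝ] ℂ)‖ * c = 1 / 2 := by
      have : ‖(L.symm : ℂ →L[ℝ] ℂ)‖ ≠ 0 := by
        rw [← coe_nnnorm]; exact_mod_cast hLpos.ne'
      rw [hc]; push_cast; field_simp
    have h6 : ‖w‖ ≤ ‖(L.symm : ℂ →L[ℝ] ℂ)‖ * (c * ‖w‖) :=
      h4.trans (mul_le_mul_of_nonneg_left h3 (norm_nonneg _))
    rw [← mul_assoc, h5] at h6
    exact norm_eq_zero.1 (le_antisymm (by linarith) (norm_nonneg w))
  let H : ℂ ≃ₜ ℂ := happ.toHomeomorph g (Or.inr hcl)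
  have hsymm : ContDiff ℝ ∞ H.symm := by
    refine H.contDiff_symm (f₀' := fun z =>
      (LinearEquiv.ofInjectiveEndo (fderiv ℝ g z).toLinearMap (hinjg z)).toContinuousLinearEquiv)
      (fun z => ?_) hgs
    exact ((hgs.differentiable (by simp)) z).hasFDerivAt
  refine ⟨PlaneDiffeo.mk g H.symm hgs hsymm (fun z => H.symm_apply_apply z)
    (fun z => H.apply_symm_apply z), r, hrpos, fun z hz => ?_⟩
  have : ρ (z / r) = 1 := hρ1 _ (by
    rw [norm_div, Complex.norm_real, Real.norm_eq_abs, abs_of_pos hrpos, div_le_one hrpos]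
    exact hz.le)
  change f 0 + L z + ρ (z / r) • e z = f z
  rw [this, one_smul]
  simp only [e]
  ring

/-- Multiplication by a positive constant. -/
def scaleDiffeo (c : ℝ) (hc : c ≠ 0) : PlaneDiffeo :=
  PlaneDiffeo.mk (fun z => c * z) (fun z => (c : ℂ)⁻¹ * z) (contDiff_const.mul contDiff_id)
    (contDiff_const.mul contDiff_id)
    (fun z => inv_mul_cancel_left₀ (by exact_mod_cast hc) z)
    (fun z => mul_inv_cancel_left₀ (by exact_mod_cast hc) z)

/-! ### Straightening the strands at a point of a diagram -/

/-- Charts in which the strands through a point are straight segments run through at constant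
speed. -/
theorem exists_straight_chart {D : KnotoidDiagram} {P : ℂ} {T : Set ℝ} {dir : ℝ → ℂ}
    {Ψ : ℂ → ℂ} (hΨ : ContDiff ℝ ∞ Ψ) (hinj : Function.Injective (fderiv ℝ Ψ 0)) (h0 : Ψ 0 = P)
    (hT : T.Finite) (hT01 : T ⊆ Ioo 0 1) (hdir : ∀ τ ∈ T, ‖dir τ‖ = 1)
    (hD : ∀ τ ∈ T, ∀ x : ℝ, D.curve (τ + x) = Ψ (x * dir τ))
    (honly : ∀ t ∈ Icc (0 : ℝ) 1, D.curve t = P → t ∈ T)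
    {R δ : ℝ} (hR : 0 < R) (hδ : 0 < δ) {W : Set ℂ} (hW : W ∈ 𝓝 P) :
    ∃ (G : PlaneDiffeo) (l : ℝ), 0 < l ∧ R / l < δ ∧
      (∀ τ ∈ T, ∀ u : ℝ, |u| < R → τ + u / l ∈ Ioo (0 : ℝ) 1 ∧ D.curve (τ + u / l) = G (u * dir τ)) ∧
      (∀ t ∈ Icc (0 : ℝ) 1, D.curve t ∈ G '' Metric.ball 0 R → ∃ τ ∈ T, |l * (t - τ)| < R) ∧
      G '' Metric.ball 0 R ⊆ W := by
  obtain ⟨G, r₀, hr₀, hG⟩ := exists_planeDiffeo_eq_near_zero hΨ hinj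
  have hG0 : G 0 = P := by rw [hG 0 (by simpa using hr₀), h0]
  -- The times far from `T`. Their image is compact and misses `P`, so a small enough disc around
  -- `P` sees only the strands at the times in `T`.
  have hcpt : IsCompact (Icc (0 : ℝ) 1 ∩ ⋂ τ ∈ T, {t | r₀ ≤ |t - τ|}) := by
    refine isCompact_Icc.inter_right (isClosed_biInter fun τ _ => ?_)
    exact isClosed_le continuous_const (by fun_prop)
  have hclosed : IsClosed (D.curve '' (Icc (0 : ℝ) 1 ∩ ⋂ τ ∈ T, {t | r₀ ≤ |t - τ|})) :=
    (hcpt.image D.smooth.continuous).isClosed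
  have hPn : P ∉ D.curve '' (Icc (0 : ℝ) 1 ∩ ⋂ τ ∈ T, {t | r₀ ≤ |t - τ|}) := by
    rintro ⟨t, ⟨ht, ht2⟩, he⟩
    have h1 := mem_iInter₂.1 ht2 t (honly t ht he)
    simp at h1
    linarith
  have hnhds : G ⁻¹' (W ∩ (D.curve '' (Icc (0 : ℝ) 1 ∩ ⋂ τ ∈ T, {t | r₀ ≤ |t - τ|}))ᶜ) ∈
      𝓝 (0 : ℂ) := by
    refine G.continuous.continuousAt.preimage_mem_nhds ?_
    rw [hG0]
    exact inter_mem hW (hclosed.isOpen_compl.mem_nhds hPn)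
  obtain ⟨r₁, hr₁, hball⟩ := Metric.mem_nhds_iff.1 hnhds
  obtain ⟨r₂, hr₂, hT2⟩ : ∃ r₂ > 0, ∀ τ ∈ T, ∀ x, |x| < r₂ → τ + x ∈ Ioo (0 : ℝ) 1 := by
    have : ∀ᶠ x in 𝓝 (0 : ℝ), ∀ τ ∈ T, τ + x ∈ Ioo (0 : ℝ) 1 := by
      refine (Set.Finite.eventually_all hT).2 fun τ hτ => ?_
      have : Tendsto (fun x => τ + x) (𝓝 0) (𝓝 τ) := by
        have := (continuous_const_add τ).tendsto 0
        rwa [add_zero] at this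
      exact this.eventually (isOpen_Ioo.mem_nhds (hT01 hτ))
    obtain ⟨r₂, hr₂, h⟩ := Metric.eventually_nhds_iff.1 this
    exact ⟨r₂, hr₂, fun τ hτ x hx => h (by simpa using hx) τ hτ⟩
  set r := min (min r₀ r₁) (min r₂ (δ / 2)) with hr
  have hrpos : 0 < r := by positivity
  have hle0 : r ≤ r₀ := (min_le_left _ _).trans (min_le_left _ _)
  have hle1 : r ≤ r₁ := (min_le_left _ _).trans (min_le_right _ _)
  have hle2 : r ≤ r₂ := (min_le_right _ _).trans (min_le_left _ _)
  have hleδ : r ≤ δ / 2 := (min_le_right _ _).trans (min_le_right _ _)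
  -- Magnification by `l` turns the small radius `r` into the prescribed radius `R`.
  set l := R / r with hl
  have hlpos : 0 < l := div_pos hR hrpos
  have hRl : R / l = r := by rw [hl]; field_simp
  have hlc : (l : ℂ)⁻¹ = ((l⁻¹ : ℝ) : ℂ) := by push_cast; rfl
  have himg : ∀ z ∈ Metric.ball (0 : ℂ) R, ((l⁻¹ : ℝ) : ℂ) * z ∈ Metric.ball (0 : ℂ) r := by
    intro z hz
    rw [mem_ball_zero_iff] at hz ⊢
    rw [norm_mul, Complex.norm_real, Real.norm_eq_abs, abs_of_pos (inv_pos.2 hlpos), ← hRl,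
      div_eq_inv_mul]
    exact mul_lt_mul_of_pos_left hz (inv_pos.2 hlpos)
  have habs : ∀ u : ℝ, |u| < R → |u / l| < r := fun u hu => by
    rw [abs_div, abs_of_pos hlpos, ← hRl]
    exact div_lt_div_of_pos_right hu hlpos
  refine ⟨(scaleDiffeo l⁻¹ (inv_ne_zero hlpos.ne')).trans G, l, hlpos, by linarith, ?_, ?_, ?_⟩
  · intro τ hτ u hu
    refine ⟨hT2 τ hτ _ ((habs u hu).trans_le hle2), ?_⟩
    rw [hD τ hτ]
    change _ = G (((l⁻¹ : ℝ) : ℂ) * (u * dir τ))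
    rw [← mul_assoc, show ((l⁻¹ : ℝ) : ℂ) * u = ((u / l : ℝ) : ℂ) by push_cast; ring, hG]
    rw [norm_mul, hdir τ hτ, mul_one, Complex.norm_real]
    exact (habs u hu).trans_le hle0
  · rintro t ht ⟨z, hz, he⟩
    have he : G (((l⁻¹ : ℝ) : ℂ) * z) = D.curve t := he
    have hz' := himg z hz
    have h1 := (hball (Metric.ball_subset_ball hle1 hz')).2
    rw [he] at h1
    have h2 : ¬ ∀ τ ∈ T, r₀ ≤ |t - τ| := fun h => h1 ⟨t, ⟨ht, mem_iInter₂.2 h⟩, rfl⟩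
    push Not at h2
    obtain ⟨τ, hτ, hlt⟩ := h2
    refine ⟨τ, hτ, ?_⟩
    have h3 := hD τ hτ (t - τ)
    rw [add_sub_cancel, ← hG _ (by
      rw [norm_mul, hdir τ hτ, mul_one, Complex.norm_real]; exact hlt)] at h3
    have h4 := G.inj (he.trans h3)
    rw [h4, mem_ball_zero_iff, norm_mul, hdir τ hτ, mul_one, Complex.norm_real, Real.norm_eq_abs]
      at hz'
    rw [abs_mul, abs_of_pos hlpos, hl]
    rwa [div_mul_eq_mul_div, div_lt_iff₀ hrpos, mul_lt_mul_iff_right₀ hR]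
  · rintro _ ⟨z, hz, rfl⟩
    exact (hball (Metric.ball_subset_ball hle1 (himg z hz))).1

/-! ### Replacing a strand of a diagram -/

/-- An arc of the diagram `E`, in its own coordinate, together with a rule that determines which
strand is the upper one at the crossings of that arc. -/
structure StrandFrame (E : KnotoidDiagram) where
  center : ℝ
  scale : ℝ
  -- Replacements take place only where the coordinate is smaller than `core` in absolute value. The
  -- collar between `core` and `radius` makes the new curve agree with the old one near the ends of
  -- the arc.
  core : ℝ
  radius : ℝ
  base : ℝ → ℂ
  isOver : Prop
  -- At crossings of the arc with itself, the value `1` puts the later passage on top and `-1` the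
  -- earlier one.
  order : ℝ
  scale_pos : 0 < scale
  core_lt : core < radius
  base_smooth : ContDiff ℝ ∞ base
  order_eq : order = 1 ∨ order = -1
  arc : ∀ u, |u| < radius → center + u / scale ∈ Ioo (0 : ℝ) 1 ∧
    E.curve (center + u / scale) = base u
  base_inj : ∀ u w, |u| < radius → |w| < radius → base u = base w → u = w
  level : ∀ u t, |u| < radius → t ∈ Icc (0 : ℝ) 1 → radius ≤ |scale * (t - center)| →
    base u = E.curve t → (center + u / scale ∈ E.upper ↔ isOver)

namespace StrandFrame

variable {E : KnotoidDiagram} (F : StrandFrame E)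

/-- The coordinate on the arc. -/
def coord (t : ℝ) : ℝ := F.scale * (t - F.center)

/-- The time at which the arc runs through the point with a given coordinate. -/
def time (u : ℝ) : ℝ := F.center + u / F.scale

@[simp] theorem coord_time (u : ℝ) : F.coord (F.time u) = u := by
  have := F.scale_pos.ne'
  rw [coord, time]; field_simp; ring

@[simp] theorem time_coord (t : ℝ) : F.time (F.coord t) = t := by
  have := F.scale_pos.ne'
  rw [coord, time]; field_simp; ring

theorem time_lt_time {u w : ℝ} : F.time u < F.time w ↔ u < w := by
  rw [time, time, add_lt_add_iff_left, div_lt_div_iff_of_pos_right F.scale_pos]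

theorem time_le_time {u w : ℝ} : F.time u ≤ F.time w ↔ u ≤ w := by
  rw [time, time, add_le_add_iff_left, div_le_div_iff_of_pos_right F.scale_pos]

theorem time_inj {u w : ℝ} : F.time u = F.time w ↔ u = w :=
  ⟨fun h => by simpa using congrArg F.coord h, fun h => h ▸ rfl⟩

/-- Times on the arc. -/
def InArc (t : ℝ) : Prop := |F.coord t| < F.radius

theorem InArc.exists_eq {F : StrandFrame E} {t : ℝ} (h : F.InArc t) :
    ∃ u, |u| < F.radius ∧ t = F.time u :=
  ⟨F.coord t, h, (F.time_coord t).symm⟩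

theorem inArc_time {u : ℝ} : F.InArc (F.time u) ↔ |u| < F.radius := by rw [InArc, coord_time]

theorem InArc.mem_Ioo {F : StrandFrame E} {t : ℝ} (h : F.InArc t) : t ∈ Ioo (0 : ℝ) 1 := by
  obtain ⟨u, hu, rfl⟩ := h.exists_eq
  exact (F.arc u hu).1

theorem curve_time {u : ℝ} (hu : |u| < F.radius) : E.curve (F.time u) = F.base u := (F.arc u hu).2

open Classical in
/-- Whether the strand at time `t` runs over the strand at time `s`. -/
def Over (t s : ℝ) : Prop :=
  if F.InArc t then if F.InArc s then 0 < F.order * (t - s) else F.isOver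
  else if F.InArc s then ¬ F.isOver else t ∈ E.upper

/-- The curves by which the arc can be replaced. -/
structure Admissible (c : ℝ → ℂ) : Prop where
  smooth : ContDiff ℝ ∞ c
  eq_base : ∀ u, F.core ≤ |u| → c u = F.base u
  immersion : ∀ u, |u| < F.radius → deriv c u ≠ 0
  no_triple : ∀ u w x, |u| < F.radius → |w| < F.radius → |x| < F.radius → c u = c w → c w = c x →
    u = w ∨ w = x ∨ u = x
  transversal : ∀ u w, |u| < F.radius → |w| < F.radius → u ≠ w → c u = c w →
    planeDet (deriv c u) (deriv c w) ≠ 0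
  rest : ∀ u t, |u| < F.radius → t ∈ Icc (0 : ℝ) 1 → ¬ F.InArc t → c u = E.curve t →
    t ∈ Ioo (0 : ℝ) 1 ∧ planeDet (deriv c u) (deriv E.curve t) ≠ 0 ∧
      (∀ w, |w| < F.radius → c w = c u → w = u) ∧
      ∀ s ∈ Icc (0 : ℝ) 1, ¬ F.InArc s → E.curve s = E.curve t → s = t

/-- The curve `E.curve` with the arc replaced by `c`. -/
def newCurve (c : ℝ → ℂ) (t : ℝ) : ℂ := E.curve t + (c (F.coord t) - F.base (F.coord t))

theorem newCurve_time {c : ℝ → ℂ} {u : ℝ} (hu : |u| < F.radius) :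
    F.newCurve c (F.time u) = c u := by
  rw [newCurve, F.curve_time hu, coord_time, add_sub_cancel]

theorem newCurve_of_not_inArc {c : ℝ → ℂ} (hc : F.Admissible c) {t : ℝ} (ht : ¬ F.InArc t) :
    F.newCurve c t = E.curve t := by
  rw [newCurve, hc.eq_base _ (F.core_lt.le.trans (not_lt.1 ht)), sub_self, add_zero]

theorem continuous_coord : Continuous F.coord := by unfold coord; fun_prop

theorem hasDerivAt_coord (t : ℝ) : HasDerivAt F.coord F.scale t := by
  have h : HasDerivAt (fun t => F.scale * (t - F.center)) (F.scale * 1) t :=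
    ((hasDerivAt_id t).sub_const _).const_mul _
  rwa [mul_one] at h

/-- The replacement adds the difference `c - base` on the whole line instead of gluing pieces, so
smoothness is immediate. -/
theorem newCurve_smooth {c : ℝ → ℂ} (hc : F.Admissible c) : ContDiff ℝ ∞ (F.newCurve c) := by
  have h : ContDiff ℝ ∞ F.coord := contDiff_const.mul (contDiff_id.sub contDiff_const)
  exact E.smooth.add ((hc.smooth.comp h).sub (F.base_smooth.comp h))

theorem deriv_newCurve_time {c : ℝ → ℂ} (hc : F.Admissible c) {u : ℝ} (hu : |u| < F.radius) :
    deriv (F.newCurve c) (F.time u) = F.scale * deriv c u := by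
  have h1 : HasDerivAt (fun t => c (F.coord t)) (F.scale • deriv c (F.coord (F.time u)))
      (F.time u) :=
    ((hc.smooth.differentiable (by simp)) _).hasDerivAt.scomp _ (F.hasDerivAt_coord _)
  rw [coord_time, Complex.real_smul] at h1
  refine (h1.congr_of_eventuallyEq ?_).deriv
  have h2 : ∀ᶠ t in 𝓝 (F.time u), |F.coord t| < F.radius :=
    (F.continuous_coord.abs.continuousAt).eventually_lt continuousAt_const (by simpa using hu)
  filter_upwards [h2] with t ht
  conv_lhs => rw [← F.time_coord t]
  exact F.newCurve_time ht

theorem deriv_newCurve_of_not_inArc {c : ℝ → ℂ} (hc : F.Admissible c) {t : ℝ}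
    (ht : ¬ F.InArc t) : deriv (F.newCurve c) t = deriv E.curve t := by
  refine Filter.EventuallyEq.deriv_eq ?_
  have h2 : ∀ᶠ s in 𝓝 t, F.core < |F.coord s| :=
    continuousAt_const.eventually_lt (F.continuous_coord.abs.continuousAt)
      (F.core_lt.trans_le (not_lt.1 ht))
  filter_upwards [h2] with s hs
  rw [newCurve, hc.eq_base _ hs.le, sub_self, add_zero]

theorem order_mul_pos (t s : ℝ) (h : t ≠ s) : 0 < F.order * (t - s) ↔ ¬ 0 < F.order * (s - t) := by
  rcases F.order_eq with h1 | h1 <;> rw [h1] <;> rcases lt_or_gt_of_ne h with h | h <;>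
    constructor <;> intro h2 <;> linarith

theorem over_iff {c : ℝ → ℂ} (hc : F.Admissible c) {t s : ℝ} (ht : t ∈ Icc (0 : ℝ) 1)
    (hs : s ∈ Icc (0 : ℝ) 1) (hne : t ≠ s) (he : F.newCurve c t = F.newCurve c s) :
    F.Over t s ↔ ¬ F.Over s t := by
  by_cases h1 : F.InArc t <;> by_cases h2 : F.InArc s
  · simpa only [Over, h1, h2, if_true] using F.order_mul_pos t s hne
  · simp only [Over, h1, h2, if_true, if_false, not_not]
  · simp only [Over, h1, h2, if_true, if_false]
  · simp only [Over, h1, h2, if_false]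
    rw [F.newCurve_of_not_inArc hc h1, F.newCurve_of_not_inArc hc h2] at he
    exact E.upper_iff t ht s hs hne he

theorem rest_mem_Ioo {c : ℝ → ℂ} (hc : F.Admissible c) {t s : ℝ} (ht : t ∈ Icc (0 : ℝ) 1)
    (hs : s ∈ Icc (0 : ℝ) 1) (hne : t ≠ s) (he : F.newCurve c t = F.newCurve c s) :
    t ∈ Ioo (0 : ℝ) 1 := by
  by_cases h1 : F.InArc t
  · exact h1.mem_Ioo
  · rw [F.newCurve_of_not_inArc hc h1] at he
    by_cases h2 : F.InArc s
    · obtain ⟨u, hu, rfl⟩ := h2.exists_eq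
      rw [F.newCurve_time hu] at he
      exact (hc.rest u t hu ht h1 he.symm).1
    · rw [F.newCurve_of_not_inArc hc h2] at he
      exact E.endpoints_simple t ht s hs hne he

theorem newCurve_triple {c : ℝ → ℂ} (hc : F.Admissible c) {s t r : ℝ} (hs : s ∈ Icc (0 : ℝ) 1)
    (ht : t ∈ Icc (0 : ℝ) 1) (hr : r ∈ Icc (0 : ℝ) 1) (h1 : F.newCurve c s = F.newCurve c t)
    (h2 : F.newCurve c t = F.newCurve c r) : s = t ∨ t = r ∨ s = r := by
  -- two times on the arc and one outside of it
  have key2 : ∀ {s t r : ℝ}, F.InArc s → F.InArc t → ¬ F.InArc r → r ∈ Icc (0 : ℝ) 1 →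
      F.newCurve c s = F.newCurve c r → F.newCurve c t = F.newCurve c r → s = t := by
    intro s t r hs ht hr hr1 h1 h2
    obtain ⟨u, hu, rfl⟩ := hs.exists_eq
    obtain ⟨w, hw, rfl⟩ := ht.exists_eq
    rw [F.newCurve_time hu, F.newCurve_of_not_inArc hc hr] at h1
    rw [F.newCurve_time hw, F.newCurve_of_not_inArc hc hr] at h2
    rw [(hc.rest u r hu hr1 hr h1).2.2.1 w hw (h2.trans h1.symm)]
  -- one time on the arc and two outside of it
  have key1 : ∀ {s t r : ℝ}, F.InArc s → ¬ F.InArc t → ¬ F.InArc r → t ∈ Icc (0 : ℝ) 1 →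
      r ∈ Icc (0 : ℝ) 1 →
      F.newCurve c s = F.newCurve c t → F.newCurve c s = F.newCurve c r → t = r := by
    intro s t r hs ht hr ht1 hr1 h1 h2
    obtain ⟨u, hu, rfl⟩ := hs.exists_eq
    rw [F.newCurve_time hu, F.newCurve_of_not_inArc hc ht] at h1
    rw [F.newCurve_time hu, F.newCurve_of_not_inArc hc hr] at h2
    exact ((hc.rest u t hu ht1 ht h1).2.2.2 r hr1 hr (h2.symm.trans h1)).symm
  by_cases is : F.InArc s <;> by_cases it : F.InArc t <;> by_cases ir : F.InArc r
  · obtain ⟨u, hu, rfl⟩ := is.exists_eq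
    obtain ⟨w, hw, rfl⟩ := it.exists_eq
    obtain ⟨x, hx, rfl⟩ := ir.exists_eq
    rw [F.newCurve_time hu, F.newCurve_time hw] at h1
    rw [F.newCurve_time hw, F.newCurve_time hx] at h2
    simpa only [F.time_inj] using hc.no_triple u w x hu hw hx h1 h2
  · exact .inl (key2 is it ir hr (h1.trans h2) h2)
  · exact .inr (.inr (key2 is ir it ht h1 h2.symm))
  · exact .inr (.inl (key1 is it ir ht hr h1 (h1.trans h2)))
  · exact .inr (.inl (key2 it ir is hs h1.symm (h1.trans h2).symm))
  · exact .inr (.inr (key1 it is ir hs hr h1.symm h2))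
  · exact .inl (key1 ir is it hs ht (h1.trans h2).symm h2.symm)
  · rw [F.newCurve_of_not_inArc hc is, F.newCurve_of_not_inArc hc it] at h1
    rw [F.newCurve_of_not_inArc hc it, F.newCurve_of_not_inArc hc ir] at h2
    exact E.no_triple s hs t ht r hr h1 h2

/-- The diagram with the arc replaced by an admissible curve. -/
def replace {c : ℝ → ℂ} (hc : F.Admissible c) : KnotoidDiagram where
  curve := F.newCurve c
  upper := {t | t ∈ Icc (0 : ℝ) 1 ∧ ∃ s ∈ Icc (0 : ℝ) 1, t ≠ s ∧
    F.newCurve c t = F.newCurve c s ∧ F.Over t s}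
  smooth := F.newCurve_smooth hc
  immersion t ht := by
    by_cases h : F.InArc t
    · obtain ⟨u, hu, rfl⟩ := h.exists_eq
      rw [F.deriv_newCurve_time hc hu]
      exact mul_ne_zero (by exact_mod_cast F.scale_pos.ne') (hc.immersion u hu)
    · rw [F.deriv_newCurve_of_not_inArc hc h]
      exact E.immersion t ht
  no_triple s hs t ht r hr h1 h2 := F.newCurve_triple hc hs ht hr h1 h2
  transversal s hs t ht hne he := by
    have key : ∀ {s t : ℝ}, F.InArc s → ¬ F.InArc t → t ∈ Icc (0 : ℝ) 1 →
        F.newCurve c s = F.newCurve c t →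
        planeDet (deriv (F.newCurve c) s) (deriv (F.newCurve c) t) ≠ 0 := by
      intro s t is it ht he
      obtain ⟨u, hu, rfl⟩ := is.exists_eq
      rw [F.newCurve_time hu, F.newCurve_of_not_inArc hc it] at he
      rw [F.deriv_newCurve_time hc hu, F.deriv_newCurve_of_not_inArc hc it, planeDet_smul_left]
      exact mul_ne_zero F.scale_pos.ne' (hc.rest u t hu ht it he).2.1
    by_cases is : F.InArc s <;> by_cases it : F.InArc t
    · obtain ⟨u, hu, rfl⟩ := is.exists_eq
      obtain ⟨w, hw, rfl⟩ := it.exists_eq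
      rw [F.newCurve_time hu, F.newCurve_time hw] at he
      rw [F.deriv_newCurve_time hc hu, F.deriv_newCurve_time hc hw, planeDet_smul_left,
        planeDet_smul_right]
      exact mul_ne_zero F.scale_pos.ne' (mul_ne_zero F.scale_pos.ne'
        (hc.transversal u w hu hw (fun h => hne (h ▸ rfl)) he))
    · exact key is it ht he
    · rw [planeDet_swap, neg_ne_zero]
      exact key it is hs he.symm
    · rw [F.newCurve_of_not_inArc hc is, F.newCurve_of_not_inArc hc it] at he
      rw [F.deriv_newCurve_of_not_inArc hc is, F.deriv_newCurve_of_not_inArc hc it]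
      exact E.transversal s hs t ht hne he
  endpoints_simple s hs t ht hne he := F.rest_mem_Ioo hc hs ht hne he
  upper_crossing s hs := ⟨hs.1, by obtain ⟨-, t, ht, h1, h2, -⟩ := hs; exact ⟨t, ht, h1, h2⟩⟩
  upper_iff := by
    have key : ∀ s ∈ Icc (0 : ℝ) 1, ∀ t ∈ Icc (0 : ℝ) 1, s ≠ t → F.newCurve c s = F.newCurve c t →
        ((s ∈ Icc (0 : ℝ) 1 ∧ ∃ r ∈ Icc (0 : ℝ) 1, s ≠ r ∧
          F.newCurve c s = F.newCurve c r ∧ F.Over s r) ↔ F.Over s t) := by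
      refine fun s hs t ht hne he => ⟨fun ⟨_, r, hr, h1, h2, h3⟩ => ?_,
        fun h => ⟨hs, t, ht, hne, he, h⟩⟩
      rcases F.newCurve_triple hc ht hs hr he.symm h2 with h | h | h
      · exact absurd h.symm hne
      · exact absurd h h1
      · rwa [h]
    intro s hs t ht hne he
    have h1 := key s hs t ht hne he
    have h2 := key t ht s hs hne.symm he.symm
    rw [mem_ofPred_eq, mem_ofPred_eq, h1, h2]
    exact F.over_iff hc hs ht hne he

section Replace

variable {c : ℝ → ℂ} (hc : F.Admissible c)

@[simp] theorem replace_curve : (F.replace hc).curve = F.newCurve c := rfl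

theorem mem_upper_replace {s t : ℝ} (hs : s ∈ Icc (0 : ℝ) 1) (ht : t ∈ Icc (0 : ℝ) 1) (hne : s ≠ t)
    (he : F.newCurve c s = F.newCurve c t) : s ∈ (F.replace hc).upper ↔ F.Over s t := by
  refine ⟨fun ⟨_, r, hr, h1, h2, h3⟩ => ?_, fun h => ⟨hs, t, ht, hne, he, h⟩⟩
  rcases F.newCurve_triple hc ht hs hr he.symm h2 with h | h | h
  · exact absurd h.symm hne
  · exact absurd h h1
  · rwa [h]

theorem mem_crossings_replace {p : ℝ × ℝ} : p ∈ (F.replace hc).crossings ↔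
    p.1 ∈ Icc (0 : ℝ) 1 ∧ p.2 ∈ Icc (0 : ℝ) 1 ∧ p.1 ≠ p.2 ∧
      F.newCurve c p.1 = F.newCurve c p.2 ∧ F.Over p.1 p.2 := by
  constructor
  · rintro ⟨h1, h2, h3, h4, h5⟩
    exact ⟨h1, h2, h3, h4, (F.mem_upper_replace hc h1 h2 h3 h4).1 h5⟩
  · rintro ⟨h1, h2, h3, h4, h5⟩
    exact ⟨h1, h2, h3, h4, (F.mem_upper_replace hc h1 h2 h3 h4).2 h5⟩

end Replace

/-- Replacing the arc by itself. -/
theorem replace_base (hb : F.Admissible F.base) : F.replace hb = E := by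
  have hcurve : F.newCurve F.base = E.curve := funext fun t => by simp [newCurve]
  have hmem : ∀ s t, s ∈ Icc (0 : ℝ) 1 → t ∈ Icc (0 : ℝ) 1 → s ≠ t → E.curve s = E.curve t →
      (F.Over s t ↔ s ∈ E.upper) := by
    intro s t hs ht hne he
    by_cases is : F.InArc s <;> by_cases it : F.InArc t
    · obtain ⟨u, hu, rfl⟩ := is.exists_eq
      obtain ⟨w, hw, rfl⟩ := it.exists_eq
      rw [F.curve_time hu, F.curve_time hw] at he
      exact absurd (by rw [F.base_inj u w hu hw he]) hne
    · obtain ⟨u, hu, rfl⟩ := is.exists_eq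
      simp only [Over, is, it, if_true, if_false]
      exact (F.level u t hu ht (not_lt.1 it) ((F.curve_time hu).symm.trans he)).symm
    · obtain ⟨u, hu, rfl⟩ := it.exists_eq
      simp only [Over, is, it, if_true, if_false]
      rw [E.upper_iff s hs _ ht hne he]
      exact not_congr (F.level u s hu hs (not_lt.1 is)
        ((F.curve_time hu).symm.trans he.symm)).symm
    · simp only [Over, is, it, if_false]
  have hupper : (F.replace hb).upper = E.upper := by
    ext s
    constructor
    · rintro ⟨hs, t, ht, hne, he, ho⟩
      rw [hcurve] at he
      exact (hmem s t hs ht hne he).1 ho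
    · intro h
      obtain ⟨hs, t, ht, hne, he⟩ := E.upper_crossing s h
      exact ⟨hs, t, ht, hne, by rw [hcurve]; exact he, (hmem s t hs ht hne he).2 h⟩
  cases E
  simp only [replace, KnotoidDiagram.mk.injEq]
  exact ⟨hcurve, hupper⟩

/-- Two replacements that coincide outside of a disc are related by a local change. -/
theorem localChange_replace {c c' : ℝ → ℂ} (hc : F.Admissible c) (hc' : F.Admissible c')
    {B : Set ℂ} {n : ℕ} {a b : Fin n → ℝ} (hB : IsDisc B)
    (harcs : ∀ i, 0 < a i ∧ a i < b i ∧ b i < 1)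
    (hdisj : ∀ i j, i ≠ j → Disjoint (Icc (a i) (b i)) (Icc (a j) (b j)))
    (hm : MeetsDiscInArcs (F.replace hc) B a b) (hm' : MeetsDiscInArcs (F.replace hc') B a b)
    (heq : ∀ u, |u| < F.radius → (∀ i, F.time u ∉ Ioo (a i) (b i)) → c' u = c u) :
    LocalChange (F.replace hc) (F.replace hc') B a b := by
  have hcurve : ∀ t ∈ Icc (0 : ℝ) 1, (∀ i, t ∉ Ioo (a i) (b i)) →
      F.newCurve c' t = F.newCurve c t := by
    intro t _ hi
    by_cases h : F.InArc t
    · obtain ⟨u, hu, rfl⟩ := h.exists_eq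
      rw [F.newCurve_time hu, F.newCurve_time hu, heq u hu hi]
    · rw [F.newCurve_of_not_inArc hc h, F.newCurve_of_not_inArc hc' h]
  refine ⟨hB, harcs, hdisj, hm, hm', fun t ht hi => ⟨hcurve t ht hi, ?_⟩⟩
  -- If `s` lay in an open arc, the common point would be interior to `B`, and then `t` would lie in
  -- an open arc too. So a time outside the arcs crosses only times outside the arcs.
  have hout : ∀ {d : ℝ → ℂ} (hd : F.Admissible d), MeetsDiscInArcs (F.replace hd) B a b →
      ∀ s ∈ Icc (0 : ℝ) 1, F.newCurve d t = F.newCurve d s → ∀ i, s ∉ Ioo (a i) (b i) := by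
    intro d hd hmd s hs he i hsi
    have h1 : F.newCurve d s ∈ interior B := (hmd.2.1 s hs).2 ⟨i, hsi⟩
    obtain ⟨j, hj⟩ := (hmd.2.1 t ht).1 (by rw [← he] at h1; exact h1)
    exact hi j hj
  constructor
  · rintro ⟨-, s, hs, hne, he, ho⟩
    have hs' := hout hc' hm' s hs he
    rw [hcurve t ht hi, hcurve s hs hs'] at he
    exact ⟨ht, s, hs, hne, he, ho⟩
  · rintro ⟨-, s, hs, hne, he, ho⟩
    have hs' := hout hc hm s hs he
    rw [← hcurve t ht hi, ← hcurve s hs hs'] at he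
    exact ⟨ht, s, hs, hne, he, ho⟩

end StrandFrame

/-! ### Plane curves in coordinates -/

theorem contDiff_complex_mk {E : Type*} [NormedAddCommGroup E] [NormedSpace ℝ E] {f g : E → ℝ}
    (hf : ContDiff ℝ ∞ f) (hg : ContDiff ℝ ∞ g) : ContDiff ℝ ∞ fun e => (⟨f e, g e⟩ : ℂ) :=
  Complex.equivRealProdCLM.symm.contDiff.comp (hf.prodMk hg)

theorem contDiff_re {E : Type*} [NormedAddCommGroup E] [NormedSpace ℝ E] {f : E → ℂ}
    (hf : ContDiff ℝ ∞ f) : ContDiff ℝ ∞ fun e => (f e).re := Complex.reCLM.contDiff.comp hf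

theorem contDiff_im {E : Type*} [NormedAddCommGroup E] [NormedSpace ℝ E] {f : E → ℂ}
    (hf : ContDiff ℝ ∞ f) : ContDiff ℝ ∞ fun e => (f e).im := Complex.imCLM.contDiff.comp hf

theorem hasDerivAt_complex_mk {f g : ℝ → ℝ} {f' g' t : ℝ} (hf : HasDerivAt f f' t)
    (hg : HasDerivAt g g' t) : HasDerivAt (fun t => (⟨f t, g t⟩ : ℂ)) ⟨f', g'⟩ t := by
  have h : HasDerivAt (fun t => (f t : ℂ) + (g t : ℂ) * Complex.I)
      ((f' : ℂ) + (g' : ℂ) * Complex.I) t :=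
    hf.ofReal_comp.add (hg.ofReal_comp.mul_const _)
  simpa only [← Complex.mk_eq_add_mul_I] using h

/-! ### Transition functions -/

/-- A smooth even function that vanishes on `[-a, a]` and equals `1` outside of `[-b, b]`. -/
def ramp (a b u : ℝ) : ℝ := Real.smoothTransition ((u ^ 2 - a ^ 2) / (b ^ 2 - a ^ 2))

section Ramp

variable {a b u : ℝ}

theorem ramp_contDiff (a b : ℝ) : ContDiff ℝ ∞ (ramp a b) :=
  Real.smoothTransition.contDiff.comp (((contDiff_id.pow 2).sub contDiff_const).div_const _)

theorem ramp_neg (a b u : ℝ) : ramp a b (-u) = ramp a b u := by simp [ramp]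

theorem ramp_nonneg (a b u : ℝ) : 0 ≤ ramp a b u := Real.smoothTransition.nonneg _

theorem ramp_le_one (a b u : ℝ) : ramp a b u ≤ 1 := Real.smoothTransition.le_one _

theorem ramp_eq_zero (ha : 0 ≤ a) (hab : a < b) (h : |u| ≤ a) : ramp a b u = 0 := by
  refine Real.smoothTransition.zero_of_nonpos (div_nonpos_of_nonpos_of_nonneg ?_ ?_)
  · rw [← sq_abs u]; nlinarith [abs_nonneg u]
  · nlinarith

theorem ramp_eq_one (ha : 0 ≤ a) (hab : a < b) (h : b ≤ |u|) : ramp a b u = 1 := by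
  refine Real.smoothTransition.one_of_one_le ?_
  rw [← sq_abs u, one_le_div (by nlinarith)]
  nlinarith [abs_nonneg u]

theorem ramp_mono (ha : 0 ≤ a) (hab : a < b) {w : ℝ} (hu : 0 ≤ u) (h : u ≤ w) :
    ramp a b u ≤ ramp a b w := by
  refine Real.smoothTransition.monotone (div_le_div_of_nonneg_right ?_ (by nlinarith))
  nlinarith

end Ramp

/-! ### Boxes -/

/-- The square of the half-height, at abscissa `x`, of a region containing the unit disc that agrees
with it for `|x| ≤ 1 / 2`. -/
def boxProfile (x : ℝ) : ℝ := 1 - x ^ 2 * (1 - ramp (1 / 2) (3 / 4) x)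

theorem boxProfile_pos (x : ℝ) : 0 < boxProfile x := by
  unfold boxProfile
  rcases le_or_gt (3 / 4) |x| with h | h
  · rw [ramp_eq_one (by norm_num) (by norm_num) h]; norm_num
  · have h1 := ramp_nonneg (1 / 2) (3 / 4) x
    have h2 := ramp_le_one (1 / 2) (3 / 4) x
    have h3 : x ^ 2 < 1 := by rw [← sq_abs]; nlinarith [abs_nonneg x]
    nlinarith [sq_nonneg x]

theorem boxProfile_contDiff : ContDiff ℝ ∞ boxProfile :=
  contDiff_const.sub ((contDiff_id.pow 2).mul (contDiff_const.sub (ramp_contDiff _ _)))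

theorem le_boxProfile (x : ℝ) : 1 - x ^ 2 ≤ boxProfile x := by
  unfold boxProfile
  nlinarith [ramp_nonneg (1 / 2) (3 / 4) x, sq_nonneg x]

theorem boxProfile_eq {x : ℝ} (h : |x| ≤ 1 / 2) : boxProfile x = 1 - x ^ 2 := by
  rw [boxProfile, ramp_eq_zero (by norm_num) (by norm_num) h]; ring

/-- A diffeomorphism that carries the unit disc to a region whose middle part is a rectangle. -/
def boxDiffeo (M h y₀ : ℝ) (hM : M ≠ 0) (hh : h ≠ 0) : PlaneDiffeo :=
  PlaneDiffeo.mk (fun z => ⟨M * z.re, y₀ + h * (z.im * (√(boxProfile z.re))⁻¹)⟩)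
    (fun z => ⟨M⁻¹ * z.re, h⁻¹ * (z.im - y₀) * √(boxProfile (M⁻¹ * z.re))⟩)
    (contDiff_complex_mk (contDiff_const.mul (contDiff_re contDiff_id))
      (contDiff_const.add (contDiff_const.mul ((contDiff_im contDiff_id).mul
        (((boxProfile_contDiff.comp (contDiff_re contDiff_id)).sqrt
          fun z => (boxProfile_pos _).ne').inv
            fun z => (Real.sqrt_pos.2 (boxProfile_pos _)).ne')))))
    (contDiff_complex_mk (contDiff_const.mul (contDiff_re contDiff_id))
      ((contDiff_const.mul ((contDiff_im contDiff_id).sub contDiff_const)).mul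
        ((boxProfile_contDiff.comp (contDiff_const.mul (contDiff_re contDiff_id))).sqrt
          fun z => (boxProfile_pos _).ne')))
    (fun z => by
      have := (Real.sqrt_pos.2 (boxProfile_pos z.re)).ne'
      apply Complex.ext
      · simp [hM]
      · simp only [inv_mul_cancel_left₀ hM]
        field_simp
        ring)
    (fun z => by
      have := (Real.sqrt_pos.2 (boxProfile_pos (M⁻¹ * z.re))).ne'
      apply Complex.ext
      · simp [hM]
      · simp only
        rw [mul_inv_cancel_right₀ this, mul_inv_cancel_left₀ hh]
        ring)

/-- Dividing the ordinate by the square root of the profile flattens the top and bottom of the unit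
disc for abscissae up to `1 / 2`. In the middle half of the box, membership therefore depends on the
height alone; `le_boxProfile` keeps the rest within the strip. -/
theorem exists_box {M y₁ y₂ : ℝ} (hM : 0 < M) (hy : y₁ < y₂) : ∃ B : Set ℂ, IsDisc B ∧
    (∀ z ∈ B, |z.re| ≤ M ∧ y₁ ≤ z.im ∧ z.im ≤ y₂) ∧
    ∀ z : ℂ, |z.re| ≤ M / 2 → (z ∈ B ↔ y₁ ≤ z.im ∧ z.im ≤ y₂) ∧
      (z ∈ interior B ↔ y₁ < z.im ∧ z.im < y₂) := by
  set h := (y₂ - y₁) / 2 with hh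
  set y₀ := (y₁ + y₂) / 2 with hy₀
  have hpos : 0 < h := by rw [hh]; linarith
  set G := boxDiffeo M h y₀ hM.ne' hpos.ne' with hG
  have hnsq : ∀ z : ℂ, ‖z‖ ^ 2 = z.re ^ 2 + z.im ^ 2 := fun z => by
    rw [← Complex.normSq_eq_norm_sq, Complex.normSq_apply]; ring
  have hGre : ∀ z, (G z).re = M * z.re := fun z => rfl
  have hGim : ∀ z, (G z).im = y₀ + h * (z.im * (√(boxProfile z.re))⁻¹) := fun z => rfl
  have hsq : ∀ z : ℂ, (z.im * (√(boxProfile z.re))⁻¹) ^ 2 = z.im ^ 2 / boxProfile z.re := fun z => by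
    rw [mul_pow, inv_pow, Real.sq_sqrt (boxProfile_pos _).le]; rfl
  have hle : ∀ s : ℝ, (y₁ ≤ y₀ + h * s ∧ y₀ + h * s ≤ y₂) ↔ s ^ 2 ≤ 1 := fun s => by
    rw [sq_le_one_iff_abs_le_one, abs_le, ← mul_le_mul_iff_right₀ hpos (b := -1),
      ← mul_le_mul_iff_right₀ hpos (c := 1), hh, hy₀]
    constructor <;> rintro ⟨h1, h2⟩ <;> constructor <;> linarith
  have hlt : ∀ s : ℝ, (y₁ < y₀ + h * s ∧ y₀ + h * s < y₂) ↔ s ^ 2 < 1 := fun s => by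
    rw [sq_lt_one_iff_abs_lt_one, abs_lt, ← mul_lt_mul_iff_right₀ hpos (b := -1),
      ← mul_lt_mul_iff_right₀ hpos (c := 1), hh, hy₀]
    constructor <;> rintro ⟨h1, h2⟩ <;> constructor <;> linarith
  have hin : interior (G '' Metric.closedBall 0 1) = G '' Metric.ball 0 1 := by
    rw [G.interior_image, interior_closedBall _ one_ne_zero]
  refine ⟨G '' Metric.closedBall 0 1, ⟨G, rfl⟩, ?_, ?_⟩
  · rintro _ ⟨z, hz, rfl⟩
    rw [mem_closedBall_zero_iff] at hz
    have h1 : z.re ^ 2 + z.im ^ 2 ≤ 1 := by rw [← hnsq]; nlinarith [norm_nonneg z]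
    rw [hGre, hGim, hle, hsq, div_le_one (boxProfile_pos _), abs_mul, abs_of_pos hM]
    refine ⟨?_, by linarith [le_boxProfile z.re]⟩
    have : |z.re| ≤ 1 := (Complex.abs_re_le_norm z).trans hz
    nlinarith
  · intro z hz
    obtain ⟨w, hw⟩ : ∃ w, G w = z := G.surjective z
    subst hw
    rw [hin, G.inj.mem_set_image, G.inj.mem_set_image, hGim, hle, hlt, hsq,
      mem_closedBall_zero_iff, mem_ball_zero_iff]
    rw [hGre, abs_mul, abs_of_pos hM] at hz
    have hz' : |w.re| ≤ 1 / 2 := by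
      by_contra hc
      nlinarith
    rw [div_le_one (boxProfile_pos _), div_lt_one (boxProfile_pos _), boxProfile_eq hz',
      ← abs_of_nonneg (norm_nonneg w), ← sq_le_one_iff_abs_le_one, ← sq_lt_one_iff_abs_lt_one,
      hnsq]
    constructor <;> constructor <;> intro h <;> linarith

/-! ### Profiles of kinks -/

/-- A function `k` for which the curve `u ↦ (u * k u, -u²)` has finitely many transversal double
points and is a parabola for large `|u|`. -/
structure IsKinkProfile (k : ℝ → ℝ) : Prop where
  smooth : ContDiff ℝ ∞ k
  even : ∀ u, k (-u) = k u
  abs_le : ∀ u, |k u| ≤ 1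
  eq_one : ∀ u, 7 / 5 ≤ |u| → k u = 1
  zero_ne : k 0 ≠ 0
  deriv_ne : ∀ u, k u = 0 → deriv k u ≠ 0

/-- The profile of a single kink. -/
def kinkProfile (u : ℝ) : ℝ := 1 - (2 - u ^ 2) * (1 - ramp (6 / 5) (7 / 5) u)

/-- The quartic that describes a kink inside of a kink. -/
def kinkQuartic (u : ℝ) : ℝ := (u ^ 2 - 1) * (4 * u ^ 2 - 1)

/-- The profile of a kink inside of a kink. -/
def doubleKinkProfile (u : ℝ) : ℝ :=
  1 + ramp (3 / 10) (2 / 5) u * (kinkQuartic u - 1) +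
    ramp (4 / 5) (9 / 10) u * (kinkProfile u - kinkQuartic u)

theorem kinkProfile_contDiff : ContDiff ℝ ∞ kinkProfile :=
  contDiff_const.sub ((contDiff_const.sub (contDiff_id.pow 2)).mul
    (contDiff_const.sub (ramp_contDiff _ _)))

theorem kinkQuartic_contDiff : ContDiff ℝ ∞ kinkQuartic :=
  ((contDiff_id.pow 2).sub contDiff_const).mul
    ((contDiff_const.mul (contDiff_id.pow 2)).sub contDiff_const)

theorem doubleKinkProfile_contDiff : ContDiff ℝ ∞ doubleKinkProfile :=
  (contDiff_const.add ((ramp_contDiff _ _).mul (kinkQuartic_contDiff.sub contDiff_const))).add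
    ((ramp_contDiff _ _).mul (kinkProfile_contDiff.sub kinkQuartic_contDiff))

theorem kinkProfile_neg (u : ℝ) : kinkProfile (-u) = kinkProfile u := by
  simp [kinkProfile, ramp_neg]

/-- On this part the curve is `(u³ - u, -u²)`, a loop that closes up at `u = ±1`. -/
theorem kinkProfile_inner {u : ℝ} (h : |u| ≤ 6 / 5) : kinkProfile u = u ^ 2 - 1 := by
  rw [kinkProfile, ramp_eq_zero (by norm_num) (by norm_num) h]; ring

theorem kinkProfile_outer {u : ℝ} (h : 7 / 5 ≤ |u|) : kinkProfile u = 1 := by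
  rw [kinkProfile, ramp_eq_one (by norm_num) (by norm_num) h]; ring

theorem kinkProfile_between {u : ℝ} (h : 6 / 5 < |u|) (h' : |u| < 7 / 5) :
    2 / 5 < kinkProfile u ∧ kinkProfile u ≤ 1 := by
  have h1 := ramp_nonneg (6 / 5) (7 / 5) u
  have h2 := ramp_le_one (6 / 5) (7 / 5) u
  have h3 : u ^ 2 ≤ 49 / 25 := by rw [← sq_abs]; nlinarith
  have h4 : 36 / 25 ≤ u ^ 2 := by rw [← sq_abs]; nlinarith
  unfold kinkProfile
  constructor <;> nlinarith

theorem kinkProfile_eq_zero {u : ℝ} (h : kinkProfile u = 0) : u = 1 ∨ u = -1 := by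
  rcases le_or_gt |u| (6 / 5) with h1 | h1
  · rw [kinkProfile_inner h1] at h
    exact sq_eq_one_iff.1 (by linarith)
  · rcases lt_or_ge |u| (7 / 5) with h2 | h2
    · linarith [(kinkProfile_between h1 h2).1]
    · rw [kinkProfile_outer h2] at h; norm_num at h

theorem abs_kinkProfile_le (u : ℝ) : |kinkProfile u| ≤ 1 := by
  rcases le_or_gt |u| (6 / 5) with h1 | h1
  · rw [kinkProfile_inner h1, abs_le]
    have : u ^ 2 ≤ 36 / 25 := by rw [← sq_abs]; nlinarith [abs_nonneg u]
    constructor <;> nlinarith [sq_nonneg u]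
  · rcases lt_or_ge |u| (7 / 5) with h2 | h2
    · have := kinkProfile_between h1 h2
      rw [abs_le]; constructor <;> linarith
    · rw [kinkProfile_outer h2, abs_one]

theorem deriv_kinkProfile {u : ℝ} (h : |u| < 6 / 5) : deriv kinkProfile u = 2 * u := by
  have h1 : HasDerivAt (fun u : ℝ => u ^ 2 - 1) (2 * u) u := by
    simpa using (hasDerivAt_pow 2 u).sub_const 1
  refine (h1.congr_of_eventuallyEq ?_).deriv
  filter_upwards [continuous_abs.continuousAt.eventually_lt continuousAt_const h] with w hw
  exact kinkProfile_inner hw.le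

theorem isKinkProfile_kinkProfile : IsKinkProfile kinkProfile where
  smooth := kinkProfile_contDiff
  even := kinkProfile_neg
  abs_le := abs_kinkProfile_le
  eq_one _ := kinkProfile_outer
  zero_ne := by rw [kinkProfile_inner (by norm_num)]; norm_num
  deriv_ne u h := by
    rcases kinkProfile_eq_zero h with rfl | rfl
    · rw [deriv_kinkProfile (by norm_num)]; norm_num
    · rw [deriv_kinkProfile (by norm_num)]; norm_num

theorem isKinkProfile_one : IsKinkProfile (fun _ => 1) where
  smooth := contDiff_const
  even _ := rfl
  abs_le _ := by simp
  eq_one _ _ := rfl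
  zero_ne := one_ne_zero
  deriv_ne _ h := absurd h one_ne_zero

theorem doubleKinkProfile_inner {u : ℝ} (h : |u| ≤ 3 / 10) : doubleKinkProfile u = 1 := by
  rw [doubleKinkProfile, ramp_eq_zero (by norm_num) (by norm_num) h,
    ramp_eq_zero (by norm_num) (by norm_num) (h.trans (by norm_num))]
  ring

theorem doubleKinkProfile_middle {u : ℝ} (h : 2 / 5 ≤ |u|) (h' : |u| ≤ 4 / 5) :
    doubleKinkProfile u = kinkQuartic u := by
  rw [doubleKinkProfile, ramp_eq_one (by norm_num) (by norm_num) h,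
    ramp_eq_zero (by norm_num) (by norm_num) h']
  ring

theorem doubleKinkProfile_outer {u : ℝ} (h : 9 / 10 ≤ |u|) :
    doubleKinkProfile u = kinkProfile u := by
  rw [doubleKinkProfile, ramp_eq_one (by norm_num) (by norm_num) h,
    ramp_eq_one (by norm_num) (by norm_num) (le_trans (by norm_num) h)]
  ring

theorem doubleKinkProfile_first {u : ℝ} (h : 3 / 10 < |u|) (h' : |u| < 2 / 5) :
    0 < doubleKinkProfile u ∧ doubleKinkProfile u ≤ 1 := by
  have h1 := ramp_nonneg (3 / 10) (2 / 5) u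
  have h2 := ramp_le_one (3 / 10) (2 / 5) u
  have h3 : u ^ 2 ≤ 4 / 25 := by rw [← sq_abs]; nlinarith
  have h4 := sq_nonneg u
  rw [doubleKinkProfile, ramp_eq_zero (a := 4 / 5) (by norm_num) (by norm_num)
    (h'.le.trans (by norm_num)), zero_mul, add_zero, kinkQuartic]
  have h5 : 3 / 10 ≤ (u ^ 2 - 1) * (4 * u ^ 2 - 1) := by nlinarith
  have h6 : (u ^ 2 - 1) * (4 * u ^ 2 - 1) ≤ 1 := by nlinarith
  constructor <;> nlinarith

theorem doubleKinkProfile_last {u : ℝ} (h : 4 / 5 < |u|) (h' : |u| < 9 / 10) :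
    doubleKinkProfile u < 0 ∧ -1 ≤ doubleKinkProfile u := by
  have h1 := ramp_nonneg (4 / 5) (9 / 10) u
  have h2 := ramp_le_one (4 / 5) (9 / 10) u
  have h3 : u ^ 2 ≤ 81 / 100 := by rw [← sq_abs]; nlinarith
  have h4 : 16 / 25 ≤ u ^ 2 := by rw [← sq_abs]; nlinarith
  rw [doubleKinkProfile, ramp_eq_one (a := 3 / 10) (by norm_num) (by norm_num)
    (le_trans (by norm_num) h.le), kinkProfile_inner (h'.le.trans (by norm_num)), kinkQuartic]
  have h5 : -1 ≤ (u ^ 2 - 1) * (4 * u ^ 2 - 1) := by nlinarith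
  have h6 : (u ^ 2 - 1) * (4 * u ^ 2 - 1) < -1 / 10 := by nlinarith
  constructor <;> nlinarith

/-- The profile is positive near `0`, follows the quartic through its zeros `±1 / 2`, stays negative
until it meets the single kink, and then has the zeros `±1`. It decreases at `1 / 2` and increases
at `1`, so the two crossings have opposite signs. -/
theorem doubleKinkProfile_eq_zero {u : ℝ} (h : doubleKinkProfile u = 0) :
    (u = 1 ∨ u = -1) ∨ u = 1 / 2 ∨ u = -1 / 2 := by
  rcases le_or_gt |u| (3 / 10) with h1 | h1
  · rw [doubleKinkProfile_inner h1] at h; norm_num at h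
  rcases lt_or_ge |u| (2 / 5) with h2 | h2
  · linarith [(doubleKinkProfile_first h1 h2).1]
  rcases le_or_gt |u| (4 / 5) with h3 | h3
  · right
    rw [doubleKinkProfile_middle h2 h3, kinkQuartic] at h
    have h4 : u ^ 2 - 1 ≠ 0 := by
      have : u ^ 2 ≤ 16 / 25 := by rw [← sq_abs]; nlinarith
      linarith
    have h5 : (u - 1 / 2) * (u - -1 / 2) = 0 := by
      linear_combination (1 / 4) * (mul_eq_zero.1 h).resolve_left h4
    rcases mul_eq_zero.1 h5 with h5 | h5
    · exact .inl (sub_eq_zero.1 h5)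
    · exact .inr (sub_eq_zero.1 h5)
  rcases lt_or_ge |u| (9 / 10) with h4 | h4
  · linarith [(doubleKinkProfile_last h3 h4).1]
  · rw [doubleKinkProfile_outer h4] at h
    exact .inl (kinkProfile_eq_zero h)

theorem deriv_doubleKinkProfile_outer {u : ℝ} (h : 9 / 10 < |u|) :
    deriv doubleKinkProfile u = deriv kinkProfile u := by
  refine Filter.EventuallyEq.deriv_eq ?_
  filter_upwards [continuousAt_const.eventually_lt continuous_abs.continuousAt h] with w hw
  exact doubleKinkProfile_outer hw.le

theorem deriv_doubleKinkProfile_middle {u : ℝ} (h : 2 / 5 < |u|) (h' : |u| < 4 / 5) :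
    deriv doubleKinkProfile u = 2 * u * (8 * u ^ 2 - 5) := by
  have h1 : HasDerivAt (fun u : ℝ => (u ^ 2 - 1) * (4 * u ^ 2 - 1))
      (2 * u * (8 * u ^ 2 - 5)) u := by
    have h2 : HasDerivAt (fun u : ℝ => u ^ 2) (2 * u) u := by simpa using hasDerivAt_pow 2 u
    have h3 := (h2.sub_const 1).fun_mul ((h2.const_mul 4).sub_const 1)
    rwa [show 2 * u * (4 * u ^ 2 - 1) + (u ^ 2 - 1) * (4 * (2 * u)) = 2 * u * (8 * u ^ 2 - 5) by
      ring] at h3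
  refine (h1.congr_of_eventuallyEq ?_).deriv
  filter_upwards [continuous_abs.continuousAt.eventually_lt continuousAt_const h',
    continuousAt_const.eventually_lt continuous_abs.continuousAt h] with w hw hw'
  exact doubleKinkProfile_middle hw'.le hw.le

theorem isKinkProfile_doubleKinkProfile : IsKinkProfile doubleKinkProfile where
  smooth := doubleKinkProfile_contDiff
  even u := by simp [doubleKinkProfile, ramp_neg, kinkProfile_neg, kinkQuartic]
  abs_le u := by
    rcases le_or_gt |u| (3 / 10) with h1 | h1
    · rw [doubleKinkProfile_inner h1, abs_one]
    rcases lt_or_ge |u| (2 / 5) with h2 | h2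
    · have := doubleKinkProfile_first h1 h2
      rw [abs_le]; constructor <;> linarith
    rcases le_or_gt |u| (4 / 5) with h3 | h3
    · rw [doubleKinkProfile_middle h2 h3, kinkQuartic, abs_le]
      have h4 : u ^ 2 ≤ 16 / 25 := by rw [← sq_abs]; nlinarith
      have h5 := sq_nonneg u
      -- As a polynomial in `u²` the quartic has its minimum `-9 / 16` at `5 / 8`.
      constructor <;> nlinarith [sq_nonneg (u ^ 2 - 5 / 8)]
    rcases lt_or_ge |u| (9 / 10) with h4 | h4
    · have := doubleKinkProfile_last h3 h4
      rw [abs_le]; constructor <;> linarith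
    · rw [doubleKinkProfile_outer h4]
      exact abs_kinkProfile_le u
  eq_one u h := by
    rw [doubleKinkProfile_outer (le_trans (by norm_num) h), kinkProfile_outer h]
  zero_ne := by rw [doubleKinkProfile_inner (by norm_num)]; norm_num
  deriv_ne u h := by
    rcases doubleKinkProfile_eq_zero h with h1 | rfl | rfl
    · have h2 : |u| = 1 := by rcases h1 with rfl | rfl <;> norm_num
      have h3 : kinkProfile u = 0 := by
        rw [← doubleKinkProfile_outer (by rw [h2]; norm_num), h]
      rw [deriv_doubleKinkProfile_outer (by rw [h2]; norm_num)]
      exact isKinkProfile_kinkProfile.deriv_ne u h3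
    · rw [deriv_doubleKinkProfile_middle (by norm_num [abs_of_pos]) (by norm_num [abs_of_pos])]
      norm_num
    · rw [deriv_doubleKinkProfile_middle (by norm_num [abs_div]) (by norm_num [abs_div])]
      norm_num

/-! ### Kinks on a single strand -/

/-- The curve with profile `k`. -/
def profileCurve (k : ℝ → ℝ) (u : ℝ) : ℂ := ⟨u * k u, -u ^ 2⟩

namespace IsKinkProfile

variable {k : ℝ → ℝ} (hk : IsKinkProfile k)
include hk

theorem profileCurve_contDiff : ContDiff ℝ ∞ (profileCurve k) :=
  contDiff_complex_mk (contDiff_id.mul hk.smooth) (contDiff_id.pow 2).neg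

theorem deriv_profileCurve (u : ℝ) : deriv (profileCurve k) u = ⟨k u + u * deriv k u, -(2 * u)⟩ := by
  have h1 : HasDerivAt (fun u => u * k u) (k u + u * deriv k u) u := by
    simpa using (hasDerivAt_id u).fun_mul ((hk.smooth.differentiable (by simp)) u).hasDerivAt
  have h2 : HasDerivAt (fun u : ℝ => -u ^ 2) (-(2 * u)) u := by
    simpa using (hasDerivAt_pow 2 u).fun_neg
  exact (hasDerivAt_complex_mk h1 h2).deriv

/-- Equal ordinates `-u²` force `w = -u`; since `k` is even the abscissa is odd, so it must vanish.
-/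
theorem eq_neg_of_eq {u w : ℝ} (hne : u ≠ w) (h : profileCurve k u = profileCurve k w) :
    w = -u ∧ k u = 0 := by
  have h1 : u * k u = w * k w := congrArg Complex.re h
  have h2 : -u ^ 2 = -w ^ 2 := congrArg Complex.im h
  have h3 : w = -u := by
    rcases sq_eq_sq_iff_eq_or_eq_neg.1 (neg_injective h2) with h | h
    · exact absurd h hne
    · linarith
  refine ⟨h3, ?_⟩
  have hu : u ≠ 0 := fun h0 => hne (by rw [h3, h0, neg_zero])
  rw [h3, hk.even] at h1
  have : u * k u = 0 := by linarith
  exact (mul_eq_zero.1 this).resolve_left hu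

/-- At a zero of `k` this is `4 * u² * deriv k u`, so the sign of the crossing is the sign of `deriv
k u`. -/
theorem planeDet_deriv (u : ℝ) : planeDet (deriv (profileCurve k) u) (deriv (profileCurve k) (-u)) =
    4 * u * (k u + u * deriv k u) := by
  have hodd : deriv k (-u) = -deriv k u := by
    have h1 : deriv (fun x => k (-x)) u = -deriv k (-u) := deriv_comp_neg k u
    rw [show (fun x => k (-x)) = k from funext hk.even] at h1
    linarith
  rw [hk.deriv_profileCurve, hk.deriv_profileCurve, hodd, hk.even]
  simp only [planeDet]
  ring

theorem abs_lt_of_eq_zero {u : ℝ} (h : k u = 0) : |u| < 7 / 5 := by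
  by_contra hc
  rw [hk.eq_one u (not_lt.1 hc)] at h
  exact one_ne_zero h

/-- The quantity is the squared norm after straightening the parabola `y = -x²` by a shear. On the
outer part it equals `u²`; on the inner part, where `|u| < 7 / 5`, it is at most `6`. So the curve
stays in the region that contains no other strand. -/
theorem profileCurve_bound {u : ℝ} (hu : |u| < 30) :
    (profileCurve k u).re ^ 2 + ((profileCurve k u).im + (profileCurve k u).re ^ 2) ^ 2 < 900 := by
  have hsq : u ^ 2 < 900 := by rw [← sq_abs]; nlinarith [abs_nonneg u]
  simp only [profileCurve]
  rcases le_or_gt (7 / 5) |u| with h | h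
  · rw [hk.eq_one u h]
    nlinarith
  · have h1 : u ^ 2 < 2 := by rw [← sq_abs]; nlinarith [abs_nonneg u]
    have h2 : k u ^ 2 ≤ 1 := (sq_le_one_iff_abs_le_one _).2 (hk.abs_le u)
    have h3 : 0 ≤ u ^ 2 := sq_nonneg u
    have h4 : 0 ≤ k u ^ 2 := sq_nonneg _
    have h5 : (u * k u) ^ 2 ≤ 2 := by rw [mul_pow]; nlinarith
    have h6 := sq_nonneg (u * k u)
    have h7 : |-u ^ 2 + (u * k u) ^ 2| ≤ 2 := _root_.abs_le.2 ⟨by linarith, by linarith⟩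
    have h8 : (-u ^ 2 + (u * k u) ^ 2) ^ 2 ≤ 4 := by rw [← sq_abs]; nlinarith [abs_nonneg (-u ^ 2 + (u * k u) ^ 2)]
    linarith

/-- How the curve meets a box. -/
theorem profileCurve_mem_box {y₁ y₂ : ℝ} {B : Set ℂ} (hy : -4 ≤ y₁)
    (hB₁ : ∀ z ∈ B, |z.re| ≤ 4 ∧ y₁ ≤ z.im ∧ z.im ≤ y₂)
    (hB₂ : ∀ z : ℂ, |z.re| ≤ 4 / 2 → (z ∈ B ↔ y₁ ≤ z.im ∧ z.im ≤ y₂) ∧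
      (z ∈ interior B ↔ y₁ < z.im ∧ z.im < y₂)) (u : ℝ) :
    (profileCurve k u ∈ B ↔ y₁ ≤ -u ^ 2 ∧ -u ^ 2 ≤ y₂) ∧
      (profileCurve k u ∈ interior B ↔ y₁ < -u ^ 2 ∧ -u ^ 2 < y₂) := by
  rcases le_or_gt |u| 2 with h | h
  · refine hB₂ _ ?_
    rw [profileCurve, abs_mul]
    have := hk.abs_le u
    nlinarith [abs_nonneg u, abs_nonneg (k u)]
  · have h1 : 4 < u ^ 2 := by rw [← sq_abs]; nlinarith
    have h2 : profileCurve k u ∉ B := fun hm => by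
      have := (hB₁ _ hm).2.1
      simp only [profileCurve] at this
      linarith
    exact ⟨iff_of_false h2 fun h => by linarith [h.1],
      iff_of_false (fun h => h2 (interior_subset h)) fun h => by linarith [h.1]⟩

end IsKinkProfile

/-- Frames around an arc that lies on the standard parabola in an otherwise empty region. -/
structure StrandFrame.IsSingle {E : KnotoidDiagram} (F : StrandFrame E) : Prop where
  base_eq : F.base = profileCurve fun _ => 1
  core_eq : F.core = 2
  radius_eq : F.radius = 30
  rest : ∀ t ∈ Icc (0 : ℝ) 1, ¬ F.InArc t →
    900 ≤ (E.curve t).re ^ 2 + ((E.curve t).im + (E.curve t).re ^ 2) ^ 2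

namespace StrandFrame.IsSingle

variable {E : KnotoidDiagram} {F : StrandFrame E} (hF : F.IsSingle) {k : ℝ → ℝ}
  (hk : IsKinkProfile k)

include hF

include hk in
theorem ne_of_not_inArc {u t : ℝ} (hu : |u| < F.radius) (ht : t ∈ Icc (0 : ℝ) 1)
    (hn : ¬ F.InArc t) : profileCurve k u ≠ E.curve t := fun h => by
  have h1 := hk.profileCurve_bound (hF.radius_eq ▸ hu)
  rw [h] at h1
  linarith [hF.rest t ht hn]

/-- In such a box `x² ≤ 16` and `|y + x²| ≤ 19`, so the squared sheared norm is far below `900`. -/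
theorem notMem_box {y₁ y₂ : ℝ} {B : Set ℂ} (hy : -4 ≤ y₁) (hy' : y₂ ≤ 3)
    (hB₁ : ∀ z ∈ B, |z.re| ≤ 4 ∧ y₁ ≤ z.im ∧ z.im ≤ y₂) {t : ℝ} (ht : t ∈ Icc (0 : ℝ) 1)
    (hn : ¬ F.InArc t) : E.curve t ∉ B := fun h => by
  obtain ⟨h1, h2, h3⟩ := hB₁ _ h
  have h4 := hF.rest t ht hn
  have h5 : (E.curve t).re ^ 2 ≤ 16 := by rw [← sq_abs]; nlinarith [abs_nonneg (E.curve t).re]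
  have h6 := sq_nonneg (E.curve t).re
  nlinarith

include hk in
theorem admissible : F.Admissible (profileCurve k) where
  smooth := hk.profileCurve_contDiff
  eq_base u h := by
    rw [hF.base_eq, profileCurve, profileCurve, hk.eq_one u]
    rw [hF.core_eq] at h
    linarith
  immersion u _ h := by
    rw [hk.deriv_profileCurve] at h
    have h1 : -(2 * u) = 0 := congrArg Complex.im h
    have h2 : k u + u * deriv k u = 0 := congrArg Complex.re h
    have h3 : u = 0 := by linarith
    rw [h3, zero_mul, add_zero] at h2
    exact hk.zero_ne h2
  no_triple u w x _ _ _ h1 h2 := by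
    by_contra! hne
    have e1 := (hk.eq_neg_of_eq hne.1 h1).1
    have e2 := (hk.eq_neg_of_eq hne.2.1 h2).1
    exact hne.2.2 (by rw [e2, e1, neg_neg])
  transversal u w _ _ hne h := by
    obtain ⟨rfl, h0⟩ := hk.eq_neg_of_eq hne h
    have hu : u ≠ 0 := fun h => hne (by rw [h, neg_zero])
    rw [hk.planeDet_deriv, h0, zero_add]
    exact mul_ne_zero (mul_ne_zero four_ne_zero hu) (mul_ne_zero hu (hk.deriv_ne u h0))
  rest u t hu ht hn h := absurd h (hF.ne_of_not_inArc hk hu ht hn)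

include hk in
-- Double points occur only at opposite parameters. The condition `0 < F.order * u` selects the one
-- on the upper strand, which is listed first.
theorem mem_crossingsIn {B : Set ℂ} (hB : ∀ t ∈ Icc (0 : ℝ) 1, ¬ F.InArc t → E.curve t ∉ B)
    {p : ℝ × ℝ} : p ∈ (F.replace (hF.admissible hk)).crossingsIn B ↔
      ∃ u, p = (F.time u, F.time (-u)) ∧ k u = 0 ∧ 0 < F.order * u ∧ profileCurve k u ∈ B := by
  constructor
  · rintro ⟨hp, hpB⟩
    obtain ⟨h1, h2, h3, h4, h5⟩ := (F.mem_crossings_replace _).1 hp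
    have i1 : F.InArc p.1 := by
      by_contra hn
      have : F.newCurve (profileCurve k) p.1 ∈ B := hpB
      rw [F.newCurve_of_not_inArc (hF.admissible hk) hn] at this
      exact hB _ h1 hn this
    have i2 : F.InArc p.2 := by
      by_contra hn
      have : F.newCurve (profileCurve k) p.1 ∈ B := hpB
      rw [h4, F.newCurve_of_not_inArc (hF.admissible hk) hn] at this
      exact hB _ h2 hn this
    obtain ⟨u, hu, e1⟩ := i1.exists_eq
    obtain ⟨w, hw, e2⟩ := i2.exists_eq
    have hpB' : F.newCurve (profileCurve k) p.1 ∈ B := hpB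
    simp only [Over, i1, i2, if_true] at h5
    rw [e1, F.newCurve_time hu] at hpB'
    rw [e1, e2, F.newCurve_time hu, F.newCurve_time hw] at h4
    obtain ⟨h6, h7⟩ := hk.eq_neg_of_eq (fun h => h3 (by rw [e1, e2, h])) h4
    refine ⟨u, by rw [← h6, ← e1, ← e2], h7, ?_, hpB'⟩
    rw [e1, e2, h6, time, time, show F.center + u / F.scale - (F.center + -u / F.scale) =
      2 / F.scale * u by ring, mul_left_comm] at h5
    exact (mul_pos_iff_of_pos_left (div_pos two_pos F.scale_pos)).1 h5
  · rintro ⟨u, rfl, h0, hu, hB'⟩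
    have hlt : |u| < F.radius := by
      rw [hF.radius_eq]; linarith [hk.abs_lt_of_eq_zero h0]
    have hlt' : |-u| < F.radius := by rwa [abs_neg]
    have hne : u ≠ 0 := fun h => by rw [h, mul_zero] at hu; exact hu.false
    refine ⟨(F.mem_crossings_replace _).2 ⟨Ioo_subset_Icc_self (F.arc u hlt).1,
      Ioo_subset_Icc_self (F.arc _ hlt').1, ?_, ?_, ?_⟩, ?_⟩
    · rw [Ne, F.time_inj]; intro h; exact hne (by linarith)
    · rw [F.newCurve_time hlt, F.newCurve_time hlt', profileCurve, profileCurve, hk.even, h0,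
        neg_sq, mul_zero, mul_zero]
    · simp only [Over, F.inArc_time.2 hlt, F.inArc_time.2 hlt', if_true]
      rw [time, time, show F.center + u / F.scale - (F.center + -u / F.scale) =
        2 / F.scale * u by ring, mul_left_comm]
      exact mul_pos (div_pos two_pos F.scale_pos) hu
    · change F.newCurve (profileCurve k) (F.time u) ∈ B
      rwa [F.newCurve_time hlt]

include hk in
theorem crossingSign_eq {u : ℝ} (h0 : k u = 0) (hu : u ≠ 0) :
    (F.replace (hF.admissible hk)).crossingSign (F.time u, F.time (-u)) =
      (SignType.sign (deriv k u) : ℤ) := by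
  have hlt : |u| < F.radius := by
    rw [hF.radius_eq]; linarith [hk.abs_lt_of_eq_zero h0]
  have hlt' : |-u| < F.radius := by rwa [abs_neg]
  rw [KnotoidDiagram.crossingSign, replace_curve,
    F.deriv_newCurve_time (hF.admissible hk) hlt, F.deriv_newCurve_time (hF.admissible hk) hlt',
    planeDet_smul_left, planeDet_smul_right, hk.planeDet_deriv, h0,
    zero_add, show F.scale * (F.scale * (4 * u * (u * deriv k u))) =
      (4 * (F.scale * u) ^ 2) * deriv k u by ring, sign_mul,
    sign_pos (by have := F.scale_pos; positivity), one_mul]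

/-- Local changes between curves with different profiles. -/
theorem localChange {k' : ℝ → ℝ} (hk : IsKinkProfile k) (hk' : IsKinkProfile k') {y₁ y₂ : ℝ}
    {B : Set ℂ} (hy : -4 ≤ y₁) (hy' : y₂ ≤ 3) (hB : IsDisc B)
    (hB₁ : ∀ z ∈ B, |z.re| ≤ 4 ∧ y₁ ≤ z.im ∧ z.im ≤ y₂)
    (hB₂ : ∀ z : ℂ, |z.re| ≤ 4 / 2 → (z ∈ B ↔ y₁ ≤ z.im ∧ z.im ≤ y₂) ∧
      (z ∈ interior B ↔ y₁ < z.im ∧ z.im < y₂)) {n : ℕ} (α β : Fin n → ℝ)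
    (hα : ∀ i, -2 ≤ α i) (hαβ : ∀ i, α i < β i) (hβ : ∀ i, β i ≤ 2)
    (hdisj : ∀ i j, i ≠ j → β i < α j ∨ β j < α i)
    (hcl : ∀ u, (y₁ ≤ -u ^ 2 ∧ -u ^ 2 ≤ y₂) ↔ ∃ i, u ∈ Icc (α i) (β i))
    (hop : ∀ u, (y₁ < -u ^ 2 ∧ -u ^ 2 < y₂) ↔ ∃ i, u ∈ Ioo (α i) (β i))
    (hcr : ∀ u, k u = 0 → y₁ ≤ -u ^ 2 ∧ -u ^ 2 ≤ y₂ → y₁ < -u ^ 2 ∧ -u ^ 2 < y₂)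
    (hcr' : ∀ u, k' u = 0 → y₁ ≤ -u ^ 2 ∧ -u ^ 2 ≤ y₂ → y₁ < -u ^ 2 ∧ -u ^ 2 < y₂)
    (heq : ∀ u, (∀ i, u ∉ Ioo (α i) (β i)) → k' u = k u) :
    LocalChange (F.replace (hF.admissible hk)) (F.replace (hF.admissible hk')) B
      (fun i => F.time (α i)) (fun i => F.time (β i)) := by
  have hIcc : ∀ u i, F.time u ∈ Icc (F.time (α i)) (F.time (β i)) ↔ u ∈ Icc (α i) (β i) :=
    fun u i => by rw [mem_Icc, mem_Icc, F.time_le_time, F.time_le_time]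
  have hIoo : ∀ u i, F.time u ∈ Ioo (F.time (α i)) (F.time (β i)) ↔ u ∈ Ioo (α i) (β i) :=
    fun u i => by rw [mem_Ioo, mem_Ioo, F.time_lt_time, F.time_lt_time]
  have hrest := fun t ht hn => hF.notMem_box (t := t) hy hy' hB₁ ht hn
  have hout : ∀ t i, ¬ F.InArc t → t ∉ Icc (F.time (α i)) (F.time (β i)) := by
    intro t i hn hm
    rw [← F.time_coord t, hIcc] at hm
    apply hn
    rw [InArc, hF.radius_eq, abs_lt]
    constructor
    · linarith [hm.1, hα i]
    · linarith [hm.2, hβ i]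
  have hmeets : ∀ {d : ℝ → ℝ} (hd : IsKinkProfile d),
      (∀ u, d u = 0 → y₁ ≤ -u ^ 2 ∧ -u ^ 2 ≤ y₂ → y₁ < -u ^ 2 ∧ -u ^ 2 < y₂) →
      MeetsDiscInArcs (F.replace (hF.admissible hd)) B (fun i => F.time (α i))
        (fun i => F.time (β i)) := by
    intro d hd hcr
    have hbox := hd.profileCurve_mem_box hy hB₁ hB₂
    refine ⟨fun t ht => ?_, fun t ht => ?_, fun p hp => ?_⟩
    · by_cases h : F.InArc t
      · obtain ⟨u, hu, rfl⟩ := h.exists_eq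
        simp only [hIcc]
        rw [replace_curve, F.newCurve_time hu, (hbox u).1, hcl]
      · rw [replace_curve, F.newCurve_of_not_inArc (hF.admissible hd) h]
        exact iff_of_false (hrest t ht h) fun ⟨i, hi⟩ => hout t i h hi
    · by_cases h : F.InArc t
      · obtain ⟨u, hu, rfl⟩ := h.exists_eq
        simp only [hIoo]
        rw [replace_curve, F.newCurve_time hu, (hbox u).2, hop]
      · rw [replace_curve, F.newCurve_of_not_inArc (hF.admissible hd) h]
        exact iff_of_false (fun h' => hrest t ht h (interior_subset h'))
          fun ⟨i, hi⟩ => hout t i h (Ioo_subset_Icc_self hi)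
    · obtain ⟨u, h1, h2, h3, h4⟩ := (hF.mem_crossingsIn hd hrest).1 hp
      exact (hF.mem_crossingsIn hd fun t ht hn h => hrest t ht hn (interior_subset h)).2
        ⟨u, h1, h2, h3, (hbox u).2.2 (hcr u h2 ((hbox u).1.1 h4))⟩
  refine F.localChange_replace _ _ hB (fun i => ⟨?_, F.time_lt_time.2 (hαβ i), ?_⟩) ?_
    (hmeets hk hcr) (hmeets hk' hcr') ?_
  · refine (F.arc (α i) ?_).1.1
    rw [hF.radius_eq, abs_lt]
    constructor <;> linarith [hα i, hαβ i, hβ i]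
  · refine (F.arc (β i) ?_).1.2
    rw [hF.radius_eq, abs_lt]
    constructor <;> linarith [hα i, hαβ i, hβ i]
  · intro i j hij
    rw [Set.disjoint_left]
    intro t h1 h2
    rcases hdisj i j hij with h | h
    · exact absurd (h2.1.trans h1.2) (not_le.2 (F.time_lt_time.2 h))
    · exact absurd (h1.1.trans h2.2) (not_le.2 (F.time_lt_time.2 h))
  · intro u _ hi
    rw [profileCurve, profileCurve, heq u fun i => (hIoo u i).not.1 (hi i)]

end StrandFrame.IsSingle

namespace StrandFrame

variable {E : KnotoidDiagram} (F : StrandFrame E)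

theorem order_mul_pos_iff {u : ℝ} (h : u = 1 ∨ u = -1) : 0 < F.order * u ↔ u = F.order := by
  rcases F.order_eq with h1 | h1 <;> rcases h with rfl | rfl <;> rw [h1] <;> norm_num

theorem doubleKinkProfile_order : doubleKinkProfile F.order = 0 := by
  have hη : F.order = 1 ∨ F.order = -1 := F.order_eq
  rw [doubleKinkProfile_outer (by rcases hη with h | h <;> rw [h] <;> norm_num),
    kinkProfile_inner (by rcases hη with h | h <;> rw [h] <;> norm_num)]
  rcases hη with h | h <;> rw [h] <;> norm_num

theorem abs_half_order : |F.order / 2| = 1 / 2 := by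
  rcases F.order_eq with h | h <;> rw [h] <;> norm_num [abs_div]

theorem doubleKinkProfile_half_order : doubleKinkProfile (F.order / 2) = 0 := by
  rw [doubleKinkProfile_middle (by rw [F.abs_half_order]; norm_num)
    (by rw [F.abs_half_order]; norm_num), kinkQuartic]
  rcases F.order_eq with h | h <;> rw [h] <;> norm_num

theorem sign_deriv_half_order :
    SignType.sign (deriv doubleKinkProfile (F.order / 2)) = -SignType.sign F.order := by
  rw [deriv_doubleKinkProfile_middle (by rw [F.abs_half_order]; norm_num)
    (by rw [F.abs_half_order]; norm_num)]
  rcases F.order_eq with h | h <;> rw [h] <;> norm_num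

theorem sign_deriv_order :
    SignType.sign (deriv doubleKinkProfile F.order) = SignType.sign F.order := by
  have hη : F.order = 1 ∨ F.order = -1 := F.order_eq
  rw [deriv_doubleKinkProfile_outer (by rcases hη with h | h <;> rw [h] <;> norm_num),
    deriv_kinkProfile (by rcases hη with h | h <;> rw [h] <;> norm_num), sign_mul,
    sign_pos two_pos, one_mul]

theorem eq_order_or_of_pos {u : ℝ} (h : doubleKinkProfile u = 0) (hu : 0 < F.order * u) :
    u = F.order ∨ u = F.order / 2 := by
  rcases F.order_eq with h1 | h1 <;> rw [h1] at hu ⊢ <;>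
    rcases doubleKinkProfile_eq_zero h with (rfl | rfl) | rfl | rfl <;>
      first | (norm_num; done) | norm_num at hu

namespace IsSingle

variable {F} (hF : F.IsSingle)

include hF

theorem replace_one : F.replace (hF.admissible isKinkProfile_one) = E := by
  have h := F.replace_base (hF.base_eq ▸ hF.admissible isKinkProfile_one)
  simpa only [hF.base_eq] using h

/-- The parabola is replaced by the single kink. The lower edge `-4` of the box cuts the curve at
`|u| = 2`, where both profiles are already `1`. The sign of the kink is `F.order`. -/
theorem addsKink : ∃ (B : Set ℂ) (ε : ℤ), IsDisc B ∧ (ε : ℝ) = F.order ∧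
    (∀ z ∈ B, |z.re| ≤ 4 ∧ -4 ≤ z.im ∧ z.im ≤ 3) ∧
    AddsKink E (F.replace (hF.admissible isKinkProfile_kinkProfile)) B (F.time (-2)) (F.time 2)
      ε := by
  obtain ⟨B, hB, hB₁, hB₂⟩ := exists_box (M := 4) (y₁ := -4) (y₂ := 3) (by norm_num) (by norm_num)
  have hl := hF.localChange isKinkProfile_one isKinkProfile_kinkProfile (y₁ := -4) (y₂ := 3)
    le_rfl le_rfl hB hB₁ hB₂ (n := 1) (fun _ => -2) (fun _ => 2) (fun _ => le_rfl)
    (fun _ => by norm_num) (fun _ => le_rfl) (fun i j h => absurd (Subsingleton.elim i j) h)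
    (fun u => by
      simp only [mem_Icc, exists_const]
      constructor
      · intro h; exact abs_le.1 (abs_le_of_sq_le_sq (by linarith [h.1]) (by norm_num))
      · intro h; constructor <;> nlinarith [h.1, h.2])
    (fun u => by
      simp only [mem_Ioo, exists_const]
      constructor
      · intro h; exact abs_lt.1 (abs_lt_of_sq_lt_sq (by linarith [h.1]) (by norm_num))
      · intro h; constructor <;> nlinarith [h.1, h.2])
    (fun u h => absurd h one_ne_zero)
    (fun u h _ => by rcases kinkProfile_eq_zero h with rfl | rfl <;> norm_num)
    (fun u h => by
      refine kinkProfile_outer ?_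
      have h1 := h 0
      by_contra hc
      rw [not_le, abs_lt] at hc
      exact h1 ⟨by linarith [hc.1], by linarith [hc.2]⟩)
  have hrest := fun t ht hn => hF.notMem_box (t := t) le_rfl le_rfl hB₁ ht hn
  rw [hF.replace_one] at hl
  have hη : F.order = 1 ∨ F.order = -1 := F.order_eq
  have hk0 : kinkProfile F.order = 0 := by
    rw [kinkProfile_inner (by rcases hη with h | h <;> rw [h] <;> norm_num)]
    rcases hη with h | h <;> rw [h] <;> norm_num
  have hne : F.order ≠ 0 := by rcases hη with h | h <;> rw [h] <;> norm_num
  refine ⟨B, (SignType.sign F.order : ℤ), hB, ?_, hB₁, hl, ?_, (F.time F.order, F.time (-F.order)),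
    ?_, ?_⟩
  · rcases hη with h | h <;> rw [h] <;> simp
  · have h1 := fun p => hF.mem_crossingsIn isKinkProfile_one hrest (p := p)
    rw [hF.replace_one] at h1
    exact eq_empty_of_forall_notMem fun p hp => by
      obtain ⟨u, -, h0, -⟩ := (h1 p).1 hp
      exact one_ne_zero h0
  · ext p
    rw [hF.mem_crossingsIn isKinkProfile_kinkProfile hrest, mem_singleton_iff]
    constructor
    · rintro ⟨u, rfl, h0, hu, -⟩
      rw [(F.order_mul_pos_iff (kinkProfile_eq_zero h0)).1 hu]
    · rintro rfl
      refine ⟨F.order, rfl, hk0, (F.order_mul_pos_iff hη).2 rfl, ?_⟩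
      rw [(isKinkProfile_kinkProfile.profileCurve_mem_box le_rfl hB₁ hB₂ _).1]
      rcases hη with h | h <;> rw [h] <;> norm_num
  · rw [hF.crossingSign_eq isKinkProfile_kinkProfile hk0 hne,
      deriv_kinkProfile (by rcases hη with h | h <;> rw [h] <;> norm_num), sign_mul,
      sign_pos two_pos, one_mul]

/-- The profiles of the single and the double kink differ only for `|u| < 9 / 10`. The box is cut
off at `|u| = 19 / 20`, so it contains the inner crossing at `±1 / 2` but not the outer one at `±1`.
-/
theorem addsKink_double : ∃ (B : Set ℂ) (ε : ℤ), (ε : ℝ) = -F.order ∧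
    AddsKink (F.replace (hF.admissible isKinkProfile_kinkProfile))
      (F.replace (hF.admissible isKinkProfile_doubleKinkProfile)) B (F.time (-19 / 20))
      (F.time (19 / 20)) ε := by
  obtain ⟨B, hB, hB₁, hB₂⟩ := exists_box (M := 4) (y₁ := -(19 / 20) ^ 2) (y₂ := 3) (by norm_num)
    (by norm_num)
  have hy : (-4 : ℝ) ≤ -(19 / 20) ^ 2 := by norm_num
  have hl := hF.localChange isKinkProfile_kinkProfile isKinkProfile_doubleKinkProfile
    (y₁ := -(19 / 20) ^ 2) (y₂ := 3) hy le_rfl hB hB₁ hB₂ (n := 1) (fun _ => -19 / 20)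
    (fun _ => 19 / 20) (fun _ => by norm_num)
    (fun _ => by norm_num) (fun _ => by norm_num) (fun i j h => absurd (Subsingleton.elim i j) h)
    (fun u => by
      simp only [mem_Icc, exists_const, neg_div]
      constructor
      · intro h; exact abs_le.1 (abs_le_of_sq_le_sq (by linarith [h.1]) (by norm_num))
      · intro h; constructor <;> nlinarith [h.1, h.2])
    (fun u => by
      simp only [mem_Ioo, exists_const, neg_div]
      constructor
      · intro h; exact abs_lt.1 (abs_lt_of_sq_lt_sq (by linarith [h.1]) (by norm_num))
      · intro h; constructor <;> nlinarith [h.1, h.2])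
    (fun u h => by rcases kinkProfile_eq_zero h with rfl | rfl <;> norm_num)
    (fun u h _ => by
      rcases doubleKinkProfile_eq_zero h with (rfl | rfl) | rfl | rfl <;> norm_num at *)
    (fun u h => by
      refine doubleKinkProfile_outer ?_
      have h1 := h 0
      by_contra hc
      rw [not_le, abs_lt] at hc
      exact h1 ⟨by linarith [hc.1], by linarith [hc.2]⟩)
  have hrest := fun t ht hn => hF.notMem_box (t := t) hy le_rfl hB₁ ht hn
  have hk := isKinkProfile_doubleKinkProfile
  have hne : F.order / 2 ≠ 0 := by rcases F.order_eq with h | h <;> rw [h] <;> norm_num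
  refine ⟨B, (SignType.sign (-F.order) : ℤ), ?_, hl, ?_,
    (F.time (F.order / 2), F.time (-(F.order / 2))), ?_, ?_⟩
  · rcases F.order_eq with h | h <;> rw [h] <;> simp
  · refine eq_empty_of_forall_notMem fun p hp => ?_
    obtain ⟨u, -, h0, -, hu⟩ := (hF.mem_crossingsIn isKinkProfile_kinkProfile hrest).1 hp
    rw [(isKinkProfile_kinkProfile.profileCurve_mem_box hy hB₁ hB₂ _).1] at hu
    rcases kinkProfile_eq_zero h0 with rfl | rfl <;> norm_num at hu
  · ext p
    rw [hF.mem_crossingsIn hk hrest, mem_singleton_iff]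
    constructor
    · rintro ⟨u, rfl, h0, hu, hB'⟩
      rw [(hk.profileCurve_mem_box hy hB₁ hB₂ _).1] at hB'
      rcases F.eq_order_or_of_pos h0 hu with rfl | rfl
      · rcases F.order_eq with h | h <;> rw [h] at hB' <;> norm_num at hB'
      · rfl
    · rintro rfl
      refine ⟨F.order / 2, rfl, F.doubleKinkProfile_half_order, ?_, ?_⟩
      · rcases F.order_eq with h | h <;> rw [h] <;> norm_num
      · rw [(hk.profileCurve_mem_box hy hB₁ hB₂ _).1]
        rcases F.order_eq with h | h <;> rw [h] <;> norm_num
  · rw [hF.crossingSign_eq hk F.doubleKinkProfile_half_order hne, F.sign_deriv_half_order,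
      Left.sign_neg]

/-- Removing the tip `|u| < 1 / 5`, where the profile is `1` before and after, leaves two arcs, one
for each sign of `u`. They have no crossing before, and afterwards two of opposite signs at `±1` and
`±1 / 2`. As `F.order` fixes which sign of `u` runs on top, the same arc is the upper one at both.
-/
theorem reidemeisterTwo : ReidemeisterTwo E
    (F.replace (hF.admissible isKinkProfile_doubleKinkProfile)) := by
  obtain ⟨B, hB, hB₁, hB₂⟩ := exists_box (M := 4) (y₁ := -4) (y₂ := -(1 / 5) ^ 2) (by norm_num)
    (by norm_num)
  have hy' : -(1 / 5 : ℝ) ^ 2 ≤ 3 := by norm_num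
  have hη : F.order = 1 ∨ F.order = -1 := F.order_eq
  -- the arc that runs over the other one comes first
  set α : Fin 2 → ℝ := if F.order = 1 then ![1 / 5, -2] else ![-2, 1 / 5] with hα
  set β : Fin 2 → ℝ := if F.order = 1 then ![2, -(1 / 5)] else ![-(1 / 5), 2] with hβ
  have hcases : (∀ P : ℝ → ℝ → Prop, (∃ i, P (α i) (β i)) ↔ P (1 / 5) 2 ∨ P (-2) (-(1 / 5))) := by
    intro P
    rw [Fin.exists_fin_two]
    rcases hη with h | h
    · simp [hα, hβ, h]
    · have : ¬ ((-1 : ℝ) = 1) := by norm_num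
      simp only [hα, hβ, h, this, if_false]
      exact or_comm
  have hall : (∀ P : ℝ → ℝ → Prop, (∀ i, P (α i) (β i)) ↔ P (1 / 5) 2 ∧ P (-2) (-(1 / 5))) := by
    intro P
    rw [Fin.forall_fin_two]
    rcases hη with h | h
    · simp [hα, hβ, h]
    · have : ¬ ((-1 : ℝ) = 1) := by norm_num
      simp only [hα, hβ, h, this, if_false]
      exact and_comm
  have hl := hF.localChange isKinkProfile_one isKinkProfile_doubleKinkProfile
    (y₁ := -4) (y₂ := -(1 / 5) ^ 2) le_rfl hy' hB hB₁ hB₂ α β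
    ((hall fun a _ => -2 ≤ a).2 (by norm_num))
    ((hall fun a b => a < b).2 (by norm_num)) ((hall fun _ b => b ≤ 2).2 (by norm_num))
    (fun i j hij => by
      rcases hη with h | h
      · simp only [hα, hβ, h, if_true]
        fin_cases i <;> fin_cases j <;> first | exact absurd rfl hij | norm_num
      · have : ¬ ((-1 : ℝ) = 1) := by norm_num
        simp only [hα, hβ, h, this, if_false]
        fin_cases i <;> fin_cases j <;> first | exact absurd rfl hij | norm_num)
    (fun u => by
      rw [hcases fun a b => u ∈ Icc a b, mem_Icc, mem_Icc]
      constructor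
      · intro h
        have h1 := abs_le.1 (abs_le_of_sq_le_sq (b := 2) (a := u) (by linarith [h.1]) (by norm_num))
        rcases le_abs.1 (abs_le_of_sq_le_sq' (a := 1 / 5) (b := |u|)
          (by rw [sq_abs]; linarith [h.2]) (abs_nonneg u)).2 with h2 | h2
        · exact .inl ⟨h2, h1.2⟩
        · exact .inr ⟨h1.1, by linarith⟩
      · rintro (h | h) <;> constructor <;> nlinarith [h.1, h.2])
    (fun u => by
      rw [hcases fun a b => u ∈ Ioo a b, mem_Ioo, mem_Ioo]
      constructor
      · intro h
        have h1 := abs_lt.1 (abs_lt_of_sq_lt_sq (b := 2) (a := u) (by linarith [h.1]) (by norm_num))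
        rcases lt_abs.1 (abs_lt_of_sq_lt_sq' (a := 1 / 5) (b := |u|)
          (by rw [sq_abs]; linarith [h.2]) (abs_nonneg u)).2 with h2 | h2
        · exact .inl ⟨h2, h1.2⟩
        · exact .inr ⟨h1.1, by linarith⟩
      · rintro (h | h) <;> constructor <;> nlinarith [h.1, h.2])
    (fun u h => absurd h one_ne_zero)
    (fun u h _ => by
      rcases doubleKinkProfile_eq_zero h with (rfl | rfl) | rfl | rfl <;> norm_num)
    (fun u h => by
      have h := (hall fun a b => u ∉ Ioo a b).1 h
      rcases le_or_gt |u| (3 / 10) with h1 | h1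
      · exact doubleKinkProfile_inner h1
      · refine isKinkProfile_doubleKinkProfile.eq_one u ?_
        by_contra hc
        rw [not_le, abs_lt] at hc
        rcases lt_abs.1 h1 with h2 | h2
        · exact h.1 ⟨by linarith, by linarith [hc.2]⟩
        · exact h.2 ⟨by linarith [hc.1], by linarith⟩)
  have hrest := fun t ht hn => hF.notMem_box (t := t) le_rfl hy' hB₁ ht hn
  have hk := isKinkProfile_doubleKinkProfile
  have hne : F.order ≠ 0 := by rcases hη with h | h <;> rw [h] <;> norm_num
  rw [hF.replace_one] at hl
  have hmem : ∀ u, u = F.order ∨ u = F.order / 2 →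
      F.time u ∈ Icc (F.time (α 0)) (F.time (β 0)) ∧
        F.time (-u) ∈ Icc (F.time (α 1)) (F.time (β 1)) := by
    intro u hu
    rw [mem_Icc, mem_Icc, F.time_le_time, F.time_le_time, F.time_le_time, F.time_le_time]
    rcases hη with h | h
    · simp only [hα, hβ, h, if_true] at hu ⊢
      rcases hu with rfl | rfl <;> norm_num
    · have : ¬ ((-1 : ℝ) = 1) := by norm_num
      simp only [hα, hβ, h, this, if_false] at hu ⊢
      rcases hu with rfl | rfl <;> norm_num
  refine ⟨B, _, _, hl, ?_, (F.time F.order, F.time (-F.order)),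
    (F.time (F.order / 2), F.time (-(F.order / 2))), ?_, ?_, (hmem _ (.inl rfl)).1,
    (hmem _ (.inr rfl)).1, (hmem _ (.inl rfl)).2, (hmem _ (.inr rfl)).2, ?_⟩
  · have h1 := fun p => hF.mem_crossingsIn isKinkProfile_one hrest (p := p)
    rw [hF.replace_one] at h1
    exact eq_empty_of_forall_notMem fun p hp => by
      obtain ⟨u, -, h0, -⟩ := (h1 p).1 hp
      exact one_ne_zero h0
  · intro h
    have := F.time_inj.1 (Prod.ext_iff.1 h).1
    exact hne (by linarith)
  · ext p
    rw [hF.mem_crossingsIn hk hrest, mem_insert_iff, mem_singleton_iff]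
    constructor
    · rintro ⟨u, rfl, h0, hu, hB'⟩
      rcases F.eq_order_or_of_pos h0 hu with rfl | rfl
      · exact .inl rfl
      · exact .inr rfl
    · rintro (rfl | rfl)
      · refine ⟨_, rfl, F.doubleKinkProfile_order, ?_, ?_⟩
        · rcases hη with h | h <;> rw [h] <;> norm_num
        · rw [(hk.profileCurve_mem_box le_rfl hB₁ hB₂ _).1]
          rcases hη with h | h <;> rw [h] <;> norm_num
      · refine ⟨_, rfl, F.doubleKinkProfile_half_order, ?_, ?_⟩
        · rcases hη with h | h <;> rw [h] <;> norm_num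
        · rw [(hk.profileCurve_mem_box le_rfl hB₁ hB₂ _).1]
          rcases hη with h | h <;> rw [h] <;> norm_num
  · rw [hF.crossingSign_eq hk F.doubleKinkProfile_order hne,
      hF.crossingSign_eq hk F.doubleKinkProfile_half_order (div_ne_zero hne two_ne_zero),
      F.sign_deriv_order, F.sign_deriv_half_order]
    rcases hη with h | h <;> rw [h] <;> simp

end IsSingle

end StrandFrame

/-! ### Existence of kinks -/

/-- The shear `(x, y) ↦ (x, y + f x)`. -/
def shearDiffeo (f : ℝ → ℝ) (hf : ContDiff ℝ ∞ f) : PlaneDiffeo :=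
  PlaneDiffeo.mk (fun z => ⟨z.re, z.im + f z.re⟩) (fun z => ⟨z.re, z.im - f z.re⟩)
    (contDiff_complex_mk (contDiff_re contDiff_id)
      ((contDiff_im contDiff_id).add (hf.comp (contDiff_re contDiff_id))))
    (contDiff_complex_mk (contDiff_re contDiff_id)
      ((contDiff_im contDiff_id).sub (hf.comp (contDiff_re contDiff_id))))
    (fun z => Complex.ext rfl (by simp)) (fun z => Complex.ext rfl (by simp))

@[simp] theorem shearDiffeo_apply (f : ℝ → ℝ) (hf : ContDiff ℝ ∞ f) (z : ℂ) :
    shearDiffeo f hf z = ⟨z.re, z.im + f z.re⟩ := rfl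

@[simp] theorem shearDiffeo_symm_apply (f : ℝ → ℝ) (hf : ContDiff ℝ ∞ f) (z : ℂ) :
    (shearDiffeo f hf).symm z = ⟨z.re, z.im - f z.re⟩ := rfl

theorem PlaneDiffeo.apply_symm (G : PlaneDiffeo) (z : ℂ) : G (G.symm z) = z :=
  G.apply_symm_apply z

theorem PlaneDiffeo.symm_apply (G : PlaneDiffeo) (z : ℂ) : G.symm (G z) = z :=
  G.symm_apply_apply z

theorem norm_sq_eq (z : ℂ) : ‖z‖ ^ 2 = z.re ^ 2 + z.im ^ 2 := by
  rw [← Complex.normSq_eq_norm_sq, Complex.normSq_apply]; ring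

/-- A chart around a simple point of a diagram. -/
theorem exists_simple_chart (D : KnotoidDiagram) {t₀ : ℝ} (ht₀ : t₀ ∈ Ioo (0 : ℝ) 1)
    (hs : ∀ t ∈ Icc (0 : ℝ) 1, D.curve t = D.curve t₀ → t = t₀) {W : Set ℂ}
    (hW : W ∈ 𝓝 (D.curve t₀)) {R : ℝ} (hR : 0 < R) :
    ∃ (G : PlaneDiffeo) (l : ℝ), 0 < l ∧
      (∀ u : ℝ, |u| < R → t₀ + u / l ∈ Ioo (0 : ℝ) 1 ∧ D.curve (t₀ + u / l) = G u) ∧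
      (∀ t ∈ Icc (0 : ℝ) 1, D.curve t ∈ G '' Metric.ball 0 R → |l * (t - t₀)| < R) ∧
      G '' Metric.ball 0 R ⊆ W := by
  set v := deriv D.curve t₀ with hv
  have hv0 : v ≠ 0 := D.immersion t₀ (Ioo_subset_Icc_self ht₀)
  let Ψ : ℂ → ℂ := fun z => D.curve (t₀ + z.re) + z.im * (Complex.I * v)
  have hre : ContDiff ℝ ∞ fun z : ℂ => z.re := contDiff_re contDiff_id
  have hΨ : ContDiff ℝ ∞ Ψ :=
    (D.smooth.comp (contDiff_const.add hre)).add
      ((Complex.ofRealCLM.contDiff.comp (contDiff_im contDiff_id)).mul contDiff_const)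
  have hder : HasFDerivAt Ψ ((ContinuousLinearMap.toSpanSingleton ℝ v).comp Complex.reCLM +
      (ContinuousLinearMap.toSpanSingleton ℝ (Complex.I * v)).comp Complex.imCLM) 0 := by
    have h1 : HasFDerivAt (fun z : ℂ => t₀ + z.re) Complex.reCLM 0 :=
      Complex.reCLM.hasFDerivAt.const_add t₀
    have h2 : HasFDerivAt (fun z : ℂ => D.curve (t₀ + z.re))
        ((ContinuousLinearMap.toSpanSingleton ℝ v).comp Complex.reCLM) 0 := by
      have h3 : HasFDerivAt D.curve (ContinuousLinearMap.toSpanSingleton ℝ v) (t₀ + (0 : ℂ).re) := by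
        rw [Complex.zero_re, add_zero]
        exact (D.hasDerivAt t₀).hasFDerivAt
      exact h3.comp (0 : ℂ) h1
    have h4 : HasFDerivAt (fun z : ℂ => (z.im : ℂ) * (Complex.I * v))
        ((ContinuousLinearMap.toSpanSingleton ℝ (Complex.I * v)).comp Complex.imCLM) 0 := by
      have := ((ContinuousLinearMap.toSpanSingleton ℝ (Complex.I * v)).comp
        Complex.imCLM).hasFDerivAt (x := 0)
      refine this.congr_of_eventuallyEq (Eventually.of_forall fun z => ?_)
      simp
    exact h2.add h4
  have hinj : Function.Injective (fderiv ℝ Ψ 0) := by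
    rw [hder.fderiv]
    have h1 : ∀ z : ℂ, ((ContinuousLinearMap.toSpanSingleton ℝ v).comp Complex.reCLM +
      (ContinuousLinearMap.toSpanSingleton ℝ (Complex.I * v)).comp Complex.imCLM) z = z * v := by
      intro z
      have h2 : z * v = (z.re + z.im * Complex.I) * v := by rw [Complex.re_add_im]
      change z.re • v + z.im • (Complex.I * v) = z * v
      rw [h2, Complex.real_smul, Complex.real_smul]
      ring
    intro z w h
    rw [h1, h1] at h
    exact mul_right_cancel₀ hv0 h
  obtain ⟨G, l, hl, -, h1, h2, h3⟩ := exists_straight_chart (D := D) (T := {t₀})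
    (dir := fun _ => 1) hΨ hinj (P := D.curve t₀) (by simp [Ψ]) (finite_singleton _)
    (singleton_subset_iff.2 ht₀) (by simp) (by simp [Ψ])
    (fun t ht h => hs t ht h) hR one_pos hW
  refine ⟨G, l, hl, fun u hu => ?_, fun t ht h => ?_, h3⟩
  · simpa using h1 t₀ rfl u hu
  · obtain ⟨τ, rfl, h⟩ := h2 t ht h
    exact h

/-- A chart makes the strand a horizontal segment and a shear bends it to the parabola. The order
includes the orientation of the chart, so that pulling back yields kinks of sign `ε`. -/
theorem exists_isSingle (D : KnotoidDiagram) {t₀ : ℝ} (ht₀ : t₀ ∈ Ioo (0 : ℝ) 1)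
    (hs : ∀ t ∈ Icc (0 : ℝ) 1, D.curve t = D.curve t₀ → t = t₀) {W : Set ℂ}
    (hW : W ∈ 𝓝 (D.curve t₀)) {ε : ℤ} (hε : ε = 1 ∨ ε = -1) :
    ∃ (G : PlaneDiffeo) (F : StrandFrame (D.map G)), F.IsSingle ∧ F.center = t₀ ∧
      F.order = (PlaneDiffeo.orientation G.symm * ε : ℤ) ∧
      ∀ z : ℂ, |z.re| ≤ 4 ∧ -4 ≤ z.im ∧ z.im ≤ 3 → G.symm z ∈ W := by
  obtain ⟨G, l, hl, h1, h2, h3⟩ := exists_simple_chart D ht₀ hs hW (R := 30) (by norm_num)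
  have hf : ContDiff ℝ ∞ fun x : ℝ => -x ^ 2 := (contDiff_id.pow 2).neg
  set S := shearDiffeo (fun x => -x ^ 2) hf with hS
  have hcurve : ∀ t, (D.map (G.symm.trans S)).curve t = S (G.symm (D.curve t)) := fun _ => rfl
  have hrest : ∀ t ∈ Icc (0 : ℝ) 1, ¬ |l * (t - t₀)| < 30 →
      (30 : ℝ) ≤ ‖G.symm (D.curve t)‖ := by
    intro t ht hn
    by_contra hc
    refine hn (h2 t ht ⟨G.symm (D.curve t), ?_, G.apply_symm _⟩)
    simpa using hc
  have hbase : ∀ u, |u| < 30 → (D.map (G.symm.trans S)).curve (t₀ + u / l) =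
      profileCurve (fun _ => 1) u := by
    intro u hu
    rw [hcurve, (h1 u hu).2, G.symm_apply, hS, shearDiffeo_apply, profileCurve]
    simp
  refine ⟨G.symm.trans S,
    { center := t₀
      scale := l
      core := 2
      radius := 30
      base := profileCurve fun _ => 1
      -- Arbitrary, since the arc through a simple point has no crossings with the rest of the
      -- diagram.
      isOver := True
      order := (PlaneDiffeo.orientation (G.symm.trans S).symm * ε : ℤ)
      scale_pos := hl
      core_lt := by norm_num
      base_smooth := isKinkProfile_one.profileCurve_contDiff
      order_eq := by
        rcases PlaneDiffeo.orientation_eq (G.symm.trans S).symm with h | h <;> rw [h] <;>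
          rcases hε with rfl | rfl <;> norm_num
      arc := fun u hu => ⟨(h1 u hu).1, hbase u hu⟩
      base_inj := fun u w _ _ h => by simpa [profileCurve] using congrArg Complex.re h
      level := fun u t hu ht hn he => ?_ }, ⟨rfl, rfl, rfl, fun t ht hn => ?_⟩, rfl, rfl, ?_⟩
  · exfalso
    rw [← hbase u hu, hcurve, hcurve, (h1 u hu).2, G.symm_apply] at he
    have h4 := hrest t ht (not_lt.2 hn)
    rw [← S.inj he, Complex.norm_real, Real.norm_eq_abs] at h4
    linarith
  · have h4 := hrest t ht hn
    have h5 := norm_sq_eq (G.symm (D.curve t))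
    rw [hcurve, hS, shearDiffeo_apply]
    simp only [neg_add_cancel_right]
    nlinarith
  · rintro z ⟨h4, h5, h6⟩
    refine h3 ⟨S.symm z, ?_, rfl⟩
    have h7 := norm_sq_eq (S.symm z)
    rw [hS, shearDiffeo_symm_apply] at h7 ⊢
    simp only [sub_neg_eq_add] at h7 ⊢
    rw [mem_ball_zero_iff]
    have h8 : z.re ^ 2 ≤ 16 := by rw [← sq_abs]; nlinarith [abs_nonneg z.re]
    have h9 := sq_nonneg z.re
    by_contra hc
    nlinarith

/-- On any simple point of a diagram, there are small kinks, and kinks inside of kinks that can be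
removed together by a single second Reidemeister move. -/
theorem exists_nested_kinks (D : KnotoidDiagram) {t₀ : ℝ} (ht₀ : t₀ ∈ Ioo (0 : ℝ) 1)
    (hs : ∀ t ∈ Icc (0 : ℝ) 1, D.curve t = D.curve t₀ → t = t₀) {W : Set ℂ}
    (hW : W ∈ 𝓝 (D.curve t₀)) {ε : ℤ} (hε : ε = 1 ∨ ε = -1) :
    ∃ (D' D'' : KnotoidDiagram) (B B' : Set ℂ) (a b a' b' : ℝ), AddsKink D D' B a b ε ∧
      t₀ ∈ Ioo a b ∧ B ⊆ W ∧ AddsKink D' D'' B' a' b' (-ε) ∧ ReidemeisterTwo D D'' := by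
  obtain ⟨G, F, hF, rfl, ho, hG⟩ := exists_isSingle D ht₀ hs hW hε
  obtain ⟨B, δ, hB, hδ, hB₁, hk⟩ := hF.addsKink
  obtain ⟨B', δ', hδ', hk'⟩ := hF.addsKink_double
  have hr := hF.reidemeisterTwo.map G.symm
  have h1 := hk.map G.symm
  have h2 := hk'.map G.symm
  rw [D.map_map_symm] at hr h1
  -- The orientation enters once through `order` and once through the transport back, and cancels.
  have hsq : PlaneDiffeo.orientation G.symm * PlaneDiffeo.orientation G.symm = 1 := by
    rcases PlaneDiffeo.orientation_eq G.symm with h | h <;> rw [h] <;> norm_num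
  rw [show δ = PlaneDiffeo.orientation G.symm * ε by rw [ho] at hδ; exact_mod_cast hδ, ← mul_assoc, hsq,
    one_mul] at h1
  rw [show δ' = -(PlaneDiffeo.orientation G.symm * ε) by rw [ho] at hδ'; exact_mod_cast hδ', mul_neg,
    ← mul_assoc, hsq, one_mul] at h2
  refine ⟨_, _, _, _, _, _, _, _, h1, ?_, ?_, h2, hr⟩
  · have h0 : F.time 0 = F.center := by simp [StrandFrame.time]
    rw [← h0, mem_Ioo, F.time_lt_time, F.time_lt_time]
    norm_num
  · rintro _ ⟨z, hz, rfl⟩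
    exact hG z (hB₁ z hz)

/-! ### Kinks near a given time -/

namespace KnotoidDiagram

/-- The curve runs only once through the point at time `t`. -/
def IsSimple (D : KnotoidDiagram) (t : ℝ) : Prop :=
  ∀ s ∈ Icc (0 : ℝ) 1, D.curve s = D.curve t → s = t

theorem finite_not_isSimple (D : KnotoidDiagram) :
    {t | t ∈ Icc (0 : ℝ) 1 ∧ ¬ D.IsSimple t}.Finite := by
  refine (D.finite_doublePoints.image Prod.fst).subset ?_
  rintro t ⟨ht, hn⟩
  simp only [IsSimple, not_forall] at hn
  obtain ⟨s, hs, he, hne⟩ := hn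
  exact ⟨(t, s), ⟨ht, hs, Ne.symm hne, he.symm⟩, rfl⟩

theorem exists_isSimple (D : KnotoidDiagram) {a b : ℝ} (h : a < b) (ha : 0 ≤ a) (hb : b ≤ 1) :
    ∃ t ∈ Ioo a b, D.IsSimple t := by
  obtain ⟨t, ht, hn⟩ := ((Ioo_infinite h).sdiff D.finite_not_isSimple).nonempty
  refine ⟨t, ht, ?_⟩
  by_contra hc
  exact hn ⟨⟨ha.trans ht.1.le, ht.2.le.trans hb⟩, hc⟩

theorem mem_crossings_or {D : KnotoidDiagram} {s t : ℝ} (hs : s ∈ Icc (0 : ℝ) 1)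
    (ht : t ∈ Icc (0 : ℝ) 1) (hne : s ≠ t) (he : D.curve s = D.curve t) :
    (s, t) ∈ D.crossings ∨ (t, s) ∈ D.crossings := by
  by_cases h : s ∈ D.upper
  · exact .inl ⟨hs, ht, hne, he, h⟩
  · exact .inr ⟨ht, hs, hne.symm, he.symm, by
      by_contra hc; exact h ((D.upper_iff s hs t ht hne he).2 hc)⟩

end KnotoidDiagram

namespace AddsKink

variable {D K : KnotoidDiagram} {B : Set ℂ} {a b : ℝ} {ε : ℤ} (h : AddsKink D K B a b ε)
include h

theorem mem_Ioo {t : ℝ} (ht : t ∈ Ioo a b) : t ∈ Ioo (0 : ℝ) 1 :=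
  ⟨(h.1.arcs 0).1.trans ht.1, ht.2.trans (h.1.arcs 0).2.2⟩

theorem curve_mem_interior {t : ℝ} (ht : t ∈ Ioo a b) : D.curve t ∈ interior B :=
  (h.1.meets.2.1 t (Ioo_subset_Icc_self (h.mem_Ioo ht))).2 ⟨0, ht⟩

theorem isSimple {t : ℝ} (ht : t ∈ Ioo a b) : D.IsSimple t := by
  intro s hs he
  by_contra hne
  have hB : D.curve t ∈ B := interior_subset (h.curve_mem_interior ht)
  have ht' := Ioo_subset_Icc_self (h.mem_Ioo ht)
  have : ∀ p ∈ D.crossings, D.curve p.1 ∈ B → False := fun p hp hpB => by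
    have h1 : p ∈ D.crossingsIn B := ⟨hp, hpB⟩
    rw [h.2.1] at h1
    exact h1
  rcases KnotoidDiagram.mem_crossings_or hs ht' hne he with h1 | h1
  · exact this _ h1 (by rw [he]; exact hB)
  · exact this _ h1 hB

/-- Between the two discs `D` has no crossings and `K` agrees with `D`, so the small kink can be
regarded as one in the larger disc. This makes different kinks comparable by R1', which requires a
common disc. -/
theorem enlarge {K₁ : KnotoidDiagram} {B₁ : Set ℂ} {a₁ b₁ : ℝ} {ε₁ : ℤ}
    (h₁ : AddsKink D K₁ B₁ a₁ b₁ ε₁) (hB : B ⊆ interior B₁) : AddsKink D K B₁ a₁ b₁ ε := by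
  have hsub : ∀ t ∈ Icc a b, t ∈ Ioo a₁ b₁ := fun t ht => by
    have ht' := Ioo_subset_Icc_self (h.1.Icc_subset 0 ht)
    have h2 : D.curve t ∈ B := (h.1.meets.1 t ht').2 ⟨0, ht⟩
    obtain ⟨_, h3⟩ := (h₁.1.meets.2.1 t ht').1 (hB h2)
    exact h3
  have hin : ∀ t ∈ Icc a b, K.curve t ∈ interior B₁ := fun t ht =>
    hB ((h.1.meets'.1 t (Ioo_subset_Icc_self (h.1.Icc_subset 0 ht))).2 ⟨0, ht⟩)
  have hout : ∀ t ∈ Icc (0 : ℝ) 1, t ∉ Icc a b → K.curve t = D.curve t :=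
    fun t ht hn => h.1.eq_outside ht fun _ => hn
  have hcr : K.crossingsIn B₁ = K.crossingsIn B := by
    refine Subset.antisymm (fun p hp => ⟨hp.1, ?_⟩) fun p hp => ⟨hp.1, interior_subset (hB hp.2)⟩
    by_contra hpB
    obtain ⟨⟨h2, h3⟩, -⟩ := h.1.symm.crossings_diff_subset (p := p) ⟨hp.1, hpB⟩
    have h4 : p ∈ D.crossingsIn B₁ := ⟨h2, by
      rw [← hout p.1 h2.1 (h.1.symm.notMem_arcs h2.1 hpB 0)]; exact hp.2⟩
    rw [h₁.2.1] at h4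
    exact h4
  refine ⟨⟨h₁.1.disc, h₁.1.arcs, h₁.1.disjoint, h₁.1.meets, ⟨fun t ht => ?_, fun t ht => ?_, ?_⟩,
    fun t ht hi => ?_⟩, h₁.2.1, by rw [hcr]; exact h.2.2⟩
  · by_cases hab : t ∈ Icc a b
    · exact iff_of_true (interior_subset (hin t hab)) ⟨0, Ioo_subset_Icc_self (hsub t hab)⟩
    · rw [hout t ht hab]; exact h₁.1.meets.1 t ht
  · by_cases hab : t ∈ Icc a b
    · exact iff_of_true (hin t hab) ⟨0, hsub t hab⟩
    · rw [hout t ht hab]; exact h₁.1.meets.2.1 t ht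
  · rw [hcr]
    exact fun p hp => ⟨hp.1, hB hp.2⟩
  · exact h.1.outside t ht fun _ hab => hi 0 (hsub t (Ioo_subset_Icc_self hab))

end AddsKink

/-- `c` is the class of the diagrams that arise from `D` by adding a kink near the time `t`. -/
def IsKinkClass (D : KnotoidDiagram) (ε : ℤ) (t : ℝ) (c : Quot RegularStep) : Prop :=
  ∃ K B a b, AddsKink D K B a b ε ∧ t ∈ Ioo a b ∧ regularClass K = c

namespace IsKinkClass

variable {D : KnotoidDiagram} {ε : ℤ} {t : ℝ} {c c' : Quot RegularStep}

theorem exists_of_isSimple (hε : ε = 1 ∨ ε = -1) (ht : t ∈ Ioo (0 : ℝ) 1) (hs : D.IsSimple t) :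
    ∃ c, IsKinkClass D ε t c := by
  obtain ⟨K, -, B, -, a, b, -, -, h, hab, -⟩ := exists_nested_kinks D ht hs univ_mem hε
  exact ⟨_, K, B, a, b, h, hab, rfl⟩

/-- A third kink at `t`, small enough to lie inside both discs, is related to each of the two given
ones by a single R1' after enlarging its disc. -/
theorem unique (hε : ε = 1 ∨ ε = -1) (h : IsKinkClass D ε t c) (h' : IsKinkClass D ε t c') :
    c = c' := by
  obtain ⟨K, B, a, b, h, hab, rfl⟩ := h
  obtain ⟨K', B', a', b', h', hab', rfl⟩ := h'
  obtain ⟨K₀, -, B₀, -, a₀, b₀, -, -, h₀, -, hB₀, -⟩ := exists_nested_kinks D (h.mem_Ioo hab)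
    (h.isSimple hab) (W := interior B ∩ interior B')
    ((isOpen_interior.inter isOpen_interior).mem_nhds
      ⟨h.curve_mem_interior hab, h'.curve_mem_interior hab'⟩) hε
  have e1 : regularClass K = regularClass K₀ := Quot.sound (.r1' ⟨D, B, a, b, ε, h,
    h₀.enlarge h fun z hz => (hB₀ hz).1⟩)
  have e2 : regularClass K' = regularClass K₀ := Quot.sound (.r1' ⟨D, B', a', b', ε, h',
    h₀.enlarge h' fun z hz => (hB₀ hz).2⟩)
  exact e1.trans e2.symm

theorem eventually (h : IsKinkClass D ε t c) : ∀ᶠ s in 𝓝 t, IsKinkClass D ε s c := by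
  obtain ⟨K, B, a, b, h, hab, rfl⟩ := h
  filter_upwards [isOpen_Ioo.mem_nhds hab] with s hs
  exact ⟨K, B, a, b, h, hs, rfl⟩

/-- Along simple points the kink class exists, is unique and is locally constant, so it is constant
on connected sets of times. -/
theorem of_isPreconnected (hε : ε = 1 ∨ ε = -1) {S : Set ℝ} (hS : IsPreconnected S)
    (hS' : ∀ s ∈ S, s ∈ Ioo (0 : ℝ) 1 ∧ D.IsSimple s) {s : ℝ} (hs : s ∈ S) (ht : t ∈ S)
    (h : IsKinkClass D ε t c) : IsKinkClass D ε s c := by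
  obtain ⟨c', h1, h2⟩ := hS.induction₂ (fun x y => ∃ c, IsKinkClass D ε x c ∧ IsKinkClass D ε y c)
    (fun x hx => by
      obtain ⟨c, hc⟩ := exists_of_isSimple hε (hS' x hx).1 (hS' x hx).2
      filter_upwards [nhdsWithin_le_nhds hc.eventually] with y hy using ⟨c, hc, hy⟩)
    (fun x y z _ _ _ ⟨c, h1, h2⟩ ⟨c', h3, h4⟩ => ⟨c, h1, by rwa [h2.unique hε h3]⟩)
    (fun x y _ _ ⟨c, h1, h2⟩ => ⟨c, h2, h1⟩) hs ht
  rwa [h.unique hε h2]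

/-- If the kink class does not change when passing through a double point, it does not depend on
the time. -/
theorem eq_of_pass (hε : ε = 1 ∨ ε = -1)
    (hpass : ∀ τ ∈ Ioo (0 : ℝ) 1, ¬ D.IsSimple τ → ∀ δ > 0, ∃ t ∈ Ioo (τ - δ) τ,
      ∃ t' ∈ Ioo τ (τ + δ), ∃ c, IsKinkClass D ε t c ∧ IsKinkClass D ε t' c)
    {t' : ℝ} (h : IsKinkClass D ε t c) (h' : IsKinkClass D ε t' c') : c = c' := by
  -- Every time has a punctured neighbourhood with a single kink class. At a non-simple time the
  -- finitely many other non-simple times are avoided, the class is constant on either side, and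
  -- `hpass` identifies the two sides.
  have hex : ∀ τ ∈ Ioo (0 : ℝ) 1, ∃ c, ∀ᶠ s in 𝓝[≠] τ, IsKinkClass D ε s c := by
    intro τ hτ
    by_cases hs : D.IsSimple τ
    · obtain ⟨c, hc⟩ := exists_of_isSimple hε hτ hs
      exact ⟨c, nhdsWithin_le_nhds hc.eventually⟩
    · have hev : ∀ᶠ s in 𝓝 τ, s ∈ Ioo (0 : ℝ) 1 ∧
          s ∉ {t | t ∈ Icc (0 : ℝ) 1 ∧ ¬ D.IsSimple t} \ {τ} :=
        (isOpen_Ioo.eventually_mem hτ).and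
          ((D.finite_not_isSimple.sdiff).isClosed.isOpen_compl.eventually_mem (by simp))
      obtain ⟨δ, hδ, hball⟩ := Metric.eventually_nhds_iff_ball.1 hev
      have hsim : ∀ s, |s - τ| < δ → s ≠ τ → s ∈ Ioo (0 : ℝ) 1 ∧ D.IsSimple s := by
        intro s hs hne
        obtain ⟨h1, h2⟩ := hball s hs
        refine ⟨h1, ?_⟩
        by_contra hc
        exact h2 ⟨⟨Ioo_subset_Icc_self h1, hc⟩, hne⟩
      obtain ⟨t, ht, t', ht', c, h1, h2⟩ := hpass τ hτ hs δ hδ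
      refine ⟨c, eventually_nhdsWithin_iff.2 (Metric.eventually_nhds_iff_ball.2
        ⟨δ, hδ, fun s hs hne => ?_⟩)⟩
      have hs' := abs_lt.1 (show |s - τ| < δ from hs)
      rcases lt_or_gt_of_ne (show s ≠ τ from hne) with hlt | hlt
      · refine of_isPreconnected hε isPreconnected_Ioo (fun x hx => hsim x ?_ hx.2.ne)
          (s := s) ⟨by linarith, hlt⟩ ht h1
        rw [abs_lt]; constructor <;> linarith [hx.1, hx.2]
      · refine of_isPreconnected hε isPreconnected_Ioo (fun x hx => hsim x ?_ hx.1.ne')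
          (s := s) ⟨hlt, by linarith⟩ ht' h2
        rw [abs_lt]; constructor <;> linarith [hx.1, hx.2]
  have hmem : ∀ {t c}, IsKinkClass D ε t c → t ∈ Ioo (0 : ℝ) 1 := by
    rintro t c ⟨K, B, a, b, h, hab, -⟩
    exact h.mem_Ioo hab
  -- Two classes that are valid on punctured neighbourhoods of the same time agree by uniqueness, so
  -- they propagate along the whole interval, including non-simple times.
  obtain ⟨d, h1, h2⟩ := isPreconnected_Ioo.induction₂
    (fun x y => ∃ c, (∀ᶠ s in 𝓝[≠] x, IsKinkClass D ε s c) ∧ ∀ᶠ s in 𝓝[≠] y, IsKinkClass D ε s c)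
    (fun x hx => by
      obtain ⟨c, hc⟩ := hex x hx
      refine nhdsWithin_le_nhds ?_
      rw [eventually_nhdsWithin_iff] at hc
      filter_upwards [hc] with y hy
      refine ⟨c, eventually_nhdsWithin_iff.2 hc, ?_⟩
      by_cases hxy : y = x
      · rw [hxy]; exact eventually_nhdsWithin_iff.2 hc
      · exact nhdsWithin_le_nhds (hy hxy).eventually)
    (fun x y z _ _ _ ⟨c, h1, h2⟩ ⟨c', h3, h4⟩ => ⟨c, h1, by
      obtain ⟨s, hs, hs'⟩ := (h2.and h3).exists
      rwa [hs.unique hε hs']⟩)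
    (fun x y _ _ ⟨c, h1, h2⟩ => ⟨c, h2, h1⟩) (hmem h) (hmem h')
  obtain ⟨s, hs, hs'⟩ := (h1.and (nhdsWithin_le_nhds h.eventually)).exists
  obtain ⟨r, hr, hr'⟩ := (h2.and (nhdsWithin_le_nhds h'.eventually)).exists
  rw [hs'.unique hε hs, hr'.unique hε hr]

end IsKinkClass

/-! ### Reparametrized diagrams -/

namespace KnotoidDiagram

/-- Reparametrization of a diagram. -/
def reparam (D : KnotoidDiagram) {h : ℝ → ℝ} (hh : IsReparam h) : KnotoidDiagram where
  curve t := D.curve (h t)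
  -- The restriction to the unit interval is necessary because `h` is not controlled outside and
  -- might send other times to upper ones.
  upper := {t | t ∈ Icc (0 : ℝ) 1 ∧ h t ∈ D.upper}
  smooth := D.smooth.comp hh.smooth
  immersion t ht := by
    have h1 : HasDerivAt (fun t => D.curve (h t)) (deriv h t • deriv D.curve (h t)) t :=
      (D.hasDerivAt (h t)).scomp t (hh.smooth.differentiable (by simp) t).hasDerivAt
    rw [h1.deriv]
    exact smul_ne_zero (hh.deriv_pos t ht).ne' (D.immersion _ (hh.mapsTo_Icc ht))
  no_triple s hs t ht u hu h1 h2 := by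
    have := D.no_triple _ (hh.mapsTo_Icc hs) _ (hh.mapsTo_Icc ht) _ (hh.mapsTo_Icc hu) h1 h2
    rwa [hh.strictMonoOn.injOn.eq_iff hs ht, hh.strictMonoOn.injOn.eq_iff ht hu,
      hh.strictMonoOn.injOn.eq_iff hs hu] at this
  transversal s hs t ht hst he := by
    have h1 : ∀ t, HasDerivAt (fun t => D.curve (h t)) (deriv h t • deriv D.curve (h t)) t :=
      fun t => (D.hasDerivAt (h t)).scomp t (hh.smooth.differentiable (by simp) t).hasDerivAt
    rw [(h1 s).deriv, (h1 t).deriv, Complex.real_smul, Complex.real_smul, planeDet_smul_left,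
      planeDet_smul_right]
    exact mul_ne_zero (hh.deriv_pos s hs).ne' (mul_ne_zero (hh.deriv_pos t ht).ne'
      (D.transversal _ (hh.mapsTo_Icc hs) _ (hh.mapsTo_Icc ht)
        (fun he => hst (hh.strictMonoOn.injOn hs ht he)) he))
  endpoints_simple s hs t ht hst he := by
    have h1 := D.endpoints_simple _ (hh.mapsTo_Icc hs) _ (hh.mapsTo_Icc ht)
        (fun he => hst (hh.strictMonoOn.injOn hs ht he)) he
    refine ⟨hs.1.lt_of_ne fun h0 => ?_, hs.2.lt_of_ne fun h0 => ?_⟩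
    · rw [← h0, hh.zero] at h1; exact h1.1.false
    · rw [h0, hh.one] at h1; exact h1.2.false
  upper_crossing s hs := by
    obtain ⟨h1, h2⟩ := hs
    obtain ⟨-, t, ht, hne, he⟩ := D.upper_crossing _ h2
    obtain ⟨t, ht', rfl⟩ := hh.surjOn_Icc ht
    exact ⟨h1, t, ht', fun h => hne (h ▸ rfl), he⟩
  upper_iff s hs t ht hst he := by
    have h1 := D.upper_iff _ (hh.mapsTo_Icc hs) _ (hh.mapsTo_Icc ht)
        (fun he => hst (hh.strictMonoOn.injOn hs ht he)) he
    simp only [mem_ofPred_eq, hs, ht, true_and]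
    exact h1

variable {D : KnotoidDiagram} {h : ℝ → ℝ} (hh : IsReparam h)

theorem deriv_reparam (t : ℝ) : deriv (D.reparam hh).curve t = deriv h t * deriv D.curve (h t) := by
  have h1 : HasDerivAt (fun t => D.curve (h t)) (deriv h t • deriv D.curve (h t)) t :=
    (D.hasDerivAt (h t)).scomp t (hh.smooth.differentiable (by simp) t).hasDerivAt
  rw [Complex.real_smul] at h1
  exact h1.deriv

theorem mem_crossings_reparam {p : ℝ × ℝ} : p ∈ (D.reparam hh).crossings ↔
    p.1 ∈ Icc (0 : ℝ) 1 ∧ p.2 ∈ Icc (0 : ℝ) 1 ∧ (h p.1, h p.2) ∈ D.crossings := by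
  constructor
  · rintro ⟨h1, h2, h3, h4, h5⟩
    exact ⟨h1, h2, hh.mapsTo_Icc h1, hh.mapsTo_Icc h2,
      fun he => h3 (hh.strictMonoOn.injOn h1 h2 he), h4, h5.2⟩
  · rintro ⟨h1, h2, -, -, h5, h6, h7⟩
    exact ⟨h1, h2, fun he => h5 (congrArg h he), h6, h1, h7⟩

theorem crossingSign_reparam {p : ℝ × ℝ} (h1 : p.1 ∈ Icc (0 : ℝ) 1) (h2 : p.2 ∈ Icc (0 : ℝ) 1) :
    (D.reparam hh).crossingSign p = D.crossingSign (h p.1, h p.2) := by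
  rw [crossingSign, crossingSign, deriv_reparam, deriv_reparam, planeDet_smul_left,
    planeDet_smul_right, sign_mul, sign_mul, sign_pos (hh.deriv_pos _ h1),
    sign_pos (hh.deriv_pos _ h2), one_mul, one_mul]

end KnotoidDiagram

section Reparam

variable {D K : KnotoidDiagram} {B : Set ℂ} {h : ℝ → ℝ} (hh : IsReparam h)

include hh in
theorem IsReparam.mem_Icc_iff {a b t : ℝ} (ha : a ∈ Icc (0 : ℝ) 1) (hb : b ∈ Icc (0 : ℝ) 1)
    (ht : t ∈ Icc (0 : ℝ) 1) : h t ∈ Icc (h a) (h b) ↔ t ∈ Icc a b := by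
  rw [mem_Icc, mem_Icc, hh.strictMonoOn.le_iff_le ha ht, hh.strictMonoOn.le_iff_le ht hb]

include hh in
theorem IsReparam.mem_Ioo_iff {a b t : ℝ} (ha : a ∈ Icc (0 : ℝ) 1) (hb : b ∈ Icc (0 : ℝ) 1)
    (ht : t ∈ Icc (0 : ℝ) 1) : h t ∈ Ioo (h a) (h b) ↔ t ∈ Ioo a b := by
  rw [mem_Ioo, mem_Ioo, hh.strictMonoOn.lt_iff_lt ha ht, hh.strictMonoOn.lt_iff_lt ht hb]

theorem MeetsDiscInArcs.reparam {n : ℕ} {a b : Fin n → ℝ} (ha : ∀ i, a i ∈ Icc (0 : ℝ) 1)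
    (hb : ∀ i, b i ∈ Icc (0 : ℝ) 1)
    (hm : MeetsDiscInArcs D B (fun i => h (a i)) (fun i => h (b i))) :
    MeetsDiscInArcs (D.reparam hh) B a b := by
  refine ⟨fun t ht => ?_, fun t ht => ?_, fun p hp => ⟨hp.1, ?_⟩⟩
  · exact (hm.1 _ (hh.mapsTo_Icc ht)).trans
      (exists_congr fun i => hh.mem_Icc_iff (ha i) (hb i) ht)
  · exact (hm.2.1 _ (hh.mapsTo_Icc ht)).trans
      (exists_congr fun i => hh.mem_Ioo_iff (ha i) (hb i) ht)
  · have h1 := ((KnotoidDiagram.mem_crossings_reparam hh).1 hp.1).2.2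
    exact (hm.2.2 (⟨h1, hp.2⟩ : (h p.1, h p.2) ∈ D.crossingsIn B)).2

theorem LocalChange.reparam {n : ℕ} {a b : Fin n → ℝ} (ha : ∀ i, a i ∈ Ioo (0 : ℝ) 1)
    (hb : ∀ i, b i ∈ Ioo (0 : ℝ) 1)
    (hl : LocalChange D K B (fun i => h (a i)) (fun i => h (b i))) :
    LocalChange (D.reparam hh) (K.reparam hh) B a b where
  disc := hl.disc
  arcs i := ⟨(ha i).1, (hh.strictMonoOn.lt_iff_lt (Ioo_subset_Icc_self (ha i))
    (Ioo_subset_Icc_self (hb i))).1 (hl.arcs i).2.1, (hb i).2⟩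
  disjoint i j hij := by
    rw [Set.disjoint_left]
    intro t h1 h2
    have ht : t ∈ Icc (0 : ℝ) 1 := ⟨(ha i).1.le.trans h1.1, h1.2.trans (hb i).2.le⟩
    have hI : ∀ i, a i ∈ Icc (0 : ℝ) 1 := fun i => Ioo_subset_Icc_self (ha i)
    have hJ : ∀ i, b i ∈ Icc (0 : ℝ) 1 := fun i => Ioo_subset_Icc_self (hb i)
    exact disjoint_left.1 (hl.disjoint i j hij) ((hh.mem_Icc_iff (hI i) (hJ i) ht).2 h1)
      ((hh.mem_Icc_iff (hI j) (hJ j) ht).2 h2)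
  meets := hl.meets.reparam hh (fun i => Ioo_subset_Icc_self (ha i))
    fun i => Ioo_subset_Icc_self (hb i)
  meets' := hl.meets'.reparam hh (fun i => Ioo_subset_Icc_self (ha i))
    fun i => Ioo_subset_Icc_self (hb i)
  outside t ht hi := by
    have := hl.outside (h t) (hh.mapsTo_Icc ht) fun i hti => hi i
      ((hh.mem_Ioo_iff (Ioo_subset_Icc_self (ha i)) (Ioo_subset_Icc_self (hb i)) ht).1 hti)
    exact ⟨this.1, and_congr_right fun _ => this.2⟩

theorem AddsKink.reparam {a b : ℝ} {ε : ℤ} (ha : a ∈ Ioo (0 : ℝ) 1) (hb : b ∈ Ioo (0 : ℝ) 1)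
    (hk : AddsKink D K B (h a) (h b) ε) : AddsKink (D.reparam hh) (K.reparam hh) B a b ε := by
  obtain ⟨hl, h0, ⟨q₁, q₂⟩, hq, hs⟩ := hk
  refine ⟨hl.reparam hh (fun _ => ha) fun _ => hb, ?_, ?_⟩
  · refine eq_empty_of_forall_notMem fun p hp => ?_
    have h1 : (h p.1, h p.2) ∈ D.crossingsIn B :=
      ⟨((KnotoidDiagram.mem_crossings_reparam hh).1 hp.1).2.2, hp.2⟩
    rw [h0] at h1
    exact h1
  · have hmem : (q₁, q₂) ∈ K.crossingsIn B := by rw [hq]; rfl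
    obtain ⟨p₁, hp₁, rfl⟩ := hh.surjOn_Icc hmem.1.1
    obtain ⟨p₂, hp₂, rfl⟩ := hh.surjOn_Icc hmem.1.2.1
    refine ⟨(p₁, p₂), ?_, by rw [KnotoidDiagram.crossingSign_reparam hh hp₁ hp₂]; exact hs⟩
    ext p
    constructor
    · intro hp
      have h1 := (KnotoidDiagram.mem_crossings_reparam hh).1 hp.1
      have h2 : (h p.1, h p.2) ∈ K.crossingsIn B := ⟨h1.2.2, hp.2⟩
      rw [hq, mem_singleton_iff, Prod.mk.injEq, hh.strictMonoOn.injOn.eq_iff h1.1 hp₁,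
        hh.strictMonoOn.injOn.eq_iff h1.2.1 hp₂] at h2
      exact Prod.ext h2.1 h2.2
    · rintro rfl
      exact ⟨(KnotoidDiagram.mem_crossings_reparam hh).2 ⟨hp₁, hp₂, hmem.1⟩, hmem.2⟩

end Reparam

/-! ### Diagrams that agree on the unit interval -/

/-- The curve outside the unit interval is part of the structure but irrelevant to the moves. This
allows diagrams that are equal only on the interval to be exchanged. -/
theorem AddsKink.congr_left {D D' K : KnotoidDiagram} {B : Set ℂ} {a b : ℝ} {ε : ℤ}
    (hD : ∀ t ∈ Icc (0 : ℝ) 1, D'.curve t = D.curve t ∧ (t ∈ D'.upper ↔ t ∈ D.upper))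
    (h : AddsKink D K B a b ε) : AddsKink D' K B a b ε := by
  have hcr : ∀ p, p ∈ D'.crossings ↔ p ∈ D.crossings := by
    intro p
    constructor
    · rintro ⟨h1, h2, h3, h4, h5⟩
      exact ⟨h1, h2, h3, by rw [← (hD _ h1).1, h4, (hD _ h2).1], (hD _ h1).2.1 h5⟩
    · rintro ⟨h1, h2, h3, h4, h5⟩
      exact ⟨h1, h2, h3, by rw [(hD _ h1).1, h4, (hD _ h2).1], (hD _ h1).2.2 h5⟩
  have hin : ∀ C, D'.crossingsIn C = D.crossingsIn C := by
    intro C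
    ext p
    constructor
    · rintro ⟨h1, h2⟩
      exact ⟨(hcr p).1 h1, by rw [← (hD _ h1.1).1]; exact h2⟩
    · rintro ⟨h1, h2⟩
      exact ⟨(hcr p).2 h1, by rw [(hD _ h1.1).1]; exact h2⟩
  obtain ⟨hl, h0, hp⟩ := h
  refine ⟨⟨hl.disc, hl.arcs, hl.disjoint, ⟨fun t ht => ?_, fun t ht => ?_, ?_⟩, hl.meets',
    fun t ht hi => ?_⟩, by rw [hin, h0], hp⟩
  · rw [(hD t ht).1]; exact hl.meets.1 t ht
  · rw [(hD t ht).1]; exact hl.meets.2.1 t ht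
  · rw [hin, hin]; exact hl.meets.2.2
  · exact ⟨(hl.outside t ht hi).1.trans (hD t ht).1.symm,
      (hl.outside t ht hi).2.trans (hD t ht).2.symm⟩

theorem AmbientIsotopy.orientation_eq (F : AmbientIsotopy) (s : ℝ) :
    PlaneDiffeo.orientation (F.toDiffeo s) = 1 := by
  rw [PlaneDiffeo.orientation, sign_pos (F.jac_pos s 0)]
  rfl

/-- Kinks are carried along by isotopies. -/
theorem IsKinkClass.of_isotopyCarries {D D' : KnotoidDiagram} {F : AmbientIsotopy} {h : ℝ → ℝ}
    (hh : IsReparam h) (hD : ∀ t ∈ Icc (0 : ℝ) 1,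
      D'.curve t = F.toDiffeo 1 (D.curve (h t)) ∧ (t ∈ D'.upper ↔ h t ∈ D.upper))
    {ε : ℤ} {t : ℝ} {c : Quot RegularStep} (ht : t ∈ Icc (0 : ℝ) 1)
    (hc : IsKinkClass D ε (h t) c) : IsKinkClass D' ε t c := by
  obtain ⟨K, B, a, b, hk, hab, rfl⟩ := hc
  have h0 := hk.1.arcs 0
  have key : ∀ x ∈ Ioo (0 : ℝ) 1, ∃ y ∈ Ioo (0 : ℝ) 1, h y = x := by
    intro x hx
    obtain ⟨y, hy, rfl⟩ := hh.surjOn_Icc (Ioo_subset_Icc_self hx)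
    refine ⟨y, ⟨hy.1.lt_of_ne fun h0 => ?_, hy.2.lt_of_ne fun h0 => ?_⟩, rfl⟩
    · rw [← h0, hh.zero] at hx; exact hx.1.false
    · rw [h0, hh.one] at hx; exact hx.2.false
  obtain ⟨a, ha, rfl⟩ := key a ⟨h0.1, h0.2.1.trans h0.2.2⟩
  obtain ⟨b, hb, rfl⟩ := key b ⟨h0.1.trans h0.2.1, h0.2.2⟩
  have hD' : ∀ s ∈ Icc (0 : ℝ) 1, D'.curve s = ((D.reparam hh).map (F.toDiffeo 1)).curve s ∧
      (s ∈ D'.upper ↔ s ∈ ((D.reparam hh).map (F.toDiffeo 1)).upper) := fun s hs =>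
    ⟨(hD s hs).1, (hD s hs).2.trans ⟨fun h => ⟨hs, h⟩, fun h => h.2⟩⟩
  have hk' := ((hk.reparam hh ha hb).map (F.toDiffeo 1)).congr_left hD'
  rw [F.orientation_eq, one_mul] at hk'
  refine ⟨_, _, a, b, hk',
    (hh.mem_Ioo_iff (Ioo_subset_Icc_self ha) (Ioo_subset_Icc_self hb) ht).1 hab,
    (Quot.sound (.isotopy F ⟨h, hh, fun s hs => ⟨rfl, ?_⟩⟩)).symm⟩
  exact ⟨fun h => h.2, fun h => ⟨hs, h⟩⟩

/-! ### Local changes in disjoint discs -/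

/-- The diagrams agree at the times outside of the given arcs. -/
def AgreeOff (D D' : KnotoidDiagram) {n : ℕ} (a b : Fin n → ℝ) : Prop :=
  ∀ t ∈ Icc (0 : ℝ) 1, (∀ i, t ∉ Icc (a i) (b i)) → D'.curve t = D.curve t ∧
    deriv D'.curve t = deriv D.curve t ∧ (t ∈ D'.upper ↔ t ∈ D.upper)

theorem LocalChange.agreeOff {D D' : KnotoidDiagram} {B : Set ℂ} {n : ℕ} {a b : Fin n → ℝ}
    (h : LocalChange D D' B a b) : AgreeOff D D' a b := fun t ht hi =>
  ⟨h.eq_outside ht hi, h.deriv_eq ht hi,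
    (h.outside t ht fun i hti => hi i (Ioo_subset_Icc_self hti)).2⟩

namespace AgreeOff

variable {D D' : KnotoidDiagram} {B : Set ℂ} {m n : ℕ} {a b : Fin m → ℝ} {a' b' : Fin n → ℝ}

theorem symm (h : AgreeOff D D' a' b') : AgreeOff D' D a' b' := fun t ht hi =>
  ⟨(h t ht hi).1.symm, (h t ht hi).2.1.symm, (h t ht hi).2.2.symm⟩

variable (h : AgreeOff D D' a' b')
  (hB : ∀ t ∈ Icc (0 : ℝ) 1, ∀ j, t ∈ Icc (a' j) (b' j) → D.curve t ∉ B)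
  (hB' : ∀ t ∈ Icc (0 : ℝ) 1, ∀ j, t ∈ Icc (a' j) (b' j) → D'.curve t ∉ B)
include h hB hB'

theorem curve_mem_iff {C : Set ℂ} (hC : C ⊆ B) {t : ℝ} (ht : t ∈ Icc (0 : ℝ) 1) :
    D'.curve t ∈ C ↔ D.curve t ∈ C := by
  by_cases hj : ∃ j, t ∈ Icc (a' j) (b' j)
  · obtain ⟨j, hj⟩ := hj
    exact iff_of_false (fun h => hB' t ht j hj (hC h)) fun h => hB t ht j hj (hC h)
  · rw [(h t ht (not_exists.1 hj)).1]

omit hB' in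
theorem crossingsIn_subset {C : Set ℂ} (hC : C ⊆ B) :
    ∀ p ∈ D.crossingsIn C, p ∈ D'.crossingsIn C ∧ D'.crossingSign p = D.crossingSign p := by
  rintro p ⟨⟨h1, h2, h3, h4, h5⟩, hp⟩
  have n1 : ∀ j, p.1 ∉ Icc (a' j) (b' j) := fun j hj => hB _ h1 j hj (hC hp)
  have n2 : ∀ j, p.2 ∉ Icc (a' j) (b' j) := fun j hj => hB _ h2 j hj (h4 ▸ hC hp)
  obtain ⟨e1, d1, u1⟩ := h _ h1 n1
  obtain ⟨e2, d2, -⟩ := h _ h2 n2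
  refine ⟨⟨⟨h1, h2, h3, by rw [e1, e2, h4], u1.2 h5⟩, by rw [e1]; exact hp⟩, ?_⟩
  rw [KnotoidDiagram.crossingSign, KnotoidDiagram.crossingSign, d1, d2]

theorem crossingsIn_eq {C : Set ℂ} (hC : C ⊆ B) : D'.crossingsIn C = D.crossingsIn C :=
  Subset.antisymm (fun p hp => (h.symm.crossingsIn_subset hB' hC p hp).1)
    fun p hp => (h.crossingsIn_subset hB hC p hp).1

theorem meetsDiscInArcs (hm : MeetsDiscInArcs D B a b) : MeetsDiscInArcs D' B a b := by
  refine ⟨fun t ht => ?_, fun t ht => ?_, ?_⟩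
  · rw [h.curve_mem_iff hB hB' Subset.rfl ht]; exact hm.1 t ht
  · rw [h.curve_mem_iff hB hB' interior_subset ht]; exact hm.2.1 t ht
  · rw [h.crossingsIn_eq hB hB' Subset.rfl, h.crossingsIn_eq hB hB' interior_subset]
    exact hm.2.2

end AgreeOff

section Merge

variable {D K D' : KnotoidDiagram} {B₁ B₂ : Set ℂ} {m n : ℕ} {a₁ b₁ : Fin m → ℝ}
  {a₂ b₂ : Fin n → ℝ}

theorem LocalChange.notMem_of_disjoint (h : LocalChange D K B₁ a₁ b₁) (hB : Disjoint B₁ B₂) {t : ℝ}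
    {i : Fin m} (hi : t ∈ Icc (a₁ i) (b₁ i)) : D.curve t ∉ B₂ ∧ K.curve t ∉ B₂ := by
  have ht := Ioo_subset_Icc_self (h.Icc_subset i hi)
  exact ⟨fun hB2 => disjoint_left.1 hB ((h.meets.1 t ht).2 ⟨i, hi⟩) hB2,
    fun hB2 => disjoint_left.1 hB ((h.meets'.1 t ht).2 ⟨i, hi⟩) hB2⟩

theorem LocalChange.disjoint_arcs (h₁ : LocalChange D K B₁ a₁ b₁) (h₂ : LocalChange D D' B₂ a₂ b₂)
    (hB : Disjoint B₁ B₂) {t : ℝ} {i : Fin m} (hi : t ∈ Icc (a₁ i) (b₁ i)) (j : Fin n) :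
    t ∉ Icc (a₂ j) (b₂ j) := fun hj =>
  (h₁.notMem_of_disjoint hB hi).1
    ((h₂.meets.1 t (Ioo_subset_Icc_self (h₁.Icc_subset i hi))).2 ⟨j, hj⟩)

/-- A local change can be transported along a second one in a disjoint disc. -/
theorem LocalChange.transport {K' : KnotoidDiagram} (h₁ : LocalChange D K B₁ a₁ b₁)
    (h₂ : LocalChange D D' B₂ a₂ b₂) (hB : Disjoint B₁ B₂) (hK : AgreeOff K K' a₂ b₂)
    (hD' : AgreeOff D' K' a₁ b₁) : LocalChange D' K' B₁ a₁ b₁ ∧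
      D'.crossingsIn B₁ = D.crossingsIn B₁ ∧ K'.crossingsIn B₁ = K.crossingsIn B₁ ∧
      (∀ p ∈ D.crossingsIn B₁, D'.crossingSign p = D.crossingSign p) ∧
      ∀ p ∈ K.crossingsIn B₁, K'.crossingSign p = K.crossingSign p := by
  have n1 : ∀ t ∈ Icc (0 : ℝ) 1, ∀ j, t ∈ Icc (a₂ j) (b₂ j) → D.curve t ∉ B₁ :=
    fun t _ j hj => (h₂.notMem_of_disjoint hB.symm hj).1
  have n2 : ∀ t ∈ Icc (0 : ℝ) 1, ∀ j, t ∈ Icc (a₂ j) (b₂ j) → D'.curve t ∉ B₁ :=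
    fun t _ j hj => (h₂.notMem_of_disjoint hB.symm hj).2
  have hoff : ∀ {t} j, t ∈ Icc (a₂ j) (b₂ j) → ∀ i, t ∉ Icc (a₁ i) (b₁ i) :=
    fun j hj i => h₂.disjoint_arcs h₁ hB.symm hj i
  have n3 : ∀ t ∈ Icc (0 : ℝ) 1, ∀ j, t ∈ Icc (a₂ j) (b₂ j) → K.curve t ∉ B₁ :=
    fun t ht j hj => by rw [h₁.eq_outside ht (hoff j hj)]; exact n1 t ht j hj
  have n4 : ∀ t ∈ Icc (0 : ℝ) 1, ∀ j, t ∈ Icc (a₂ j) (b₂ j) → K'.curve t ∉ B₁ :=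
    fun t ht j hj => by rw [(hD' t ht (hoff j hj)).1]; exact n2 t ht j hj
  refine ⟨⟨h₁.disc, h₁.arcs, h₁.disjoint, h₂.agreeOff.meetsDiscInArcs n1 n2 h₁.meets,
    hK.meetsDiscInArcs n3 n4 h₁.meets', fun t ht hi => ?_⟩,
    h₂.agreeOff.crossingsIn_eq n1 n2 Subset.rfl, hK.crossingsIn_eq n3 n4 Subset.rfl,
    fun p hp => (h₂.agreeOff.crossingsIn_subset n1 Subset.rfl p hp).2,
    fun p hp => (hK.crossingsIn_subset n3 Subset.rfl p hp).2⟩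
  by_cases hj : ∃ j, t ∈ Icc (a₂ j) (b₂ j)
  · obtain ⟨j, hj⟩ := hj
    have := hD' t ht (hoff j hj)
    exact ⟨this.1, this.2.2⟩
  · have e1 := hK t ht (not_exists.1 hj)
    have e2 := h₂.agreeOff t ht (not_exists.1 hj)
    have e3 := h₁.outside t ht hi
    exact ⟨by rw [e1.1, e3.1, e2.1], by rw [e1.2.2, e3.2, e2.2.2]⟩

/-- Two local changes in disjoint discs can be carried out simultaneously. -/
theorem LocalChange.exists_merge (h₁ : LocalChange D K B₁ a₁ b₁) (h₂ : LocalChange D D' B₂ a₂ b₂)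
    (hB : Disjoint B₁ B₂) :
    ∃ K' : KnotoidDiagram, AgreeOff K K' a₂ b₂ ∧ AgreeOff D' K' a₁ b₁ := by
  classical
  -- Both modifications are added. The discs are disjoint, so at each time at least one of the two
  -- differences vanishes.
  let γ : ℝ → ℂ := fun t => K.curve t + (D'.curve t - D.curve t)
  have hγd : ∀ t, deriv γ t = deriv K.curve t + (deriv D'.curve t - deriv D.curve t) := fun t =>
    ((K.hasDerivAt t).add ((D'.hasDerivAt t).sub (D.hasDerivAt t))).deriv
  have f1 : ∀ t ∈ Icc (0 : ℝ) 1, (∀ j, t ∉ Icc (a₂ j) (b₂ j)) →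
      γ t = K.curve t ∧ deriv γ t = deriv K.curve t := by
    intro t ht hj
    rw [hγd, h₂.deriv_eq ht hj, sub_self, add_zero]
    exact ⟨by simp only [γ]; rw [h₂.eq_outside ht hj, sub_self, add_zero], rfl⟩
  have f2 : ∀ t ∈ Icc (0 : ℝ) 1, (∀ i, t ∉ Icc (a₁ i) (b₁ i)) →
      γ t = D'.curve t ∧ deriv γ t = deriv D'.curve t := by
    intro t ht hi
    rw [hγd, h₁.deriv_eq ht hi, add_sub_cancel]
    exact ⟨by simp only [γ]; rw [h₁.eq_outside ht hi, add_sub_cancel], rfl⟩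
  have hoff : ∀ {t} i, t ∈ Icc (a₁ i) (b₁ i) → ∀ j, t ∉ Icc (a₂ j) (b₂ j) :=
    fun i hi j => h₁.disjoint_arcs h₂ hB hi j
  -- A time belongs to the first set of arcs exactly if its point lies in `B₁`. Times with the same
  -- image are therefore on the same side of this distinction, and each condition for a diagram
  -- reduces to that for `K` or for `D'`.
  let In : ℝ → Prop := fun t => ∃ i, t ∈ Icc (a₁ i) (b₁ i)
  have g1 : ∀ t ∈ Icc (0 : ℝ) 1, In t → γ t = K.curve t ∧ deriv γ t = deriv K.curve t :=
    fun t ht ⟨i, hi⟩ => f1 t ht (hoff i hi)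
  have g2 : ∀ t ∈ Icc (0 : ℝ) 1, ¬ In t → γ t = D'.curve t ∧ deriv γ t = deriv D'.curve t :=
    fun t ht hi => f2 t ht (not_exists.1 hi)
  have hD'in : ∀ t ∈ Icc (0 : ℝ) 1, D'.curve t ∈ B₁ ↔ In t := by
    intro t ht
    rw [h₂.agreeOff.curve_mem_iff (B := B₁) (fun t _ j hj => (h₂.notMem_of_disjoint hB.symm hj).1)
      (fun t _ j hj => (h₂.notMem_of_disjoint hB.symm hj).2) Subset.rfl ht]
    exact h₁.meets.1 t ht
  have hγin : ∀ t ∈ Icc (0 : ℝ) 1, γ t ∈ B₁ ↔ In t := by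
    intro t ht
    by_cases hi : In t
    · rw [(g1 t ht hi).1]; exact h₁.meets'.1 t ht
    · rw [(g2 t ht hi).1]; exact hD'in t ht
  have hsame : ∀ s ∈ Icc (0 : ℝ) 1, ∀ t ∈ Icc (0 : ℝ) 1, γ s = γ t → (In s ↔ In t) := by
    intro s hs t ht he
    rw [← hγin s hs, ← hγin t ht, he]
  let K' : KnotoidDiagram :=
    { curve := γ
      upper := {t | t ∈ Icc (0 : ℝ) 1 ∧ if In t then t ∈ K.upper else t ∈ D'.upper}
      smooth := K.smooth.add (D'.smooth.sub D.smooth)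
      immersion := fun t ht => by
        by_cases hi : In t
        · rw [(g1 t ht hi).2]; exact K.immersion t ht
        · rw [(g2 t ht hi).2]; exact D'.immersion t ht
      no_triple := fun s hs t ht u hu h1 h2 => by
        have i1 := hsame s hs t ht h1
        have i2 := hsame t ht u hu h2
        by_cases hi : In t
        · rw [(g1 s hs (i1.2 hi)).1, (g1 t ht hi).1] at h1
          rw [(g1 t ht hi).1, (g1 u hu (i2.1 hi)).1] at h2
          exact K.no_triple s hs t ht u hu h1 h2
        · rw [(g2 s hs (i1.not.2 hi)).1, (g2 t ht hi).1] at h1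
          rw [(g2 t ht hi).1, (g2 u hu (i2.not.1 hi)).1] at h2
          exact D'.no_triple s hs t ht u hu h1 h2
      transversal := fun s hs t ht hne h1 => by
        have i1 := hsame s hs t ht h1
        by_cases hi : In t
        · rw [(g1 s hs (i1.2 hi)).1, (g1 t ht hi).1] at h1
          rw [(g1 s hs (i1.2 hi)).2, (g1 t ht hi).2]
          exact K.transversal s hs t ht hne h1
        · rw [(g2 s hs (i1.not.2 hi)).1, (g2 t ht hi).1] at h1
          rw [(g2 s hs (i1.not.2 hi)).2, (g2 t ht hi).2]
          exact D'.transversal s hs t ht hne h1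
      endpoints_simple := fun s hs t ht hne h1 => by
        have i1 := hsame s hs t ht h1
        by_cases hi : In t
        · rw [(g1 s hs (i1.2 hi)).1, (g1 t ht hi).1] at h1
          exact K.endpoints_simple s hs t ht hne h1
        · rw [(g2 s hs (i1.not.2 hi)).1, (g2 t ht hi).1] at h1
          exact D'.endpoints_simple s hs t ht hne h1
      upper_crossing := fun s ⟨hs, hu⟩ => by
        refine ⟨hs, ?_⟩
        by_cases hi : In s
        · rw [if_pos hi] at hu
          obtain ⟨-, t, ht, hne, he⟩ := K.upper_crossing s hu
          have hi' : In t := (h₁.meets'.1 t ht).1 (he ▸ (h₁.meets'.1 s hs).2 hi)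
          exact ⟨t, ht, hne, by rw [(g1 s hs hi).1, (g1 t ht hi').1, he]⟩
        · rw [if_neg hi] at hu
          obtain ⟨-, t, ht, hne, he⟩ := D'.upper_crossing s hu
          have hi' : ¬ In t := fun h => hi ((hD'in s hs).1 (he ▸ (hD'in t ht).2 h))
          exact ⟨t, ht, hne, by rw [(g2 s hs hi).1, (g2 t ht hi').1, he]⟩
      upper_iff := fun s hs t ht hne h1 => by
        have i1 := hsame s hs t ht h1
        simp only [mem_ofPred_eq, hs, ht, true_and]
        by_cases hi : In t
        · rw [(g1 s hs (i1.2 hi)).1, (g1 t ht hi).1] at h1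
          rw [if_pos hi, if_pos (i1.2 hi)]
          exact K.upper_iff s hs t ht hne h1
        · rw [(g2 s hs (i1.not.2 hi)).1, (g2 t ht hi).1] at h1
          rw [if_neg hi, if_neg (i1.not.2 hi)]
          exact D'.upper_iff s hs t ht hne h1 }
  have hup : ∀ t ∈ Icc (0 : ℝ) 1, t ∈ K'.upper ↔ if In t then t ∈ K.upper else t ∈ D'.upper :=
    fun t ht => and_iff_right ht
  refine ⟨K', fun t ht hj => ⟨(f1 t ht hj).1, (f1 t ht hj).2, ?_⟩,
    fun t ht hi => ⟨(f2 t ht hi).1, (f2 t ht hi).2, ?_⟩⟩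
  · rw [hup t ht]
    by_cases hi : In t
    · rw [if_pos hi]
    · rw [if_neg hi, (h₂.agreeOff t ht hj).2.2, (h₁.agreeOff t ht (not_exists.1 hi)).2.2]
  · rw [hup t ht, if_neg (not_exists.2 hi)]

end Merge

/-! ### Kinks and Reidemeister moves -/

section Moves

variable {D K D' K' : KnotoidDiagram} {B B₂ : Set ℂ} {a b : ℝ} {ε : ℤ} {n : ℕ} {a₂ b₂ : Fin n → ℝ}

theorem AddsKink.transport (h : AddsKink D K B a b ε) (h₂ : LocalChange D D' B₂ a₂ b₂)
    (hB : Disjoint B B₂) (hK : AgreeOff K K' a₂ b₂)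
    (hD' : AgreeOff D' K' (fun _ : Fin 1 => a) fun _ : Fin 1 => b) : AddsKink D' K' B a b ε := by
  obtain ⟨hl, h0, p, hp, hs⟩ := h
  obtain ⟨t1, t2, t3, -, t5⟩ := hl.transport h₂ hB hK hD'
  exact ⟨t1, by rw [t2, h0], p, by rw [t3, hp], by rw [t5 p (by rw [hp]; rfl), hs]⟩

/-- A small kink away from a given disc. -/
theorem LocalChange.exists_kink (h₂ : LocalChange D D' B₂ a₂ b₂) (hε : ε = 1 ∨ ε = -1) :
    ∃ K B a b, AddsKink D K B a b ε ∧ Disjoint B B₂ := by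
  -- The leg lies outside the disc, so all sufficiently early times avoid the arcs, and a simple one
  -- among them carries the kink.
  have hfin : ∃ δ > 0, δ < 1 ∧ ∀ t ∈ Ioo (0 : ℝ) δ, ∀ j, t ∉ Icc (a₂ j) (b₂ j) := by
    have hev : ∀ᶠ t in 𝓝 (0 : ℝ), ∀ j, t ∉ Icc (a₂ j) (b₂ j) :=
      eventually_all.2 fun j => isClosed_Icc.isOpen_compl.mem_nhds (h₂.zero_notMem j)
    obtain ⟨δ, hδ, hball⟩ := Metric.eventually_nhds_iff.1 hev
    refine ⟨min δ (1 / 2), by positivity, by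
      exact (min_le_right _ _).trans_lt (by norm_num), fun t ht => hball ?_⟩
    rw [Real.dist_eq, sub_zero, abs_of_pos ht.1]
    exact ht.2.trans_le (min_le_left _ _)
  obtain ⟨δ, hδ, hδ1, hn⟩ := hfin
  obtain ⟨t, ht, hs⟩ := D.exists_isSimple hδ le_rfl hδ1.le
  have ht01 : t ∈ Ioo (0 : ℝ) 1 := ⟨ht.1, ht.2.trans hδ1⟩
  have hout : D.curve t ∈ B₂ᶜ := fun hB => by
    obtain ⟨j, hj⟩ := (h₂.meets.1 t (Ioo_subset_Icc_self ht01)).1 hB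
    exact hn t ht j hj
  obtain ⟨K, -, B, -, a, b, -, -, hk, -, hB, -⟩ := exists_nested_kinks D ht01 hs
    (h₂.disc.isClosed.isOpen_compl.mem_nhds hout) hε
  exact ⟨K, B, a, b, hk, disjoint_left.2 fun z hz => hB hz⟩

/-- The kink is placed away from the disc of the move, and both changes are carried out
simultaneously. The resulting square shows that adding a kink is compatible with the move. -/
theorem exists_kinks_of_reidemeisterTwo (h : ReidemeisterTwo D D') (hε : ε = 1 ∨ ε = -1) :
    ∃ K K' B a b, AddsKink D K B a b ε ∧ AddsKink D' K' B a b ε ∧ ReidemeisterTwo K K' := by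
  obtain ⟨B₂, a₂, b₂, hl, h0, p, q, hpq, hin, i1, i2, i3, i4, hs⟩ := h
  obtain ⟨K, B, a, b, hk, hB⟩ := hl.exists_kink hε
  obtain ⟨K', hK, hD'⟩ := hk.1.exists_merge hl hB
  obtain ⟨t1, t2, t3, -, t5⟩ := hl.transport hk.1 hB.symm hD' hK
  have hp : p ∈ D'.crossingsIn B₂ := by rw [hin]; simp
  have hq : q ∈ D'.crossingsIn B₂ := by rw [hin]; simp
  exact ⟨K, K', B, a, b, hk, hk.transport hl hB hK hD', B₂, a₂, b₂, t1, by rw [t2, h0], p, q, hpq,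
    by rw [t3, hin], i1, i2, i3, i4, by rw [t5 p hp, t5 q hq, hs]⟩

theorem exists_kinks_of_reidemeisterThree (h : ReidemeisterThree D D') (hε : ε = 1 ∨ ε = -1) :
    ∃ K K' B a b, AddsKink D K B a b ε ∧ AddsKink D' K' B a b ε ∧ ReidemeisterThree K K' := by
  obtain ⟨B₂, a₂, b₂, hl, p, q, r, p', q', r', ht, ht', s1, s2, s3⟩ := h
  obtain ⟨K, B, a, b, hk, hB⟩ := hl.exists_kink hε
  obtain ⟨K', hK, hD'⟩ := hk.1.exists_merge hl hB
  obtain ⟨t1, t2, t3, t4, t5⟩ := hl.transport hk.1 hB.symm hD' hK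
  have hm : ∀ x, x = p ∨ x = q ∨ x = r → x ∈ D.crossingsIn B₂ := fun x hx => by rw [ht.1]; exact hx
  have hm' : ∀ x, x = p' ∨ x = q' ∨ x = r' → x ∈ D'.crossingsIn B₂ := fun x hx => by
    rw [ht'.1]; exact hx
  exact ⟨K, K', B, a, b, hk, hk.transport hl hB hK hD', B₂, a₂, b₂, t1, p, q, r, p', q', r',
    ⟨by rw [t2, ht.1], ht.2⟩, ⟨by rw [t3, ht'.1], ht'.2⟩,
    by rw [t4 p (hm p (by simp)), t5 p' (hm' p' (by simp)), s1],
    by rw [t4 q (hm q (by simp)), t5 q' (hm' q' (by simp)), s2],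
    by rw [t4 r (hm r (by simp)), t5 r' (hm' r' (by simp)), s3]⟩

theorem exists_kinks_of_weakReidemeisterOne (h : WeakReidemeisterOne D D')
    (hε : ε = 1 ∨ ε = -1) : ∃ K K' B a b, AddsKink D K B a b ε ∧ AddsKink D' K' B a b ε ∧
      WeakReidemeisterOne K K' := by
  obtain ⟨D₀, B₂, a₂, b₂, ε₂, h1, h2⟩ := h
  obtain ⟨K₀, B, a, b, hk, hB⟩ := h1.1.exists_kink hε
  obtain ⟨K, hK, hD⟩ := hk.1.exists_merge h1.1 hB
  obtain ⟨K', hK', hD'⟩ := hk.1.exists_merge h2.1 hB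
  exact ⟨K, K', B, a, b, hk.transport h1.1 hB hK hD, hk.transport h2.1 hB hK' hD', K₀, B₂, a₂, b₂,
    ε₂, h1.transport hk.1 hB.symm hD hK, h2.transport hk.1 hB.symm hD' hK'⟩

end Moves

/-! ### A plateau function with small slope -/

/-- A smooth even function that is `1` on `[-N, N]`, vanishes outside of `[-2N, 2N]`, and has small
slope. -/
structure IsPlateau (N : ℝ) (g : ℝ → ℝ) : Prop where
  le : 20 ≤ N
  smooth : ContDiff ℝ ∞ g
  even : ∀ u, g (-u) = g u
  nonneg : ∀ u, 0 ≤ g u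
  le_one : ∀ u, g u ≤ 1
  eq_one : ∀ u, |u| ≤ N → g u = 1
  eq_zero : ∀ u, 2 * N ≤ |u| → g u = 0
  deriv_le : ∀ u, |deriv g u| ≤ 1 / 10

theorem exists_isPlateau : ∃ N g, IsPlateau N g := by
  have h12 : (1 : ℝ) < 2 := by norm_num
  set f : ℝ → ℝ := fun u => 1 - ramp 1 2 u with hf
  have hfs : ContDiff ℝ ∞ f := contDiff_const.sub (ramp_contDiff _ _)
  have hf0 : ∀ u, 2 ≤ |u| → f u = 0 := fun u hu => by
    simp only [hf]; rw [ramp_eq_one zero_le_one h12 hu, sub_self]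
  obtain ⟨C, hC⟩ := ContDiff.lipschitzWith_of_hasCompactSupport (𝕂 := ℝ) (f := f)
    (HasCompactSupport.of_support_subset_isCompact (isCompact_closedBall (0 : ℝ) 2) fun z hz => by
      rw [mem_closedBall_zero_iff, Real.norm_eq_abs]
      by_contra h
      exact hz (hf0 z (not_le.1 h).le)) hfs (by simp)
  have hder : ∀ u, |deriv f u| ≤ C := fun u => norm_deriv_le_of_lipschitz hC
  -- Stretching by `N` divides the slope by `N`, which gives the bound `1 / 10`; the value `20`
  -- leaves room for displacements by `5`.
  set N : ℝ := max 20 (10 * C) with hN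
  have hN20 : 20 ≤ N := le_max_left _ _
  have hNC : 10 * (C : ℝ) ≤ N := le_max_right _ _
  have hN0 : 0 < N := by linarith
  have habs : ∀ u : ℝ, |u / N| = |u| / N := fun u => by rw [abs_div, abs_of_pos hN0]
  refine ⟨N, fun u => f (u / N), hN20, hfs.comp (contDiff_id.div_const _), fun u => ?_, fun u => ?_,
    fun u => ?_, fun u hu => ?_, fun u hu => hf0 _ ?_, fun u => ?_⟩
  · simp only [hf, neg_div, ramp_neg]
  · simp only [hf]; linarith [ramp_le_one 1 2 (u / N)]
  · simp only [hf]; linarith [ramp_nonneg 1 2 (u / N)]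
  · simp only [hf]
    rw [ramp_eq_zero zero_le_one h12 (by rw [habs, div_le_one hN0]; exact hu), sub_zero]
  · rw [habs, le_div_iff₀ hN0]; exact hu
  · have h1 : HasDerivAt (fun u => f (u / N)) (deriv f (u / N) * (1 / N)) u :=
      HasDerivAt.comp (h₂ := f) (h := fun u : ℝ => u / N) u
        ((hfs.differentiable (by simp)) (u / N)).hasDerivAt ((hasDerivAt_id' u).div_const N)
    rw [h1.deriv, abs_mul, abs_of_pos (by positivity : 0 < 1 / N), mul_one_div, div_le_iff₀ hN0]
    linarith [hder (u / N)]

/-! ### Heights -/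

theorem expNegInvGlue_lt {x y : ℝ} (hxy : x < y) (hy : 0 < y) :
    expNegInvGlue x < expNegInvGlue y := by
  rcases le_or_gt x 0 with hx | hx
  · rw [expNegInvGlue.zero_of_nonpos hx]; exact expNegInvGlue.pos_of_pos hy
  · rw [expNegInvGlue, expNegInvGlue, if_neg (not_le.2 hx), if_neg (not_le.2 hy), Real.exp_lt_exp,
      neg_lt_neg_iff]
    exact inv_strictAnti₀ hx hxy

theorem expNegInvGlue_le_one (x : ℝ) : expNegInvGlue x ≤ 1 := by
  rcases le_or_gt x 0 with hx | hx
  · rw [expNegInvGlue.zero_of_nonpos hx]; exact zero_le_one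
  · rw [expNegInvGlue, if_neg (not_le.2 hx), Real.exp_le_one_iff, neg_nonpos]
    exact (inv_pos.2 hx).le

theorem exists_hasDerivAt_expNegInvGlue {x : ℝ} (hx : 0 < x) :
    ∃ d, 0 < d ∧ HasDerivAt expNegInvGlue d x := by
  have h1 : HasDerivAt (fun x : ℝ => Real.exp (-x⁻¹)) (Real.exp (-x⁻¹) * -(-(x ^ 2)⁻¹)) x :=
    (hasDerivAt_inv hx.ne').fun_neg.exp
  refine ⟨_, by rw [neg_neg]; positivity, h1.congr_of_eventuallyEq ?_⟩
  filter_upwards [lt_mem_nhds hx] with y hy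
  rw [expNegInvGlue, if_neg (not_le.2 hy)]

/-- The height of the unmodified strand. -/
def baseHeight (N u : ℝ) : ℝ := -expNegInvGlue (u ^ 2 - 4 * N ^ 2)

/-- The height of a strand with a bump in the middle. -/
def bumpHeight (N u : ℝ) : ℝ := baseHeight N u + expNegInvGlue (9 - u ^ 2)

section Height

variable {N : ℝ}

theorem baseHeight_contDiff (N : ℝ) : ContDiff ℝ ∞ (baseHeight N) :=
  (expNegInvGlue.contDiff.comp ((contDiff_id.pow 2).sub contDiff_const)).neg

theorem bumpHeight_contDiff (N : ℝ) : ContDiff ℝ ∞ (bumpHeight N) :=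
  (baseHeight_contDiff N).add (expNegInvGlue.contDiff.comp (contDiff_const.sub (contDiff_id.pow 2)))

theorem baseHeight_mem (N u : ℝ) : -1 ≤ baseHeight N u ∧ baseHeight N u ≤ 0 :=
  ⟨neg_le_neg (expNegInvGlue_le_one _), neg_nonpos.2 (expNegInvGlue.nonneg _)⟩

theorem baseHeight_eq_zero {u : ℝ} (h : |u| ≤ 2 * N) : baseHeight N u = 0 := by
  rw [baseHeight, expNegInvGlue.zero_of_nonpos, neg_zero]
  rw [← sq_abs]; nlinarith [abs_nonneg u]

theorem bumpHeight_mem (N u : ℝ) : -1 ≤ bumpHeight N u ∧ bumpHeight N u ≤ 1 := by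
  have h1 := baseHeight_mem N u
  have h2 := expNegInvGlue.nonneg (9 - u ^ 2)
  have h3 := expNegInvGlue_le_one (9 - u ^ 2)
  unfold bumpHeight
  constructor <;> linarith

theorem bumpHeight_neg (u : ℝ) : bumpHeight N (-u) = bumpHeight N u := by
  simp [bumpHeight, baseHeight]

theorem bumpHeight_eq {u : ℝ} (h : 3 ≤ |u|) : bumpHeight N u = baseHeight N u := by
  rw [bumpHeight, expNegInvGlue.zero_of_nonpos, add_zero]
  rw [← sq_abs]; nlinarith

theorem bumpHeight_le {u w : ℝ} (h : |u| ≤ |w|) : bumpHeight N w ≤ bumpHeight N u := by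
  have h1 : u ^ 2 ≤ w ^ 2 := sq_le_sq.2 h
  exact add_le_add (neg_le_neg (expNegInvGlue.monotone (by linarith)))
    (expNegInvGlue.monotone (by linarith))

theorem bumpHeight_lt (hN : 0 ≤ N) {u w : ℝ} (h : |u| < |w|) (h' : |u| < 3 ∨ 2 * N < |w|) :
    bumpHeight N w < bumpHeight N u := by
  have h1 : u ^ 2 < w ^ 2 := sq_lt_sq.2 h
  rcases h' with h' | h'
  · refine add_lt_add_of_le_of_lt (neg_le_neg (expNegInvGlue.monotone (by linarith)))
      (expNegInvGlue_lt (by linarith) ?_)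
    rw [← sq_abs u]; nlinarith [abs_nonneg u]
  · refine add_lt_add_of_lt_of_le (neg_lt_neg (expNegInvGlue_lt (by linarith) ?_))
      (expNegInvGlue.monotone (by linarith))
    rw [← sq_abs w]; nlinarith [abs_nonneg w]

/-- As a function of `|u|` the height decreases strictly for `|u| < 3` because of the bump, is
constant in between, and decreases strictly beyond `2 * N` because of the base height. A horizontal
edge of a box at a height of one of the strict parts therefore cuts the strand at exactly `±w`. -/
theorem bumpHeight_le_iff (hN : 0 ≤ N) {u w : ℝ} (h : |w| < 3 ∨ 2 * N < |w|) :
    (bumpHeight N w ≤ bumpHeight N u ↔ |u| ≤ |w|) ∧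
      (bumpHeight N w < bumpHeight N u ↔ |u| < |w|) ∧
      (bumpHeight N u ≤ bumpHeight N w ↔ |w| ≤ |u|) ∧
      (bumpHeight N u < bumpHeight N w ↔ |w| < |u|) := by
  have k1 : |u| < |w| → bumpHeight N w < bumpHeight N u := fun hlt => bumpHeight_lt hN hlt (by
    rcases h with h | h
    · exact .inl (hlt.trans h)
    · exact .inr h)
  have k2 : |w| < |u| → bumpHeight N u < bumpHeight N w := fun hlt => bumpHeight_lt hN hlt (by
    rcases h with h | h
    · exact .inl h
    · exact .inr (h.trans hlt))
  refine ⟨⟨fun hle => ?_, bumpHeight_le⟩, ⟨fun hlt => ?_, k1⟩, ⟨fun hle => ?_, bumpHeight_le⟩,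
    ⟨fun hlt => ?_, k2⟩⟩
  · by_contra hc
    exact absurd (k2 (not_le.1 hc)) (not_lt.2 hle)
  · by_contra hc
    exact absurd (bumpHeight_le (N := N) (not_lt.1 hc)) (not_le.2 hlt)
  · by_contra hc
    exact absurd (k1 (not_le.1 hc)) (not_lt.2 hle)
  · by_contra hc
    exact absurd (bumpHeight_le (N := N) (not_lt.1 hc)) (not_le.2 hlt)

/-- Distinct absolute values with equal heights can occur only on the flat part, where the strand is
a graph over its strictly increasing horizontal position. -/
theorem abs_eq_or_of_bumpHeight_eq (hN : 0 ≤ N) {u w : ℝ} (h : bumpHeight N u = bumpHeight N w) :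
    |u| = |w| ∨ 3 ≤ |u| ∧ 3 ≤ |w| ∧ |u| ≤ 2 * N ∧ |w| ≤ 2 * N := by
  rcases lt_trichotomy |u| |w| with hlt | he | hlt
  · right
    by_contra hc
    refine absurd (bumpHeight_lt hN hlt ?_) (by rw [h]; exact lt_irrefl _)
    by_contra hc'
    rw [not_or, not_lt, not_lt] at hc'
    exact hc ⟨hc'.1, hc'.1.trans hlt.le, hlt.le.trans hc'.2, hc'.2⟩
  · exact .inl he
  · right
    by_contra hc
    refine absurd (bumpHeight_lt hN hlt ?_) (by rw [h]; exact lt_irrefl _)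
    by_contra hc'
    rw [not_or, not_lt, not_lt] at hc'
    exact hc ⟨hc'.1.trans hlt.le, hc'.1, hc'.2, hlt.le.trans hc'.2⟩

theorem deriv_bumpHeight (h3 : 3 ≤ 2 * N) {u : ℝ} (h : |u| < 3) :
    ∃ d, 0 < d ∧ deriv (bumpHeight N) u = -(d * u) := by
  obtain ⟨d, hd, h1⟩ := exists_hasDerivAt_expNegInvGlue (x := 9 - u ^ 2) (by
    rw [← sq_abs]; nlinarith [abs_nonneg u])
  have h2 : HasDerivAt (fun u : ℝ => 9 - u ^ 2) (-(2 * u)) u := by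
    simpa using (hasDerivAt_pow 2 u).const_sub 9
  have h4 : HasDerivAt (fun u : ℝ => expNegInvGlue (9 - u ^ 2)) (d * -(2 * u)) u :=
    HasDerivAt.comp (h₂ := expNegInvGlue) (h := fun u : ℝ => 9 - u ^ 2) u h1 h2
  have h5 : HasDerivAt (bumpHeight N) (d * -(2 * u)) u := by
    refine h4.congr_of_eventuallyEq ?_
    filter_upwards [continuous_abs.continuousAt.eventually_lt continuousAt_const h] with w hw
    rw [bumpHeight, baseHeight_eq_zero (by linarith), zero_add]
  exact ⟨2 * d, by positivity, by rw [h5.deriv]; ring⟩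

end Height

/-! ### Horizontal positions -/

/-- The horizontal position on a strand with a kink, up to a shift. -/
def kinkPos (u : ℝ) : ℝ := u * kinkProfile u

theorem kinkPos_contDiff : ContDiff ℝ ∞ kinkPos := contDiff_id.mul kinkProfile_contDiff

theorem kinkPos_neg (u : ℝ) : kinkPos (-u) = -kinkPos u := by
  rw [kinkPos, kinkPos, kinkProfile_neg]; ring

theorem abs_kinkPos_le (u : ℝ) : |kinkPos u| ≤ |u| := by
  rw [kinkPos, abs_mul]
  exact mul_le_of_le_one_right (abs_nonneg u) (abs_kinkProfile_le u)

theorem kinkPos_eq_zero {u : ℝ} (h : kinkPos u = 0) : u = 0 ∨ u = 1 ∨ u = -1 :=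
  (mul_eq_zero.1 h).imp id kinkProfile_eq_zero

theorem kinkPos_outer {u : ℝ} (h : 7 / 5 ≤ |u|) : kinkPos u = u := by
  rw [kinkPos, kinkProfile_outer h, mul_one]

theorem kinkPos_inner {u : ℝ} (h : |u| ≤ 6 / 5) : kinkPos u = u ^ 3 - u := by
  rw [kinkPos, kinkProfile_inner h]; ring

theorem deriv_kinkPos {u : ℝ} (h : |u| < 6 / 5) : deriv kinkPos u = 3 * u ^ 2 - 1 := by
  have h1 : HasDerivAt (fun u : ℝ => u ^ 3 - u) (3 * u ^ 2 - 1) u := by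
    simpa using (hasDerivAt_pow 3 u).fun_sub (hasDerivAt_id' u)
  refine (h1.congr_of_eventuallyEq ?_).deriv
  filter_upwards [continuous_abs.continuousAt.eventually_lt continuousAt_const h] with w hw
  exact kinkPos_inner hw.le

namespace IsPlateau

variable {N : ℝ} {g : ℝ → ℝ} (hg : IsPlateau N g)

/-- A displacement along the strand. -/
def slide (g : ℝ → ℝ) (u : ℝ) : ℝ := u - 5 * g u

/-- The horizontal position on a strand with a kink displaced to the left, with displacement
weighted by `ρ`. -/
def pos (g ρ : ℝ → ℝ) (u : ℝ) : ℝ := kinkPos u - 5 * (g u * ρ u)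

include hg

theorem slide_contDiff : ContDiff ℝ ∞ (slide g) := contDiff_id.sub (contDiff_const.mul hg.smooth)

theorem hasDerivAt_slide (u : ℝ) : HasDerivAt (slide g) (1 - 5 * deriv g u) u :=
  (hasDerivAt_id u).sub (((hg.smooth.differentiable (by simp)) u).hasDerivAt.const_mul 5)

/-- The slope of `5 * g` is at most `1 / 2`. -/
theorem deriv_slide_pos (u : ℝ) : 0 < deriv (slide g) u := by
  rw [(hg.hasDerivAt_slide u).deriv]
  linarith [(abs_le.1 (hg.deriv_le u)).2]

theorem strictMono_slide : StrictMono (slide g) := strictMono_of_deriv_pos hg.deriv_slide_pos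

theorem slide_outer {u : ℝ} (h : 2 * N ≤ |u|) : slide g u = u := by
  rw [slide, hg.eq_zero u h]; ring

theorem abs_slide_le {u : ℝ} (h : |u| ≤ 2 * N) : |slide g u| ≤ 2 * N := by
  have h1 := hg.slide_outer (u := 2 * N) (le_abs_self _)
  have h2 := hg.slide_outer (u := -(2 * N)) (by rw [abs_neg]; exact le_abs_self _)
  rw [abs_le] at h ⊢
  exact ⟨h2 ▸ hg.strictMono_slide.monotone h.1, h1 ▸ hg.strictMono_slide.monotone h.2⟩

/-- The slid position is `-2` at `3` and `2 * N` at `2 * N`. The zero is where the strand, after the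
kink, crosses the vertical one. -/
theorem exists_slide_eq_zero : ∃ x, 3 < x ∧ x < 2 * N ∧ slide g x = 0 := by
  have hN := hg.le
  have h1 := hg.slide_outer (u := 2 * N) (le_abs_self _)
  have h2 : slide g 3 = -2 := by
    rw [slide, hg.eq_one 3 (by rw [abs_of_pos three_pos]; linarith)]; norm_num
  obtain ⟨x, hx, hx0⟩ := intermediate_value_Ioo (by linarith : (3 : ℝ) ≤ 2 * N)
    hg.slide_contDiff.continuous.continuousOn (show (0 : ℝ) ∈ Ioo (slide g 3) (slide g (2 * N)) by
      rw [h1, h2]; constructor <;> linarith)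
  exact ⟨x, hx.1, hx.2, hx0⟩

end IsPlateau

/-- The weights for displacements. -/
structure IsWeight (ρ : ℝ → ℝ) : Prop where
  smooth : ContDiff ℝ ∞ ρ
  even : ∀ u, ρ (-u) = ρ u
  nonneg : ∀ u, 0 ≤ ρ u
  le_one : ∀ u, ρ u ≤ 1
  eq_one : ∀ u, 9 / 10 ≤ |u| → ρ u = 1
  eq_const : ∀ u, |u| ≤ 3 / 5 → ρ u = ρ 0

theorem isWeight_one : IsWeight fun _ => 1 :=
  ⟨contDiff_const, fun _ => rfl, fun _ => zero_le_one, fun _ => le_rfl, fun _ _ => rfl,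
    fun _ _ => rfl⟩

/-- With the constant weight the whole kink is displaced away from the vertical strand. With this
weight the tip `|u| ≤ 3 / 5` stays in place, lying across the vertical strand, while the double
point at `±1` is displaced. -/
theorem isWeight_ramp : IsWeight (ramp (3 / 5) (9 / 10)) :=
  ⟨ramp_contDiff _ _, ramp_neg _ _, ramp_nonneg _ _, ramp_le_one _ _,
    fun _ h => ramp_eq_one (by norm_num) (by norm_num) h, fun _ h => by
      rw [ramp_eq_zero (by norm_num) (by norm_num) h,
        ramp_eq_zero (by norm_num) (by norm_num) (by norm_num)]⟩

namespace IsPlateau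

variable {N : ℝ} {g ρ : ℝ → ℝ} (hg : IsPlateau N g) (hρ : IsWeight ρ)

include hg hρ

theorem pos_contDiff : ContDiff ℝ ∞ (pos g ρ) :=
  kinkPos_contDiff.sub (contDiff_const.mul (hg.smooth.mul hρ.smooth))

theorem pos_outer {u : ℝ} (h : 7 / 5 ≤ |u|) : pos g ρ u = slide g u := by
  rw [pos, slide, kinkPos_outer h, hρ.eq_one u (by linarith), mul_one]

theorem pos_far {u : ℝ} (h : 2 * N ≤ |u|) : pos g ρ u = u := by
  rw [hg.pos_outer hρ (by linarith [hg.le]), hg.slide_outer h]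

theorem pos_sub_pos_neg (u : ℝ) : pos g ρ u - pos g ρ (-u) = 2 * kinkPos u := by
  rw [pos, pos, kinkPos_neg, hg.even, hρ.even]; ring

theorem abs_pos_le (u : ℝ) : |pos g ρ u| ≤ |u| + 5 := by
  have h1 := abs_kinkPos_le u
  have h2 : 0 ≤ g u * ρ u := mul_nonneg (hg.nonneg u) (hρ.nonneg u)
  have h3 : g u * ρ u ≤ 1 := mul_le_one₀ (hg.le_one u) (hρ.nonneg u) (hρ.le_one u)
  rw [abs_le] at h1 ⊢
  unfold pos
  constructor <;> linarith

theorem deriv_pos_outer {u : ℝ} (h : 7 / 5 < |u|) : 0 < deriv (pos g ρ) u := by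
  have h1 : deriv (pos g ρ) u = deriv (slide g) u := by
    refine Filter.EventuallyEq.deriv_eq ?_
    filter_upwards [continuousAt_const.eventually_lt continuous_abs.continuousAt h] with w hw
    exact hg.pos_outer hρ hw.le
  rw [h1]
  exact hg.deriv_slide_pos u

/-- Where the weight is locally constant and `g = 1`, the displacement is constant and only the
cubic `u³ - u` contributes. -/
theorem deriv_pos_eq {u c : ℝ} (h : |u| < 6 / 5) (hc : ∀ᶠ w in 𝓝 u, ρ w = c) :
    deriv (pos g ρ) u = 3 * u ^ 2 - 1 := by
  have h1 : HasDerivAt (fun w => kinkPos w - 5 * c) (3 * u ^ 2 - 1) u := by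
    rw [← deriv_kinkPos h]
    exact ((kinkPos_contDiff.differentiable (by simp)) u).hasDerivAt.sub_const _
  refine (h1.congr_of_eventuallyEq ?_).deriv
  filter_upwards [hc, continuous_abs.continuousAt.eventually_lt continuousAt_const h] with w hw hw'
  rw [pos, hw, hg.eq_one w (by linarith [hg.le]), one_mul]

theorem deriv_pos_zero : deriv (pos g ρ) 0 = -1 := by
  rw [hg.deriv_pos_eq hρ (u := 0) (c := ρ 0) (by norm_num)]
  · norm_num
  · have h : ∀ᶠ w in 𝓝 (0 : ℝ), |w| < 3 / 5 :=
      continuous_abs.continuousAt.eventually_lt continuousAt_const (by norm_num)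
    filter_upwards [h] with w hw
    exact hρ.eq_const w hw.le

theorem deriv_pos_one {u : ℝ} (h : |u| = 1) : deriv (pos g ρ) u = 2 := by
  rw [hg.deriv_pos_eq hρ (u := u) (c := 1) (by rw [h]; norm_num)]
  · rw [← sq_abs, h]; norm_num
  · have h1 : ∀ᶠ w in 𝓝 u, 9 / 10 < |w| :=
      continuousAt_const.eventually_lt continuous_abs.continuousAt (by rw [h]; norm_num)
    filter_upwards [h1] with w hw
    exact hρ.eq_one w hw.le

/-- Here the displacement is the full `5`, which exceeds `|kinkPos u| ≤ 7 / 5`. -/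
theorem pos_neg_of_middle {u : ℝ} (h : 9 / 10 ≤ |u|) (h' : |u| ≤ 7 / 5) : pos g ρ u < 0 := by
  have h1 := (abs_le.1 (abs_kinkPos_le u)).2
  rw [pos, hρ.eq_one u h, hg.eq_one u (by linarith [hg.le])]
  linarith

/-- The double points of a curve with these horizontal positions. -/
theorem eq_of_pos_eq {u w : ℝ} (hne : u ≠ w) (hX : pos g ρ u = pos g ρ w)
    (hY : bumpHeight N u = bumpHeight N w) : u = 1 ∧ w = -1 ∨ u = -1 ∧ w = 1 := by
  -- For opposite parameters the even displacements cancel, so equal positions force a zero of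
  -- `kinkPos`. On the flat part the position is strictly increasing, and there are no double
  -- points.
  rcases abs_eq_or_of_bumpHeight_eq (by linarith [hg.le]) hY with h | ⟨h1, h2, -, -⟩
  · have h3 : w = -u := by
      rcases abs_eq_abs.1 h with h | h
      · exact absurd h hne
      · linarith
    have h4 := hg.pos_sub_pos_neg hρ u
    rw [← h3, hX, sub_self] at h4
    rcases kinkPos_eq_zero (by linarith : kinkPos u = 0) with rfl | rfl | rfl
    · exact absurd (by rw [h3, neg_zero]) hne
    · exact .inl ⟨rfl, h3⟩
    · exact .inr ⟨rfl, by rw [h3, neg_neg]⟩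
  · rw [hg.pos_outer hρ (by linarith), hg.pos_outer hρ (by linarith)] at hX
    exact absurd (hg.strictMono_slide.injective hX) hne

end IsPlateau

/-! ### Replacing a strand that crosses another one -/

/-- The curve with given coordinate functions. -/
def planeCurve (x y : ℝ → ℝ) (u : ℝ) : ℂ := ⟨x u, y u⟩

/-- Curves that replace the horizontal strand. Such a curve has at most one double point, at the
parameters `±1`; it has one if and only if `loop` holds. -/
structure IsModel (N : ℝ) (x y : ℝ → ℝ) (loop : Prop) : Prop where
  le : 20 ≤ N
  smooth_fst : ContDiff ℝ ∞ x
  smooth_snd : ContDiff ℝ ∞ y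
  far : ∀ u, 2 * N ≤ |u| → x u = u ∧ y u = baseHeight N u
  near : ∀ u, |u| ≤ 2 * N → |x u| ≤ 5 * N ∧ |y u| ≤ 4
  immersion : ∀ u, deriv x u ≠ 0 ∨ deriv y u ≠ 0
  double : ∀ u w, u ≠ w → x u = x w → y u = y w → loop ∧ (u = 1 ∧ w = -1 ∨ u = -1 ∧ w = 1)
  fst_one : loop → x 1 = x (-1) ∧ x 1 ≠ 0
  snd_one : loop → y 1 = y (-1)
  det_one : loop → 0 < deriv x 1 * deriv y (-1) - deriv y 1 * deriv x (-1)
  zero : ∀ u, x u = 0 → deriv x u ≠ 0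

namespace IsModel

variable {N : ℝ} {x y : ℝ → ℝ} {loop : Prop} (hm : IsModel N x y loop)
include hm

theorem contDiff : ContDiff ℝ ∞ (planeCurve x y) := contDiff_complex_mk hm.smooth_fst hm.smooth_snd

theorem deriv_planeCurve (u : ℝ) : deriv (planeCurve x y) u = ⟨deriv x u, deriv y u⟩ :=
  (hasDerivAt_complex_mk ((hm.smooth_fst.differentiable (by simp)) u).hasDerivAt
    ((hm.smooth_snd.differentiable (by simp)) u).hasDerivAt).deriv

theorem of_eq {u w : ℝ} (hne : u ≠ w) (h : planeCurve x y u = planeCurve x y w) :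
    loop ∧ (u = 1 ∧ w = -1 ∨ u = -1 ∧ w = 1) :=
  hm.double u w hne (congrArg Complex.re h) (congrArg Complex.im h)

theorem eq_one (hs : loop) : planeCurve x y 1 = planeCurve x y (-1) :=
  Complex.ext (hm.fst_one hs).1 (hm.snd_one hs)

theorem lt_of_eq_zero {u : ℝ} (h : x u = 0) : |u| < 2 * N := by
  by_contra hc
  have h1 := (hm.far u (not_lt.1 hc)).1
  rw [h] at h1
  rw [← h1, abs_zero] at hc
  linarith [hm.le]

theorem ne_of_eq_zero {u w : ℝ} (h : x u = 0) (he : planeCurve x y w = planeCurve x y u) :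
    w = u := by
  by_contra hne
  obtain ⟨hs, h1⟩ := hm.of_eq hne he
  have h2 := hm.fst_one hs
  rcases h1 with ⟨-, rfl⟩ | ⟨-, rfl⟩
  · exact h2.2 (h2.1.trans h)
  · exact h2.2 h

end IsModel

/-- The left side is at most `25 * N² + 25`, which is less than `36 * N²` for `N ≥ 20`. So this
rectangle lies in the region where only the two strands run. -/
theorem lt_of_bounded {N : ℝ} (hN : 20 ≤ N) {z : ℂ} (h1 : |z.re| ≤ 5 * N) (h2 : |z.im| ≤ 4) :
    z.re ^ 2 + (z.im - baseHeight N z.re) ^ 2 < (6 * N) ^ 2 := by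
  have h3 := baseHeight_mem N z.re
  have h4 : z.re ^ 2 ≤ (5 * N) ^ 2 := sq_le_sq.2 (by rwa [abs_of_pos (by linarith : 0 < 5 * N)])
  have h5 : (z.im - baseHeight N z.re) ^ 2 ≤ 5 ^ 2 := by
    rw [abs_le] at h2
    exact sq_le_sq' (by linarith) (by linarith)
  nlinarith

namespace StrandFrame

variable {E : KnotoidDiagram}

/-- Frames around a horizontal strand which crosses a vertical one, in an otherwise empty region.
The time at the crossing on the vertical strand is `s₀`. -/
structure IsDouble (F : StrandFrame E) (N s₀ : ℝ) : Prop where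
  base_eq : F.base = planeCurve (fun u => u) (baseHeight N)
  core_eq : F.core = 2 * N
  radius_eq : F.radius = 6 * N
  second : ∀ y, |y| < 6 * N → s₀ + y / F.scale ∈ Ioo (0 : ℝ) 1 ∧ ¬ F.InArc (s₀ + y / F.scale) ∧
    E.curve (s₀ + y / F.scale) = ⟨0, y⟩ ∧ deriv E.curve (s₀ + y / F.scale) = ⟨0, F.scale⟩
  rest : ∀ t ∈ Icc (0 : ℝ) 1, ¬ F.InArc t → (∃ y, |y| < 6 * N ∧ t = s₀ + y / F.scale) ∨
    (6 * N) ^ 2 ≤ (E.curve t).re ^ 2 + ((E.curve t).im - baseHeight N (E.curve t).re) ^ 2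

/-- The points on the two strands. -/
def strandTime (F : StrandFrame E) (s₀ : ℝ) (k : Bool) (u : ℝ) : ℝ :=
  cond k (s₀ + u / F.scale) (F.time u)

/-- The positions on the two strands, the first one being replaced by `c`. -/
def strandCurve (c : ℝ → ℂ) (k : Bool) (u : ℝ) : ℂ := cond k ⟨0, u⟩ (c u)

/-- How the strands meet a region. -/
def StrandsMeet (N : ℝ) (c : ℝ → ℂ) (B : Set ℂ) {n : ℕ} (kind : Fin n → Bool) (α β : Fin n → ℝ) :
    Prop :=
  ∀ k u, |u| < 6 * N → (strandCurve c k u ∈ B ↔ ∃ i, k = kind i ∧ u ∈ Icc (α i) (β i)) ∧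
    (strandCurve c k u ∈ interior B ↔ ∃ i, k = kind i ∧ u ∈ Ioo (α i) (β i))

namespace IsDouble

variable {F : StrandFrame E} {N s₀ : ℝ} (hF : F.IsDouble N s₀) {x y : ℝ → ℝ} {loop : Prop}
  (hm : IsModel N x y loop)

include hF

theorem strandTime_mem (k : Bool) {u : ℝ} (hu : |u| < 6 * N) :
    F.strandTime s₀ k u ∈ Ioo (0 : ℝ) 1 := by
  cases k
  · exact (F.arc u (hF.radius_eq ▸ hu)).1
  · exact (hF.second u hu).1

theorem inArc_strandTime {k : Bool} {u : ℝ} (hu : |u| < 6 * N) :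
    F.InArc (F.strandTime s₀ k u) ↔ k = false := by
  cases k
  · exact iff_of_true (F.inArc_time.2 (hF.radius_eq ▸ hu)) rfl
  · exact iff_of_false (hF.second u hu).2.1 (by simp)

/-- The times on the vertical strand are not on the arc, so the two time windows are disjoint and an
interval on one strand contains no time of the other. -/
theorem strandTime_mem_Icc {k k' : Bool} {u a b : ℝ} (hu : |u| < 6 * N) (ha : |a| < 6 * N)
    (hb : |b| < 6 * N) : F.strandTime s₀ k u ∈ Icc (F.strandTime s₀ k' a) (F.strandTime s₀ k' b) ↔
      k = k' ∧ u ∈ Icc a b := by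
  have hpos := F.scale_pos
  have hle : ∀ p q : ℝ, s₀ + p / F.scale ≤ s₀ + q / F.scale ↔ p ≤ q := fun p q => by
    rw [add_le_add_iff_left, div_le_div_iff_of_pos_right hpos]
  rw [abs_lt] at ha hb
  cases k <;> cases k'
  · simp [strandTime, F.time_le_time]
  · refine iff_of_false (fun h => ?_) (by simp)
    obtain ⟨w, hw⟩ : ∃ w, F.time u = s₀ + w / F.scale :=
      ⟨F.scale * (F.time u - s₀), by field_simp; ring⟩
    simp only [strandTime, cond_true, cond_false, hw, mem_Icc, hle] at h
    refine (hF.second w (abs_lt.2 ⟨by linarith [h.1], by linarith [h.2]⟩)).2.1 ?_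
    rw [← hw, F.inArc_time, hF.radius_eq]
    exact hu
  · refine iff_of_false (fun h => ?_) (by simp)
    refine (hF.second u hu).2.1 ?_
    simp only [strandTime, cond_true, cond_false, mem_Icc] at h
    rw [← F.time_coord (s₀ + u / F.scale)] at h ⊢
    rw [F.time_le_time, F.time_le_time] at h
    rw [F.inArc_time, hF.radius_eq, abs_lt]
    exact ⟨by linarith [h.1], by linarith [h.2]⟩
  · simp [strandTime, hle]

theorem strandTime_inj {k k' : Bool} {u w : ℝ} (hu : |u| < 6 * N) (hw : |w| < 6 * N) :
    F.strandTime s₀ k u = F.strandTime s₀ k' w ↔ k = k' ∧ u = w := by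
  have h := hF.strandTime_mem_Icc (k := k) (k' := k') hu hw hw
  rwa [Icc_self, Icc_self, mem_singleton_iff, mem_singleton_iff] at h

theorem strandTime_lt {k : Bool} {a b : ℝ} :
    F.strandTime s₀ k a < F.strandTime s₀ k b ↔ a < b := by
  cases k
  · exact F.time_lt_time
  · simp only [strandTime, cond_true]
    rw [add_lt_add_iff_left, div_lt_div_iff_of_pos_right F.scale_pos]

theorem strandTime_mem_Ioo {k k' : Bool} {u a b : ℝ} (hu : |u| < 6 * N) (ha : |a| < 6 * N)
    (hb : |b| < 6 * N) : F.strandTime s₀ k u ∈ Ioo (F.strandTime s₀ k' a) (F.strandTime s₀ k' b) ↔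
      k = k' ∧ u ∈ Ioo a b := by
  constructor
  · intro h
    obtain ⟨rfl, -⟩ := (hF.strandTime_mem_Icc hu ha hb).1 (Ioo_subset_Icc_self h)
    exact ⟨rfl, hF.strandTime_lt.1 h.1, hF.strandTime_lt.1 h.2⟩
  · rintro ⟨rfl, h⟩
    exact ⟨hF.strandTime_lt.2 h.1, hF.strandTime_lt.2 h.2⟩

theorem cover {t : ℝ} (ht : t ∈ Icc (0 : ℝ) 1) :
    (∃ k u, |u| < 6 * N ∧ t = F.strandTime s₀ k u) ∨ ¬ F.InArc t ∧
      (6 * N) ^ 2 ≤ (E.curve t).re ^ 2 + ((E.curve t).im - baseHeight N (E.curve t).re) ^ 2 := by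
  by_cases h : F.InArc t
  · obtain ⟨u, hu, rfl⟩ := h.exists_eq
    exact .inl ⟨false, u, hF.radius_eq ▸ hu, rfl⟩
  · rcases hF.rest t ht h with ⟨u, hu, rfl⟩ | h1
    · exact .inl ⟨true, u, hu, rfl⟩
    · exact .inr ⟨h, h1⟩

include hm

theorem bound_second {u : ℝ} (hu : |u| < 6 * N) :
    (0 : ℝ) ^ 2 + (u - baseHeight N 0) ^ 2 < (6 * N) ^ 2 := by
  rw [baseHeight_eq_zero (by rw [abs_zero]; linarith [hm.le]), ← sq_abs (u - 0), sub_zero]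
  have := abs_nonneg u
  nlinarith

theorem bound {u : ℝ} (hu : |u| < 6 * N) :
    (planeCurve x y u).re ^ 2 + ((planeCurve x y u).im - baseHeight N (planeCurve x y u).re) ^ 2 <
      (6 * N) ^ 2 := by
  rcases le_or_gt (2 * N) |u| with h | h
  · simp only [planeCurve]
    rw [(hm.far u h).1, (hm.far u h).2, sub_self, ← sq_abs u]
    have := abs_nonneg u
    nlinarith
  · exact lt_of_bounded hm.le (hm.near u h.le).1 (hm.near u h.le).2

theorem admissible : F.Admissible (planeCurve x y) where
  smooth := hm.contDiff
  eq_base u h := by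
    rw [hF.base_eq, planeCurve, planeCurve]
    rw [hF.core_eq] at h
    rw [(hm.far u h).1, (hm.far u h).2]
  immersion u _ h := by
    rw [hm.deriv_planeCurve] at h
    exact (hm.immersion u).elim (fun h' => h' (congrArg Complex.re h))
      fun h' => h' (congrArg Complex.im h)
  no_triple u w r _ _ _ h1 h2 := by
    by_contra! hne
    obtain ⟨-, e1⟩ := hm.of_eq hne.1 h1
    obtain ⟨-, e2⟩ := hm.of_eq hne.2.1 h2
    rcases e1 with ⟨rfl, rfl⟩ | ⟨rfl, rfl⟩ <;> rcases e2 with ⟨e, rfl⟩ | ⟨e, rfl⟩ <;>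
      first | exact hne.2.2 rfl | norm_num at e
  transversal u w _ _ hne h := by
    obtain ⟨hs, h1⟩ := hm.of_eq hne h
    have h2 := hm.det_one hs
    rw [hm.deriv_planeCurve, hm.deriv_planeCurve]
    simp only [planeDet]
    rcases h1 with ⟨rfl, rfl⟩ | ⟨rfl, rfl⟩
    · exact h2.ne'
    · intro h3; linarith
  rest u t hu ht hn h := by
    rw [hF.radius_eq] at hu
    have hb := hF.bound hm hu
    rcases hF.rest t ht hn with ⟨w, hw, rfl⟩ | h1
    · obtain ⟨i1, i2, i3, i4⟩ := hF.second w hw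
      rw [i3] at h
      have hx : x u = 0 := congrArg Complex.re h
      refine ⟨i1, ?_, fun w _ he => hm.ne_of_eq_zero hx he, fun s hs hsn he => ?_⟩
      · rw [i4, hm.deriv_planeCurve]
        simp only [planeDet, mul_zero, sub_zero]
        exact mul_ne_zero (hm.zero u hx) F.scale_pos.ne'
      · rw [i3] at he
        rcases hF.rest s hs hsn with ⟨r, hr, rfl⟩ | h1
        · rw [(hF.second r hr).2.2.1] at he
          rw [show r = w from congrArg Complex.im he]
        · rw [he] at h1
          exact absurd (hF.bound_second hm hw) (not_lt.2 h1)
    · rw [← h] at h1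
      exact absurd hb (not_lt.2 h1)

theorem newCurve_strandTime (k : Bool) {u : ℝ} (hu : |u| < 6 * N) :
    F.newCurve (planeCurve x y) (F.strandTime s₀ k u) = strandCurve (planeCurve x y) k u := by
  cases k
  · exact F.newCurve_time (hF.radius_eq ▸ hu)
  · obtain ⟨-, i2, i3, -⟩ := hF.second u hu
    exact (F.newCurve_of_not_inArc (hF.admissible hm) i2).trans i3

theorem deriv_newCurve_false {u : ℝ} (hu : |u| < 6 * N) :
    deriv (F.newCurve (planeCurve x y)) (F.strandTime s₀ false u) =
      F.scale * ⟨deriv x u, deriv y u⟩ := by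
  rw [← hm.deriv_planeCurve]
  exact F.deriv_newCurve_time (hF.admissible hm) (hF.radius_eq ▸ hu)

theorem deriv_newCurve_true {u : ℝ} (hu : |u| < 6 * N) :
    deriv (F.newCurve (planeCurve x y)) (F.strandTime s₀ true u) = ⟨0, F.scale⟩ := by
  obtain ⟨-, i2, -, i4⟩ := hF.second u hu
  exact (F.deriv_newCurve_of_not_inArc (hF.admissible hm) i2).trans i4

/-- A region where only the two strands lie. -/
theorem exists_of_mem {B : Set ℂ} (hB : ∀ z ∈ B, |z.re| ≤ 5 * N ∧ |z.im| ≤ 4) {t : ℝ}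
    (ht : t ∈ Icc (0 : ℝ) 1) (hmem : F.newCurve (planeCurve x y) t ∈ B) :
    ∃ k u, |u| < 6 * N ∧ t = F.strandTime s₀ k u := by
  rcases hF.cover ht with h | ⟨h1, h2⟩
  · exact h
  · rw [F.newCurve_of_not_inArc (hF.admissible hm) h1] at hmem
    exact absurd (lt_of_bounded hm.le (hB _ hmem).1 (hB _ hmem).2) (not_lt.2 h2)

end IsDouble

open Classical in
/-- The crossing of the two strands at a zero `u` of the abscissa. -/
def mixedPair (F : StrandFrame E) (s₀ : ℝ) (y : ℝ → ℝ) (u : ℝ) : ℝ × ℝ :=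
  if F.isOver then (F.strandTime s₀ false u, F.strandTime s₀ true (y u))
  else (F.strandTime s₀ true (y u), F.strandTime s₀ false u)

/-- The crossing of the horizontal strand with itself. -/
def selfPair (F : StrandFrame E) (s₀ : ℝ) : ℝ × ℝ :=
  (F.strandTime s₀ false F.order, F.strandTime s₀ false (-F.order))

namespace IsDouble

variable {F : StrandFrame E} {N s₀ : ℝ} (hF : F.IsDouble N s₀) {x y : ℝ → ℝ} {loop : Prop}
  (hm : IsModel N x y loop)

include hF hm

theorem abs_snd_lt {u : ℝ} (h : x u = 0) : |y u| < 6 * N := by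
  have := (hm.near u (hm.lt_of_eq_zero h).le).2
  linarith [hm.le]

omit hF in
theorem abs_order_lt : |F.order| < 6 * N ∧ |-F.order| < 6 * N := by
  rw [abs_neg, and_self]
  rcases F.order_eq with h | h <;> rw [h] <;> norm_num <;> linarith [hm.le]

omit hF in
theorem planeCurve_order (hs : loop) : planeCurve x y F.order = planeCurve x y 1 ∧
    planeCurve x y (-F.order) = planeCurve x y 1 := by
  rcases F.order_eq with h | h <;> rw [h]
  · exact ⟨rfl, (hm.eq_one hs).symm⟩
  · rw [neg_neg]; exact ⟨(hm.eq_one hs).symm, rfl⟩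

/-- The vertical strand is the axis `x = 0` parametrized by height, so the horizontal strand meets
it at the zeros `u` of its abscissa, with height `y u` on the vertical strand. The only other
crossing is that of the loop with itself. -/
theorem mem_crossingsIn {B : Set ℂ} (hB : ∀ z ∈ B, |z.re| ≤ 5 * N ∧ |z.im| ≤ 4) {p : ℝ × ℝ} :
    p ∈ (F.replace (hF.admissible hm)).crossingsIn B ↔
      loop ∧ p = F.selfPair s₀ ∧ planeCurve x y 1 ∈ B ∨
      ∃ u, p = F.mixedPair s₀ y u ∧ x u = 0 ∧ planeCurve x y u ∈ B := by
  constructor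
  · rintro ⟨hp, hpB⟩
    obtain ⟨h1, h2, h3, h4, h5⟩ := (F.mem_crossings_replace _).1 hp
    replace hpB : F.newCurve (planeCurve x y) p.1 ∈ B := hpB
    obtain ⟨k, u, hu, e1⟩ := hF.exists_of_mem hm hB h1 hpB
    obtain ⟨k', w, hw, e2⟩ := hF.exists_of_mem hm hB h2 (h4 ▸ hpB)
    rw [e1, e2, hF.newCurve_strandTime hm k hu, hF.newCurve_strandTime hm k' hw] at h4
    rw [e1, hF.newCurve_strandTime hm k hu] at hpB
    have hp' : p = (F.strandTime s₀ k u, F.strandTime s₀ k' w) := Prod.ext e1 e2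
    have a1 := hF.inArc_strandTime (k := k) hu
    have a2 := hF.inArc_strandTime (k := k') hw
    rw [e1, e2, Over] at h5
    rw [e1, e2, ne_eq, hF.strandTime_inj hu hw, not_and] at h3
    simp only [a1, a2] at h5
    cases k <;> cases k' <;> simp only [strandCurve, cond_true, cond_false] at h4 hpB
    · obtain ⟨hs, h6⟩ := hm.of_eq (h3 rfl) h4
      refine .inl ⟨hs, ?_, ?_⟩
      · simp only [if_true, strandTime, cond_false] at h5
        rw [hp', selfPair]
        have h7 : 0 < F.order * (u - w) := by
          rcases F.order_eq with h | h <;> rw [h] at h5 ⊢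
          · rw [one_mul, sub_pos] at h5 ⊢
            exact F.time_lt_time.1 h5
          · rw [neg_one_mul, neg_sub, sub_pos] at h5 ⊢
            exact F.time_lt_time.1 h5
        rcases F.order_eq with h | h <;> rw [h] at h7 ⊢ <;> rcases h6 with ⟨rfl, rfl⟩ | ⟨rfl, rfl⟩ <;>
          first | (norm_num; done) | norm_num at h7
      · rcases h6 with ⟨rfl, -⟩ | ⟨rfl, -⟩
        · exact hpB
        · rwa [hm.eq_one hs]
    · simp only [if_true, Bool.true_eq_false, if_false] at h5
      refine .inr ⟨u, ?_, congrArg Complex.re h4, hpB⟩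
      rw [hp', mixedPair, if_pos h5, show y u = w from congrArg Complex.im h4]
    · simp only [if_true, Bool.true_eq_false, if_false] at h5
      refine .inr ⟨w, ?_, (congrArg Complex.re h4).symm, h4 ▸ hpB⟩
      rw [hp', mixedPair, if_neg h5, show y w = u from (congrArg Complex.im h4).symm]
    · exact absurd (congrArg Complex.im h4) (h3 rfl)
  · rintro (⟨hs, rfl, hB'⟩ | ⟨u, rfl, hx, hB'⟩)
    · obtain ⟨o1, o2⟩ := abs_order_lt (F := F) hm
      obtain ⟨c1, c2⟩ := planeCurve_order (F := F) hm hs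
      refine ⟨(F.mem_crossings_replace _).2 ⟨Ioo_subset_Icc_self (hF.strandTime_mem false o1),
        Ioo_subset_Icc_self (hF.strandTime_mem false o2), ?_, ?_, ?_⟩, ?_⟩
      · rw [selfPair, ne_eq, hF.strandTime_inj o1 o2]
        rcases F.order_eq with h | h <;> rw [h] <;> norm_num
      · rw [selfPair, hF.newCurve_strandTime hm false o1, hF.newCurve_strandTime hm false o2]
        exact c1.trans c2.symm
      · simp only [selfPair, Over, hF.inArc_strandTime o1, hF.inArc_strandTime o2, if_true]
        simp only [strandTime, cond_false, time]
        have := F.scale_pos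
        rw [show F.order * (F.center + F.order / F.scale - (F.center + -F.order / F.scale)) =
          2 * F.order ^ 2 / F.scale by ring]
        rcases F.order_eq with h | h <;> rw [h] <;> positivity
      · rw [replace_curve, selfPair, hF.newCurve_strandTime hm false o1]
        exact (c1.symm ▸ hB' : planeCurve x y F.order ∈ B)
    · have b1 : |u| < 6 * N := by linarith [hm.lt_of_eq_zero hx, hm.le]
      have b2 := hF.abs_snd_lt hm hx
      have e : planeCurve x y u = ⟨0, y u⟩ := Complex.ext hx rfl
      have n1 := hF.newCurve_strandTime hm false b1
      have n2 := hF.newCurve_strandTime hm true b2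
      simp only [strandCurve, cond_true, cond_false] at n1 n2
      by_cases ho : F.isOver
      · rw [mixedPair, if_pos ho]
        refine ⟨(F.mem_crossings_replace _).2 ⟨Ioo_subset_Icc_self (hF.strandTime_mem false b1),
          Ioo_subset_Icc_self (hF.strandTime_mem true b2), ?_, ?_, ?_⟩, ?_⟩
        · rw [ne_eq, hF.strandTime_inj b1 b2]; simp
        · rw [n1, n2, e]
        · simpa only [Over, hF.inArc_strandTime b1, hF.inArc_strandTime b2, if_true,
            Bool.true_eq_false, if_false] using ho
        · rw [replace_curve, n1]; exact hB'
      · rw [mixedPair, if_neg ho]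
        refine ⟨(F.mem_crossings_replace _).2 ⟨Ioo_subset_Icc_self (hF.strandTime_mem true b2),
          Ioo_subset_Icc_self (hF.strandTime_mem false b1), ?_, ?_, ?_⟩, ?_⟩
        · rw [ne_eq, hF.strandTime_inj b2 b1]; simp
        · rw [n1, n2, e]
        · simpa only [Over, hF.inArc_strandTime b1, hF.inArc_strandTime b2, if_true,
            Bool.true_eq_false, if_false] using ho
        · rw [replace_curve, n2, ← e]; exact hB'

/-- The determinant from time `1` to time `-1` is positive. The order decides which of the two comes
first in the pair, and exchanging them changes the sign. -/
theorem crossingSign_selfPair (hs : loop) :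
    (F.replace (hF.admissible hm)).crossingSign (F.selfPair s₀) = SignType.sign F.order := by
  obtain ⟨o1, o2⟩ := abs_order_lt (F := F) hm
  have h := hm.det_one hs
  rw [KnotoidDiagram.crossingSign, replace_curve, selfPair, hF.deriv_newCurve_false hm o1,
    hF.deriv_newCurve_false hm o2, planeDet_smul_left, planeDet_smul_right, sign_mul, sign_mul,
    sign_pos F.scale_pos, one_mul, one_mul]
  simp only [planeDet]
  rcases F.order_eq with h1 | h1 <;> rw [h1]
  · rw [sign_pos h, sign_pos one_pos]
  · rw [neg_neg, sign_neg, sign_neg] <;> linarith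

open Classical in
theorem crossingSign_mixedPair {u : ℝ} (hx : x u = 0) :
    (F.replace (hF.admissible hm)).crossingSign (F.mixedPair s₀ y u) =
      (if F.isOver then 1 else -1) * SignType.sign (deriv x u) := by
  have b1 : |u| < 6 * N := by linarith [hm.lt_of_eq_zero hx, hm.le]
  have b2 := hF.abs_snd_lt hm hx
  have e : planeDet ⟨deriv x u, deriv y u⟩ ⟨0, F.scale⟩ = deriv x u * F.scale := by simp [planeDet]
  rw [KnotoidDiagram.crossingSign, replace_curve, mixedPair]
  split_ifs with ho
  · rw [hF.deriv_newCurve_false hm b1, hF.deriv_newCurve_true hm b2, planeDet_smul_left, e, sign_mul,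
      sign_mul, sign_pos F.scale_pos, one_mul, mul_one, one_mul]
  · rw [hF.deriv_newCurve_false hm b1, hF.deriv_newCurve_true hm b2, planeDet_smul_right,
      planeDet_swap, e, mul_neg, Left.sign_neg, sign_mul,
      sign_mul, sign_pos F.scale_pos, one_mul, mul_one, neg_one_mul]
    simp

theorem meetsDiscInArcs {B : Set ℂ} (hB : ∀ z ∈ B, |z.re| ≤ 5 * N ∧ |z.im| ≤ 4) {n : ℕ}
    {kind : Fin n → Bool} {α β : Fin n → ℝ} (hα : ∀ i, |α i| < 6 * N) (hβ : ∀ i, |β i| < 6 * N)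
    (hmeet : StrandsMeet N (planeCurve x y) B kind α β)
    (hself : loop → planeCurve x y 1 ∈ B → planeCurve x y 1 ∈ interior B)
    (hzero : ∀ u, x u = 0 → planeCurve x y u ∈ B → planeCurve x y u ∈ interior B) :
    MeetsDiscInArcs (F.replace (hF.admissible hm)) B (fun i => F.strandTime s₀ (kind i) (α i))
      fun i => F.strandTime s₀ (kind i) (β i) := by
  have hex : ∀ t ∈ Icc (0 : ℝ) 1, ∀ i, t ∈ Icc (F.strandTime s₀ (kind i) (α i))
      (F.strandTime s₀ (kind i) (β i)) → ∃ k u, |u| < 6 * N ∧ t = F.strandTime s₀ k u := by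
    intro t _ i hi
    have hpos := F.scale_pos
    obtain ⟨w, rfl⟩ : ∃ w, t = F.strandTime s₀ (kind i) w := by
      cases kind i
      · exact ⟨F.coord t, (F.time_coord t).symm⟩
      · exact ⟨F.scale * (t - s₀), by simp only [strandTime, cond_true]; field_simp; ring⟩
    have h1 := not_lt.1 (mt hF.strandTime_lt.2 (not_lt.2 hi.1))
    have h2 := not_lt.1 (mt hF.strandTime_lt.2 (not_lt.2 hi.2))
    have h3 := abs_lt.1 (hα i)
    have h4 := abs_lt.1 (hβ i)
    exact ⟨_, w, abs_lt.2 ⟨by linarith, by linarith⟩, rfl⟩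
  refine ⟨fun t ht => ?_, fun t ht => ?_, fun p hp => ?_⟩
  · by_cases h : ∃ k u, |u| < 6 * N ∧ t = F.strandTime s₀ k u
    · obtain ⟨k, u, hu, rfl⟩ := h
      rw [replace_curve, hF.newCurve_strandTime hm k hu, (hmeet k u hu).1]
      exact exists_congr fun i => (hF.strandTime_mem_Icc hu (hα i) (hβ i)).symm
    · exact iff_of_false (fun h' => h (hF.exists_of_mem hm hB ht h')) fun ⟨i, hi⟩ => h (hex t ht i hi)
  · by_cases h : ∃ k u, |u| < 6 * N ∧ t = F.strandTime s₀ k u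
    · obtain ⟨k, u, hu, rfl⟩ := h
      rw [replace_curve, hF.newCurve_strandTime hm k hu, (hmeet k u hu).2]
      exact exists_congr fun i => (hF.strandTime_mem_Ioo hu (hα i) (hβ i)).symm
    · exact iff_of_false (fun h' => h (hF.exists_of_mem hm hB ht (interior_subset h')))
        fun ⟨i, hi⟩ => h (hex t ht i (Ioo_subset_Icc_self hi))
  · refine (hF.mem_crossingsIn hm fun z hz => hB z (interior_subset hz)).2 ?_
    rcases (hF.mem_crossingsIn hm hB).1 hp with ⟨h1, h2, h3⟩ | ⟨u, h1, h2, h3⟩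
    · exact .inl ⟨h1, h2, hself h1 h3⟩
    · exact .inr ⟨u, h1, h2, hzero u h2 h3⟩

/-- Only the horizontal strand is modified, but the disc may also contain an arc of the vertical
one; `kind` tells on which strand each arc lies. -/
theorem localChange {x' y' : ℝ → ℝ} {loop' : Prop} (hm' : IsModel N x' y' loop') {B : Set ℂ}
    (hD : IsDisc B) (hB : ∀ z ∈ B, |z.re| ≤ 5 * N ∧ |z.im| ≤ 4) {n : ℕ}
    {kind : Fin n → Bool} {α β : Fin n → ℝ} (hα : ∀ i, |α i| < 6 * N) (hβ : ∀ i, |β i| < 6 * N)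
    (hαβ : ∀ i, α i < β i)
    (hdisj : ∀ i j, i ≠ j → kind i = kind j → β i < α j ∨ β j < α i)
    (hmeet : StrandsMeet N (planeCurve x y) B kind α β)
    (hself : loop → planeCurve x y 1 ∈ B → planeCurve x y 1 ∈ interior B)
    (hzero : ∀ u, x u = 0 → planeCurve x y u ∈ B → planeCurve x y u ∈ interior B)
    (hmeet' : StrandsMeet N (planeCurve x' y') B kind α β)
    (hself' : loop' → planeCurve x' y' 1 ∈ B → planeCurve x' y' 1 ∈ interior B)
    (hzero' : ∀ u, x' u = 0 → planeCurve x' y' u ∈ B → planeCurve x' y' u ∈ interior B)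
    (heq : ∀ u, (∀ i, false = kind i → u ∉ Ioo (α i) (β i)) → x' u = x u ∧ y' u = y u) :
    LocalChange (F.replace (hF.admissible hm)) (F.replace (hF.admissible hm')) B
      (fun i => F.strandTime s₀ (kind i) (α i)) fun i => F.strandTime s₀ (kind i) (β i) := by
  refine F.localChange_replace _ _ hD (fun i => ⟨(hF.strandTime_mem _ (hα i)).1,
    hF.strandTime_lt.2 (hαβ i), (hF.strandTime_mem _ (hβ i)).2⟩) (fun i j hij => ?_)
    (hF.meetsDiscInArcs hm hB hα hβ hmeet hself hzero)
    (hF.meetsDiscInArcs hm' hB hα hβ hmeet' hself' hzero') fun u hu hi => ?_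
  · rw [Set.disjoint_left]
    intro t h1 h2
    have hpos := F.scale_pos
    obtain ⟨w, rfl⟩ : ∃ w, t = F.strandTime s₀ (kind i) w := by
      cases kind i
      · exact ⟨F.coord t, (F.time_coord t).symm⟩
      · exact ⟨F.scale * (t - s₀), by simp only [strandTime, cond_true]; field_simp; ring⟩
    have g1 := not_lt.1 (mt hF.strandTime_lt.2 (not_lt.2 h1.1))
    have g2 := not_lt.1 (mt hF.strandTime_lt.2 (not_lt.2 h1.2))
    have g3 := abs_lt.1 (hα i)
    have g4 := abs_lt.1 (hβ i)
    have hw : |w| < 6 * N := abs_lt.2 ⟨by linarith, by linarith⟩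
    obtain ⟨hk, h3⟩ := (hF.strandTime_mem_Icc hw (hα j) (hβ j)).1 h2
    rcases hdisj i j hij hk with h | h <;> linarith [h3.1, h3.2]
  · rw [hF.radius_eq] at hu
    obtain ⟨h1, h2⟩ := heq u fun i hk h => hi i
      ((hF.strandTime_mem_Ioo (k := false) hu (hα i) (hβ i)).2 ⟨hk, h⟩)
    rw [planeCurve, planeCurve, h1, h2]

end IsDouble

end StrandFrame

/-! ### A displaced kink -/

namespace IsPlateau

variable {N : ℝ} {g ρ : ℝ → ℝ} (hg : IsPlateau N g) (hρ : IsWeight ρ) {σ : ℝ}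
  (hσ : σ = 1 ∨ σ = -1)

/-- The conjugate of `f` by the multiplication with `σ`. -/
def conj (σ : ℝ) (f : ℝ → ℝ) (u : ℝ) : ℝ := σ * f (σ * u)

include hσ in
theorem abs_sign_mul (u : ℝ) : |σ * u| = |u| := by
  rcases hσ with rfl | rfl <;> simp

include hσ in
theorem sign_mul_self (u : ℝ) : σ * (σ * u) = u := by
  rcases hσ with rfl | rfl <;> simp

include hσ in
theorem conj_eq_zero {f : ℝ → ℝ} {u : ℝ} : conj σ f u = 0 ↔ f (σ * u) = 0 := by
  rcases hσ with rfl | rfl <;> simp [conj]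

theorem conj_contDiff {f : ℝ → ℝ} (hf : ContDiff ℝ ∞ f) : ContDiff ℝ ∞ (conj σ f) :=
  contDiff_const.mul (hf.comp (contDiff_const.mul contDiff_id))

include hσ in
-- The two factors `σ` cancel. For `σ = -1` and an even height, conjugation is reflection in the
-- vertical strand combined with a reversal of the parameter, and the two effects on the derivative
-- of the abscissa compensate each other. Hence crossing signs do not depend on the side on which
-- the kink lies.
theorem deriv_conj {f : ℝ → ℝ} (hf : ContDiff ℝ ∞ f) (u : ℝ) :
    deriv (conj σ f) u = deriv f (σ * u) := by
  have h0 : HasDerivAt (fun u : ℝ => σ * u) σ u := by simpa using (hasDerivAt_id' u).const_mul σ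
  have h1 : HasDerivAt (fun u => σ * f (σ * u)) (σ * (deriv f (σ * u) * σ)) u :=
    (HasDerivAt.comp (h₂ := f) (h := fun u : ℝ => σ * u) u
      ((hf.differentiable (by simp)) (σ * u)).hasDerivAt h0).const_mul σ
  rw [show conj σ f = fun u => σ * f (σ * u) from rfl, h1.deriv]
  rcases hσ with rfl | rfl <;> ring

include hg

theorem isModel_base : IsModel N (fun u => u) (baseHeight N) False where
  le := hg.le
  smooth_fst := contDiff_id
  smooth_snd := baseHeight_contDiff N
  far _ _ := ⟨rfl, rfl⟩
  near u h := ⟨by linarith [hg.le], by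
    have := baseHeight_mem N u
    exact abs_le.2 ⟨by linarith, by linarith⟩⟩
  immersion u := .inl (by simp)
  double u w hne h _ := absurd h hne
  fst_one h := h.elim
  snd_one h := h.elim
  det_one h := h.elim
  zero u _ := by simp

include hσ

theorem isModel_slide : IsModel N (conj σ (slide g)) (baseHeight N) False where
  le := hg.le
  smooth_fst := conj_contDiff hg.slide_contDiff
  smooth_snd := baseHeight_contDiff N
  far u h := ⟨by
    rw [conj, hg.slide_outer (by rwa [abs_sign_mul hσ]), sign_mul_self hσ], rfl⟩
  near u h := ⟨by
    rw [conj, abs_sign_mul hσ]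
    have := hg.abs_slide_le (u := σ * u) (by rwa [abs_sign_mul hσ])
    linarith [hg.le], by
    have := baseHeight_mem N u
    exact abs_le.2 ⟨by linarith, by linarith⟩⟩
  immersion u := .inl (by
    rw [deriv_conj hσ hg.slide_contDiff]
    exact (hg.deriv_slide_pos _).ne')
  double u w hne h _ := by
    refine absurd ?_ hne
    have h1 : σ * (σ * slide g (σ * u)) = σ * (σ * slide g (σ * w)) := congrArg (σ * ·) h
    rw [sign_mul_self hσ, sign_mul_self hσ] at h1
    have h2 := congrArg (σ * ·) (hg.strictMono_slide.injective h1)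
    simpa only [sign_mul_self hσ] using h2
  fst_one h := h.elim
  snd_one h := h.elim
  det_one h := h.elim
  zero u _ := by
    rw [deriv_conj hσ hg.slide_contDiff]
    exact (hg.deriv_slide_pos _).ne'

include hρ

/-- All properties are common to the two weights except transversality to the vertical strand, which
is assumed as `hz`: the positions of the zeros depend on the weight. -/
theorem isModel_pos (hz : ∀ u, pos g ρ u = 0 → deriv (pos g ρ) u ≠ 0) :
    IsModel N (conj σ (pos g ρ)) (bumpHeight N) True := by
  have hN := hg.le
  have hd := deriv_conj hσ (hg.pos_contDiff hρ)
  have h1 : pos g ρ 1 = pos g ρ (-1) := by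
    have := hg.pos_sub_pos_neg hρ 1
    rw [kinkPos_inner (by norm_num)] at this
    linarith
  have h2 : pos g ρ 1 < 0 := hg.pos_neg_of_middle hρ (by norm_num) (by norm_num)
  refine ⟨hg.le, conj_contDiff (hg.pos_contDiff hρ), bumpHeight_contDiff N, fun u h => ⟨?_, ?_⟩,
    fun u h => ⟨?_, ?_⟩, fun u => ?_, fun u w hne hx hy => ⟨trivial, ?_⟩, fun _ => ⟨?_, ?_⟩, fun _ => ?_,
    fun _ => ?_, fun u h => ?_⟩
  · rw [conj, hg.pos_far hρ (by rwa [abs_sign_mul hσ]), sign_mul_self hσ]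
  · exact bumpHeight_eq (by linarith)
  · rw [conj, abs_sign_mul hσ]
    have := hg.abs_pos_le hρ (σ * u)
    rw [abs_sign_mul hσ] at this
    linarith
  · have := bumpHeight_mem N u
    exact abs_le.2 ⟨by linarith, by linarith⟩
  -- For `|u| < 3` the height has nonzero slope except at the tip `u = 0`, where the abscissa has
  -- slope `-1`; further out the abscissa is increasing.
  · rw [hd]
    rcases lt_or_ge |u| 3 with h | h
    · rcases eq_or_ne u 0 with rfl | hu
      · left; rw [mul_zero, hg.deriv_pos_zero hρ]; norm_num
      · right
        obtain ⟨d, hd0, hd1⟩ := deriv_bumpHeight (N := N) (by linarith) h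
        rw [hd1, neg_ne_zero]
        exact mul_ne_zero hd0.ne' hu
    · left
      exact (hg.deriv_pos_outer hρ (by rw [abs_sign_mul hσ]; linarith)).ne'
  · have hσu : ∀ u, bumpHeight N (σ * u) = bumpHeight N u := fun u => by
      rcases hσ with rfl | rfl
      · rw [one_mul]
      · rw [neg_one_mul, bumpHeight_neg]
    have h3 : σ * (σ * pos g ρ (σ * u)) = σ * (σ * pos g ρ (σ * w)) := congrArg (σ * ·) hx
    rw [sign_mul_self hσ, sign_mul_self hσ] at h3
    have h4 := hg.eq_of_pos_eq hρ (u := σ * u) (w := σ * w) (fun h => hne (by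
      have := congrArg (σ * ·) h
      simpa only [sign_mul_self hσ] using this)) h3 (by rw [hσu, hσu, hy])
    rcases hσ with rfl | rfl
    · simpa only [one_mul] using h4
    · rcases h4 with ⟨h5, h6⟩ | ⟨h5, h6⟩
      · exact .inr ⟨by linarith, by linarith⟩
      · exact .inl ⟨by linarith, by linarith⟩
  · rcases hσ with rfl | rfl <;> simp [conj, h1]
  · rw [ne_eq, conj_eq_zero hσ]
    rcases hσ with rfl | rfl
    · rw [one_mul]; exact h2.ne
    · rw [mul_one, ← h1]; exact h2.ne
  · exact (bumpHeight_neg 1).symm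
  · obtain ⟨d, hd0, hd1⟩ := deriv_bumpHeight (N := N) (u := 1) (by linarith) (by norm_num)
    obtain ⟨e, he0, he1⟩ := deriv_bumpHeight (N := N) (u := -1) (by linarith) (by norm_num)
    rw [hd, hd, hd1, he1, hg.deriv_pos_one hρ (by rw [abs_sign_mul hσ, abs_one]),
      hg.deriv_pos_one hρ (by rw [abs_sign_mul hσ, abs_neg, abs_one])]
    linarith
  · rw [hd]
    exact hz _ ((conj_eq_zero hσ).1 h)

omit hσ hρ

/-- For `|u| ≤ 7 / 5` the displacement `5` dominates `kinkPos u`, so the fully displaced kink does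
not meet the vertical strand. -/
theorem lt_abs_of_pos_one_eq_zero {u : ℝ} (h : pos g (fun _ => 1) u = 0) : 7 / 5 < |u| := by
  by_contra hc
  rw [not_lt] at hc
  have h1 := (abs_le.1 (abs_kinkPos_le u)).2
  rw [pos, hg.eq_one u (by linarith [hg.le])] at h
  linarith

theorem deriv_pos_one_ne_zero (u : ℝ) (h : pos g (fun _ => 1) u = 0) :
    deriv (pos g fun _ => 1) u ≠ 0 :=
  (hg.deriv_pos_outer isWeight_one (hg.lt_abs_of_pos_one_eq_zero h)).ne'

/-- The weight that vanishes in the middle of the kink. -/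
abbrev _root_.kinkRamp : ℝ → ℝ := ramp (3 / 5) (9 / 10)

theorem pos_kinkRamp_inner {u : ℝ} (h : |u| ≤ 3 / 5) : pos g kinkRamp u = u ^ 3 - u := by
  rw [pos, kinkPos_inner (by linarith), kinkRamp, ramp_eq_zero (by norm_num) (by norm_num) h]; ring

theorem pos_kinkRamp_middle {u : ℝ} (h : |u| ≤ 6 / 5) :
    pos g kinkRamp u = u ^ 3 - u - 5 * kinkRamp u := by
  rw [pos, kinkPos_inner h, hg.eq_one u (by linarith [hg.le]), one_mul]

/-- For `|u| > 3 / 5` the cubic has slope `3 * u² - 1 > 0`, and for negative `u` the ramp is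
decreasing, so subtracting it only adds to the slope. -/
theorem deriv_pos_kinkRamp {u : ℝ} (h : -(9 / 10) < u) (h' : u < -(3 / 5)) :
    0 < deriv (pos g kinkRamp) u := by
  set q : ℝ → ℝ := fun u => (u ^ 2 - (3 / 5) ^ 2) / ((9 / 10) ^ 2 - (3 / 5) ^ 2) with hq
  have h1 : HasDerivAt q (2 * u / ((9 / 10) ^ 2 - (3 / 5) ^ 2)) u := by
    have h1 : HasDerivAt (fun u : ℝ => u ^ 2 - (3 / 5) ^ 2) (2 * u) u := by
      simpa using (hasDerivAt_pow 2 u).sub_const ((3 / 5 : ℝ) ^ 2)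
    exact h1.div_const _
  have h2 : HasDerivAt kinkRamp (deriv Real.smoothTransition (q u) *
      (2 * u / ((9 / 10) ^ 2 - (3 / 5) ^ 2))) u :=
    HasDerivAt.comp (h₂ := Real.smoothTransition) (h := q) u
      ((Real.smoothTransition.contDiff.differentiable (n := ∞) (by simp)) (q u)).hasDerivAt h1
  have h3 : 0 ≤ deriv Real.smoothTransition (q u) := Real.smoothTransition.monotone.deriv_nonneg
  have h4 : HasDerivAt (fun u : ℝ => u ^ 3 - u) (3 * u ^ 2 - 1) u := by
    simpa using (hasDerivAt_pow 3 u).fun_sub (hasDerivAt_id' u)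
  have h5 := h4.fun_sub (h2.const_mul 5)
  have h6 : HasDerivAt (pos g kinkRamp) _ u := h5.congr_of_eventuallyEq (by
    filter_upwards [Ioo_mem_nhds h h'] with w hw
    exact hg.pos_kinkRamp_middle (abs_le.2 ⟨by linarith [hw.1], by linarith [hw.2]⟩))
  rw [h6.deriv]
  have h7 : deriv Real.smoothTransition (q u) * (2 * u / ((9 / 10) ^ 2 - (3 / 5) ^ 2)) ≤ 0 :=
    mul_nonpos_of_nonneg_of_nonpos h3 (div_nonpos_of_nonpos_of_nonneg (by linarith) (by norm_num))
  nlinarith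

/-- The zeros of the position. -/
theorem exists_pos_kinkRamp_zeros : ∃ w₁ w₂, w₁ ∈ Ioo (-(9 / 10) : ℝ) (-(3 / 5)) ∧
    w₂ ∈ Ioo 3 (2 * N) ∧ ∀ u, pos g kinkRamp u = 0 ↔ u = 0 ∨ u = w₁ ∨ u = w₂ := by
  have hN := hg.le
  obtain ⟨w₂, h1, h2, h3⟩ := hg.exists_slide_eq_zero
  have hr1 : kinkRamp (9 / 10) = 1 :=
    ramp_eq_one (by norm_num) (by norm_num) (by norm_num [abs_of_pos])
  have hr0 : kinkRamp (3 / 5) = 0 :=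
    ramp_eq_zero (by norm_num) (by norm_num) (by norm_num [abs_of_pos])
  have hm : ∀ w, 0 ≤ w → w ≤ 6 / 5 → pos g kinkRamp (-w) = w - w ^ 3 - 5 * kinkRamp w := by
    intro w hw hw'
    rw [hg.pos_kinkRamp_middle (by rw [abs_neg, abs_of_nonneg hw]; exact hw'), kinkRamp, ramp_neg]
    ring
  have hanti : ∀ w w' : ℝ, 3 / 5 ≤ w → w < w' → w' ≤ 9 / 10 →
      pos g kinkRamp (-w') < pos g kinkRamp (-w) := by
    intro w w' h h' h''
    rw [hm w (by linarith) (by linarith), hm w' (by linarith) (by linarith)]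
    have := ramp_mono (a := 3 / 5) (b := 9 / 10) (by norm_num) (by norm_num)
      (by linarith : 0 ≤ w) h'.le
    -- The second factor is positive because `3 * (3 / 5)² > 1`; it comes from factoring the
    -- difference of the cubics.
    have h4 : 0 < (w' - w) * (w ^ 2 + w * w' + w' ^ 2 - 1) :=
      mul_pos (by linarith) (by nlinarith)
    simp only [kinkRamp]
    nlinarith
  obtain ⟨w, hw, hw0⟩ := intermediate_value_Ioo' (by norm_num : (3 / 5 : ℝ) ≤ 9 / 10)
    (f := fun w => pos g kinkRamp (-w))
    ((hg.pos_contDiff isWeight_ramp).continuous.comp continuous_neg).continuousOn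
    (show (0 : ℝ) ∈ Ioo (pos g kinkRamp (-(9 / 10))) (pos g kinkRamp (-(3 / 5))) by
      rw [hm _ (by norm_num) (by norm_num), hm _ (by norm_num) (by norm_num), hr1, hr0]
      norm_num)
  refine ⟨-w, w₂, ⟨by linarith [hw.2], by linarith [hw.1]⟩, ⟨h1, h2⟩, fun u => ⟨fun h => ?_, ?_⟩⟩
  · rcases le_or_gt |u| (3 / 5) with k1 | k1
    · rw [hg.pos_kinkRamp_inner k1] at h
      have h4 : u * (u ^ 2 - 1) = 0 := by linarith
      rcases mul_eq_zero.1 h4 with h5 | h5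
      · exact .inl h5
      · rw [← sq_abs] at h5
        nlinarith [abs_nonneg u]
    rcases le_or_gt (9 / 10) |u| with k2 | k2
    · rcases le_or_gt |u| (7 / 5) with k3 | k3
      · exact absurd h (hg.pos_neg_of_middle isWeight_ramp k2 k3).ne
      · rw [hg.pos_outer isWeight_ramp k3.le, ← h3] at h
        exact .inr (.inr (hg.strictMono_slide.injective h))
    · rcases le_or_gt 0 u with k3 | k3
      · rw [abs_of_nonneg k3] at k1 k2
        rw [hg.pos_kinkRamp_middle (by rw [abs_of_nonneg k3]; linarith)] at h
        have := ramp_nonneg (3 / 5) (9 / 10) u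
        simp only [kinkRamp] at h
        nlinarith [mul_pos (by linarith : 0 < u) (by nlinarith : 0 < 1 - u ^ 2)]
      · rw [abs_of_neg k3] at k1 k2
        refine .inr (.inl ?_)
        by_contra hne
        have hne' : -u ≠ w := fun h => hne (by rw [← h, neg_neg])
        replace hw0 : pos g kinkRamp (-w) = 0 := hw0
        rcases lt_or_gt_of_ne hne' with h4 | h4
        · have := hanti _ _ k1.le h4 hw.2.le
          rw [neg_neg, h, hw0] at this
          exact lt_irrefl _ this
        · have := hanti _ _ hw.1.le h4 k2.le
          rw [neg_neg, h, hw0] at this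
          exact lt_irrefl _ this
  · rintro (rfl | rfl | rfl)
    · rw [hg.pos_kinkRamp_inner (by norm_num)]; norm_num
    · exact hw0
    · rw [hg.pos_outer isWeight_ramp (by rw [abs_of_pos] <;> linarith), h3]

theorem deriv_pos_kinkRamp_ne_zero (u : ℝ) (h : pos g kinkRamp u = 0) :
    deriv (pos g kinkRamp) u ≠ 0 := by
  obtain ⟨w₁, w₂, h1, h2, h3⟩ := hg.exists_pos_kinkRamp_zeros
  rcases (h3 u).1 h with rfl | rfl | rfl
  · rw [hg.deriv_pos_zero isWeight_ramp]; norm_num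
  · exact (hg.deriv_pos_kinkRamp h1.1 h1.2).ne'
  · exact (hg.deriv_pos_outer isWeight_ramp (by
      rw [abs_of_pos (by linarith [h2.1])]; linarith [h2.1])).ne'

include hσ

theorem isModel_kink : IsModel N (conj σ (pos g fun _ => 1)) (bumpHeight N) True :=
  hg.isModel_pos isWeight_one hσ hg.deriv_pos_one_ne_zero

theorem isModel_kinkRamp : IsModel N (conj σ (pos g kinkRamp)) (bumpHeight N) True :=
  hg.isModel_pos isWeight_ramp hσ hg.deriv_pos_kinkRamp_ne_zero

theorem exists_conj_zeros : ∃ w₁ w₂, σ * w₁ ∈ Ioo (-(9 / 10) : ℝ) (-(3 / 5)) ∧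
    σ * w₂ ∈ Ioo 3 (2 * N) ∧ (∀ u, conj σ (pos g kinkRamp) u = 0 ↔ u = 0 ∨ u = w₁ ∨ u = w₂) ∧
    deriv (conj σ (pos g kinkRamp)) 0 = -1 ∧ 0 < deriv (conj σ (pos g kinkRamp)) w₁ ∧
    0 < deriv (conj σ (pos g kinkRamp)) w₂ := by
  obtain ⟨w₁, w₂, h1, h2, h3⟩ := hg.exists_pos_kinkRamp_zeros
  have hd := deriv_conj hσ (hg.pos_contDiff isWeight_ramp)
  have hiff : ∀ u w : ℝ, σ * u = w ↔ u = σ * w := fun u w =>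
    ⟨fun h => by rw [← h, sign_mul_self hσ], fun h => by rw [h, sign_mul_self hσ]⟩
  refine ⟨σ * w₁, σ * w₂, by rwa [sign_mul_self hσ], by rwa [sign_mul_self hσ], fun u => ?_, ?_, ?_,
    ?_⟩
  · rw [conj_eq_zero hσ, h3, hiff, hiff, hiff, mul_zero]
  · rw [hd, mul_zero, hg.deriv_pos_zero isWeight_ramp]
  · rw [hd, sign_mul_self hσ]
    exact hg.deriv_pos_kinkRamp h1.1 h1.2
  · rw [hd, sign_mul_self hσ]
    exact hg.deriv_pos_outer isWeight_ramp (by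
      rw [abs_of_pos (by linarith [h2.1])]; linarith [h2.1])

end IsPlateau

/-! ### Moving a kink across a strand -/

/-- Within the strip of the box both strands stay in its middle half, so membership is decided by
the height alone. -/
theorem strandCurve_mem_box {M y₁ y₂ : ℝ} {B : Set ℂ} (hM : 0 < M)
    (hB₁ : ∀ z ∈ B, |z.re| ≤ M ∧ y₁ ≤ z.im ∧ z.im ≤ y₂)
    (hB₂ : ∀ z : ℂ, |z.re| ≤ M / 2 → (z ∈ B ↔ y₁ ≤ z.im ∧ z.im ≤ y₂) ∧
      (z ∈ interior B ↔ y₁ < z.im ∧ z.im < y₂)) {x y : ℝ → ℝ}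
    (hx : ∀ u, y₁ ≤ y u → y u ≤ y₂ → |x u| ≤ M / 2) (k : Bool) (u : ℝ) :
    (StrandFrame.strandCurve (planeCurve x y) k u ∈ B ↔ y₁ ≤ cond k u (y u) ∧ cond k u (y u) ≤ y₂) ∧
    (StrandFrame.strandCurve (planeCurve x y) k u ∈ interior B ↔
      y₁ < cond k u (y u) ∧ cond k u (y u) < y₂) := by
  have him : (StrandFrame.strandCurve (planeCurve x y) k u).im = cond k u (y u) := by cases k <;> rfl
  by_cases h : y₁ ≤ cond k u (y u) ∧ cond k u (y u) ≤ y₂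
  · rw [← him]
    refine hB₂ _ ?_
    cases k
    · exact hx u h.1 h.2
    · simp only [StrandFrame.strandCurve, cond_true, abs_zero]; linarith
  · have h1 : StrandFrame.strandCurve (planeCurve x y) k u ∉ B := fun hm => h (him ▸ (hB₁ _ hm).2)
    exact ⟨iff_of_false h1 h, iff_of_false (fun h' => h1 (interior_subset h'))
      fun h' => h ⟨h'.1.le, h'.2.le⟩⟩

namespace StrandFrame.IsDouble

variable {E : KnotoidDiagram} {F : StrandFrame E} {N s₀ : ℝ} (hF : F.IsDouble N s₀) {g : ℝ → ℝ}
  (hg : IsPlateau N g) {σ : ℝ} (hσ : σ = 1 ∨ σ = -1)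

include hF

theorem strandTime_le {k : Bool} {a b : ℝ} :
    F.strandTime s₀ k a ≤ F.strandTime s₀ k b ↔ a ≤ b := by
  rw [← not_lt, ← not_lt, hF.strandTime_lt]

/-- The tip of the displaced kink is pushed across the vertical strand. The box lies above the
height at parameter `19 / 20`, where both weights are `1`, so it contains neither the double point
nor the crossing at `w₂`. There are no crossings in it before, and afterwards there are those at `0`
and `w₁`, where the abscissa has slopes of opposite signs. -/
theorem reidemeisterTwo : ReidemeisterTwo
    (F.replace (hF.admissible (hg.isModel_kink hσ)))
    (F.replace (hF.admissible (hg.isModel_kinkRamp hσ))) := by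
  have hN := hg.le
  have hN0 : 0 ≤ N := by linarith
  set h := bumpHeight N (19 / 20) with hh
  have hh1 := bumpHeight_mem N (19 / 20)
  have hle : ∀ u, (h ≤ bumpHeight N u ↔ |u| ≤ 19 / 20) ∧ (h < bumpHeight N u ↔ |u| < 19 / 20) := by
    intro u
    obtain ⟨k1, k2, -⟩ := bumpHeight_le_iff (N := N) hN0 (u := u) (w := 19 / 20)
      (.inl (by rw [abs_of_pos] <;> norm_num))
    rw [abs_of_pos (by norm_num : (0 : ℝ) < 19 / 20)] at k1 k2
    exact ⟨k1, k2⟩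
  have hlt3 : ∀ u, bumpHeight N u < 3 := fun u => by linarith [(bumpHeight_mem N u).2]
  -- For `|u| ≤ 19 / 20` the abscissa is at most `19 / 20 + 5 < 6` in absolute value.
  obtain ⟨B, hD, hB₁, hB₂⟩ := exists_box (M := 12) (y₁ := h) (y₂ := 3) (by norm_num) (by linarith)
  have hB : ∀ z ∈ B, |z.re| ≤ 5 * N ∧ |z.im| ≤ 4 := fun z hz => by
    obtain ⟨k1, k2, k3⟩ := hB₁ z hz
    exact ⟨by linarith, abs_le.2 ⟨by linarith, by linarith⟩⟩
  have hbox : ∀ {ρ : ℝ → ℝ}, IsWeight ρ → ∀ k u, _ := fun {ρ} hρ =>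
    strandCurve_mem_box (x := IsPlateau.conj σ (IsPlateau.pos g ρ)) (y := bumpHeight N) (by norm_num)
      hB₁ hB₂ fun u h1 _ => by
        have h2 := (hle u).1.1 h1
        have h3 := hg.abs_pos_le hρ (σ * u)
        rw [IsPlateau.abs_sign_mul hσ] at h3
        rw [IsPlateau.conj, IsPlateau.abs_sign_mul hσ]
        linarith
  -- the arcs, the upper one first
  obtain ⟨kind, α, β, hex, hinj, hpair⟩ : ∃ (kind : Fin 2 → Bool) (α β : Fin 2 → ℝ),
      (∀ P : Bool → ℝ → ℝ → Prop, (∃ i, P (kind i) (α i) (β i)) ↔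
        P false (-(19 / 20)) (19 / 20) ∨ P true h 3) ∧ (∀ i j, i ≠ j → kind i ≠ kind j) ∧
      ∀ u, |u| ≤ 19 / 20 → (F.mixedPair s₀ (bumpHeight N) u).1 ∈
          Icc (F.strandTime s₀ (kind 0) (α 0)) (F.strandTime s₀ (kind 0) (β 0)) ∧
        (F.mixedPair s₀ (bumpHeight N) u).2 ∈
          Icc (F.strandTime s₀ (kind 1) (α 1)) (F.strandTime s₀ (kind 1) (β 1)) := by
    have e1 : ∀ u, |u| ≤ 19 / 20 → F.strandTime s₀ false u ∈
        Icc (F.strandTime s₀ false (-(19 / 20))) (F.strandTime s₀ false (19 / 20)) := fun u hu => by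
      rw [mem_Icc, hF.strandTime_le, hF.strandTime_le]; exact abs_le.1 hu
    have e2 : ∀ u, |u| ≤ 19 / 20 → F.strandTime s₀ true (bumpHeight N u) ∈
        Icc (F.strandTime s₀ true h) (F.strandTime s₀ true 3) := fun u hu => by
      rw [mem_Icc, hF.strandTime_le, hF.strandTime_le]; exact ⟨(hle u).1.2 hu, (hlt3 u).le⟩
    by_cases ho : F.isOver
    · refine ⟨![false, true], ![-(19 / 20), h], ![19 / 20, 3], fun P => by simp, fun i j hij => ?_,
        fun u hu => ?_⟩
      · fin_cases i <;> fin_cases j <;> simp at hij ⊢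
      · rw [mixedPair, if_pos ho]; exact ⟨e1 u hu, e2 u hu⟩
    · refine ⟨![true, false], ![h, -(19 / 20)], ![3, 19 / 20], fun P => by simp [or_comm],
        fun i j hij => ?_, fun u hu => ?_⟩
      · fin_cases i <;> fin_cases j <;> simp at hij ⊢
      · rw [mixedPair, if_neg ho]; exact ⟨e2 u hu, e1 u hu⟩
  have hall : ∀ P : Bool → ℝ → ℝ → Prop, (∀ i, P (kind i) (α i) (β i)) ↔
      P false (-(19 / 20)) (19 / 20) ∧ P true h 3 := fun P => by
    rw [← not_iff_not, not_forall, hex fun k a b => ¬ P k a b, not_and_or]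
  have hmeet : ∀ {ρ : ℝ → ℝ}, IsWeight ρ →
      StrandsMeet N (planeCurve (IsPlateau.conj σ (IsPlateau.pos g ρ)) (bumpHeight N)) B kind α β := by
    intro ρ hρ k u hu
    rw [(hbox hρ k u).1, (hbox hρ k u).2, hex fun κ a b => k = κ ∧ u ∈ Icc a b,
      hex fun κ a b => k = κ ∧ u ∈ Ioo a b]
    cases k
    · simp [(hle u).1, (hle u).2, abs_le, abs_lt, hlt3 u, (hlt3 u).le]
    · simp
  have hself : ∀ {ρ : ℝ → ℝ}, IsWeight ρ →
      planeCurve (IsPlateau.conj σ (IsPlateau.pos g ρ)) (bumpHeight N) 1 ∉ B := fun hρ hm => by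
    have := (hle 1).1.1 ((hbox hρ false 1).1.1 hm).1
    norm_num at this
  have hzero1 : ∀ u, IsPlateau.conj σ (IsPlateau.pos g fun _ => 1) u = 0 →
      planeCurve (IsPlateau.conj σ (IsPlateau.pos g fun _ => 1)) (bumpHeight N) u ∉ B := by
    intro u hu hm
    have h1 := (hle u).1.1 ((hbox isWeight_one false u).1.1 hm).1
    have h2 := hg.lt_abs_of_pos_one_eq_zero ((IsPlateau.conj_eq_zero hσ).1 hu)
    rw [IsPlateau.abs_sign_mul hσ] at h2
    linarith
  obtain ⟨w₁, w₂, hw₁, hw₂, hw, d0, d1, -⟩ := hg.exists_conj_zeros hσ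
  have aw₁ : |w₁| < 9 / 10 := by
    rw [← IsPlateau.abs_sign_mul hσ, abs_lt]; exact ⟨by linarith [hw₁.1], by linarith [hw₁.2]⟩
  have aw₂ : 3 < |w₂| := by
    rw [← IsPlateau.abs_sign_mul hσ]; exact hw₂.1.trans_le (le_abs_self _)
  have hin : ∀ u, |u| ≤ 9 / 10 → planeCurve (IsPlateau.conj σ (IsPlateau.pos g kinkRamp))
      (bumpHeight N) u ∈ interior B := fun u hu =>
    (hbox isWeight_ramp false u).2.2 ⟨(hle u).2.2 (by linarith), hlt3 u⟩
  have hw₂' : planeCurve (IsPlateau.conj σ (IsPlateau.pos g kinkRamp)) (bumpHeight N) w₂ ∉ B :=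
    fun hm => by linarith [(hle w₂).1.1 ((hbox isWeight_ramp false w₂).1.1 hm).1]
  have hne : (0 : ℝ) ≠ w₁ := fun h => by
    rw [← h, mul_zero] at hw₁
    linarith [hw₁.2]
  refine ⟨B, _, _, hF.localChange (hg.isModel_kink hσ) (hg.isModel_kinkRamp hσ) hD hB (kind := kind)
    (α := α) (β := β) ?_ ?_ ?_ (fun i j hij hk => absurd hk (hinj i j hij)) (hmeet isWeight_one)
    (fun _ hm => absurd hm (hself isWeight_one)) (fun u hu hm => absurd hm (hzero1 u hu))
    (hmeet isWeight_ramp) (fun _ hm => absurd hm (hself isWeight_ramp)) (fun u hu hm => ?_) ?_, ?_,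
    F.mixedPair s₀ (bumpHeight N) 0, F.mixedPair s₀ (bumpHeight N) w₁, ?_, ?_, (hpair 0 ?_).1,
    (hpair w₁ ?_).1, (hpair 0 ?_).2, (hpair w₁ ?_).2, ?_⟩
  · refine (hall fun _ a _ => |a| < 6 * N).2 ⟨?_, abs_lt.2 ⟨by linarith, by linarith⟩⟩
    rw [abs_neg, abs_of_pos] <;> linarith
  · refine (hall fun _ _ b => |b| < 6 * N).2 ⟨?_, ?_⟩ <;> rw [abs_of_pos] <;> linarith
  · exact (hall fun _ a b => a < b).2 ⟨by norm_num, by linarith⟩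
  · rcases (hw u).1 hu with rfl | rfl | rfl
    · exact hin 0 (by norm_num)
    · exact hin u aw₁.le
    · exact absurd hm hw₂'
  · intro u hu
    obtain ⟨h1, -⟩ := (hall fun k a b => false = k → u ∉ Ioo a b).1 hu
    have h2 : 19 / 20 ≤ |u| := by
      by_contra hc
      exact h1 rfl (abs_lt.1 (not_le.1 hc))
    rw [IsPlateau.conj, IsPlateau.conj, IsPlateau.pos, IsPlateau.pos,
      show kinkRamp (σ * u) = 1 from isWeight_ramp.eq_one _
        (by rw [IsPlateau.abs_sign_mul hσ]; linarith)]
    exact ⟨rfl, rfl⟩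
  · refine eq_empty_of_forall_notMem fun p hp => ?_
    rcases (hF.mem_crossingsIn (hg.isModel_kink hσ) hB).1 hp with ⟨-, -, hm⟩ | ⟨u, -, hu, hm⟩
    · exact hself isWeight_one hm
    · exact hzero1 u hu hm
  · intro he
    have h1 : F.strandTime s₀ false 0 = F.strandTime s₀ false w₁ := by
      by_cases ho : F.isOver
      · simp only [mixedPair, if_pos ho] at he
        exact (Prod.ext_iff.1 he).1
      · simp only [mixedPair, if_neg ho] at he
        exact (Prod.ext_iff.1 he).2
    exact hne ((hF.strandTime_inj (by rw [abs_zero]; linarith) (by linarith)).1 h1).2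
  · ext p
    rw [hF.mem_crossingsIn (hg.isModel_kinkRamp hσ) hB, mem_insert_iff, mem_singleton_iff]
    constructor
    · rintro (⟨-, -, hm⟩ | ⟨u, rfl, hu, hm⟩)
      · exact absurd hm (hself isWeight_ramp)
      · rcases (hw u).1 hu with rfl | rfl | rfl
        · exact .inl rfl
        · exact .inr rfl
        · exact absurd hm hw₂'
    · rintro (rfl | rfl)
      · exact .inr ⟨0, rfl, (hw 0).2 (.inl rfl), interior_subset (hin 0 (by norm_num))⟩
      · exact .inr ⟨w₁, rfl, (hw w₁).2 (.inr (.inl rfl)), interior_subset (hin w₁ aw₁.le)⟩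
  · norm_num
  · linarith
  · norm_num
  · linarith
  · rw [hF.crossingSign_mixedPair (hg.isModel_kinkRamp hσ) ((hw 0).2 (.inl rfl)),
      hF.crossingSign_mixedPair (hg.isModel_kinkRamp hσ) ((hw w₁).2 (.inr (.inl rfl))), d0,
      sign_pos d1, sign_neg (by norm_num)]
    simp

end StrandFrame.IsDouble

/-- The two components of the annular range are described by centre and half-length, the first one
being on the side of `e`, so that both signs of `e` are treated by the same formula. -/
theorem mem_Icc_or_iff {e d u : ℝ} (he : e = 1 ∨ e = -1) :
    (1 / 2 ≤ |u| ∧ |u| ≤ d ↔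
      u ∈ Icc (e * ((d + 1 / 2) / 2) - (d - 1 / 2) / 2) (e * ((d + 1 / 2) / 2) + (d - 1 / 2) / 2) ∨
      u ∈ Icc (-e * ((d + 1 / 2) / 2) - (d - 1 / 2) / 2)
        (-e * ((d + 1 / 2) / 2) + (d - 1 / 2) / 2)) ∧
    (1 / 2 < |u| ∧ |u| < d ↔
      u ∈ Ioo (e * ((d + 1 / 2) / 2) - (d - 1 / 2) / 2) (e * ((d + 1 / 2) / 2) + (d - 1 / 2) / 2) ∨
      u ∈ Ioo (-e * ((d + 1 / 2) / 2) - (d - 1 / 2) / 2)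
        (-e * ((d + 1 / 2) / 2) + (d - 1 / 2) / 2)) := by
  simp only [mem_Icc, mem_Ioo]
  constructor
  · constructor
    · rintro ⟨h1, h2⟩
      rw [abs_le] at h2
      rcases he with rfl | rfl <;> rcases le_abs.1 h1 with h | h
      · left; constructor <;> linarith
      · right; constructor <;> linarith
      · right; constructor <;> linarith
      · left; constructor <;> linarith
    · intro h
      rw [abs_le, le_abs]
      rcases he with rfl | rfl <;> rcases h with ⟨h1, h2⟩ | ⟨h1, h2⟩
      · exact ⟨.inl (by linarith), by linarith, by linarith⟩
      · exact ⟨.inr (by linarith), by linarith, by linarith⟩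
      · exact ⟨.inr (by linarith), by linarith, by linarith⟩
      · exact ⟨.inl (by linarith), by linarith, by linarith⟩
  · constructor
    · rintro ⟨h1, h2⟩
      rw [abs_lt] at h2
      rcases he with rfl | rfl <;> rcases lt_abs.1 h1 with h | h
      · left; constructor <;> linarith
      · right; constructor <;> linarith
      · right; constructor <;> linarith
      · left; constructor <;> linarith
    · intro h
      rw [abs_lt, lt_abs]
      rcases he with rfl | rfl <;> rcases h with ⟨h1, h2⟩ | ⟨h1, h2⟩
      · exact ⟨.inl (by linarith), by linarith, by linarith⟩
      · exact ⟨.inr (by linarith), by linarith, by linarith⟩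
      · exact ⟨.inr (by linarith), by linarith, by linarith⟩
      · exact ⟨.inl (by linarith), by linarith, by linarith⟩

/-- The zeros are named by their side relative to `e`, not by their size. With `e` the order of the
frame, `w₁` lies on the upper arc at the self-crossing and `w₂` on the lower one, for either value
of `σ`. -/
theorem IsPlateau.exists_ordered_zeros {N : ℝ} {g : ℝ → ℝ} (hg : IsPlateau N g) {σ e : ℝ}
    (hσ : σ = 1 ∨ σ = -1) (he : e = 1 ∨ e = -1) : ∃ w₁ w₂, e * w₁ ∈ Ioo (1 / 2) (2 * N) ∧
    -e * w₂ ∈ Ioo (1 / 2) (2 * N) ∧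
    (∀ u, conj σ (pos g kinkRamp) u = 0 ↔ u = 0 ∨ u = w₁ ∨ u = w₂) ∧
    0 < deriv (conj σ (pos g kinkRamp)) w₁ ∧ 0 < deriv (conj σ (pos g kinkRamp)) w₂ := by
  obtain ⟨w₁, w₂, h1, h2, h3, -, h4, h5⟩ := hg.exists_conj_zeros hσ
  have hN := hg.le
  simp only [mem_Ioo] at h1 h2 ⊢
  by_cases heq : e = σ
  · refine ⟨w₂, w₁, ?_, ?_, fun u => by rw [h3, or_comm (a := u = w₂)], h5, h4⟩
    · rw [heq]; constructor <;> linarith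
    · rw [heq, neg_mul]; constructor <;> linarith
  · have heq' : e = -σ := by
      rcases hσ with rfl | rfl <;> rcases he with rfl | rfl
      · exact absurd rfl heq
      · rfl
      · rw [neg_neg]
      · exact absurd rfl heq
    refine ⟨w₁, w₂, ?_, ?_, h3, h4, h5⟩
    · rw [heq', neg_mul]; constructor <;> linarith
    · rw [heq', neg_neg]; constructor <;> linarith

namespace StrandFrame.IsDouble

variable {E : KnotoidDiagram} {F : StrandFrame E} {N s₀ : ℝ} (hF : F.IsDouble N s₀) {g : ℝ → ℝ}
  (hg : IsPlateau N g)

include hF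

open Classical in
-- Below the tip the loop and the vertical strand form a triangle: the self-crossing at `±1`, and
-- one crossing of the vertical strand with each leg of the loop. The reflected curve has the same
-- heights, and it has the same abscissae near the tip and far out, so the two differ inside a box
-- that excludes the tip crossing at `0`. The signs agree because the slopes of the abscissa at `w₁`
-- and `w₂` are positive on both sides.
theorem reidemeisterThree : ReidemeisterThree
    (F.replace (hF.admissible (hg.isModel_kinkRamp (.inl rfl))))
    (F.replace (hF.admissible (hg.isModel_kinkRamp (.inr rfl)))) := by
  have hN := hg.le
  have hN0 : 0 ≤ N := by linarith
  have he := F.order_eq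
  set e := F.order with heq
  set d := 2 * N + 1 with hd
  set m := (d + 1 / 2) / 2 with hm
  set l := (d - 1 / 2) / 2 with hl
  set h₁ := bumpHeight N d with hh₁
  set h₂ := bumpHeight N (1 / 2) with hh₂
  have b₁ := bumpHeight_mem N d
  have b₂ := bumpHeight_mem N (1 / 2)
  have ad : |d| = d := abs_of_pos (by linarith)
  have ah : |(1 / 2 : ℝ)| = 1 / 2 := abs_of_pos (by norm_num)
  have hd' : ∀ u, (h₁ ≤ bumpHeight N u ↔ |u| ≤ d) ∧ (h₁ < bumpHeight N u ↔ |u| < d) := by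
    intro u
    obtain ⟨k1, k2, -⟩ := bumpHeight_le_iff (N := N) hN0 (u := u) (w := d)
      (.inr (by rw [ad]; linarith))
    rw [ad] at k1 k2
    exact ⟨k1, k2⟩
  have hh' : ∀ u, (bumpHeight N u ≤ h₂ ↔ 1 / 2 ≤ |u|) ∧ (bumpHeight N u < h₂ ↔ 1 / 2 < |u|) := by
    intro u
    obtain ⟨-, -, k1, k2⟩ := bumpHeight_le_iff (N := N) hN0 (u := u) (w := 1 / 2)
      (.inl (by rw [ah]; norm_num))
    rw [ah] at k1 k2
    exact ⟨k1, k2⟩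
  have h12 : h₁ < h₂ := (hd' _).2.2 (by rw [ah]; linarith)
  -- For `|u| ≤ 2 * N + 1` the abscissa is at most `2 * N + 6` in absolute value, less than half of
  -- this width; `N ≥ 20` keeps the width within `5 * N`.
  obtain ⟨B, hD, hB₁, hB₂⟩ := exists_box (M := 4 * N + 20) (y₁ := h₁) (y₂ := h₂) (by linarith) h12
  have hB : ∀ z ∈ B, |z.re| ≤ 5 * N ∧ |z.im| ≤ 4 := fun z hz => by
    obtain ⟨k1, k2, k3⟩ := hB₁ z hz
    exact ⟨by linarith, abs_le.2 ⟨by linarith, by linarith⟩⟩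
  have hbox : ∀ {σ : ℝ}, (σ = 1 ∨ σ = -1) → ∀ k u, _ := fun {σ} hσ =>
    strandCurve_mem_box (x := IsPlateau.conj σ (IsPlateau.pos g kinkRamp)) (y := bumpHeight N)
      (by linarith) hB₁ hB₂ fun u h1 _ => by
        have h2 := (hd' u).1.1 h1
        have h3 := hg.abs_pos_le isWeight_ramp (σ * u)
        rw [IsPlateau.abs_sign_mul hσ] at h3
        rw [IsPlateau.conj, IsPlateau.abs_sign_mul hσ]
        linarith
  have hnum : e * m - l < e * m + l ∧ -e * m - l < -e * m + l ∧ |e * m - l| < 6 * N ∧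
      |e * m + l| < 6 * N ∧ |-e * m - l| < 6 * N ∧ |-e * m + l| < 6 * N := by
    simp only [abs_lt]
    rcases he with h | h <;> rw [h, hm, hl, hd] <;>
      refine ⟨?_, ?_, ⟨?_, ?_⟩, ⟨?_, ?_⟩, ⟨?_, ?_⟩, ?_, ?_⟩ <;> linarith
  have hsep : e * m + l < -e * m - l ∨ -e * m + l < e * m - l := by
    rcases he with h | h <;> rw [h, hm, hl, hd]
    · right; linarith
    · left; linarith
  obtain ⟨hi, hlo⟩ : (F.order ∈ Icc (e * m - l) (e * m + l)) ∧
      -F.order ∈ Icc (-e * m - l) (-e * m + l) := by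
    rw [← heq, mem_Icc, mem_Icc]
    rcases he with h | h <;> rw [h, hm, hl, hd] <;>
      refine ⟨⟨?_, ?_⟩, ?_, ?_⟩ <;> linarith
  -- the arcs, in the order from top to bottom
  obtain ⟨kind, α, β, s, hex, hdisj, htri⟩ : ∃ (kind : Fin 3 → Bool) (α β : Fin 3 → ℝ) (s : Fin 3 → ℤ),
      (∀ P : Bool → ℝ → ℝ → Prop, (∃ i, P (kind i) (α i) (β i)) ↔
        P false (e * m - l) (e * m + l) ∨ P false (-e * m - l) (-e * m + l) ∨ P true h₁ h₂) ∧
      (∀ i j, i ≠ j → kind i = kind j → β i < α j ∨ β j < α i) ∧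
      ∀ (K : KnotoidDiagram) (w₁ w₂ : ℝ), w₁ ∈ Icc (e * m - l) (e * m + l) →
        w₂ ∈ Icc (-e * m - l) (-e * m + l) → bumpHeight N w₁ ∈ Icc h₁ h₂ →
        bumpHeight N w₂ ∈ Icc h₁ h₂ → K.crossingsIn B =
          {F.selfPair s₀, F.mixedPair s₀ (bumpHeight N) w₁, F.mixedPair s₀ (bumpHeight N) w₂} →
        K.crossingSign (F.selfPair s₀) = SignType.sign F.order →
        K.crossingSign (F.mixedPair s₀ (bumpHeight N) w₁) = (if F.isOver then 1 else -1) →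
        K.crossingSign (F.mixedPair s₀ (bumpHeight N) w₂) = (if F.isOver then 1 else -1) →
        ∃ p q r, IsTriangle K B (fun i => F.strandTime s₀ (kind i) (α i))
          (fun i => F.strandTime s₀ (kind i) (β i)) p q r ∧
          K.crossingSign p = s 0 ∧ K.crossingSign q = s 1 ∧ K.crossingSign r = s 2 := by
    have hT : ∀ k u a b, u ∈ Icc a b →
        F.strandTime s₀ k u ∈ Icc (F.strandTime s₀ k a) (F.strandTime s₀ k b) := fun k u a b hu => by
      rw [mem_Icc, hF.strandTime_le, hF.strandTime_le]; exact hu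
    by_cases ho : F.isOver
    · refine ⟨![false, false, true], ![e * m - l, -e * m - l, h₁], ![e * m + l, -e * m + l, h₂],
        ![SignType.sign F.order, 1, 1], fun P => ?_, fun i j hij hk => ?_, ?_⟩
      · simp [Fin.exists_fin_succ]
      · fin_cases i <;> fin_cases j <;> simp at hij hk ⊢
        · simpa using hsep
        · simpa using hsep.symm
      · intro K w₁ w₂ h1 h2 h3 h4 hK h5 h6 h7
        rw [if_pos ho] at h6 h7
        refine ⟨_, _, _, ⟨hK, ?_⟩, h5, h6, h7⟩
        simp only [selfPair, mixedPair, if_pos ho]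
        exact ⟨hT _ _ _ _ hi, hT _ _ _ _ hlo, hT _ _ _ _ h1, hT _ _ _ _ h3, hT _ _ _ _ h2,
          hT _ _ _ _ h4⟩
    · refine ⟨![true, false, false], ![h₁, e * m - l, -e * m - l], ![h₂, e * m + l, -e * m + l],
        ![-1, -1, SignType.sign F.order], fun P => ?_, fun i j hij hk => ?_, ?_⟩
      · simp [Fin.exists_fin_succ]
        tauto
      · fin_cases i <;> fin_cases j <;> simp at hij hk ⊢
        · simpa using hsep
        · simpa using hsep.symm
      · intro K w₁ w₂ h1 h2 h3 h4 hK h5 h6 h7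
        rw [if_neg ho] at h6 h7
        refine ⟨_, _, _, ⟨hK.trans ?_, ?_⟩, h6, h7, h5⟩
        · ext p; simp only [mem_insert_iff, mem_singleton_iff]; tauto
        · simp only [selfPair, mixedPair, if_neg ho]
          exact ⟨hT _ _ _ _ h3, hT _ _ _ _ h1, hT _ _ _ _ h4, hT _ _ _ _ h2, hT _ _ _ _ hi,
            hT _ _ _ _ hlo⟩
  have hall : ∀ P : Bool → ℝ → ℝ → Prop, (∀ i, P (kind i) (α i) (β i)) ↔
      P false (e * m - l) (e * m + l) ∧ P false (-e * m - l) (-e * m + l) ∧ P true h₁ h₂ := fun P => by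
    rw [← not_iff_not, not_forall, hex fun k a b => ¬ P k a b, not_and_or, not_and_or]
  have hmeet : ∀ {σ : ℝ}, (σ = 1 ∨ σ = -1) → StrandsMeet N
      (planeCurve (IsPlateau.conj σ (IsPlateau.pos g kinkRamp)) (bumpHeight N)) B kind α β := by
    intro σ hσ k u hu
    rw [(hbox hσ k u).1, (hbox hσ k u).2, hex fun κ a b => k = κ ∧ u ∈ Icc a b,
      hex fun κ a b => k = κ ∧ u ∈ Ioo a b]
    obtain ⟨k1, k2⟩ := mem_Icc_or_iff (e := e) (d := d) (u := u) he
    cases k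
    · simp only [cond_false, (hd' u).1, (hd' u).2, (hh' u).1, (hh' u).2, true_and,
        Bool.false_eq_true, false_and, or_false]
      exact ⟨and_comm.trans k1, and_comm.trans k2⟩
    · simp
  have hint : ∀ {σ : ℝ}, (σ = 1 ∨ σ = -1) → ∀ u, 1 / 2 < |u| → |u| < d →
      planeCurve (IsPlateau.conj σ (IsPlateau.pos g kinkRamp)) (bumpHeight N) u ∈ interior B :=
    fun hσ u h1 h2 => (hbox hσ false u).2.2 ⟨(hd' u).2.2 h2, (hh' u).2.2 h1⟩
  have hint1 : ∀ {σ : ℝ}, (σ = 1 ∨ σ = -1) →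
      planeCurve (IsPlateau.conj σ (IsPlateau.pos g kinkRamp)) (bumpHeight N) 1 ∈ interior B :=
    fun hσ => hint hσ 1 (by norm_num) (by rw [abs_one]; linarith)
  have hzero0 : ∀ {σ : ℝ}, (σ = 1 ∨ σ = -1) →
      planeCurve (IsPlateau.conj σ (IsPlateau.pos g kinkRamp)) (bumpHeight N) 0 ∉ B := by
    intro σ hσ hmem
    have := (hh' 0).1.1 ((hbox hσ false 0).1.1 hmem).2
    norm_num at this
  have habs : ∀ w, (e * w ∈ Ioo (1 / 2) (2 * N) ∨ -e * w ∈ Ioo (1 / 2) (2 * N)) →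
      1 / 2 < |w| ∧ |w| < d := by
    intro w h
    rw [lt_abs, abs_lt]
    rcases he with h' | h' <;> rw [h'] at h <;> rcases h with ⟨h1, h2⟩ | ⟨h1, h2⟩
    · exact ⟨.inl (by linarith), by linarith, by linarith⟩
    · exact ⟨.inr (by linarith), by linarith, by linarith⟩
    · exact ⟨.inr (by linarith), by linarith, by linarith⟩
    · exact ⟨.inl (by linarith), by linarith, by linarith⟩
  have hzero : ∀ {σ : ℝ} (_ : σ = 1 ∨ σ = -1) (u : ℝ),
      IsPlateau.conj σ (IsPlateau.pos g kinkRamp) u = 0 →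
      planeCurve (IsPlateau.conj σ (IsPlateau.pos g kinkRamp)) (bumpHeight N) u ∈ B →
      planeCurve (IsPlateau.conj σ (IsPlateau.pos g kinkRamp)) (bumpHeight N) u ∈ interior B := by
    intro σ hσ u hu hmem
    obtain ⟨w₁, w₂, k1, k2, k3, -⟩ := hg.exists_ordered_zeros hσ he
    rcases (k3 u).1 hu with rfl | rfl | rfl
    · exact absurd hmem (hzero0 hσ)
    · exact hint hσ _ (habs _ (.inl k1)).1 (habs _ (.inl k1)).2
    · exact hint hσ _ (habs _ (.inr k2)).1 (habs _ (.inr k2)).2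
  have htri' : ∀ {σ : ℝ} (hσ : σ = 1 ∨ σ = -1),
      ∃ p q r, IsTriangle (F.replace (hF.admissible (hg.isModel_kinkRamp hσ))) B
        (fun i => F.strandTime s₀ (kind i) (α i)) (fun i => F.strandTime s₀ (kind i) (β i)) p q r ∧
        (F.replace (hF.admissible (hg.isModel_kinkRamp hσ))).crossingSign p = s 0 ∧
        (F.replace (hF.admissible (hg.isModel_kinkRamp hσ))).crossingSign q = s 1 ∧
        (F.replace (hF.admissible (hg.isModel_kinkRamp hσ))).crossingSign r = s 2 := by
    intro σ hσ
    obtain ⟨w₁, w₂, k1, k2, k3, k4, k5⟩ := hg.exists_ordered_zeros hσ he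
    obtain ⟨a1, a1'⟩ := habs w₁ (.inl k1)
    obtain ⟨a2, a2'⟩ := habs w₂ (.inr k2)
    have z1 := (k3 w₁).2 (.inr (.inl rfl))
    have z2 := (k3 w₂).2 (.inr (.inr rfl))
    refine htri _ w₁ w₂ ?_ ?_ ⟨(hd' w₁).1.2 a1'.le, (hh' w₁).1.2 a1.le⟩
      ⟨(hd' w₂).1.2 a2'.le, (hh' w₂).1.2 a2.le⟩ ?_ (hF.crossingSign_selfPair (hg.isModel_kinkRamp hσ) trivial) ?_ ?_
    · rw [mem_Icc]
      rcases he with h | h <;> rw [h] at k1 ⊢ <;> rw [hm, hl, hd] <;>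
        constructor <;> linarith [k1.1, k1.2]
    · rw [mem_Icc]
      rcases he with h | h <;> rw [h] at k2 ⊢ <;> rw [hm, hl, hd] <;>
        constructor <;> linarith [k2.1, k2.2]
    · ext p
      rw [hF.mem_crossingsIn (hg.isModel_kinkRamp hσ) hB]
      simp only [mem_insert_iff, mem_singleton_iff]
      constructor
      · rintro (⟨-, h, -⟩ | ⟨u, rfl, hu, hmem⟩)
        · exact .inl h
        · rcases (k3 u).1 hu with rfl | rfl | rfl
          · exact absurd hmem (hzero0 hσ)
          · exact .inr (.inl rfl)
          · exact .inr (.inr rfl)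
      · rintro (rfl | rfl | rfl)
        · exact .inl ⟨trivial, rfl, interior_subset (hint1 hσ)⟩
        · exact .inr ⟨w₁, rfl, z1, interior_subset (hint hσ _ a1 a1')⟩
        · exact .inr ⟨w₂, rfl, z2, interior_subset (hint hσ _ a2 a2')⟩
    · rw [hF.crossingSign_mixedPair (hg.isModel_kinkRamp hσ) z1, sign_pos k4]; simp
    · rw [hF.crossingSign_mixedPair (hg.isModel_kinkRamp hσ) z2, sign_pos k5]; simp
  obtain ⟨p, q, r, ht, t0, t1, t2⟩ := htri' (σ := 1) (.inl rfl)
  obtain ⟨p', q', r', ht', t0', t1', t2'⟩ := htri' (σ := -1) (.inr rfl)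
  refine ⟨B, _, _, hF.localChange (hg.isModel_kinkRamp (.inl rfl)) (hg.isModel_kinkRamp (.inr rfl))
    hD hB ?_ ?_ ?_ hdisj (hmeet (.inl rfl)) (fun _ _ => hint1 (.inl rfl)) (hzero (.inl rfl))
    (hmeet (.inr rfl)) (fun _ _ => hint1 (.inr rfl)) (hzero (.inr rfl)) ?_, p, q, r, p', q', r', ht,
    ht', t0.trans t0'.symm, t1.trans t1'.symm, t2.trans t2'.symm⟩
  · exact (hall fun _ a _ => |a| < 6 * N).2 ⟨hnum.2.2.1, hnum.2.2.2.2.1,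
      abs_lt.2 ⟨by linarith, by linarith⟩⟩
  · exact (hall fun _ _ b => |b| < 6 * N).2 ⟨hnum.2.2.2.1, hnum.2.2.2.2.2,
      abs_lt.2 ⟨by linarith, by linarith⟩⟩
  · exact (hall fun _ a b => a < b).2 ⟨hnum.1, hnum.2.1, h12⟩
  · intro u hu
    obtain ⟨k1, k2, -⟩ := (hall fun k a b => false = k → u ∉ Ioo a b).1 hu
    refine ⟨?_, rfl⟩
    -- Near the tip the abscissa is the odd cubic `u³ - u`, and far out it is `u`; both are
    -- invariant under conjugation.
    rcases le_or_gt |u| (1 / 2) with h | h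
    · rw [IsPlateau.conj, IsPlateau.conj, hg.pos_kinkRamp_inner (by rw [neg_one_mul, abs_neg]; linarith),
        hg.pos_kinkRamp_inner (by rw [one_mul]; linarith)]
      ring
    · have h' : d ≤ |u| := by
        by_contra hc
        rcases (mem_Icc_or_iff (e := e) (d := d) he).2.1 ⟨h, not_le.1 hc⟩ with h3 | h3
        · exact k1 rfl h3
        · exact k2 rfl h3
      rw [IsPlateau.conj, IsPlateau.conj, hg.pos_far isWeight_ramp (by rw [neg_one_mul, abs_neg]; linarith),
        hg.pos_far isWeight_ramp (by rw [one_mul]; linarith)]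
      ring

end StrandFrame.IsDouble

theorem isDisc_closedBall (c : ℂ) {r : ℝ} (hr : 0 < r) : IsDisc (Metric.closedBall c r) := by
  have hr' : (r : ℂ) ≠ 0 := by exact_mod_cast hr.ne'
  refine ⟨PlaneDiffeo.mk (fun z => c + r * z) (fun z => (r : ℂ)⁻¹ * (z - c))
    (contDiff_const.add (contDiff_const.mul contDiff_id))
    (contDiff_const.mul (contDiff_id.sub contDiff_const))
    (fun z => by simp [hr']) (fun z => by simp [hr']), ?_⟩
  ext z
  rw [mem_closedBall_iff_norm]
  constructor
  · intro h
    refine ⟨(r : ℂ)⁻¹ * (z - c), ?_, ?_⟩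
    · rw [mem_closedBall_zero_iff, norm_mul, norm_inv, Complex.norm_real, Real.norm_eq_abs,
        abs_of_pos hr, inv_mul_le_iff₀ hr, mul_one]
      exact h
    · change c + r * ((r : ℂ)⁻¹ * (z - c)) = z
      rw [mul_inv_cancel_left₀ hr', add_sub_cancel]
  · rintro ⟨w, hw, rfl⟩
    rw [mem_closedBall_zero_iff] at hw
    change ‖c + r * w - c‖ ≤ r
    rw [add_sub_cancel_left, norm_mul, Complex.norm_real, Real.norm_eq_abs, abs_of_pos hr]
    nlinarith

theorem mem_closedBall_iff_sq {c : ℝ} {r : ℝ} (hr : 0 < r) (z : ℂ) :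
    (z ∈ Metric.closedBall (c : ℂ) r ↔ (z.re - c) ^ 2 + z.im ^ 2 ≤ r ^ 2) ∧
      (z ∈ interior (Metric.closedBall (c : ℂ) r) ↔ (z.re - c) ^ 2 + z.im ^ 2 < r ^ 2) := by
  have h := norm_sq_eq (z - c)
  rw [Complex.sub_re, Complex.sub_im, Complex.ofReal_re, Complex.ofReal_im, sub_zero] at h
  rw [interior_closedBall _ hr.ne', mem_closedBall_iff_norm, mem_ball_iff_norm, ← h,
    sq_le_sq₀ (norm_nonneg _) hr.le, sq_lt_sq₀ (norm_nonneg _) hr.le]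
  exact ⟨Iff.rfl, Iff.rfl⟩

namespace StrandFrame.IsDouble

variable {E : KnotoidDiagram} {F : StrandFrame E} {N s₀ : ℝ} (hF : F.IsDouble N s₀) {g : ℝ → ℝ}
  (hg : IsPlateau N g) {σ : ℝ} (hσ : σ = 1 ∨ σ = -1)

include hF hg hσ

/-- The disc of radius `4` is centred at distance `5` from the vertical strand, hence misses it. The
slid strand crosses the disc along a diameter for `|u| ≤ 4`, where `g = 1`, and the bump of the kink
over `|u| ≤ 3` stays inside. -/
theorem addsKink {ε : ℤ} (hε : (ε : ℝ) = F.order) : ∃ B, AddsKink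
    (F.replace (hF.admissible (hg.isModel_slide hσ)))
    (F.replace (hF.admissible (hg.isModel_kink hσ))) B (F.time (-4)) (F.time 4) ε := by
  have hN := hg.le
  have hσ2 : σ * σ = 1 := by rcases hσ with rfl | rfl <;> norm_num
  set B := Metric.closedBall ((-(5 * σ) : ℝ) : ℂ) 4 with hBdef
  have hD : IsDisc B := isDisc_closedBall _ (by norm_num)
  have hmem := fun z => mem_closedBall_iff_sq (c := -(5 * σ)) (r := 4) (by norm_num) z
  simp only [sub_neg_eq_add] at hmem
  have hB : ∀ z ∈ B, |z.re| ≤ 5 * N ∧ |z.im| ≤ 4 := fun z hz => by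
    have h1 := (hmem z).1.1 hz
    have h2 := abs_le_of_sq_le_sq (a := z.re + 5 * σ) (b := 4) (by nlinarith [sq_nonneg z.im])
      (by norm_num)
    have h3 := abs_le_of_sq_le_sq (a := z.im) (b := 4) (by nlinarith [sq_nonneg (z.re + 5 * σ)])
      (by norm_num)
    refine ⟨?_, h3⟩
    rw [abs_le] at h2 ⊢
    rcases hσ with rfl | rfl <;> constructor <;> linarith
  -- the two curves
  have hslide : ∀ u, IsPlateau.conj σ (IsPlateau.slide g) u + 5 * σ = u + 5 * σ * (1 - g (σ * u)) := by
    intro u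
    rw [IsPlateau.conj, IsPlateau.slide]
    linear_combination u * hσ2
  have hout : ∀ u, 3 ≤ |u| → IsPlateau.conj σ (IsPlateau.pos g fun _ => 1) u =
      IsPlateau.conj σ (IsPlateau.slide g) u ∧ bumpHeight N u = baseHeight N u := by
    intro u hu
    refine ⟨?_, bumpHeight_eq hu⟩
    rw [IsPlateau.conj, IsPlateau.conj,
      hg.pos_outer isWeight_one (by rw [IsPlateau.abs_sign_mul hσ]; linarith)]
  have hq1 : ∀ u, |u| ≤ N →
      (IsPlateau.conj σ (IsPlateau.slide g) u + 5 * σ) ^ 2 + baseHeight N u ^ 2 = |u| ^ 2 := by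
    intro u hu
    rw [hslide, hg.eq_one _ (by rwa [IsPlateau.abs_sign_mul hσ]), baseHeight_eq_zero (by linarith),
      sq_abs]
    ring
  -- For `|u| > N ≥ 20` the displacement, at most `5`, cannot bring the point back within distance
  -- `15` of the centre.
  have hq2 : ∀ u, N < |u| →
      16 < (IsPlateau.conj σ (IsPlateau.slide g) u + 5 * σ) ^ 2 + baseHeight N u ^ 2 := by
    intro u hu
    rw [hslide]
    have h1 := hg.nonneg (σ * u)
    have h2 := hg.le_one (σ * u)
    have h3 : 15 ≤ |u + 5 * σ * (1 - g (σ * u))| := by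
      rcases lt_abs.1 hu with h | h
      · refine le_trans ?_ (le_abs_self _)
        rcases hσ with rfl | rfl <;> nlinarith
      · refine le_trans ?_ (neg_le_abs _)
        rcases hσ with rfl | rfl <;> nlinarith
    have h4 : 15 ^ 2 ≤ (u + 5 * σ * (1 - g (σ * u))) ^ 2 := by
      rw [← sq_abs (u + 5 * σ * (1 - g (σ * u)))]
      nlinarith
    nlinarith [sq_nonneg (baseHeight N u)]
  have hq3 : ∀ u, |u| ≤ 3 → (IsPlateau.conj σ (IsPlateau.pos g fun _ => 1) u + 5 * σ) ^ 2 +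
      bumpHeight N u ^ 2 < 16 := by
    intro u hu
    have h1 : IsPlateau.conj σ (IsPlateau.pos g fun _ => 1) u + 5 * σ = σ * kinkPos (σ * u) := by
      rw [IsPlateau.conj, IsPlateau.pos, hg.eq_one _ (by rw [IsPlateau.abs_sign_mul hσ]; linarith)]
      ring
    have h2 := abs_kinkPos_le (σ * u)
    rw [IsPlateau.abs_sign_mul hσ] at h2
    have h3 := bumpHeight_mem N u
    have h4 : (σ * kinkPos (σ * u)) ^ 2 ≤ 3 ^ 2 := by
      rw [mul_pow, sq σ, hσ2, one_mul]
      exact sq_le_sq.2 (by rw [abs_of_pos (by norm_num : (0 : ℝ) < 3)]; linarith)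
    have h5 : bumpHeight N u ^ 2 ≤ 1 ^ 2 := sq_le_sq' (by linarith) h3.2
    rw [h1]
    linarith
  have hsq : ∀ u : ℝ, (|u| ^ 2 ≤ 4 ^ 2 ↔ |u| ≤ 4) ∧ (|u| ^ 2 < 4 ^ 2 ↔ |u| < 4) := fun u =>
    ⟨sq_le_sq₀ (abs_nonneg u) (by norm_num), sq_lt_sq₀ (abs_nonneg u) (by norm_num)⟩
  have hsec : ∀ y : ℝ, (⟨0, y⟩ : ℂ) ∉ B := fun y h => by
    have h1 := (hmem _).1.1 h
    simp only [zero_add] at h1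
    nlinarith [sq_nonneg y]
  have hfst : ∀ (x y : ℝ → ℝ) u, x u = 0 → planeCurve x y u ∉ B := fun x y u hu h => by
    rw [planeCurve, hu] at h
    exact hsec _ h
  have hm1 : ∀ u, (planeCurve (IsPlateau.conj σ (IsPlateau.slide g)) (baseHeight N) u ∈ B ↔
      |u| ≤ 4) ∧ (planeCurve (IsPlateau.conj σ (IsPlateau.slide g)) (baseHeight N) u ∈ interior B ↔
      |u| < 4) := by
    intro u
    rw [(hmem _).1, (hmem _).2]
    simp only [planeCurve]
    rcases le_or_gt |u| N with h | h
    · rw [hq1 u h]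
      exact hsq u
    · have := hq2 u h
      exact ⟨iff_of_false (by linarith) (by linarith), iff_of_false (by linarith) (by linarith)⟩
  have hm2 : ∀ u, (planeCurve (IsPlateau.conj σ (IsPlateau.pos g fun _ => 1)) (bumpHeight N) u ∈ B ↔
      |u| ≤ 4) ∧ (planeCurve (IsPlateau.conj σ (IsPlateau.pos g fun _ => 1)) (bumpHeight N) u ∈
      interior B ↔ |u| < 4) := by
    intro u
    rcases le_or_gt |u| 3 with h | h
    · rw [(hmem _).1, (hmem _).2]
      simp only [planeCurve]
      have := hq3 u h
      exact ⟨iff_of_true (by linarith) (by linarith), iff_of_true (by linarith) (by linarith)⟩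
    · have h1 := hm1 u
      rw [planeCurve, ← (hout u h.le).1, ← (hout u h.le).2] at h1
      exact h1
  have hmeet : ∀ {x y : ℝ → ℝ}, (∀ u, (planeCurve x y u ∈ B ↔ |u| ≤ 4) ∧
      (planeCurve x y u ∈ interior B ↔ |u| < 4)) → StrandsMeet N (planeCurve x y) B
        (fun _ : Fin 1 => false) (fun _ => -4) fun _ => 4 := by
    intro x y h k u _
    cases k
    · simpa [strandCurve, abs_le, abs_lt] using h u
    · have h1 := hsec u
      simp only [strandCurve, cond_true]
      exact ⟨iff_of_false h1 (by simp), iff_of_false (fun h' => h1 (interior_subset h')) (by simp)⟩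
  refine ⟨B, hF.localChange (hg.isModel_slide hσ) (hg.isModel_kink hσ) hD hB
    (kind := fun _ : Fin 1 => false) (α := fun _ => -4) (β := fun _ => 4) (fun _ => ?_) (fun _ => ?_)
    (fun _ => by norm_num) (fun i j hij => absurd (Subsingleton.elim i j) hij) (hmeet hm1)
    (fun h => h.elim) (fun u hu h => absurd h (hfst _ _ u hu)) (hmeet hm2)
    (fun _ _ => (hm2 1).2.2 (by norm_num)) (fun u hu h => absurd h (hfst _ _ u hu)) (fun u hu => ?_),
    ?_, F.selfPair s₀, ?_, ?_⟩
  · rw [abs_neg, abs_of_pos] <;> linarith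
  · rw [abs_of_pos] <;> linarith
  · refine hout u ?_
    by_contra hc
    rw [not_le, abs_lt] at hc
    exact hu 0 rfl ⟨by linarith [hc.1], by linarith [hc.2]⟩
  · refine eq_empty_of_forall_notMem fun p hp => ?_
    rcases (hF.mem_crossingsIn (hg.isModel_slide hσ) hB).1 hp with ⟨h, -⟩ | ⟨u, -, hu, h⟩
    · exact h
    · exact hfst _ _ u hu h
  · ext p
    rw [hF.mem_crossingsIn (hg.isModel_kink hσ) hB, mem_singleton_iff]
    constructor
    · rintro (⟨-, h, -⟩ | ⟨u, -, hu, h⟩)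
      · exact h
      · exact absurd h (hfst _ _ u hu)
    · rintro rfl
      exact .inl ⟨trivial, rfl, (hm2 1).1.2 (by norm_num)⟩
  · rw [hF.crossingSign_selfPair (hg.isModel_kink hσ) trivial]
    rcases F.order_eq with h | h <;> rw [h] at hε ⊢
    · rw [sign_pos one_pos]; exact_mod_cast hε.symm
    · rw [sign_neg (by norm_num)]; exact_mod_cast hε.symm

/-- Sliding the horizontal strand along itself is a reparametrization. -/
theorem exists_isReparam : ∃ h : ℝ → ℝ, IsReparam h ∧ h (F.time 0) = F.time (-(5 * σ)) ∧
    ∀ t ∈ Icc (0 : ℝ) 1,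
      (F.replace (hF.admissible (hg.isModel_slide hσ))).curve t = E.curve (h t) ∧
      (t ∈ (F.replace (hF.admissible (hg.isModel_slide hσ))).upper ↔ h t ∈ E.upper) := by
  have hN := hg.le
  -- `φ` is increasing and fixes everything beyond `2 * N`, and it moves points only where the base
  -- height is `0`. So the slid strand is the base strand run through at times changed by `φ`.
  set φ := IsPlateau.conj σ (IsPlateau.slide g) with hφ
  have hm := hg.isModel_slide hσ
  have hsmooth : ContDiff ℝ ∞ φ := hm.smooth_fst
  have hder : ∀ u, 0 < deriv φ u := fun u => by
    rw [hφ, IsPlateau.deriv_conj hσ hg.slide_contDiff]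
    exact hg.deriv_slide_pos _
  have hfar : ∀ u, 2 * N ≤ |u| → φ u = u := fun u hu => (hm.far u hu).1
  have hnear : ∀ u, |u| ≤ 2 * N → |φ u| ≤ 2 * N := fun u hu => by
    rw [hφ, IsPlateau.conj, IsPlateau.abs_sign_mul hσ]
    exact hg.abs_slide_le (by rwa [IsPlateau.abs_sign_mul hσ])
  set h : ℝ → ℝ := fun t => F.time (φ (F.coord t)) with hh
  have hht : ∀ u, h (F.time u) = F.time (φ u) := fun u => by rw [hh]; simp only [coord_time]
  have hiff : ∀ u, |φ u| < 6 * N ↔ |u| < 6 * N := fun u => by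
    rcases le_or_gt (2 * N) |u| with h1 | h1
    · rw [hfar u h1]
    · exact iff_of_true (by linarith [hnear u h1.le]) (by linarith)
  have hin : ∀ t, F.InArc (h t) ↔ F.InArc t := fun t => by
    rw [hh, F.inArc_time, hF.radius_eq, hiff, InArc, hF.radius_eq]
  have hnot : ∀ t, ¬ F.InArc t → h t = t := fun t ht => by
    rw [InArc, hF.radius_eq, not_lt] at ht
    rw [hh]
    simp only [hfar _ (by linarith : 2 * N ≤ |F.coord t|), time_coord]
  have hdh : ∀ t, HasDerivAt h (deriv φ (F.coord t)) t := fun t => by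
    have h1 : HasDerivAt (fun t => φ (F.coord t)) (deriv φ (F.coord t) * F.scale) t :=
      HasDerivAt.comp (h₂ := φ) (h := F.coord) t
        ((hsmooth.differentiable (by simp)) _).hasDerivAt (F.hasDerivAt_coord t)
    have h2 : HasDerivAt (fun t => F.center + φ (F.coord t) / F.scale)
        (deriv φ (F.coord t) * F.scale / F.scale) t := (h1.div_const _).const_add _
    rwa [mul_div_cancel_right₀ _ F.scale_pos.ne'] at h2
  have hhs : ContDiff ℝ ∞ h := contDiff_const.add
    ((hsmooth.comp (contDiff_const.mul (contDiff_id.sub contDiff_const))).div_const _)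
  have hhm : StrictMono h := strictMono_of_deriv_pos fun t => by
    rw [(hdh t).deriv]; exact hder _
  have h0 : ∀ t, t ∉ Ioo (0 : ℝ) 1 → h t = t := fun t ht => hnot t fun h' => ht h'.mem_Ioo
  have hrep : IsReparam h := ⟨hhs, h0 0 (by simp), h0 1 (by simp), fun t _ => by
    rw [(hdh t).deriv]; exact hder _⟩
  have hcurve : ∀ t, F.newCurve (planeCurve φ (baseHeight N)) t = E.curve (h t) := fun t => by
    by_cases ht : F.InArc t
    · obtain ⟨u, hu, rfl⟩ := ht.exists_eq
      have hu' : |φ u| < F.radius := by rw [hF.radius_eq] at hu ⊢; exact (hiff u).2 hu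
      rw [F.newCurve_time hu, hht, F.curve_time hu', hF.base_eq, planeCurve, planeCurve]
      rcases le_or_gt (2 * N) |u| with h1 | h1
      · rw [hfar u h1]
      · rw [baseHeight_eq_zero h1.le, baseHeight_eq_zero (hnear u h1.le)]
    · rw [F.newCurve_of_not_inArc (hF.admissible hm) ht, hnot t ht]
  have hb : F.Admissible F.base := hF.base_eq ▸ hF.admissible hg.isModel_base
  have hover : ∀ t s, F.Over (h t) (h s) ↔ F.Over t s := fun t s => by
    have h1 : 0 < F.order * (h t - h s) ↔ 0 < F.order * (t - s) := by
      rcases F.order_eq with h1 | h1 <;> rw [h1]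
      · rw [one_mul, one_mul, sub_pos, sub_pos, hhm.lt_iff_lt]
      · rw [neg_one_mul, neg_one_mul, neg_sub, neg_sub, sub_pos, sub_pos, hhm.lt_iff_lt]
    by_cases ht : F.InArc t <;> by_cases hs : F.InArc s
    · simp only [Over, (hin t).2 ht, (hin s).2 hs, ht, hs, if_true, h1]
    · simp only [Over, (hin t).2 ht, mt (hin s).1 hs, ht, hs, if_true, if_false]
    · simp only [Over, mt (hin t).1 ht, (hin s).2 hs, ht, hs, if_true, if_false]
    · simp only [Over, mt (hin s).1 hs, ht, hs, if_false, hnot t ht]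
  have hbase : ∀ t, F.newCurve F.base t = E.curve t := fun t => by simp [newCurve]
  refine ⟨h, hrep, ?_, fun t ht => ⟨hcurve t, ?_⟩⟩
  · rw [hht]
    congr 1
    rw [hφ, IsPlateau.conj, IsPlateau.slide, mul_zero, hg.eq_one 0 (by rw [abs_zero]; linarith)]
    ring
  · have himg : ∀ s, s ∈ Icc (0 : ℝ) 1 ↔ h s ∈ Icc (0 : ℝ) 1 := fun s => by
      rw [mem_Icc, mem_Icc, ← hhm.le_iff_le (a := 0), ← hhm.le_iff_le (b := 1), hrep.zero, hrep.one]
    have hsurj : ∀ r ∈ Icc (0 : ℝ) 1, ∃ s ∈ Icc (0 : ℝ) 1, h s = r := fun r hr => by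
      obtain ⟨s, hs, hsr⟩ := intermediate_value_Icc zero_le_one hhs.continuous.continuousOn
        (show r ∈ Icc (h 0) (h 1) by rw [hrep.zero, hrep.one]; exact hr)
      exact ⟨s, hs, hsr⟩
    -- Writing `E` as the replacement of the arc by itself expresses both sets of upper times
    -- through `Over`, which is invariant under the increasing map `h`.
    have hE : h t ∈ E.upper ↔ h t ∈ (F.replace hb).upper := by rw [F.replace_base hb]
    rw [hE]
    constructor
    · rintro ⟨-, s, hs, hne, he, ho⟩
      refine ⟨(himg t).1 ht, h s, (himg s).1 hs, hhm.injective.ne hne, ?_, (hover t s).2 ho⟩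
      rw [hbase, hbase, ← hcurve, ← hcurve, he]
    · rintro ⟨-, r, hr, hne, he, ho⟩
      obtain ⟨s, hs, rfl⟩ := hsurj r hr
      rw [hbase, hbase, ← hcurve, ← hcurve] at he
      exact ⟨ht, s, hs, fun h' => hne (h' ▸ rfl), he, (hover t s).1 ho⟩

end StrandFrame.IsDouble

/-! ### Kinks on both sides of a crossing -/

theorem hasFDerivAt_sum_curves (D : KnotoidDiagram) (τ s : ℝ) (P : ℂ) :
    HasFDerivAt (fun z : ℂ => D.curve (τ + z.re) + D.curve (s + z.im) - P)
      ((ContinuousLinearMap.toSpanSingleton ℝ (deriv D.curve τ)).comp Complex.reCLM +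
        (ContinuousLinearMap.toSpanSingleton ℝ (deriv D.curve s)).comp Complex.imCLM) 0 := by
  have h3 : HasFDerivAt D.curve (ContinuousLinearMap.toSpanSingleton ℝ (deriv D.curve τ))
      (τ + (0 : ℂ).re) := by
    rw [Complex.zero_re, add_zero]; exact (D.hasDerivAt τ).hasFDerivAt
  have h4 : HasFDerivAt D.curve (ContinuousLinearMap.toSpanSingleton ℝ (deriv D.curve s))
      (s + (0 : ℂ).im) := by
    rw [Complex.zero_im, add_zero]; exact (D.hasDerivAt s).hasFDerivAt
  have h1 : HasFDerivAt (fun z : ℂ => τ + z.re) Complex.reCLM 0 :=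
    Complex.reCLM.hasFDerivAt.const_add τ
  have h2 : HasFDerivAt (fun z : ℂ => s + z.im) Complex.imCLM 0 :=
    Complex.imCLM.hasFDerivAt.const_add s
  have h5 : HasFDerivAt (fun z : ℂ => D.curve (τ + z.re))
      ((ContinuousLinearMap.toSpanSingleton ℝ (deriv D.curve τ)).comp Complex.reCLM) 0 :=
    h3.comp (0 : ℂ) h1
  have h6 : HasFDerivAt (fun z : ℂ => D.curve (s + z.im))
      ((ContinuousLinearMap.toSpanSingleton ℝ (deriv D.curve s)).comp Complex.imCLM) 0 :=
    h4.comp (0 : ℂ) h2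
  exact (h5.add h6).sub_const P

/-- Adding the two strands, one in each coordinate, gives a smooth map whose derivative is injective
by transversality; in the resulting chart the strands are the coordinate axes. A shear then brings
the horizontal axis to the base height, without moving the vertical one. -/
theorem exists_isDouble (D : KnotoidDiagram) {τ s : ℝ} (hτ : τ ∈ Icc (0 : ℝ) 1)
    (hs : s ∈ Icc (0 : ℝ) 1) (hne : s ≠ τ) (he : D.curve s = D.curve τ) {N : ℝ} (hN : 20 ≤ N)
    {δ : ℝ} (hδ : 0 < δ) {ε : ℤ} (hε : ε = 1 ∨ ε = -1) :
    ∃ (H : PlaneDiffeo) (F : StrandFrame (D.map H)), F.IsDouble N s ∧ F.center = τ ∧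
      F.order = (PlaneDiffeo.orientation H.symm * ε : ℤ) ∧ F.radius / F.scale < δ := by
  set P := D.curve τ with hP
  let Ψ : ℂ → ℂ := fun z => D.curve (τ + z.re) + D.curve (s + z.im) - P
  have hΨ : ContDiff ℝ ∞ Ψ :=
    ((D.smooth.comp (contDiff_const.add (contDiff_re contDiff_id))).add
      (D.smooth.comp (contDiff_const.add (contDiff_im contDiff_id)))).sub contDiff_const
  have hinj : Function.Injective (fderiv ℝ Ψ 0) := by
    rw [(hasFDerivAt_sum_curves D τ s P).fderiv]
    have hdet := D.transversal τ hτ s hs hne.symm he.symm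
    refine (injective_iff_map_eq_zero _).2 fun z hz => ?_
    have hz : z.re • deriv D.curve τ + z.im • deriv D.curve s = 0 := hz
    have hre := congrArg Complex.re hz
    have him := congrArg Complex.im hz
    simp only [Complex.add_re, Complex.add_im, Complex.smul_re, Complex.smul_im, smul_eq_mul,
      Complex.zero_re, Complex.zero_im] at hre him
    unfold planeDet at hdet
    refine Complex.ext ?_ ?_
    · refine (mul_eq_zero.1 (?_ : z.re * _ = 0)).resolve_right hdet
      linear_combination (deriv D.curve s).im * hre - (deriv D.curve s).re * him
    · refine (mul_eq_zero.1 (?_ : z.im * _ = 0)).resolve_right hdet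
      linear_combination (deriv D.curve τ).re * him - (deriv D.curve τ).im * hre
  have hdirτ : (fun t : ℝ => if t = τ then (1 : ℂ) else Complex.I) τ = 1 := if_pos rfl
  have hdirs : (fun t : ℝ => if t = τ then (1 : ℂ) else Complex.I) s = Complex.I := if_neg hne
  obtain ⟨G, l, hl, hlδ, h1, h2, -⟩ := exists_straight_chart (D := D) (T := {τ, s}) (P := P)
    (dir := fun t => if t = τ then (1 : ℂ) else Complex.I) hΨ hinj
    (by simp only [Ψ, Complex.zero_re, Complex.zero_im, add_zero, he]; ring)
    (by simp) (by
      rintro _ (rfl | rfl)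
      · exact D.endpoints_simple _ hτ s hs hne.symm he.symm
      · exact D.endpoints_simple _ hs τ hτ hne he)
    (by
      intro t _
      split_ifs <;> simp)
    (by
      rintro _ (rfl | rfl) x
      · simp only [if_true, Ψ]; simp [he]
      · simp only [hne, if_false, Ψ]; simp [hP])
    (fun t ht h => by
      rcases D.no_triple t ht τ hτ s hs h he.symm with h | h | h
      · exact .inl h
      · exact absurd h.symm hne
      · exact .inr h)
    (R := 6 * N) (by linarith) hδ univ_mem
  obtain ⟨S, hSdef⟩ : ∃ S, S = shearDiffeo (baseHeight N) (baseHeight_contDiff N) := ⟨_, rfl⟩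
  have hcurve : ∀ t, (D.map (G.symm.trans S)).curve t =
      ⟨(G.symm (D.curve t)).re, (G.symm (D.curve t)).im + baseHeight N (G.symm (D.curve t)).re⟩ :=
    fun t => by rw [hSdef]; rfl
  have hb0 : baseHeight N 0 = 0 := baseHeight_eq_zero (by rw [abs_zero]; linarith)
  have hfirst : ∀ u, |u| < 6 * N → τ + u / l ∈ Ioo (0 : ℝ) 1 ∧
      (D.map (G.symm.trans S)).curve (τ + u / l) = planeCurve (fun u => u) (baseHeight N) u := by
    intro u hu
    obtain ⟨k1, k2⟩ := h1 τ (.inl rfl) u hu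
    refine ⟨k1, ?_⟩
    simp only [if_true, mul_one] at k2
    rw [hcurve, k2, G.symm_apply, Complex.ofReal_re, Complex.ofReal_im, zero_add]
    rfl
  have hsecond : ∀ u, |u| < 6 * N → s + u / l ∈ Ioo (0 : ℝ) 1 ∧
      (D.map (G.symm.trans S)).curve (s + u / l) = ⟨0, u⟩ := by
    intro u hu
    obtain ⟨k1, k2⟩ := h1 s (.inr rfl) u hu
    refine ⟨k1, ?_⟩
    simp only [hne, if_false] at k2
    rw [hcurve, k2, G.symm_apply]
    simp [hb0]
  have hrest : ∀ t ∈ Icc (0 : ℝ) 1, |l * (t - τ)| < 6 * N ∨ |l * (t - s)| < 6 * N ∨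
      (6 * N) ^ 2 ≤ ((D.map (G.symm.trans S)).curve t).re ^ 2 +
        (((D.map (G.symm.trans S)).curve t).im -
          baseHeight N ((D.map (G.symm.trans S)).curve t).re) ^ 2 := by
    intro t ht
    by_cases hmem : G.symm (D.curve t) ∈ Metric.ball 0 (6 * N)
    · obtain ⟨r, hr, h⟩ := h2 t ht ⟨_, hmem, G.apply_symm _⟩
      rcases hr with rfl | rfl
      · exact .inl h
      · exact .inr (.inl h)
    · refine .inr (.inr ?_)
      rw [hcurve]
      simp only [add_sub_cancel_right]
      rw [← norm_sq_eq]
      rw [mem_ball_zero_iff, not_lt] at hmem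
      exact pow_le_pow_left₀ (by linarith) hmem 2
  have hdiv : ∀ t r : ℝ, r + l * (t - r) / l = t := fun t r => by
    rw [mul_div_cancel_left₀ _ hl.ne', add_sub_cancel]
  let F : StrandFrame (D.map (G.symm.trans S)) :=
    { center := τ
      scale := l
      core := 2 * N
      radius := 6 * N
      base := planeCurve (fun u => u) (baseHeight N)
      -- The arc meets the rest of the diagram only at the given double point, so its level there
      -- decides.
      isOver := τ ∈ D.upper
      order := (PlaneDiffeo.orientation (G.symm.trans S).symm * ε : ℤ)
      scale_pos := hl
      core_lt := by linarith
      base_smooth := contDiff_complex_mk contDiff_id (baseHeight_contDiff N)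
      order_eq := by
        rcases PlaneDiffeo.orientation_eq (G.symm.trans S).symm with h | h <;> rw [h] <;>
          rcases hε with rfl | rfl <;> norm_num
      arc := hfirst
      base_inj := fun u w _ _ h => congrArg Complex.re h
      level := fun u t hu ht hn h => by
        rcases hrest t ht with h' | h' | h'
        · exact absurd h' (not_lt.2 hn)
        · rw [← hdiv t s, (hsecond _ h').2] at h
          have h0 : u = 0 := congrArg Complex.re h
          rw [h0, zero_div, add_zero]
          exact Iff.rfl
        · rw [← h] at h'
          simp only [planeCurve, sub_self] at h'
          rw [← sq_abs u] at h'
          nlinarith [abs_nonneg u] }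
  refine ⟨G.symm.trans S, F, ⟨rfl, rfl, rfl, fun y hy => ?_, fun t ht hn => ?_⟩, rfl, rfl, hlδ⟩
  · obtain ⟨k1, k2⟩ := hsecond y hy
    refine ⟨k1, fun hin => ?_, k2, ?_⟩
    · obtain ⟨u, hu, hut⟩ := hin.exists_eq
      have k3 := (hfirst u hu).2
      rw [show τ + u / l = s + y / l from hut.symm, k2] at k3
      have k4 : 0 = u := congrArg Complex.re k3
      have k5 : y = baseHeight N u := congrArg Complex.im k3
      rw [← k4, hb0] at k5
      rw [← k4, k5] at hut
      refine hne ?_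
      have : s + 0 / l = τ + 0 / l := hut
      simpa using this
    · have k3 : HasDerivAt (fun t : ℝ => (⟨0, l * (t - s)⟩ : ℂ)) ⟨0, l⟩ (s + y / l) := by
        have k4 : HasDerivAt (fun t : ℝ => l * (t - s)) l (s + y / l) := by
          simpa using ((hasDerivAt_id' (s + y / l)).sub_const s).const_mul l
        exact hasDerivAt_complex_mk (hasDerivAt_const _ _) k4
      refine (k3.congr_of_eventuallyEq ?_).deriv
      have k4 : ∀ᶠ t in 𝓝 (s + y / l), |l * (t - s)| < 6 * N := by
        refine ContinuousAt.eventually_lt (by fun_prop) continuousAt_const ?_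
        rwa [add_sub_cancel_left, mul_div_cancel₀ _ hl.ne']
      filter_upwards [k4] with t ht
      have := (hsecond _ ht).2
      rwa [hdiv] at this
  · rcases hrest t ht with h' | h' | h'
    · exact absurd h' hn
    · exact .inl ⟨_, h', (hdiv t s).symm⟩
    · exact .inr h'

namespace IsKinkClass

variable {D : KnotoidDiagram} {ε : ℤ}

/-- The class of the diagrams with a kink next to a crossing. -/
theorem of_isDouble (hε : ε = 1 ∨ ε = -1) {H : PlaneDiffeo} {F : StrandFrame (D.map H)} {N s₀ : ℝ}
    (hF : F.IsDouble N s₀) (ho : F.order = (PlaneDiffeo.orientation H.symm * ε : ℤ)) {g : ℝ → ℝ}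
    (hg : IsPlateau N g) {σ : ℝ} (hσ : σ = 1 ∨ σ = -1) :
    IsKinkClass D ε (F.time (-(5 * σ)))
      (regularClass ((F.replace (hF.admissible (hg.isModel_kink hσ))).map H.symm)) := by
  obtain ⟨h, hh, h0, hE⟩ := hF.exists_isReparam hg hσ
  obtain ⟨B, hk⟩ := hF.addsKink hg hσ ho.symm
  have hab : F.time 0 ∈ Ioo (F.time (-4)) (F.time 4) := by
    rw [mem_Ioo, F.time_lt_time, F.time_lt_time]; norm_num
  have hsim := hk.isSimple hab
  have ht := hk.mem_Ioo hab
  have ht' := Ioo_subset_Icc_self ht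
  set A := F.replace (hF.admissible (hg.isModel_slide hσ)) with hA
  have hsim' : D.IsSimple (F.time (-(5 * σ))) := by
    intro r hr he
    obtain ⟨q, hq, rfl⟩ := hh.surjOn_Icc hr
    rw [← h0] at he ⊢
    rw [hsim q hq (by rw [(hE q hq).1, (hE _ ht').1]; exact congrArg H he)]
  have ht5 : F.time (-(5 * σ)) ∈ Ioo (0 : ℝ) 1 := by
    refine (F.arc _ ?_).1
    rw [hF.radius_eq]
    have := hg.le
    rcases hσ with rfl | rfl <;> rw [abs_lt] <;> constructor <;> linarith
  obtain ⟨c, hc⟩ := exists_of_isSimple hε ht5 hsim'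
  -- The slid diagram, pulled back, is `D` reparametrized. A kink in it at parameter `0` is
  -- therefore a kink of `D` at parameter `-(5 * σ)`.
  have hc' : IsKinkClass (A.map H.symm) ε (F.time 0) c := by
    refine of_isotopyCarries (D := D) (D' := A.map H.symm) (F := AmbientIsotopy.refl) hh
      (fun t ht => ⟨?_, (hE t ht).2⟩) ht' (by rw [h0]; exact hc)
    change H.symm (A.curve t) = D.curve (h t)
    rw [(hE t ht).1]
    exact H.symm_apply _
  have hk' := hk.map H.symm
  rw [← mul_assoc, show PlaneDiffeo.orientation H.symm * PlaneDiffeo.orientation H.symm = 1 by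
    rcases PlaneDiffeo.orientation_eq H.symm with h | h <;> rw [h] <;> norm_num, one_mul] at hk'
  rwa [hc'.unique hε ⟨_, _, _, _, hk', hab, rfl⟩] at hc

/-- The kink to the left is pushed over the crossing by an R2, which moves its tip across the other
strand, an R3, which moves the crossing at its base, and the inverse of the mirror-image R2. The
scale of the chart is chosen so that both positions are within `δ` of `τ`. -/
theorem pass (hε : ε = 1 ∨ ε = -1) {τ : ℝ} (hτ : τ ∈ Ioo (0 : ℝ) 1) (hn : ¬ D.IsSimple τ) {δ : ℝ}
    (hδ : 0 < δ) : ∃ t ∈ Ioo (τ - δ) τ, ∃ t' ∈ Ioo τ (τ + δ), ∃ c,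
      IsKinkClass D ε t c ∧ IsKinkClass D ε t' c := by
  simp only [KnotoidDiagram.IsSimple, not_forall] at hn
  obtain ⟨s, hs, he, hne⟩ := hn
  obtain ⟨N, g, hg⟩ := exists_isPlateau
  have hN := hg.le
  obtain ⟨H, F, hF, hc, ho, hR⟩ := exists_isDouble D (Ioo_subset_Icc_self hτ) hs hne he hg.le hδ hε
  have hpos := F.scale_pos
  have h5 : 5 / F.scale < δ := by
    refine lt_trans ?_ hR
    rw [hF.radius_eq]
    exact div_lt_div_of_pos_right (by linarith) hpos
  have h5' : 0 < 5 / F.scale := by positivity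
  -- The value `σ = 1` puts the kink before the crossing time, and `σ = -1` after it.
  have e1 : F.time (-(5 * 1)) = τ - 5 / F.scale := by rw [StrandFrame.time, hc]; ring
  have e2 : F.time (-(5 * -1)) = τ + 5 / F.scale := by rw [StrandFrame.time, hc]; ring
  have h1 := of_isDouble hε hF ho hg (σ := 1) (.inl rfl)
  have h2 := of_isDouble hε hF ho hg (σ := -1) (.inr rfl)
  have r1 : regularClass _ = regularClass _ :=
    Quot.sound (.r2 ((hF.reidemeisterTwo hg (σ := 1) (.inl rfl)).map H.symm))
  have r2 : regularClass _ = regularClass _ :=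
    Quot.sound (.r2 ((hF.reidemeisterTwo hg (σ := -1) (.inr rfl)).map H.symm))
  have r3 : regularClass _ = regularClass _ :=
    Quot.sound (.r3 ((hF.reidemeisterThree hg).map H.symm))
  rw [e1] at h1
  rw [e2, r2, ← r3, ← r1] at h2
  exact ⟨_, ⟨by linarith, by linarith⟩, _, ⟨by linarith, by linarith⟩, _, h1, h2⟩

/-- The class of the diagrams with a kink of given sign does not depend on the position of the
kink. -/
theorem eq (hε : ε = 1 ∨ ε = -1) {t t' : ℝ} {c c' : Quot RegularStep} (h : IsKinkClass D ε t c)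
    (h' : IsKinkClass D ε t' c') : c = c' :=
  eq_of_pass hε (fun _ hτ hn _ hδ => pass hε hτ hn hδ) h h'

end IsKinkClass

/-! ### Adding a kink to a class of diagrams -/

section AddKink

variable {ε : ℤ} (hε : ε = 1 ∨ ε = -1)
include hε

theorem exists_addsKink (D : KnotoidDiagram) : ∃ K B a b, AddsKink D K B a b ε := by
  obtain ⟨t, ht, hs⟩ := D.exists_isSimple zero_lt_one le_rfl le_rfl
  obtain ⟨_, K, B, a, b, h, -⟩ := IsKinkClass.exists_of_isSimple hε ht hs
  exact ⟨K, B, a, b, h⟩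

theorem AddsKink.regularClass_eq {D K K' : KnotoidDiagram} {B B' : Set ℂ} {a b a' b' : ℝ}
    (h : AddsKink D K B a b ε) (h' : AddsKink D K' B' a' b' ε) :
    regularClass K = regularClass K' := by
  obtain ⟨t, ht⟩ := nonempty_Ioo.2 (h.1.arcs 0).2.1
  obtain ⟨t', ht'⟩ := nonempty_Ioo.2 (h'.1.arcs 0).2.1
  exact IsKinkClass.eq hε ⟨K, B, a, b, h, ht, rfl⟩ ⟨K', B', a', b', h', ht', rfl⟩

/-- An isotopy carries a kink to a kink. For the other moves the kink is first shifted away from the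
disc, which independence of position permits, and then the move is performed next to it. -/
theorem AddsKink.regularClass_eq_of_step {D D' K K' : KnotoidDiagram} {B B' : Set ℂ}
    {a b a' b' : ℝ} (h : AddsKink D K B a b ε) (h' : AddsKink D' K' B' a' b' ε)
    (hD : RegularStep D D') : regularClass K = regularClass K' := by
  have key : ∀ {K₁ K₁' : KnotoidDiagram} {B₁ : Set ℂ} {a₁ b₁ : ℝ}, AddsKink D K₁ B₁ a₁ b₁ ε →
      AddsKink D' K₁' B₁ a₁ b₁ ε → RegularStep K₁ K₁' → regularClass K = regularClass K' :=
    fun h₁ h₁' hs => (h.regularClass_eq hε h₁).trans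
      ((Quot.sound hs).trans (h₁'.regularClass_eq hε h'))
  cases hD with
  | isotopy F hc =>
    obtain ⟨φ, hφ, hφD⟩ := hc
    obtain ⟨t, ht⟩ := nonempty_Ioo.2 (h.1.arcs 0).2.1
    obtain ⟨t', ht'⟩ := nonempty_Ioo.2 (h'.1.arcs 0).2.1
    obtain ⟨s, hs, rfl⟩ := hφ.surjOn_Icc (Ioo_subset_Icc_self (h.mem_Ioo ht))
    exact IsKinkClass.eq hε (IsKinkClass.of_isotopyCarries hφ hφD hs ⟨K, B, a, b, h, ht, rfl⟩)
      ⟨K', B', a', b', h', ht', rfl⟩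
  | r1' hr =>
    obtain ⟨K₁, K₁', B₁, a₁, b₁, h₁, h₁', hr'⟩ := exists_kinks_of_weakReidemeisterOne hr hε
    exact key h₁ h₁' (.r1' hr')
  | r2 hr =>
    obtain ⟨K₁, K₁', B₁, a₁, b₁, h₁, h₁', hr'⟩ := exists_kinks_of_reidemeisterTwo hr hε
    exact key h₁ h₁' (.r2 hr')
  | r3 hr =>
    obtain ⟨K₁, K₁', B₁, a₁, b₁, h₁, h₁', hr'⟩ := exists_kinks_of_reidemeisterThree hr hε
    exact key h₁ h₁' (.r3 hr')

/-- Adding a kink of sign `ε`, as an operation on the classes of diagrams. -/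
def addKink : Quot RegularStep → Quot RegularStep :=
  Quot.lift (fun D => regularClass (exists_addsKink hε D).choose) fun D D' hD => by
    obtain ⟨B, a, b, h⟩ := (exists_addsKink hε D).choose_spec
    obtain ⟨B', a', b', h'⟩ := (exists_addsKink hε D').choose_spec
    exact h.regularClass_eq_of_step hε h' hD

theorem addKink_regularClass {D K : KnotoidDiagram} {B : Set ℂ} {a b : ℝ}
    (h : AddsKink D K B a b ε) : addKink hε (regularClass D) = regularClass K := by
  obtain ⟨B', a', b', h'⟩ := (exists_addsKink hε D).choose_spec
  exact h'.regularClass_eq hε h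

/-- Any position may be used for the kinks, in particular the nested one, where both kinks together
arise from `D` by an R2. -/
theorem addKink_addKink (hε' : -ε = 1 ∨ -ε = -1) (c : Quot RegularStep) :
    addKink hε' (addKink hε c) = c := by
  obtain ⟨D, rfl⟩ := Quot.exists_rep c
  obtain ⟨t, ht, hs⟩ := D.exists_isSimple zero_lt_one le_rfl le_rfl
  obtain ⟨D', D'', B, B', a, b, a', b', h, -, -, h', hr⟩ :=
    exists_nested_kinks D ht hs univ_mem hε
  have h1 : addKink hε (Quot.mk _ D) = regularClass D' := addKink_regularClass hε h
  rw [h1, addKink_regularClass hε' h']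
  exact (Quot.sound (.r2 hr)).symm

end AddKink

/-- Adding a positive kink, with inverse the operation of adding a negative kink. -/
def kinkPerm : Equiv.Perm (Quot RegularStep) where
  toFun := addKink (.inl rfl)
  invFun := addKink (.inr rfl)
  left_inv := addKink_addKink (ε := 1) (.inl rfl) (.inr rfl)
  right_inv := addKink_addKink (ε := -1) (.inr rfl) (.inl (neg_neg 1))

theorem AddsKink.kinkPerm_zpow {D K : KnotoidDiagram} {B : Set ℂ} {a b : ℝ} {ε : ℤ}
    (hε : ε = 1 ∨ ε = -1) (h : AddsKink D K B a b ε) :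
    (kinkPerm ^ ε) (regularClass D) = regularClass K := by
  rcases hε with rfl | rfl
  · rw [zpow_one]; exact addKink_regularClass (.inl rfl) h
  · rw [zpow_neg_one]; exact addKink_regularClass (.inr rfl) h

theorem AddsKink.sign_eq {D K : KnotoidDiagram} {B : Set ℂ} {a b : ℝ} {ε : ℤ}
    (h : AddsKink D K B a b ε) : ε = 1 ∨ ε = -1 := by
  obtain ⟨-, -, p, hp, rfl⟩ := h
  have hp' : p ∈ K.crossings := by
    have : p ∈ K.crossingsIn B := by rw [hp]; rfl
    exact this.1
  have := K.transversal p.1 hp'.1 p.2 hp'.2.1 hp'.2.2.1 hp'.2.2.2.1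
  rw [KnotoidDiagram.crossingSign]
  rcases this.lt_or_gt with h | h
  · right; rw [sign_neg h]; rfl
  · left; rw [sign_pos h]; rfl

/-- The class obtained by adding kinks until the framing vanishes. -/
def unframedClass : PlanarKnotoid → Quot RegularStep :=
  Quot.lift (fun D => (kinkPerm ^ (-D.framing)) (regularClass D)) fun D D' h => by
    have key : RegularStep D D' → (kinkPerm ^ (-D.framing)) (regularClass D) =
        (kinkPerm ^ (-D'.framing)) (regularClass D') := fun h => by
      rw [h.framing_eq, show regularClass D = regularClass D' from Quot.sound h]
    cases h with
    | isotopy F hc => exact key (.isotopy F hc)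
    | r1 h =>
      -- The move multiplies the class by `kinkPerm ^ ε` and raises the framing by `ε`; the two
      -- effects cancel.
      obtain ⟨B, a, b, ε, h⟩ := h
      rw [← h.kinkPerm_zpow h.sign_eq, h.framing_eq, ← Equiv.Perm.mul_apply, ← zpow_add]
      congr 2
      ring
    | r2 h => exact key (.r2 h)
    | r3 h => exact key (.r3 h)

/-- Equal planar knotoids have the same unframed class. With equal framings the same power of the
permutation `kinkPerm` was applied, and it is injective. -/
theorem regularClass_eq_of_planar {D D' : KnotoidDiagram}
    (h : Quot.mk PlanarStep D = Quot.mk PlanarStep D') (hf : D.framing = D'.framing) :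
    regularClass D = regularClass D' := by
  have h1 : (kinkPerm ^ (-D.framing)) (regularClass D) =
    (kinkPerm ^ (-D'.framing)) (regularClass D') := congrArg unframedClass h
  rw [hf] at h1
  exact Equiv.injective _ h1

theorem mk_planar_eq_of_addsKink {D K : KnotoidDiagram} {B : Set ℂ} {a b : ℝ} {ε : ℤ}
    (h : AddsKink D K B a b ε) : Quot.mk PlanarStep D = Quot.mk PlanarStep K :=
  Quot.sound (.r1 ⟨B, a, b, ε, h⟩)

theorem mk_planar_eq_of_regularStep {D D' : KnotoidDiagram} (h : RegularStep D D') :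
    Quot.mk PlanarStep D = Quot.mk PlanarStep D' := by
  cases h with
  | isotopy F hc => exact Quot.sound (.isotopy F hc)
  | r1' h =>
    obtain ⟨D₀, B, a, b, ε, h1, h2⟩ := h
    exact (mk_planar_eq_of_addsKink h1).symm.trans (mk_planar_eq_of_addsKink h2)
  | r2 h => exact Quot.sound (.r2 h)
  | r3 h => exact Quot.sound (.r3 h)

/-- The planar knotoid and the framing of a class of diagrams. -/
def planarFraming : Quot RegularStep → PlanarKnotoid × ℤ :=
  Quot.lift (fun D => (Quot.mk PlanarStep D, D.framing)) fun _ _ h =>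
    Prod.ext (mk_planar_eq_of_regularStep h) h.framing_eq.symm

theorem planarFraming_mk (D : KnotoidDiagram) :
    planarFraming (regularClass D) = (Quot.mk PlanarStep D, D.framing) := rfl

theorem planarFraming_kinkPerm (c : Quot RegularStep) :
    planarFraming (kinkPerm c) = ((planarFraming c).1, (planarFraming c).2 + 1) := by
  obtain ⟨D, rfl⟩ := Quot.exists_rep c
  obtain ⟨K, B, a, b, h⟩ := exists_addsKink (.inl rfl) D
  have h1 : kinkPerm (regularClass D) = regularClass K := by
    have := h.kinkPerm_zpow (.inl rfl)
    rwa [zpow_one] at this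
  change planarFraming (kinkPerm (regularClass D)) = _
  rw [h1, planarFraming_mk, ← mk_planar_eq_of_addsKink h, h.framing_eq]
  rfl

theorem planarFraming_kinkPerm_zpow (n : ℤ) (c : Quot RegularStep) :
    planarFraming ((kinkPerm ^ n) c) = ((planarFraming c).1, (planarFraming c).2 + n) := by
  induction n with
  | zero => simp
  | succ n ih =>
    rw [add_comm, zpow_one_add, Equiv.Perm.mul_apply, planarFraming_kinkPerm, ih]
    refine Prod.ext rfl ?_
    simp only
    ring
  | pred n ih =>
    have h := planarFraming_kinkPerm ((kinkPerm ^ (-(n : ℤ) - 1)) c)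
    rw [← Equiv.Perm.mul_apply, ← zpow_one_add, add_sub_cancel, ih] at h
    have h1 := congrArg Prod.fst h
    have h2 := congrArg Prod.snd h
    simp only at h1 h2
    refine Prod.ext h1.symm ?_
    simp only
    linarith

/-- A suitable power of `kinkPerm` corrects the framing of any representative without changing the
planar knotoid. -/
theorem exists_framing_eq (c : PlanarKnotoid) (n : ℤ) :
    ∃ D : KnotoidDiagram, Quot.mk PlanarStep D = c ∧ D.framing = n := by
  obtain ⟨D, rfl⟩ := Quot.exists_rep c
  obtain ⟨D', hD'⟩ := Quot.exists_rep ((kinkPerm ^ (n - D.framing)) (regularClass D))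
  have h := planarFraming_kinkPerm_zpow (n - D.framing) (regularClass D)
  rw [← hD'] at h
  have h1 : (Quot.mk PlanarStep D', D'.framing) =
    (Quot.mk PlanarStep D, D.framing + (n - D.framing)) := h
  rw [Prod.mk.injEq, add_sub_cancel] at h1
  exact ⟨D', h1⟩

/-! ### The bijection -/

theorem BiframedStep.regularStep {v : ℂ} {K K' : BiframedDiagram v} (h : BiframedStep v K K') :
    RegularStep K.toKnotoidDiagram K'.toKnotoidDiagram := by
  cases h with
  | isotopy F hc _ => exact .isotopy F hc
  | r1' h => exact .r1' h
  | r2 h => exact .r2 h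
  | r3 h => exact .r3 h

/-- The underlying planar knotoid, the framing and the coframing of a biframed planar knotoid. -/
def biframedInvariant (v : ℂ) : BiframedKnotoid v → PlanarKnotoid × ℤ × ℤ :=
  -- The floor only converts the coframing, a real number known to be an integer, into an integer.
  Quot.lift (fun K => (Quot.mk PlanarStep K.toKnotoidDiagram, K.framing, ⌊K.coframing⌋))
    fun K K' h => by
      rw [mk_planar_eq_of_regularStep h.regularStep, h.regularStep.framing_eq, h.coframing_eq]

end

/-- The underlying planar knotoid, the framing and the coframing of a biframed planar knotoid are
well defined, the coframing is an integer, and together they give a bijection. -/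
theorem mainTheorem7 (v : ℂ) (hv : v ≠ 0) :
    ∃ Φ : BiframedKnotoid v → PlanarKnotoid × ℤ × ℤ,
      Function.Bijective Φ ∧
      ∀ K : BiframedDiagram v,
        (Φ (Quot.mk (BiframedStep v) K)).1 = Quot.mk PlanarStep K.toKnotoidDiagram ∧
        (Φ (Quot.mk (BiframedStep v) K)).2.1 = K.framing ∧
        ((Φ (Quot.mk (BiframedStep v) K)).2.2 : ℝ) = K.coframing := by
  have hfloor : ∀ K : BiframedDiagram v, ((⌊K.coframing⌋ : ℤ) : ℝ) = K.coframing := fun K => by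
    obtain ⟨n, hn⟩ := K.exists_coframing_eq_int
    rw [← hn, Int.floor_intCast]
  refine ⟨biframedInvariant v, ⟨fun c c' h => ?_, fun ⟨c, n, m⟩ => ?_⟩,
    fun K => ⟨rfl, rfl, hfloor K⟩⟩
  · obtain ⟨K, rfl⟩ := Quot.exists_rep c
    obtain ⟨K', rfl⟩ := Quot.exists_rep c'
    have h1 : (Quot.mk PlanarStep K.toKnotoidDiagram, K.framing, ⌊K.coframing⌋) =
      (Quot.mk PlanarStep K'.toKnotoidDiagram, K'.framing, ⌊K'.coframing⌋) := h
    rw [Prod.mk.injEq, Prod.mk.injEq] at h1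
    obtain ⟨hp, hf, hc⟩ := h1
    -- Planar knotoid and framing give the regular class; the regular class and the coframing give
    -- the biframed knotoid.
    exact mk_eq_of_regularClass_eq hv (regularClass_eq_of_planar hp hf)
      (by rw [← hfloor K, hc, hfloor K'])
  · obtain ⟨D, rfl, rfl⟩ := exists_framing_eq c n
    refine ⟨Quot.mk _ (biframing hv m D), ?_⟩
    -- Biframing a diagram stays in its regular class, so the planar knotoid and the framing of `D`
    -- persist.
    have h1 := congrArg planarFraming (regularClass_biframing hv m D)
    refine Prod.ext (congrArg Prod.fst h1 :) (Prod.ext (congrArg Prod.snd h1 :) ?_)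
    change ⌊(biframing hv m D).coframing⌋ = m
    rw [biframing_coframing, Int.floor_intCast]
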